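/- A CS manifold is a Hausdorff, second countable space with a sheaf of complex superalgebras that is locally isomorphic to $\mathbb R^{m|n}$ with its sheaf of complex-valued functions $C^\infty(\mathbb R^m,\mathbb C)\otimes\Lambda[\theta_1,\dots,\theta_n]$. A CS $Q$-group is a compact CS super-Lie group $G_Q$ (a group object in CS manifolds) with Lie superalgebra $\mathfrak g$ and an odd element $Q\in\mathfrak g_1$ such that $\mathfrak g_0$ is commutative and central and $\mathfrak g_1$ is one-dimensional and spanned by $Q$. Let $G_Q$ be a CS $Q$-group acting on a CS manifold $X$, and denote also by $Q$ the odd vector field on $X$ by which $Q\in\mathfrak g_1$ acts. Suppose that the vector field $Q$ vanishes at no point of $X$, i.e. that for every $x\in X$ there is a function $f$ defined near $x$ with $(Qf)(x)\neq 0$. Then: 1. there is an odd global function $\beta\in C^\infty(X)_1$ with $Q\beta=1$; 2. if $X$ is oriented and $\omega$ is a compactly supported section of the Berezinian line bundle $\operatorname{Ber}_X=\operatorname{sDet}(T^*_X)$ that is $Q$-invariant (its Lie derivative along $Q$ vanishes; in particular, if $\omega$ is $G_Q$-equivariant), then $\int_X\omega=0$. Here $\int_X$ is the Berezin integral: if $\omega=f(x,\theta)\,[dx\,|\,d\theta]$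 is compactly supported in an oriented chart, $\int_X\omega$ is the Lebesgue integral of the coefficient of $\theta_1\cdots\theta_n$ in $f$, and in general $\omega$ is decomposed into a finite sum of such Berezinians. -/

import Mathlib

noncomputable section

open TopologicalSpace

namespace CS

/-! ### Spaces ringed in complex superalgebras -/

/-- The sign `(-1)^i`. -/
def sgn (i : ZMod 2) : ℂ := if i = 0 then 1 else -1

/-- A topological space with a sheaf of supercommutative complex superalgebras. `par U 0` and
`par U 1` are the even and the odd sections over `U`. -/
structure SuperSpace where
  carrier : Type
  [top : TopologicalSpace carrier]
  sec : Opens carrier → Type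
  [ring : ∀ U, Ring (sec U)]
  [alg : ∀ U, Algebra ℂ (sec U)]
  par : ∀ U, ZMod 2 → Submodule ℂ (sec U)
  isCompl_par : ∀ U, IsCompl (par U 0) (par U 1)
  one_mem_par : ∀ U, (1 : sec U) ∈ par U 0
  mul_mem_par : ∀ U (i j : ZMod 2) (f g : sec U),
    f ∈ par U i → g ∈ par U j → f * g ∈ par U (i + j)
  supercomm : ∀ U (i j : ZMod 2) (f g : sec U),
    f ∈ par U i → g ∈ par U j → f * g = sgn (i * j) • (g * f)
  res : ∀ {V U : Opens carrier}, V ≤ U → sec U →ₐ[ℂ] sec V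
  res_par : ∀ {V U : Opens carrier} (h : V ≤ U) (i : ZMod 2) (f : sec U),
    f ∈ par U i → res h f ∈ par V i
  res_refl : ∀ (U : Opens carrier) (f : sec U), res (le_refl U) f = f
  res_res : ∀ {W V U : Opens carrier} (h : W ≤ V) (h' : V ≤ U) (f : sec U),
    res h (res h' f) = res (h.trans h') f
  glue : ∀ {J : Type} (U : J → Opens carrier) (f : ∀ j, sec (U j)),
    (∀ i j, res (inf_le_left : U i ⊓ U j ≤ U i) (f i) =
      res (inf_le_right : U i ⊓ U j ≤ U j) (f j)) →
    ∃! s : sec (⨆ j, U j), ∀ j, res (le_iSup U j) s = f j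

attribute [instance] SuperSpace.top SuperSpace.ring SuperSpace.alg

/-- Morphisms of superspaces: a continuous map together with an even pullback of sections. -/
@[ext]
structure Hom (X Y : SuperSpace) where
  base : C(X.carrier, Y.carrier)
  pull : ∀ V : Opens Y.carrier, Y.sec V →ₐ[ℂ] X.sec (Opens.comap base V)
  pull_par : ∀ V (i : ZMod 2) (f : Y.sec V),
    f ∈ Y.par V i → pull V f ∈ X.par (Opens.comap base V) i
  pull_res : ∀ {V' V : Opens Y.carrier} (h : V' ≤ V) (f : Y.sec V),
    pull V' (Y.res h f) = X.res (Opens.comap_mono base h) (pull V f)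

/-- The identity morphism. -/
def Hom.id (X : SuperSpace) : Hom X X where
  base := ContinuousMap.id _
  pull V := AlgHom.id ℂ (X.sec V)
  pull_par _ _ _ h := h
  pull_res _ _ := rfl

/-- The composite morphism `X → Y → Z` (first `f`, then `g`). -/
def Hom.comp {X Y Z : SuperSpace} (f : Hom X Y) (g : Hom Y Z) : Hom X Z where
  base := g.base.comp f.base
  pull V := (f.pull (Opens.comap g.base V)).comp (g.pull V)
  pull_par V i s h := f.pull_par _ i _ (g.pull_par V i s h)
  pull_res h s := by
    change f.pull _ (g.pull _ _) = _
    rw [g.pull_res h s, f.pull_res]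
    rfl

/-- An isomorphism onto an open subspace. -/
structure Hom.IsOpenImmersion {X Y : SuperSpace} (f : Hom X Y) : Prop where
  isOpenEmbedding : Topology.IsOpenEmbedding f.base
  bijective_pull : ∀ V : Opens Y.carrier, (V : Set Y.carrier) ⊆ Set.range f.base →
    Function.Bijective (f.pull V)

/-- The image of an open immersion. -/
def Hom.IsOpenImmersion.image {X Y : SuperSpace} {f : Hom X Y} (hf : f.IsOpenImmersion) :
    Opens Y.carrier :=
  ⟨Set.range f.base, hf.isOpenEmbedding.isOpen_range⟩

/-! ### The superspaces `ℝ^{m|n}` with complex-valued functions -/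

section Model

open scoped ContDiff

variable {ι κ : Type}

/-- The complex Grassmann algebra with generators indexed by `κ`. -/
abbrev Grassmann (κ : Type) : Type := ExteriorAlgebra ℂ (κ → ℂ)

/-- The parity grading of the Grassmann algebra. -/
def grassmannPar (κ : Type) (i : ZMod 2) : Submodule ℂ (Grassmann κ) :=
  CliffordAlgebra.evenOdd (0 : QuadraticForm ℂ (κ → ℂ)) i

/-- Extension by zero of a function on an open subset of `ℝ^ι`. -/
def extend {U : Opens (ι → ℝ)} (f : U → Grassmann κ) (x : ι → ℝ) : Grassmann κ :=
  open Classical in if h : x ∈ U then f ⟨x, h⟩ else 0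

/-- A Grassmann-algebra-valued function on an open subset of `ℝ^ι` is smooth if all its (complex)
components are, that is, if its composite with every linear form is. -/
def IsSmooth [Fintype ι] {U : Opens (ι → ℝ)} (f : U → Grassmann κ) : Prop :=
  ∀ l : Grassmann κ →ₗ[ℂ] ℂ, ∀ x ∈ U, ContDiffAt ℝ ∞ (fun y => l (extend f y)) x

lemma extend_of_mem {U : Opens (ι → ℝ)} (f : U → Grassmann κ) {x : ι → ℝ} (h : x ∈ U) :
    extend f x = f ⟨x, h⟩ := by
  simp [extend, h]

lemma eventually_extend {U : Opens (ι → ℝ)} {x : ι → ℝ} (h : x ∈ U) :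
    ∀ᶠ y in nhds x, y ∈ U :=
  U.isOpen.mem_nhds h

lemma isSmooth_const [Fintype ι] (U : Opens (ι → ℝ)) (a : Grassmann κ) : IsSmooth (fun _ : U => a) := by
  intro l x hx
  refine (contDiffAt_const (c := l a)).congr_of_eventuallyEq ?_
  filter_upwards [eventually_extend hx] with y hy
  rw [extend_of_mem _ hy]

lemma IsSmooth.add [Fintype ι] {U : Opens (ι → ℝ)} {f g : U → Grassmann κ} (hf : IsSmooth f)
    (hg : IsSmooth g) : IsSmooth (f + g) := by
  intro l x hx
  refine ((hf l x hx).add (hg l x hx)).congr_of_eventuallyEq ?_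
  filter_upwards [eventually_extend hx] with y hy
  simp [extend_of_mem _ hy]

lemma IsSmooth.map [Fintype ι] {κ' : Type} {U : Opens (ι → ℝ)} {f : U → Grassmann κ}
    (hf : IsSmooth f) (T : Grassmann κ →ₗ[ℂ] Grassmann κ') : IsSmooth (fun x => T (f x)) := by
  intro l x hx
  refine (hf (l.comp T) x hx).congr_of_eventuallyEq ?_
  filter_upwards [eventually_extend hx] with y hy
  rw [extend_of_mem _ hy, extend_of_mem _ hy, LinearMap.comp_apply]

lemma IsSmooth.precomp {ι' : Type} [Fintype ι] [Fintype ι'] {U : Opens (ι → ℝ)} {f : U → Grassmann κ}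
    (hf : IsSmooth f) {V : Opens (ι' → ℝ)} (p : (ι' → ℝ) →L[ℝ] (ι → ℝ))
    (hp : ∀ x ∈ V, p x ∈ U) : IsSmooth (fun x : V => f ⟨p x, hp x x.2⟩) := by
  intro l x hx
  refine ((hf l (p x) (hp x hx)).comp x p.contDiff.contDiffAt).congr_of_eventuallyEq ?_
  filter_upwards [eventually_extend hx] with y hy
  simp [extend_of_mem _ hy, extend_of_mem _ (hp y hy)]

instance finite_grassmann [Fintype κ] : Module.Finite ℂ (Grassmann κ) := by
  classical
  let : LinearOrder κ := LinearOrder.lift' (Fintype.equivFin κ) (Fintype.equivFin κ).injective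
  exact Module.Finite.of_basis (Pi.basisFun ℂ κ).ExteriorAlgebra

lemma IsSmooth.mul [Fintype ι] [Fintype κ] {U : Opens (ι → ℝ)} {f g : U → Grassmann κ} (hf : IsSmooth f)
    (hg : IsSmooth g) : IsSmooth (f * g) := by
  intro l x hx
  let b := Module.finBasis ℂ (Grassmann κ)
  have key : ∀ u v : Grassmann κ,
      l (u * v) = ∑ i, ∑ j, b.coord i u * b.coord j v * l (b i * b j) := by
    intro u v
    conv_lhs => rw [← b.sum_repr u, ← b.sum_repr v]
    simp only [Finset.sum_mul, Finset.mul_sum, map_sum, smul_mul_smul_comm, map_smul, smul_eq_mul,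
      Module.Basis.coord_apply]
    exact Finset.sum_comm
  have : ContDiffAt ℝ ∞ (fun y => ∑ i, ∑ j,
      b.coord i (extend f y) * b.coord j (extend g y) * l (b i * b j)) x :=
    ContDiffAt.sum fun i _ => ContDiffAt.sum fun j _ =>
      ((hf (b.coord i) x hx).mul (hg (b.coord j) x hx)).mul contDiffAt_const
  refine this.congr_of_eventuallyEq ?_
  filter_upwards [eventually_extend hx] with y hy
  rw [← key]
  simp [extend_of_mem _ hy]

/-- The algebra `C^∞(U) ⊗ Λ(ℂ^κ)` of complex superfunctions over the open set `U`. -/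
def smoothSec [Fintype ι] (κ : Type) [Fintype κ] (U : Opens (ι → ℝ)) : Subalgebra ℂ (U → Grassmann κ) where
  carrier := {f | IsSmooth f}
  mul_mem' := IsSmooth.mul
  add_mem' := IsSmooth.add
  algebraMap_mem' c := isSmooth_const U (algebraMap ℂ _ c)

lemma grassmann_swap (u v : κ → ℂ) : (ExteriorAlgebra.ι ℂ u * ExteriorAlgebra.ι ℂ v : Grassmann κ) =
    -(ExteriorAlgebra.ι ℂ v * ExteriorAlgebra.ι ℂ u) :=
  eq_neg_of_add_eq_zero_left (ExteriorAlgebra.ι_add_mul_swap u v)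

lemma grassmann_ι_mul_ι_comm (u v : κ → ℂ) (z : Grassmann κ) :
    Commute (ExteriorAlgebra.ι ℂ u * ExteriorAlgebra.ι ℂ v) z := by
  induction z using ExteriorAlgebra.induction with
  | algebraMap r => exact Algebra.commutes' r _ |>.symm
  | ι w =>
    change _ * _ = _ * _
    rw [mul_assoc, grassmann_swap v w, mul_neg, ← mul_assoc, grassmann_swap u w, neg_mul, neg_neg,
      mul_assoc]
  | mul a b ha hb => exact ha.mul_right hb
  | add a b ha hb => exact ha.add_right hb

lemma grassmann_even_comm (x z : Grassmann κ) (hx : x ∈ grassmannPar κ 0) : Commute x z := by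
  induction x, hx using CliffordAlgebra.even_induction with
  | algebraMap r => exact Algebra.commutes' r _
  | add x y _ _ hx hy => exact hx.add_left hy
  | ι_mul_ι_mul u v x _ hx => exact (grassmann_ι_mul_ι_comm u v z).mul_left hx

lemma grassmann_ι_odd (u : κ → ℂ) (y : Grassmann κ) (hy : y ∈ grassmannPar κ 1) :
    ExteriorAlgebra.ι ℂ u * y = -(y * ExteriorAlgebra.ι ℂ u) := by
  induction y, hy using CliffordAlgebra.odd_induction with
  | ι v => exact grassmann_swap u v
  | add x y _ _ hx hy => rw [mul_add, hx, hy, add_mul, neg_add]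
  | ι_mul_ι_mul a b x _ hx =>
    have h := (grassmann_ι_mul_ι_comm a b (ExteriorAlgebra.ι ℂ u)).eq
    change ExteriorAlgebra.ι ℂ u * (ExteriorAlgebra.ι ℂ a * ExteriorAlgebra.ι ℂ b * x) =
      -(ExteriorAlgebra.ι ℂ a * ExteriorAlgebra.ι ℂ b * x * ExteriorAlgebra.ι ℂ u)
    rw [← mul_assoc, ← h, mul_assoc, hx, mul_neg, mul_assoc _ x]

lemma grassmann_odd_odd (x y : Grassmann κ) (hx : x ∈ grassmannPar κ 1)
    (hy : y ∈ grassmannPar κ 1) : x * y = -(y * x) := by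
  induction x, hx using CliffordAlgebra.odd_induction with
  | ι v => exact grassmann_ι_odd v y hy
  | add a b _ _ ha hb => rw [add_mul, ha, hb, mul_add, neg_add]
  | ι_mul_ι_mul a b x _ hx =>
    have h := (grassmann_ι_mul_ι_comm a b y).eq
    change ExteriorAlgebra.ι ℂ a * ExteriorAlgebra.ι ℂ b * x * y =
      -(y * (ExteriorAlgebra.ι ℂ a * ExteriorAlgebra.ι ℂ b * x))
    rw [mul_assoc, hx, mul_neg, ← mul_assoc, h, mul_assoc]

lemma grassmann_supercomm (i j : ZMod 2) (x y : Grassmann κ)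
    (hx : x ∈ grassmannPar κ i) (hy : y ∈ grassmannPar κ j) :
    x * y = sgn (i * j) • (y * x) := by
  have h2 : ∀ k : ZMod 2, k = 0 ∨ k = 1 := by decide
  rcases h2 i with rfl | rfl
  · simpa [sgn] using (grassmann_even_comm x y hx).eq
  rcases h2 j with rfl | rfl
  · simpa [sgn] using (grassmann_even_comm y x hy).eq.symm
  · simpa [sgn] using grassmann_odd_odd x y hx hy

lemma map_mem_grassmannPar {κ' : Type} (q : (κ' → ℂ) →ₗ[ℂ] (κ → ℂ)) (i : ZMod 2)
    (x : Grassmann κ') (hx : x ∈ grassmannPar κ' i) :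
    ExteriorAlgebra.map q x ∈ grassmannPar κ i := by
  have h2 : ∀ k : ZMod 2, k = 0 ∨ k = 1 := by decide
  have hmul : ∀ u v (y : Grassmann κ) (j : ZMod 2), y ∈ grassmannPar κ j →
      ExteriorAlgebra.ι ℂ u * ExteriorAlgebra.ι ℂ v * y ∈ grassmannPar κ j := by
    intro u v y j hy
    have := SetLike.mul_mem_graded (CliffordAlgebra.ι_mul_ι_mem_evenOdd_zero
      (0 : QuadraticForm ℂ (κ → ℂ)) u v) hy
    rwa [zero_add] at this
  rcases h2 i with rfl | rfl
  · induction x, hx using CliffordAlgebra.even_induction with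
    | algebraMap r =>
      change ExteriorAlgebra.map q (algebraMap ℂ (Grassmann κ') r) ∈ _
      rw [AlgHom.commutes]
      exact SetLike.algebraMap_mem_graded (CliffordAlgebra.evenOdd (0 : QuadraticForm ℂ (κ → ℂ))) r
    | add x y _ _ hx hy => rw [map_add]; exact add_mem hx hy
    | ι_mul_ι_mul u v x _ hx =>
      change ExteriorAlgebra.map q (ExteriorAlgebra.ι ℂ u * ExteriorAlgebra.ι ℂ v * x) ∈ _
      rw [map_mul, map_mul, ExteriorAlgebra.map_apply_ι, ExteriorAlgebra.map_apply_ι]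
      exact hmul _ _ _ _ hx
  · induction x, hx using CliffordAlgebra.odd_induction with
    | ι v =>
      change ExteriorAlgebra.map q (ExteriorAlgebra.ι ℂ v) ∈ _
      rw [ExteriorAlgebra.map_apply_ι]
      exact CliffordAlgebra.ι_mem_evenOdd_one _ _
    | add x y _ _ hx hy => rw [map_add]; exact add_mem hx hy
    | ι_mul_ι_mul u v x _ hx =>
      change ExteriorAlgebra.map q (ExteriorAlgebra.ι ℂ u * ExteriorAlgebra.ι ℂ v * x) ∈ _
      rw [map_mul, map_mul, ExteriorAlgebra.map_apply_ι, ExteriorAlgebra.map_apply_ι]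
      exact hmul _ _ _ _ hx

/-- The superspace `ℝ^{m|n}` with its sheaf of complex superfunctions (even coordinates indexed by
`ι`, odd coordinates indexed by `κ`). -/
def modelSpace (ι κ : Type) [Fintype ι] [Fintype κ] : SuperSpace where
  carrier := ι → ℝ
  sec U := smoothSec κ U
  par U i :=
    { carrier := {f | ∀ x, f.1 x ∈ grassmannPar κ i}
      add_mem' := fun hf hg x => add_mem (hf x) (hg x)
      zero_mem' := fun _ => zero_mem _
      smul_mem' := fun c _ hf x => Submodule.smul_mem _ c (hf x) }
  isCompl_par U := by
    have hc := CliffordAlgebra.evenOdd_isCompl (0 : QuadraticForm ℂ (κ → ℂ))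
    refine ⟨Submodule.disjoint_def.2 fun f h0 h1 => ?_, codisjoint_iff.2 (eq_top_iff.2 ?_)⟩
    · ext x : 2
      exact Submodule.disjoint_def.1 hc.disjoint _ (h0 x) (h1 x)
    · intro f _
      let P₀ : Grassmann κ →ₗ[ℂ] Grassmann κ := Submodule.projection _ _ hc
      let P₁ : Grassmann κ →ₗ[ℂ] Grassmann κ := Submodule.projection _ _ hc.symm
      refine Submodule.mem_sup.2 ⟨⟨fun x => P₀ (f.1 x), f.2.map P₀⟩,
        fun x => Submodule.projection_apply_mem _ _, ⟨fun x => P₁ (f.1 x), f.2.map P₁⟩,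
        fun x => Submodule.projection_apply_mem _ _, ?_⟩
      ext x : 2
      exact Submodule.projection_add_projection_eq_self hc (f.1 x)
  one_mem_par U x :=
    SetLike.one_mem_graded (CliffordAlgebra.evenOdd (0 : QuadraticForm ℂ (κ → ℂ)))
  mul_mem_par U i j f g hf hg x :=
    SetLike.mul_mem_graded (A := CliffordAlgebra.evenOdd (0 : QuadraticForm ℂ (κ → ℂ)))
      (hf x) (hg x)
  supercomm U i j f g hf hg := by
    ext x : 2
    exact grassmann_supercomm i j _ _ (hf x) (hg x)
  res {V U} h :=
    { toFun := fun f => ⟨fun x => f.1 ⟨x, h x.2⟩, f.2.precomp (.id ℝ _) h⟩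
      map_one' := rfl
      map_mul' := fun _ _ => rfl
      map_zero' := rfl
      map_add' := fun _ _ => rfl
      commutes' := fun _ => rfl }
  res_par h i f hf x := hf ⟨x, h x.2⟩
  res_refl _ _ := rfl
  res_res _ _ _ := rfl
  glue {J} U f hf := by
    have hf' : ∀ i j x (hi : x ∈ U i) (hj : x ∈ U j), (f i).1 ⟨x, hi⟩ = (f j).1 ⟨x, hj⟩ :=
      fun i j x hi hj => congrFun (congrArg Subtype.val (hf i j)) ⟨x, hi, hj⟩
    have hm : ∀ x : ↥(⨆ j, U j), ∃ j, x.1 ∈ U j := fun x => Opens.mem_iSup.1 x.2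
    choose k hk using hm
    let s : ↥(⨆ j, U j) → Grassmann κ := fun x => (f (k x)).1 ⟨x, hk x⟩
    have hs : ∀ j x (hx : x ∈ U j) (hx' : x ∈ ⨆ j, U j), s ⟨x, hx'⟩ = (f j).1 ⟨x, hx⟩ :=
      fun j x hx hx' => hf' _ _ _ _ _
    refine ⟨⟨s, ?_⟩, fun j => ?_, fun t ht => ?_⟩
    · intro l x hx
      obtain ⟨j, hj⟩ := Opens.mem_iSup.1 hx
      refine ((f j).2 l x hj).congr_of_eventuallyEq ?_
      filter_upwards [eventually_extend hj] with y hy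
      have hy' : y ∈ ⨆ j, U j := Opens.mem_iSup.2 ⟨j, hy⟩
      rw [extend_of_mem _ hy, extend_of_mem _ hy', hs j y hy hy']
    · ext x : 2
      exact hs j x x.2 _
    · ext x : 2
      exact congrFun (congrArg Subtype.val (ht (k x))) ⟨x, hk x⟩

/-- The morphism `ℝ^{ι|κ} → ℝ^{ι'|κ'}` given by a linear map on the even coordinates and a linear
pullback of the odd coordinate functions. -/
def linearHom {ι' κ' : Type} [Fintype ι] [Fintype κ] [Fintype ι'] [Fintype κ'] (p : (ι → ℝ) →L[ℝ] (ι' → ℝ))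
    (q : (κ' → ℂ) →ₗ[ℂ] (κ → ℂ)) : Hom (modelSpace ι κ) (modelSpace ι' κ') where
  base := ⟨p, p.continuous⟩
  pull V :=
    { toFun := fun f => ⟨fun x => ExteriorAlgebra.map q (f.1 ⟨p x, x.2⟩),
        (f.2.precomp p (V := Opens.comap ⟨p, p.continuous⟩ V) fun _ h => h).map
          (ExteriorAlgebra.map q).toLinearMap⟩
      map_one' := Subtype.ext (funext fun _ => map_one _)
      map_mul' := fun _ _ => Subtype.ext (funext fun _ => map_mul _ _ _)
      map_zero' := Subtype.ext (funext fun _ => map_zero _)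
      map_add' := fun _ _ => Subtype.ext (funext fun _ => map_add _ _ _)
      commutes' := fun c => Subtype.ext (funext fun _ => AlgHom.commutes _ c) }
  pull_par _ i _ hf _ := map_mem_grassmannPar q i _ (hf _)
  pull_res _ _ := rfl

/-- The projection `ℝ^{ι ⊔ ι' | κ ⊔ κ'} → ℝ^{ι|κ}`. -/
def modelFst (ι κ ι' κ' : Type) [Fintype ι] [Fintype κ] [Fintype ι'] [Fintype κ'] :
    Hom (modelSpace (ι ⊕ ι') (κ ⊕ κ')) (modelSpace ι κ) :=
  linearHom (ContinuousLinearMap.pi fun i => ContinuousLinearMap.proj (Sum.inl i))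
    (LinearMap.pi (Sum.elim (fun k => LinearMap.proj k) 0))

/-- The projection `ℝ^{ι ⊔ ι' | κ ⊔ κ'} → ℝ^{ι'|κ'}`. -/
def modelSnd (ι κ ι' κ' : Type) [Fintype ι] [Fintype κ] [Fintype ι'] [Fintype κ'] :
    Hom (modelSpace (ι ⊕ ι') (κ ⊕ κ')) (modelSpace ι' κ') :=
  linearHom (ContinuousLinearMap.pi fun i => ContinuousLinearMap.proj (Sum.inr i))
    (LinearMap.pi (Sum.elim 0 (fun k => LinearMap.proj k)))

lemma isSmooth_coord [Fintype ι] (U : Opens (ι → ℝ)) (i : ι) :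
    IsSmooth (fun x : U => algebraMap ℂ (Grassmann κ) (x.1 i : ℂ)) := by
  intro l x hx
  have h : ContDiffAt ℝ ∞ (fun y : ι → ℝ => (y i : ℂ) * l 1) x :=
    ((Complex.ofRealCLM.contDiff.comp (contDiff_apply ℝ ℝ i)).contDiffAt).mul contDiffAt_const
  refine h.congr_of_eventuallyEq ?_
  filter_upwards [eventually_extend hx] with y hy
  rw [extend_of_mem _ hy, Algebra.algebraMap_eq_smul_one, map_smul, smul_eq_mul]

open Classical in
/-- The coordinate functions `x_i` and `θ_k` of `ℝ^{ι|κ}`, over an open set `U`. -/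
def modelCoord [Fintype ι] [Fintype κ] (U : Opens (modelSpace ι κ).carrier) :
    ι ⊕ κ → (modelSpace ι κ).sec U :=
  Sum.elim (fun i => ⟨fun x => algebraMap ℂ (Grassmann κ) (x.1 i : ℂ), isSmooth_coord U i⟩)
    (fun k => ⟨fun _ => ExteriorAlgebra.ι ℂ (Pi.single k 1), isSmooth_const U _⟩)

/-- The coefficient of `θ_1 ⋯ θ_n` of an element of the Grassmann algebra. -/
def topCoeff (n : ℕ) : Grassmann (Fin n) →ₗ[ℂ] ℂ :=
  (Pi.basisFun ℂ (Fin n)).ExteriorAlgebra.coord Finset.univ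

end Model

/-! ### CS manifolds -/

/-- A CS manifold of dimension `m|n`: a Hausdorff second countable superspace that is locally
isomorphic to `ℝ^{m|n}` with its sheaf of complex-valued superfunctions. -/
structure CSManifold extends SuperSpace where
  [t2 : T2Space carrier]
  [secondCountable : SecondCountableTopology carrier]
  evenDim : ℕ
  oddDim : ℕ
  exists_chart : ∀ x : carrier,
    ∃ φ : Hom (modelSpace (Fin evenDim) (Fin oddDim)) toSuperSpace,
      φ.IsOpenImmersion ∧ x ∈ Set.range φ.base

attribute [instance] CSManifold.t2 CSManifold.secondCountable

/-- Morphisms of CS manifolds are the morphisms of superspaces. -/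
abbrev Mor (X Y : CSManifold) : Type := Hom X.toSuperSpace Y.toSuperSpace

/-- A chart of `X`, given as a parametrization: an isomorphism from `ℝ^{m|n}` onto an open
subspace of `X`. -/
structure Chart (X : CSManifold) where
  hom : Hom (modelSpace (Fin X.evenDim) (Fin X.oddDim)) X.toSuperSpace
  isOpenImmersion : hom.IsOpenImmersion

/-- The open subset of `X` covered by a chart. -/
def Chart.image {X : CSManifold} (φ : Chart X) : Opens X.carrier := φ.isOpenImmersion.image

/-- `P` with `p : P → X` and `q : P → Y` is the product of the CS manifolds `X` and `Y`: the
underlying set is the product, and the product of any chart of `X` with any chart of `Y`, with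
domain `ℝ^{m|n} × ℝ^{m'|n'} = ℝ^{m+m'|n+n'}`, is a chart of `P`. -/
structure IsProduct {P X Y : CSManifold} (p : Mor P X) (q : Mor P Y) : Prop where
  bijective : Function.Bijective fun z : P.carrier => (p.base z, q.base z)
  exists_chart : ∀ (φ : Chart X) (ψ : Chart Y),
    ∃ χ : Hom (modelSpace (Fin X.evenDim ⊕ Fin Y.evenDim) (Fin X.oddDim ⊕ Fin Y.oddDim))
        P.toSuperSpace,
      χ.IsOpenImmersion ∧ χ.comp p = (modelFst _ _ _ _).comp φ.hom ∧
        χ.comp q = (modelSnd _ _ _ _).comp ψ.hom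

/-! ### Vector fields -/

/-- A homogeneous vector field of parity `p` on the open set `U`: a superderivation of parity `p`
of the sheaf of functions on `U`. -/
structure VectorField (X : SuperSpace) (U : Opens X.carrier) (p : ZMod 2) where
  app : ∀ V : Opens X.carrier, V ≤ U → X.sec V →ₗ[ℂ] X.sec V
  app_par : ∀ (V) (h : V ≤ U) (i : ZMod 2) (f : X.sec V),
    f ∈ X.par V i → app V h f ∈ X.par V (p + i)
  res_app : ∀ {W V : Opens X.carrier} (h : W ≤ V) (h' : V ≤ U) (f : X.sec V),
    X.res h (app V h' f) = app W (h.trans h') (X.res h f)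
  leibniz : ∀ (V) (h : V ≤ U) (i : ZMod 2) (f g : X.sec V), f ∈ X.par V i →
    app V h (f * g) = app V h f * g + sgn (p * i) • (f * app V h g)

namespace VectorField

/-- Restriction of a vector field to a smaller open set. -/
def restrict {X : SuperSpace} {U W : Opens X.carrier} {p : ZMod 2} (D : VectorField X U p)
    (h : W ≤ U) : VectorField X W p where
  app V hV := D.app V (hV.trans h)
  app_par V hV := D.app_par V (hV.trans h)
  res_app hV hV' := D.res_app hV (hV'.trans h)
  leibniz V hV := D.leibniz V (hV.trans h)

/-- `D' (f^* g) = f^* (D g)` for all local functions `g` on `Y`. -/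
def Related {X Y : SuperSpace} {p : ZMod 2} (f : Hom X Y) (D' : VectorField X ⊤ p)
    (D : VectorField Y ⊤ p) : Prop :=
  ∀ (V : Opens Y.carrier) (g : Y.sec V),
    D'.app _ le_top (f.pull V g) = f.pull V (D.app V le_top g)

/-- `D' (f^* g) = 0` for all local functions `g` on `Y`. -/
def RelatedZero {X Y : SuperSpace} {p : ZMod 2} (f : Hom X Y) (D' : VectorField X ⊤ p) : Prop :=
  ∀ (V : Opens Y.carrier) (g : Y.sec V), D'.app _ le_top (f.pull V g) = 0

/-- The vector field `D` vanishes nowhere: every point `x` has a neighbourhood with a function `f`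
on it such that the value of `D f` at `x` is nonzero. The value of a function at `x` is nonzero if
and only if the function is invertible near `x`. -/
def NowhereVanishing {X : SuperSpace} {p : ZMod 2} (D : VectorField X ⊤ p) : Prop :=
  ∀ x : X.carrier, ∃ (V : Opens X.carrier) (f : X.sec V), x ∈ V ∧
    ∃ (W : Opens X.carrier) (h : W ≤ V), x ∈ W ∧ IsUnit (X.res h (D.app V le_top f))

end VectorField

/-! ### CS Lie groups and their actions -/

/-- A group object in CS manifolds: a group structure on `Hom(S, G)`, natural in `S`. -/
class SuperLieGroup (G : CSManifold) where
  group : ∀ S : CSManifold, Group (Mor S G)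
  comp_mul : ∀ {S S' : CSManifold} (f : Mor S' S) (g h : Mor S G),
    f.comp (g * h) = f.comp g * f.comp h

attribute [reducible, instance] SuperLieGroup.group

/-- An action of the CS Lie group `G` on the CS manifold `X`: an action of the group `Hom(S, G)`
on the set `Hom(S, X)`, natural in `S`. -/
structure Action (G : CSManifold) [SuperLieGroup G] (X : CSManifold) where
  act : ∀ {S : CSManifold}, Mor S G → Mor S X → Mor S X
  one_act : ∀ {S : CSManifold} (x : Mor S X), act 1 x = x
  mul_act : ∀ {S : CSManifold} (g h : Mor S G) (x : Mor S X), act (g * h) x = act g (act h x)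
  comp_act : ∀ {S S' : CSManifold} (f : Mor S' S) (g : Mor S G) (x : Mor S X),
    f.comp (act g x) = act (f.comp g) (f.comp x)

/-- The vector field `D` on `G` belongs to the Lie superalgebra of `G`, i.e. it is left invariant:
`(1 ⊗ D) ∘ m^* = m^* ∘ D`, where `m : G × G → G` is the multiplication and `1 ⊗ D` is the vector
field on `G × G` that acts as `D` along the second factor. -/
def IsLeftInvariant {G : CSManifold} [SuperLieGroup G] {p : ZMod 2}
    (D : VectorField G.toSuperSpace ⊤ p) : Prop :=
  ∃ (P : CSManifold) (pr₁ pr₂ : Mor P G) (D' : VectorField P.toSuperSpace ⊤ p),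
    IsProduct pr₁ pr₂ ∧ D'.RelatedZero pr₁ ∧ D'.Related pr₂ D ∧ D'.Related (pr₁ * pr₂) D

/-- `G` with the vector field `Q` is a CS `Q`-group: `G` is compact, the even part of its Lie
superalgebra is commutative and central, and the odd part is one-dimensional and spanned by `Q`.
The Lie superalgebra is that of the left-invariant vector fields with the supercommutator. -/
structure IsQGroup (G : CSManifold) [SuperLieGroup G] (Q : VectorField G.toSuperSpace ⊤ 1) :
    Prop where
  compactSpace : CompactSpace G.carrier
  isLeftInvariant : IsLeftInvariant Q
  central : ∀ (D : VectorField G.toSuperSpace ⊤ 0) (p : ZMod 2)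
    (E : VectorField G.toSuperSpace ⊤ p), IsLeftInvariant D → IsLeftInvariant E →
    ∀ V f, D.app V le_top (E.app V le_top f) = E.app V le_top (D.app V le_top f)
  ne_zero : ∃ V f, Q.app V le_top f ≠ 0
  span : ∀ E : VectorField G.toSuperSpace ⊤ 1, IsLeftInvariant E →
    ∃ c : ℂ, ∀ V f, E.app V le_top f = c • Q.app V le_top f

/-- `DX` is the vector field by which the element `D` of the Lie superalgebra of `G` acts on `X`:
`DX f = j^* ((D ⊗ 1) (a^* f))`, where `a : G × X → X` is the action, `D ⊗ 1` is the vector field on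
`G × X` that acts as `D` along the first factor, and `j = (e, id) : X → G × X` is the inclusion at
the identity of `G`. (`j^{-1} a^{-1} V` equals `V`, since the composite of `j` and `a` is the
identity.) -/
def Action.IsFundamental {G : CSManifold} [SuperLieGroup G] {X : CSManifold} (a : Action G X)
    {p : ZMod 2} (D : VectorField G.toSuperSpace ⊤ p) (DX : VectorField X.toSuperSpace ⊤ p) :
    Prop :=
  ∃ (P : CSManifold) (pr₁ : Mor P G) (pr₂ : Mor P X) (D' : VectorField P.toSuperSpace ⊤ p)
    (j : Mor X P),
    IsProduct pr₁ pr₂ ∧ D'.Related pr₁ D ∧ D'.RelatedZero pr₂ ∧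
    j.comp pr₁ = 1 ∧ j.comp pr₂ = Hom.id _ ∧
    ∀ (V : Opens X.carrier) (f : X.sec V),
      ∃ h : Opens.comap j.base (Opens.comap (a.act pr₁ pr₂).base V) ≤ V,
        X.res h (DX.app V le_top f) =
          j.pull _ (D'.app _ le_top ((a.act pr₁ pr₂).pull V f))

/-! ### Berezinians -/

/-- The parities of the members of a frame. -/
def idxPar {m n : ℕ} : Fin m ⊕ Fin n → ZMod 2 := Sum.elim (fun _ => 0) (fun _ => 1)

/-- A frame of the tangent sheaf over `U`: `m` even and `n` odd vector fields that form a basis of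
the module of vector fields. -/
structure LocalFrame (X : CSManifold) (U : Opens X.carrier) where
  vec : ∀ a : Fin X.evenDim ⊕ Fin X.oddDim, VectorField X.toSuperSpace U (idxPar a)
  basis : ∀ (W : Opens X.carrier) (h : W ≤ U) (p : ZMod 2) (D : VectorField X.toSuperSpace W p),
    ∃! c : Fin X.evenDim ⊕ Fin X.oddDim → X.sec W,
      ∀ (V : Opens X.carrier) (h' : V ≤ W) (f : X.sec V),
        D.app V h' f = ∑ a, X.res h' (c a) * (vec a).app V (h'.trans h) f

/-- Restriction of a frame to a smaller open set. -/
def LocalFrame.restrict {X : CSManifold} {U W : Opens X.carrier} (e : LocalFrame X U)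
    (h : W ≤ U) : LocalFrame X W where
  vec a := (e.vec a).restrict h
  basis V hV := e.basis V (hV.trans h)

/-- The determinant `∑_σ sign(σ) ∏_i M i (σ i)`; it is only applied to matrices of even elements,
which commute with each other. -/
def evenDet {R : Type} [Ring R] {k : ℕ} (M : Matrix (Fin k) (Fin k) R) : R :=
  ∑ σ : Equiv.Perm (Fin k),
    (Equiv.Perm.sign σ : ℤ) • (List.ofFn fun i => M i (σ i)).prod

/-- The Berezinian `det (A - B D⁻¹ C) (det D)⁻¹` of an invertible even supermatrix with blocks
`A, B, C, D`. -/
def ber {R : Type} [Ring R] {m n : ℕ} (M : Matrix (Fin m ⊕ Fin n) (Fin m ⊕ Fin n) R) : R :=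
  evenDet (M.toBlocks₁₁ - M.toBlocks₁₂ * Ring.inverse M.toBlocks₂₂ * M.toBlocks₂₁) *
    Ring.inverse (evenDet M.toBlocks₂₂)

/-- A global section `ω` of the line bundle `Ber_X = sDet (T^*X)`. For a frame `e` of `TX` over
`U`, `ω.app U e` is the coefficient of `ω` with respect to the generator of `sDet (T^*X)` given by
the coframe dual to `e`. If `e' = M e`, the coefficients are related by `Ber M`. -/
structure Berezinian (X : CSManifold) where
  app : ∀ U : Opens X.carrier, LocalFrame X U → X.sec U
  res_app : ∀ {W U : Opens X.carrier} (h : W ≤ U) (e : LocalFrame X U),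
    X.res h (app U e) = app W (e.restrict h)
  change : ∀ (U : Opens X.carrier) (e e' : LocalFrame X U)
    (M : Matrix (Fin X.evenDim ⊕ Fin X.oddDim) (Fin X.evenDim ⊕ Fin X.oddDim) (X.sec U)),
    (∀ a (V : Opens X.carrier) (h : V ≤ U) (f : X.sec V),
      (e'.vec a).app V h f = ∑ b, X.res h (M a b) * (e.vec b).app V h f) →
    app U e' = ber M * app U e

namespace Berezinian

variable {X : CSManifold}

/-- The support of a Berezinian. -/
def support (ω : Berezinian X) : Set X.carrier :=
  {x | ∀ U : Opens X.carrier, x ∈ U → ∃ (V : Opens X.carrier) (_ : V ≤ U) (e : LocalFrame X V),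
    ω.app V e ≠ 0}

/-- The Lie derivative of `ω` along the vector field `D` vanishes. On a frame `e` with
`[D, e_a] = ∑_b c_a^b e_b` (supercommutators), the Lie derivative has the coefficient
`D (ω e) - (∑_a (-1)^{|a|} c_a^a) (ω e)`. -/
def IsInvariant {p : ZMod 2} (D : VectorField X.toSuperSpace ⊤ p) (ω : Berezinian X) : Prop :=
  ∀ (U : Opens X.carrier) (e : LocalFrame X U)
    (c : Matrix (Fin X.evenDim ⊕ Fin X.oddDim) (Fin X.evenDim ⊕ Fin X.oddDim) (X.sec U)),
    (∀ a (V : Opens X.carrier) (h : V ≤ U) (f : X.sec V),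
      D.app V le_top ((e.vec a).app V h f) -
          sgn (p * idxPar a) • (e.vec a).app V h (D.app V le_top f) =
        ∑ b, X.res h (c a b) * (e.vec b).app V h f) →
    D.app U le_top (ω.app U e) = (∑ a, sgn (idxPar a) • c a a) * ω.app U e

end Berezinian

/-! ### Integration -/

/-- An orientation of (the manifold underlying) `X`: a sign for every chart, such that the signs of
two charts differ by the sign of the Jacobian determinant of the underlying coordinate change `τ`
wherever they overlap. (The domain `ℝ^m` of a chart is connected.) -/
structure Orientation (X : CSManifold) where
  sign : Chart X → ℤˣ
  compat : ∀ (φ ψ : Chart X) (τ : (Fin X.evenDim → ℝ) → (Fin X.evenDim → ℝ))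
    (v : Fin X.evenDim → ℝ), (∀ᶠ y in nhds v, ψ.hom.base (τ y) = φ.hom.base y) →
    0 < (((sign φ * sign ψ : ℤˣ) : ℤ) : ℝ) * (fderiv ℝ τ v).det

/-- `e` is the frame `∂/∂x_1, …, ∂/∂x_m, ∂/∂θ_1, …, ∂/∂θ_n` of the chart `φ`. -/
def Chart.IsCoordFrame {X : CSManifold} (φ : Chart X) (e : LocalFrame X φ.image) : Prop :=
  ∀ (a b : Fin X.evenDim ⊕ Fin X.oddDim) (y : X.sec φ.image),
    φ.hom.pull φ.image y = modelCoord _ b →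
    (e.vec a).app φ.image le_rfl y = if a = b then 1 else 0

/-- `ω` is compactly supported in a chart and has the integral `c`, computed in this chart: if
`ω = f(x, θ) [dx | dθ]`, then `c` is, up to the sign of the chart, the Lebesgue integral of the
coefficient of `θ_1 ⋯ θ_n` in `f`. -/
def HasChartIntegral {X : CSManifold} (o : Orientation X) (ω : Berezinian X) (c : ℂ) : Prop :=
  ∃ (φ : Chart X) (e : LocalFrame X φ.image), φ.IsCoordFrame e ∧
    IsCompact ω.support ∧ ω.support ⊆ φ.image ∧
    c = ((o.sign φ : ℤ) : ℂ) * ∫ v : Fin X.evenDim → ℝ,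
      topCoeff X.oddDim ((φ.hom.pull φ.image (ω.app φ.image e)).1 ⟨v, Set.mem_range_self v⟩)

/-- `c` is the Berezin integral of `ω` over the oriented CS manifold `X`: `ω` is a finite sum of
Berezinians with compact support in charts, and `c` is the sum of the integrals of these. -/
def HasIntegral {X : CSManifold} (o : Orientation X) (ω : Berezinian X) (c : ℂ) : Prop :=
  ∃ (k : ℕ) (η : Fin k → Berezinian X) (d : Fin k → ℂ),
    (∀ i, HasChartIntegral o (η i) (d i)) ∧
    (∀ (U : Opens X.carrier) (e : LocalFrame X U), ω.app U e = ∑ i, (η i).app U e) ∧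
    c = ∑ i, d i

end CS

end

/-!
Sections are studied through their pullbacks along charts: `rd h s v` is the Grassmann algebra element
that the section `s` has at the point `v` of a morphism `h` from some `ℝ^{m|n}`. Identities between
sections become pointwise identities in a Grassmann algebra, with `val` (the value modulo nilpotents) as
its body.

**The odd primitive.** The vector field `Q` is exponentiated by means of odd parameters: for a morphism
`z : ℝ^{m|n} → X` and an odd element `τ`, the map `f ↦ z^* f + τ z^* (Q f)` is again a morphism
(`perturb`). Since `Hom(S, G)` is a group for every `S`, this gives, for every point `g` of `G`, a number
`c(g)` with `a_g^* Q = c(g) Q a_g^*`, because conjugation by `g` maps `Q` to an odd element of the Lie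
superalgebra, which `Q` spans (`exists_disp_mul_constHom`, `actPt_pull_app`). A partition of unity
produces an odd `f` with `Q f = 1` modulo nilpotents, as `Q` vanishes nowhere. Averaging `f` over the
compact group of points of `G`, with the weight that corrects for `c`, preserves this property and yields
an `F` with `a_g^* F = c'(g) F`. Averages of sections are handled by Hadamard's lemma: derivatives and
values of a section at a point factor through its jet, and jets commute with integrals over a compact
space. In product charts the equivariance of `F` shows that `Q² F` is a constant multiple `λ F`
(`exists_sq_eq_smul`). Here `λ = 0`, since `h = Q F` is `1` modulo nilpotents and `Q² h = λ h`,
while the even derivation `Q²` preserves nilpotents. Hence `Q (Q F) = 0` and `β = F / Q F`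
is a primitive (`exists_primitive`, `exists_odd_primitive`).

**The integral.** Let `ω` be invariant. In a chart, `Q ω = -div(Q) ω` for the coefficient of `ω`, so that
the divergence theorem gives `∫ Q(s) ω = 0` for every odd `s` with compact support in the chart
(`Berezinian.IsInvariant.chartInt_eq_zero`). For a partition of unity `ρ_j` subordinate to charts, the
choice `s = ρ_j β` gives `∫ ρ_j ω = -∫ Q(ρ_j) β ω`. The sum of the `Q(ρ_j)` is `Q(1) = 0`, and hence
the sum of the integrals `∫ ρ_j ω` vanishes (`sum_signedInt_eq_zero`).

For this last step, and because the integral of `ω` is defined by an arbitrary decomposition, the integral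
has to be independent of the chart (`chartInt_coef_eq`). The coefficient of `ω` in one chart is the sum of
`γ θ_1 ⋯ θ_n` and of derivatives in the odd directions. An odd vector field `D` acts on
the Berezinian of a supermatrix `M` with `D M = N M` by the supertrace of `N` (`app_ber`), which for the
Jacobian supermatrix is minus the divergence of `D`; therefore the odd derivatives do not contribute in
the other chart either. For `γ θ_1 ⋯ θ_n` the assertion is the classical change of variables formula.
-/

noncomputable section

open TopologicalSpace

namespace CS

set_option linter.unusedSectionVars false

/-! ### The Grassmann algebra -/

section GrassmannAlgebra

variable {κ κ' : Type}

/-- A linear map whose values lie in the range of another one factors linearly through it. -/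
lemma exists_linear_factor {A B C : Type*} [AddCommGroup A] [Module ℂ A] [AddCommGroup B]
    [Module ℂ B] [AddCommGroup C] [Module ℂ C] (Φ : A →ₗ[ℂ] B) (T : C →ₗ[ℂ] B)
    (h : ∀ x, T x ∈ LinearMap.range Φ) : ∃ S : C →ₗ[ℂ] A, ∀ x, Φ (S x) = T x := by
  obtain ⟨S, hS⟩ := Module.projective_lifting_property Φ.rangeRestrict
    (T.codRestrict (LinearMap.range Φ) h) Φ.surjective_rangeRestrict
  exact ⟨S, fun x => congrArg Subtype.val (LinearMap.congr_fun hS x)⟩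

/-- The augmentation (body) of an element of the Grassmann algebra. -/
def aug (κ : Type) : Grassmann κ →ₐ[ℂ] ℂ := ExteriorAlgebra.algebraMapInv

@[simp] lemma aug_algebraMap (c : ℂ) : aug κ (algebraMap ℂ _ c) = c :=
  ExteriorAlgebra.algebraMap_leftInverse _ c

@[simp] lemma aug_ι (w : κ → ℂ) : aug κ (ExteriorAlgebra.ι ℂ w) = 0 := by
  simp [aug, ExteriorAlgebra.algebraMapInv]

lemma aug_of_odd {x : Grassmann κ} (hx : x ∈ grassmannPar κ 1) : aug κ x = 0 := by
  induction x, hx using CliffordAlgebra.odd_induction with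
  | ι v => exact aug_ι v
  | add a b _ _ ha hb => rw [map_add, ha, hb, add_zero]
  | ι_mul_ι_mul u v x _ hx => rw [map_mul, hx, mul_zero]

/-- The augmentation ideal. -/
def augIdeal (κ : Type) : Submodule ℂ (Grassmann κ) := LinearMap.ker (aug κ).toLinearMap

lemma mem_augIdeal {x : Grassmann κ} : x ∈ augIdeal κ ↔ aug κ x = 0 := Iff.rfl

open Classical in
/-- The odd generator `θ_k`. -/
def theta (k : κ) : Grassmann κ := ExteriorAlgebra.ι ℂ (Pi.single k 1)

lemma ι_eq_sum [Fintype κ] (w : κ → ℂ) :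
    (ExteriorAlgebra.ι ℂ w : Grassmann κ) = ∑ k, w k • theta k := by
  classical
  conv_lhs => rw [pi_eq_sum_univ' w]
  simp only [map_sum, map_smul, theta]

lemma theta_odd (k : κ) : theta k ∈ grassmannPar κ 1 := CliffordAlgebra.ι_mem_evenOdd_one _ _

@[simp] lemma aug_theta (k : κ) : aug κ (theta k) = 0 := aug_ι _

lemma ι_mul_theta (w : κ → ℂ) (k : κ) :
    (ExteriorAlgebra.ι ℂ w : Grassmann κ) * theta k = -(theta k * ExteriorAlgebra.ι ℂ w) :=
  grassmann_swap _ _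

/-- The map `(y_k) ↦ ∑ θ_k y_k`, the sum being over a family of generators. -/
def thetaSum [Fintype κ'] (e : κ' → κ) : (κ' → Grassmann κ) →ₗ[ℂ] Grassmann κ :=
  ∑ k, (LinearMap.mulLeft ℂ (theta (e k))).comp (LinearMap.proj k)

lemma thetaSum_apply [Fintype κ'] (e : κ' → κ) (y : κ' → Grassmann κ) :
    thetaSum e y = ∑ k, theta (e k) * y k := by
  simp [thetaSum]

lemma thetaSum_mul [Fintype κ'] (e : κ' → κ) {x : Grassmann κ}
    (hx : x ∈ LinearMap.range (thetaSum e)) (z : Grassmann κ) :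
    x * z ∈ LinearMap.range (thetaSum e) := by
  obtain ⟨y, rfl⟩ := hx
  exact ⟨fun k => y k * z, by simp [thetaSum_apply, Finset.sum_mul, mul_assoc]⟩

lemma mul_thetaSum [Fintype κ'] (e : κ' → κ) {x : Grassmann κ}
    (hx : x ∈ LinearMap.range (thetaSum e)) (z : Grassmann κ) :
    z * x ∈ LinearMap.range (thetaSum e) := by
  induction z using ExteriorAlgebra.induction generalizing x with
  | algebraMap r =>
    rw [← Algebra.smul_def]
    exact Submodule.smul_mem _ _ hx
  | ι w =>
    obtain ⟨y, rfl⟩ := hx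
    refine ⟨fun k => -(ExteriorAlgebra.ι ℂ w * y k), ?_⟩
    simp only [thetaSum_apply, Finset.mul_sum]
    refine Finset.sum_congr rfl fun k _ => ?_
    rw [← mul_assoc, ι_mul_theta, mul_neg, neg_mul, mul_assoc]
  | mul a b ha hb => rw [mul_assoc]; exact ha (hb hx)
  | add a b ha hb => rw [add_mul]; exact add_mem (ha hx) (hb hx)

/-- If an endomorphism `T` of the Grassmann algebra moves the generators by combinations of certain
`θ_k`, then `x - T x` is a combination of these `θ_k` with coefficients linear in `x`. -/
lemma exists_theta_decomp [Fintype κ'] (e : κ' → κ) (T : Grassmann κ →ₐ[ℂ] Grassmann κ)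
    (hT : ∀ w, ExteriorAlgebra.ι ℂ w - T (ExteriorAlgebra.ι ℂ w) ∈ LinearMap.range (thetaSum e)) :
    ∃ r : κ' → Grassmann κ →ₗ[ℂ] Grassmann κ, ∀ x, x = T x + ∑ k, theta (e k) * r k x := by
  have key : ∀ x, (LinearMap.id - T.toLinearMap : Grassmann κ →ₗ[ℂ] Grassmann κ) x ∈
      LinearMap.range (thetaSum e) := by
    intro x
    change x - T x ∈ _
    induction x using ExteriorAlgebra.induction with
    | algebraMap r => rw [AlgHom.commutes, sub_self]; exact zero_mem _
    | ι w => exact hT w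
    | mul a b ha hb =>
      have : a * b - T (a * b) = (a - T a) * b + T a * (b - T b) := by
        rw [map_mul]; noncomm_ring
      rw [this]
      exact add_mem (thetaSum_mul e ha b) (mul_thetaSum e hb (T a))
    | add a b ha hb =>
      rw [map_add, add_sub_add_comm]
      exact add_mem ha hb
  obtain ⟨S, hS⟩ := exists_linear_factor _ _ key
  refine ⟨fun k => (LinearMap.proj k).comp S, fun x => ?_⟩
  have := hS x
  rw [thetaSum_apply] at this
  simp only [LinearMap.comp_apply, LinearMap.proj_apply, this]
  simp

lemma exists_aug_decomp [Fintype κ] : ∃ r : κ → Grassmann κ →ₗ[ℂ] Grassmann κ,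
    ∀ x, x = algebraMap ℂ _ (aug κ x) + ∑ k, theta k * r k x := by
  refine exists_theta_decomp (κ' := κ) id ((Algebra.ofId ℂ _).comp (aug κ)) fun w => ?_
  refine ⟨fun k => algebraMap ℂ _ (w k), ?_⟩
  simp only [thetaSum_apply, AlgHom.comp_apply, aug_ι, map_zero, sub_zero, id]
  rw [ι_eq_sum]
  exact Finset.sum_congr rfl fun k _ => by rw [← Algebra.commutes, Algebra.smul_def]

lemma ι_mul_mem_top (V : Submodule ℂ (Grassmann κ)) (hV : V = LinearMap.range (ExteriorAlgebra.ι ℂ)) :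
    ⊤ * V ≤ V * ⊤ := by
  subst hV
  rw [Submodule.mul_le]
  rintro x - _ ⟨w, rfl⟩
  induction x using ExteriorAlgebra.induction generalizing w with
  | algebraMap r =>
    rw [← Algebra.smul_def, ← mul_one (r • _)]
    exact Submodule.mul_mem_mul ⟨r • w, by simp⟩ trivial
  | ι u =>
    exact Submodule.mul_mem_mul ⟨u, rfl⟩ trivial
  | mul a b ha hb =>
    rw [mul_assoc]
    refine Submodule.mul_induction_on (hb w) ?_ ?_
    · rintro _ ⟨w', rfl⟩ z -
      rw [← mul_assoc]
      have := Submodule.mul_mem_mul (ha w') (Submodule.mem_top (x := z) (R := ℂ))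
      rw [mul_assoc (LinearMap.range (ExteriorAlgebra.ι ℂ) : Submodule ℂ (Grassmann κ))] at this
      have hle : LinearMap.range (ExteriorAlgebra.ι ℂ) * (⊤ * ⊤) ≤
          LinearMap.range (ExteriorAlgebra.ι ℂ) * (⊤ : Submodule ℂ (Grassmann κ)) :=
        mul_le_mul' le_rfl le_top
      exact hle this
    · intro y z hy hz
      rw [mul_add]; exact add_mem hy hz
  | add a b ha hb => rw [add_mul]; exact add_mem (ha w) (hb w)

lemma exteriorPower_eq_bot [Fintype κ] {i : ℕ} (hi : Fintype.card κ < i) :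
    (⋀[ℂ]^i (κ → ℂ)) = ⊥ := by
  have : Module.finrank ℂ (⋀[ℂ]^i (κ → ℂ)) = 0 := by
    rw [exteriorPower.finrank_eq, Module.finrank_fintype_fun_eq_card, Nat.choose_eq_zero_of_lt hi]
  exact Submodule.finrank_eq_zero.1 this

lemma augIdeal_pow_le [Fintype κ] (k : ℕ) :
    augIdeal κ ^ k ≤ LinearMap.range (ExteriorAlgebra.ι ℂ) ^ k * (⊤ : Submodule ℂ (Grassmann κ)) := by
  induction k with
  | zero =>
    rw [pow_zero, pow_zero, one_mul]
    exact le_top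
  | succ k ih =>
    have h1 : augIdeal κ ≤ LinearMap.range (ExteriorAlgebra.ι ℂ) * ⊤ := by
      intro x hx
      obtain ⟨r, hr⟩ := exists_aug_decomp (κ := κ)
      rw [hr x, mem_augIdeal.1 hx, map_zero, zero_add]
      exact sum_mem fun k _ => Submodule.mul_mem_mul ⟨_, rfl⟩ trivial
    calc augIdeal κ ^ (k + 1) = augIdeal κ ^ k * augIdeal κ := pow_succ _ _
      _ ≤ (LinearMap.range (ExteriorAlgebra.ι ℂ) ^ k * ⊤) * (LinearMap.range (ExteriorAlgebra.ι ℂ) * ⊤) :=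
        mul_le_mul' ih h1
      _ = LinearMap.range (ExteriorAlgebra.ι ℂ) ^ k * (⊤ * LinearMap.range (ExteriorAlgebra.ι ℂ)) * ⊤ := by
        simp only [mul_assoc]
      _ ≤ LinearMap.range (ExteriorAlgebra.ι ℂ) ^ k * (LinearMap.range (ExteriorAlgebra.ι ℂ) * ⊤) * ⊤ :=
        mul_le_mul' (mul_le_mul' le_rfl (ι_mul_mem_top _ rfl)) le_rfl
      _ = LinearMap.range (ExteriorAlgebra.ι ℂ) ^ (k + 1) * (⊤ * ⊤) := by
        rw [pow_succ]; simp only [mul_assoc]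
      _ ≤ _ := mul_le_mul' le_rfl le_top

/-- The augmentation ideal is nilpotent. -/
lemma augIdeal_pow_eq_bot [Fintype κ] : augIdeal κ ^ (Fintype.card κ + 1) = ⊥ := by
  have h := augIdeal_pow_le (κ := κ) (Fintype.card κ + 1)
  have h2 : (LinearMap.range (ExteriorAlgebra.ι ℂ) : Submodule ℂ (Grassmann κ)) ^ (Fintype.card κ + 1) = ⊥ :=
    exteriorPower_eq_bot (Nat.lt_succ_self _)
  rw [h2, Submodule.bot_mul] at h
  exact le_bot_iff.1 h

lemma isUnit_of_aug_ne_zero [Fintype κ] {x : Grassmann κ} (hx : aug κ x ≠ 0) : IsUnit x := by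
  have hn : IsNilpotent (x - algebraMap ℂ _ (aug κ x)) := by
    refine ⟨Fintype.card κ + 1, ?_⟩
    have : x - algebraMap ℂ _ (aug κ x) ∈ augIdeal κ := by simp [mem_augIdeal]
    have := Submodule.pow_mem_pow _ this (Fintype.card κ + 1)
    rwa [augIdeal_pow_eq_bot] at this
  have hu : IsUnit (algebraMap ℂ (Grassmann κ) (aug κ x)) :=
    (ExteriorAlgebra.isUnit_algebraMap _ _).2 (isUnit_iff_ne_zero.2 hx)
  have := hn.isUnit_add_left_of_commute hu (Algebra.commutes _ _).symm
  simpa using this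

/-! Two groups of odd generators. -/

/-- Setting the first group of generators to zero. -/
def killInl (κ κ' : Type) : Grassmann (κ ⊕ κ') →ₐ[ℂ] Grassmann κ' :=
  ExteriorAlgebra.map (LinearMap.pi fun k => LinearMap.proj (Sum.inr k))

/-- The pullback of odd coordinates along the second projection. -/
def inclInr (κ κ' : Type) : Grassmann κ' →ₐ[ℂ] Grassmann (κ ⊕ κ') :=
  ExteriorAlgebra.map (LinearMap.pi (Sum.elim 0 fun k => LinearMap.proj k))

lemma killInl_inclInr (x : Grassmann κ') : killInl κ κ' (inclInr κ κ' x) = x := by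
  have : (killInl κ κ').comp (inclInr κ κ') = AlgHom.id ℂ _ := by
    rw [killInl, inclInr, ExteriorAlgebra.map_comp_map, ← ExteriorAlgebra.map_id]
    rfl
  exact DFunLike.congr_fun this x

lemma exists_killInl_decomp [Fintype κ] [Fintype κ'] :
    ∃ r : κ → Grassmann (κ ⊕ κ') →ₗ[ℂ] Grassmann (κ ⊕ κ'),
    ∀ x, x = inclInr κ κ' (killInl κ κ' x) + ∑ k, theta (Sum.inl k) * r k x := by
  refine exists_theta_decomp Sum.inl ((inclInr κ κ').comp (killInl κ κ')) fun w => ?_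
  refine ⟨fun k => algebraMap ℂ _ (w (Sum.inl k)), ?_⟩
  simp only [thetaSum_apply, AlgHom.comp_apply, killInl, inclInr, ExteriorAlgebra.map_apply_ι]
  rw [← map_sub, ι_eq_sum, Fintype.sum_sum_type]
  simp [Algebra.smul_def, Algebra.commutes]

/-! Contractions and the top coefficient. -/

lemma zmod2_cases (k : ZMod 2) : k = 0 ∨ k = 1 := by revert k; decide

@[simp] lemma sgn_zero : sgn 0 = 1 := by simp [sgn]
@[simp] lemma sgn_one : sgn 1 = -1 := by simp [sgn]

lemma sgn_add (i j : ZMod 2) : sgn (i + j) = sgn i * sgn j := by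
  rcases zmod2_cases i with rfl | rfl <;> rcases zmod2_cases j with rfl | rfl <;>
    simp [sgn, show (1 : ZMod 2) + 1 = 0 from rfl]

lemma sgn_mul_self (i : ZMod 2) : sgn i * sgn i = 1 := by
  rcases zmod2_cases i with rfl | rfl <;> simp

/-- The derivative `∂/∂θ_k` on the Grassmann algebra. -/
def contr (k : κ) : Grassmann κ →ₗ[ℂ] Grassmann κ :=
  CliffordAlgebra.contractLeft (Q := (0 : QuadraticForm ℂ (κ → ℂ))) (LinearMap.proj k)

lemma contr_ι_mul (k : κ) (w : κ → ℂ) (b : Grassmann κ) :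
    contr k (ExteriorAlgebra.ι ℂ w * b) = w k • b - ExteriorAlgebra.ι ℂ w * contr k b :=
  CliffordAlgebra.contractLeft_ι_mul (Q := (0 : QuadraticForm ℂ (κ → ℂ))) _ w b

lemma contr_algebraMap (k : κ) (c : ℂ) : contr k (algebraMap ℂ (Grassmann κ) c) = 0 :=
  CliffordAlgebra.contractLeft_algebraMap (Q := (0 : QuadraticForm ℂ (κ → ℂ))) _ c

lemma contr_ι (k : κ) (w : κ → ℂ) :
    contr k (ExteriorAlgebra.ι ℂ w) = algebraMap ℂ (Grassmann κ) (w k) :=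
  CliffordAlgebra.contractLeft_ι (Q := (0 : QuadraticForm ℂ (κ → ℂ))) _ w

open Classical in
lemma contr_theta (k l : κ) : contr k (theta l) = if k = l then 1 else 0 := by
  rw [theta, contr_ι, Pi.single_apply]
  split_ifs <;> simp

lemma contr_ι_ι_mul (k : κ) (u v : κ → ℂ) (b : Grassmann κ) :
    contr k (ExteriorAlgebra.ι ℂ u * ExteriorAlgebra.ι ℂ v * b) =
      u k • (ExteriorAlgebra.ι ℂ v * b) - v k • (ExteriorAlgebra.ι ℂ u * b) +
        ExteriorAlgebra.ι ℂ u * ExteriorAlgebra.ι ℂ v * contr k b := by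
  rw [mul_assoc, contr_ι_mul, contr_ι_mul, mul_sub, mul_smul_comm, mul_assoc]
  abel

lemma contr_mul (k : κ) (i : ZMod 2) (x y : Grassmann κ) (hx : x ∈ grassmannPar κ i) :
    contr k (x * y) = contr k x * y + sgn i • (x * contr k y) := by
  rcases zmod2_cases i with rfl | rfl
  · rw [sgn_zero, one_smul]
    induction x, hx using CliffordAlgebra.even_induction with
    | algebraMap r =>
      change contr k (algebraMap ℂ (Grassmann κ) r * y) = contr k (algebraMap ℂ (Grassmann κ) r) * y +
        algebraMap ℂ (Grassmann κ) r * contr k y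
      rw [contr_algebraMap, zero_mul, zero_add, ← Algebra.smul_def, map_smul, Algebra.smul_def]
    | add a b _ _ ha hb => rw [add_mul, map_add, ha, hb, map_add]; noncomm_ring
    | ι_mul_ι_mul u v x _ hx =>
      change contr k (ExteriorAlgebra.ι ℂ u * ExteriorAlgebra.ι ℂ v * x * y) =
        contr k (ExteriorAlgebra.ι ℂ u * ExteriorAlgebra.ι ℂ v * x) * y +
          ExteriorAlgebra.ι ℂ u * ExteriorAlgebra.ι ℂ v * x * contr k y
      rw [mul_assoc (_ * _) x y, contr_ι_ι_mul, hx, contr_ι_ι_mul]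
      simp only [mul_add, add_mul, sub_mul, smul_mul_assoc, mul_assoc]
      abel
  · rw [sgn_one, neg_one_smul]
    induction x, hx using CliffordAlgebra.odd_induction with
    | ι v =>
      change contr k (ExteriorAlgebra.ι ℂ v * y) = contr k (ExteriorAlgebra.ι ℂ v) * y +
        -(ExteriorAlgebra.ι ℂ v * contr k y)
      rw [contr_ι_mul, contr_ι, Algebra.smul_def, sub_eq_add_neg]
    | add a b _ _ ha hb => rw [add_mul, map_add, ha, hb, map_add]; noncomm_ring
    | ι_mul_ι_mul u v x _ hx =>
      change contr k (ExteriorAlgebra.ι ℂ u * ExteriorAlgebra.ι ℂ v * x * y) =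
        contr k (ExteriorAlgebra.ι ℂ u * ExteriorAlgebra.ι ℂ v * x) * y +
          -(ExteriorAlgebra.ι ℂ u * ExteriorAlgebra.ι ℂ v * x * contr k y)
      rw [mul_assoc (_ * _) x y, contr_ι_ι_mul, hx, contr_ι_ι_mul]
      simp only [mul_add, add_mul, sub_mul, smul_mul_assoc, mul_assoc, mul_neg]
      abel

lemma contr_par (k : κ) (i : ZMod 2) (x : Grassmann κ) (hx : x ∈ grassmannPar κ i) :
    contr k x ∈ grassmannPar κ (1 + i) := by
  have hι : ∀ (v : κ → ℂ) (j : ZMod 2) (y : Grassmann κ), y ∈ grassmannPar κ j →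
      ExteriorAlgebra.ι ℂ v * y ∈ grassmannPar κ (1 + j) := fun v j y hy =>
    SetLike.mul_mem_graded (A := CliffordAlgebra.evenOdd (0 : QuadraticForm ℂ (κ → ℂ)))
      (CliffordAlgebra.ι_mem_evenOdd_one _ v) hy
  have hιι : ∀ (u v : κ → ℂ) (j : ZMod 2) (y : Grassmann κ), y ∈ grassmannPar κ j →
      ExteriorAlgebra.ι ℂ u * ExteriorAlgebra.ι ℂ v * y ∈ grassmannPar κ j := fun u v j y hy => by
    have := hι u _ _ (hι v j y hy)
    rwa [← add_assoc, show (1 : ZMod 2) + 1 = 0 from rfl, zero_add, ← mul_assoc] at this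
  rcases zmod2_cases i with rfl | rfl
  · induction x, hx using CliffordAlgebra.even_induction with
    | algebraMap r =>
      change contr k (algebraMap ℂ (Grassmann κ) r) ∈ _
      rw [contr_algebraMap]; exact zero_mem _
    | add a b _ _ ha hb => rw [map_add]; exact add_mem ha hb
    | ι_mul_ι_mul u v x hx ih =>
      change contr k (ExteriorAlgebra.ι ℂ u * ExteriorAlgebra.ι ℂ v * x) ∈ _
      rw [contr_ι_ι_mul]
      exact add_mem (sub_mem (Submodule.smul_mem _ _ (hι _ _ _ hx)) (Submodule.smul_mem _ _ (hι _ _ _ hx)))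
        (hιι _ _ _ _ ih)
  · induction x, hx using CliffordAlgebra.odd_induction with
    | ι v =>
      change contr k (ExteriorAlgebra.ι ℂ v) ∈ _
      rw [contr_ι]
      exact SetLike.algebraMap_mem_graded (CliffordAlgebra.evenOdd (0 : QuadraticForm ℂ (κ → ℂ))) _
    | add a b _ _ ha hb => rw [map_add]; exact add_mem ha hb
    | ι_mul_ι_mul u v x hx ih =>
      change contr k (ExteriorAlgebra.ι ℂ u * ExteriorAlgebra.ι ℂ v * x) ∈ _
      rw [contr_ι_ι_mul]
      exact add_mem (sub_mem (Submodule.smul_mem _ _ (hι _ _ _ hx)) (Submodule.smul_mem _ _ (hι _ _ _ hx)))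
        (hιι _ _ _ _ ih)

lemma contr_exteriorPower (k : κ) (i : ℕ) (x : Grassmann κ) (hx : x ∈ ⋀[ℂ]^(i + 1) (κ → ℂ)) :
    contr k x ∈ ⋀[ℂ]^i (κ → ℂ) := by
  induction i generalizing x with
  | zero =>
    change x ∈ LinearMap.range (ExteriorAlgebra.ι ℂ) ^ 1 at hx
    rw [pow_one] at hx
    obtain ⟨w, rfl⟩ := hx
    rw [contr_ι]
    change _ ∈ LinearMap.range (ExteriorAlgebra.ι ℂ) ^ 0
    rw [pow_zero]
    exact Submodule.mem_one.2 ⟨_, rfl⟩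
  | succ i ih =>
    change x ∈ LinearMap.range (ExteriorAlgebra.ι ℂ) ^ (i + 1 + 1) at hx
    rw [pow_succ'] at hx
    refine Submodule.mul_induction_on hx ?_ ?_
    · rintro _ ⟨w, rfl⟩ y hy
      rw [contr_ι_mul]
      refine sub_mem (Submodule.smul_mem _ _ hy) ?_
      change _ ∈ LinearMap.range (ExteriorAlgebra.ι ℂ) ^ (i + 1)
      rw [pow_succ']
      exact Submodule.mul_mem_mul ⟨w, rfl⟩ (ih y hy)
    · intro a b ha hb
      rw [map_add]; exact add_mem ha hb

end GrassmannAlgebra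

section TopDegree

variable {n : ℕ}

lemma ofFinEmbEquiv_univ (h : (Finset.univ : Finset (Fin n)).card = n) (i : Fin n) :
    Set.powersetCard.ofFinEmbEquiv.symm (Set.powersetCard.ofCard h) i = i := by
  have h1 : StrictMono (Set.powersetCard.ofFinEmbEquiv.symm (Set.powersetCard.ofCard h)) :=
    (Set.powersetCard.ofFinEmbEquiv.symm (Set.powersetCard.ofCard h)).strictMono
  have : Set.range (Set.powersetCard.ofFinEmbEquiv.symm (Set.powersetCard.ofCard h)) =
      Set.range (id : Fin n → Fin n) := by
    rw [Set.range_id]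
    exact (Finite.injective_iff_surjective.1 h1.injective).range_eq
  exact congrFun ((StrictMono.range_inj h1 strictMono_id).1 this) i

/-- The product `θ_1 ⋯ θ_n`. -/
def topTheta (n : ℕ) : Grassmann (Fin n) := ExteriorAlgebra.ιMulti ℂ n (Pi.basisFun ℂ (Fin n))

lemma topTheta_eq : topTheta n = (Pi.basisFun ℂ (Fin n)).ExteriorAlgebra Finset.univ := by
  rw [ExteriorAlgebra.basis_apply_ofCard _ (Finset.card_fin n)]
  change _ = ExteriorAlgebra.ιMulti ℂ n _
  rw [topTheta]
  congr 1
  funext i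
  simp only [Function.comp_apply, ofFinEmbEquiv_univ]

@[simp] lemma topCoeff_topTheta : topCoeff n (topTheta n) = 1 := by
  simp [topCoeff, topTheta_eq]

lemma topCoeff_of_mem_exteriorPower {i : ℕ} (hi : i ≠ n) {x : Grassmann (Fin n)}
    (hx : x ∈ ⋀[ℂ]^i (Fin n → ℂ)) : topCoeff n x = 0 := by
  have h := congrArg Subtype.val (((Pi.basisFun ℂ (Fin n)).exteriorPower i).sum_repr ⟨x, hx⟩)
  simp only [AddSubmonoidClass.coe_finsetSum, SetLike.val_smul] at h
  rw [← h, map_sum]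
  refine Finset.sum_eq_zero fun s _ => ?_
  rw [map_smul, ← ExteriorAlgebra.basis_eq_coe_basis, topCoeff, Module.Basis.coord_apply,
    Module.Basis.repr_self, Finsupp.single_apply, if_neg, smul_zero]
  intro hs
  apply hi
  have := s.2
  rw [Set.powersetCard.mem_iff, hs, Finset.card_fin] at this
  exact this.symm

lemma span_exteriorPower (κ : Type) : (⨆ i : ℕ, ⋀[ℂ]^i (κ → ℂ)) = (⊤ : Submodule ℂ (Grassmann κ)) :=
  (DirectSum.Decomposition.isInternal (fun i => ⋀[ℂ]^i (κ → ℂ))).submodule_iSup_eq_top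

/-- The derivatives `∂/∂θ_k` have no top component. -/
lemma topCoeff_contr (k : Fin n) (x : Grassmann (Fin n)) : topCoeff n (contr k x) = 0 := by
  have hx : x ∈ (⨆ i : ℕ, ⋀[ℂ]^i (Fin n → ℂ)) := by rw [span_exteriorPower]; trivial
  induction hx using Submodule.iSup_induction' with
  | mem i x hx =>
    rcases i with _ | i
    · change x ∈ LinearMap.range (ExteriorAlgebra.ι ℂ) ^ 0 at hx
      rw [pow_zero] at hx
      obtain ⟨c, rfl⟩ := Submodule.mem_one.1 hx
      rw [contr_algebraMap, map_zero]
    · by_cases hi : i = n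
      · rw [exteriorPower_eq_bot (by simp [hi])] at hx
        rw [(Submodule.mem_bot ℂ).1 hx, map_zero, map_zero]
      · exact topCoeff_of_mem_exteriorPower hi (contr_exteriorPower k i x hx)
  | zero => simp
  | add x y _ _ hx hy => rw [map_add, map_add, hx, hy, add_zero]

lemma contr_prod_eq_zero {κ : Type} (k : κ) (l : List (κ → ℂ)) (hl : ∀ w ∈ l, w k = 0) :
    contr k ((l.map (ExteriorAlgebra.ι ℂ)).prod : Grassmann κ) = 0 := by
  induction l with
  | nil =>
    rw [List.map_nil, List.prod_nil, ← map_one (algebraMap ℂ (Grassmann κ)), contr_algebraMap]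
  | cons w l ih =>
    rw [List.map_cons, List.prod_cons, contr_ι_mul, hl w (by simp),
      ih fun v hv => hl v (by simp [hv])]
    simp

/-- Up to its top component, an element is a combination of derivatives `∂/∂θ_k`. -/
lemma exists_contr_decomp (n : ℕ) : ∃ r : Fin n → Grassmann (Fin n) →ₗ[ℂ] Grassmann (Fin n),
    ∀ x, x = topCoeff n x • topTheta n + ∑ k, contr k (r k x) := by
  let Φ : (Fin n → Grassmann (Fin n)) →ₗ[ℂ] Grassmann (Fin n) :=
    ∑ k, (contr k).comp (LinearMap.proj k)
  have hΦ : ∀ y, Φ y = ∑ k, contr k (y k) := fun y => by simp [Φ]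
  let T : Grassmann (Fin n) →ₗ[ℂ] Grassmann (Fin n) :=
    LinearMap.id - (topCoeff n).smulRight (topTheta n)
  have hT : ∀ x, T x = x - topCoeff n x • topTheta n := fun x => by simp [T]
  have key : ∀ x, T x ∈ LinearMap.range Φ := by
    intro x
    rw [← (Pi.basisFun ℂ (Fin n)).ExteriorAlgebra.sum_repr x, map_sum]
    refine sum_mem fun A _ => ?_
    rw [map_smul]
    refine Submodule.smul_mem _ _ ?_
    rw [hT]
    by_cases hA : A = Finset.univ
    · rw [hA, ← topTheta_eq, topCoeff_topTheta, one_smul, sub_self]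
      exact zero_mem _
    -- a basis monomial `x` without `θ_k` is `∂/∂θ_k (θ_k x)`
    · obtain ⟨k, hk⟩ : ∃ k, k ∉ A := by
        by_contra! h
        exact hA (Finset.eq_univ_iff_forall.2 h)
      have h0 : topCoeff n ((Pi.basisFun ℂ (Fin n)).ExteriorAlgebra A) = 0 := by
        rw [topCoeff, Module.Basis.coord_apply, Module.Basis.repr_self, Finsupp.single_apply,
          if_neg hA]
      have h1 : contr k ((Pi.basisFun ℂ (Fin n)).ExteriorAlgebra A) = 0 := by
        rw [ExteriorAlgebra.basis_apply_ofCard _ rfl]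
        change contr k (ExteriorAlgebra.ιMulti ℂ _ _) = 0
        rw [ExteriorAlgebra.ιMulti_apply]
        have := contr_prod_eq_zero k (List.ofFn (Pi.basisFun ℂ (Fin n) ∘
          (Set.powersetCard.ofFinEmbEquiv.symm (Set.powersetCard.ofCard (s := A) rfl)))) ?_
        · rw [List.map_ofFn] at this
          exact this
        · intro w hw
          obtain ⟨i, rfl⟩ := (List.mem_ofFn' _ _).1 hw
          have hi : Set.powersetCard.ofFinEmbEquiv.symm (Set.powersetCard.ofCard (s := A) rfl) i ∈ A := by
            have := Set.powersetCard.mem_range_ofFinEmbEquiv_symm_iff_mem (Set.powersetCard.ofCard (s := A) rfl)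
              (Set.powersetCard.ofFinEmbEquiv.symm (Set.powersetCard.ofCard (s := A) rfl) i)
            exact this.1 ⟨i, rfl⟩
          rw [Function.comp_apply, Pi.basisFun_apply, Pi.single_apply, if_neg]
          rintro rfl
          exact hk hi
      refine ⟨Pi.single k (theta k * (Pi.basisFun ℂ (Fin n)).ExteriorAlgebra A), ?_⟩
      rw [hΦ, Finset.sum_eq_single k]
      · rw [Pi.single_eq_same, theta, contr_ι_mul, h1, h0]
        simp
      · intro l _ hl
        rw [Pi.single_eq_of_ne hl, map_zero]
      · simp
  obtain ⟨S, hS⟩ := exists_linear_factor _ _ key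
  refine ⟨fun k => (LinearMap.proj k).comp S, fun x => ?_⟩
  have := hS x
  rw [hΦ, hT] at this
  simp only [LinearMap.comp_apply, LinearMap.proj_apply, this]
  simp

lemma topTheta_mem : topTheta n ∈ augIdeal (Fin n) ^ n := by
  rw [topTheta, ExteriorAlgebra.ιMulti_apply]
  have : ∀ (l : List (Fin n → ℂ)),
      (l.map (ExteriorAlgebra.ι ℂ)).prod ∈ augIdeal (Fin n) ^ l.length := by
    intro l
    induction l with
    | nil => simp
    | cons w l ih =>
      rw [List.map_cons, List.prod_cons, List.length_cons, pow_succ']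
      exact Submodule.mul_mem_mul (mem_augIdeal.2 (aug_ι w)) ih
  have h := this (List.ofFn (Pi.basisFun ℂ (Fin n)))
  rwa [List.map_ofFn, List.length_ofFn] at h

lemma mul_topTheta (x : Grassmann (Fin n)) : x * topTheta n = aug _ x • topTheta n := by
  have h : x - algebraMap ℂ _ (aug _ x) ∈ augIdeal (Fin n) := by simp [mem_augIdeal]
  have h2 := Submodule.mul_mem_mul h topTheta_mem
  rw [← pow_succ'] at h2
  have h3 := augIdeal_pow_eq_bot (κ := Fin n)
  rw [Fintype.card_fin] at h3
  rw [h3, Submodule.mem_bot, sub_mul, ← Algebra.smul_def, sub_eq_zero] at h2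
  exact h2

lemma exists_linear_part {κ : Type} [Fintype κ] (x : Grassmann κ) (hx : x ∈ grassmannPar κ 1) :
    x - ExteriorAlgebra.ι ℂ (fun k => aug κ (contr k x)) ∈ augIdeal κ ^ 2 := by
  induction x, hx using CliffordAlgebra.odd_induction with
  | ι v =>
    change (ExteriorAlgebra.ι ℂ v : Grassmann κ) - ExteriorAlgebra.ι ℂ (fun k =>
      aug κ (contr k (ExteriorAlgebra.ι ℂ v))) ∈ _
    have : (fun k => aug κ (contr k (ExteriorAlgebra.ι ℂ v))) = v := by
      funext k; rw [contr_ι, aug_algebraMap]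
    rw [this, sub_self]; exact zero_mem _
  | add a b _ _ ha hb =>
    have : (fun k => aug κ (contr k (a + b))) = (fun k => aug κ (contr k a)) + fun k => aug κ (contr k b) := by
      funext k; simp
    rw [this, map_add, add_sub_add_comm]
    exact add_mem ha hb
  | ι_mul_ι_mul u v x hx ih =>
    change ExteriorAlgebra.ι ℂ u * ExteriorAlgebra.ι ℂ v * x - ExteriorAlgebra.ι ℂ (fun k =>
      aug κ (contr k (ExteriorAlgebra.ι ℂ u * ExteriorAlgebra.ι ℂ v * x))) ∈ _
    have : (fun k => aug κ (contr k (ExteriorAlgebra.ι ℂ u * ExteriorAlgebra.ι ℂ v * x))) = 0 := by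
      funext k
      rw [contr_ι_ι_mul]
      simp
    rw [this, map_zero, sub_zero, mul_assoc, pow_two]
    exact Submodule.mul_mem_mul (mem_augIdeal.2 (aug_ι u)) (mem_augIdeal.2 (by simp))

lemma prod_congr_mod {κ : Type} [Fintype κ] (l : List (Grassmann κ × (κ → ℂ)))
    (h : ∀ p ∈ l, p.1 - ExteriorAlgebra.ι ℂ p.2 ∈ augIdeal κ ^ 2) :
    (l.map Prod.fst).prod ∈ augIdeal κ ^ l.length ∧
    (l.map Prod.fst).prod - (l.map fun p => ExteriorAlgebra.ι ℂ p.2).prod ∈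
      augIdeal κ ^ (l.length + 1) := by
  have hle : augIdeal κ ^ 2 ≤ augIdeal κ := by
    rw [pow_two, Submodule.mul_le]
    intro a ha b hb
    rw [mem_augIdeal, map_mul, mem_augIdeal.1 ha, zero_mul]
  induction l with
  | nil => exact ⟨by simp, by simp⟩
  | cons p l ih =>
    obtain ⟨i1, i2⟩ := ih fun q hq => h q (by simp [hq])
    have hp := h p (by simp)
    have hι : (ExteriorAlgebra.ι ℂ p.2 : Grassmann κ) ∈ augIdeal κ := mem_augIdeal.2 (aug_ι _)
    have hp1 : p.1 ∈ augIdeal κ := by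
      have := add_mem (hle hp) hι
      rwa [sub_add_cancel] at this
    simp only [List.map_cons, List.prod_cons, List.length_cons]
    constructor
    · rw [pow_succ']; exact Submodule.mul_mem_mul hp1 i1
    · have : p.1 * (l.map Prod.fst).prod - ExteriorAlgebra.ι ℂ p.2 * (l.map fun p => ExteriorAlgebra.ι ℂ p.2).prod
        = (p.1 - ExteriorAlgebra.ι ℂ p.2) * (l.map Prod.fst).prod +
          ExteriorAlgebra.ι ℂ p.2 * ((l.map Prod.fst).prod - (l.map fun p => ExteriorAlgebra.ι ℂ p.2).prod) := by
        noncomm_ring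
      rw [this]
      refine add_mem ?_ ?_
      · rw [show l.length + 1 + 1 = 2 + l.length by ring, pow_add]
        exact Submodule.mul_mem_mul hp i1
      · rw [pow_succ']
        exact Submodule.mul_mem_mul hι i2

/-- A product of `n` odd elements in `n` generators is the determinant of the matrix of their linear
parts times `θ_1 ⋯ θ_n`. -/
lemma prod_odd (o : Fin n → Grassmann (Fin n)) (ho : ∀ k, o k ∈ grassmannPar (Fin n) 1) :
    (List.ofFn o).prod = (Matrix.of fun l k => aug _ (contr l (o k))).det • topTheta n := by
  let w : Fin n → Fin n → ℂ := fun k l => aug _ (contr l (o k))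
  have h := (prod_congr_mod (List.ofFn fun k => (o k, w k)) (by
    intro p hp
    obtain ⟨k, rfl⟩ := (List.mem_ofFn' _ _).1 hp
    exact exists_linear_part (o k) (ho k))).2
  have h3 := augIdeal_pow_eq_bot (κ := Fin n)
  rw [Fintype.card_fin] at h3
  rw [List.length_ofFn, h3, Submodule.mem_bot, sub_eq_zero, List.map_ofFn, List.map_ofFn] at h
  change (List.ofFn o).prod = (List.ofFn fun k => ExteriorAlgebra.ι ℂ (w k)).prod at h
  rw [h, ← ExteriorAlgebra.ιMulti_apply]
  have h5 : (ExteriorAlgebra.ιMulti ℂ n : (Fin n → ℂ) [⋀^Fin n]→ₗ[ℂ] Grassmann (Fin n)) =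
      (LinearMap.toSpanSingleton ℂ _ (topTheta n)).compAlternatingMap (Pi.basisFun ℂ (Fin n)).det := by
    refine Module.Basis.ext_alternating (Pi.basisFun ℂ (Fin n)) fun v hv => ?_
    let σ : Equiv.Perm (Fin n) := Equiv.ofBijective v (Finite.injective_iff_bijective.1 hv)
    have e1 : (fun i => Pi.basisFun ℂ (Fin n) (v i)) = Pi.basisFun ℂ (Fin n) ∘ σ := rfl
    rw [e1, AlternatingMap.map_perm, AlternatingMap.map_perm]
    congr 1
    rw [LinearMap.compAlternatingMap_apply, LinearMap.toSpanSingleton_apply, Module.Basis.det_self,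
      one_smul]
    rfl
  rw [h5, LinearMap.compAlternatingMap_apply, LinearMap.toSpanSingleton_apply, Pi.basisFun_det_apply]
  congr 1
  rw [← Matrix.det_transpose]
  rfl

end TopDegree

/-! ### Reading sections in coordinates -/

section Reading

open scoped ContDiff

variable {ι κ ι' κ' : Type} [Fintype ι] [Fintype κ] [Fintype ι'] [Fintype κ']

/-- Smoothness at a point of a function with values in the Grassmann algebra. -/
def SmAt {κ : Type} (F : (ι → ℝ) → Grassmann κ) (x : ι → ℝ) : Prop :=
  ∀ l : Grassmann κ →ₗ[ℂ] ℂ, ContDiffAt ℝ ∞ (fun y => l (F y)) x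

omit [Fintype κ] in
lemma SmAt.congr {F G : (ι → ℝ) → Grassmann κ} {x : ι → ℝ} (hF : SmAt F x)
    (h : ∀ᶠ y in nhds x, G y = F y) : SmAt G x := fun l =>
  (hF l).congr_of_eventuallyEq (h.mono fun _ hy => congrArg l hy)

omit [Fintype κ] in
lemma smAt_const (c : Grassmann κ) (x : ι → ℝ) : SmAt (fun _ => c) x := fun _ => contDiffAt_const

omit [Fintype κ] in
lemma SmAt.add {F G : (ι → ℝ) → Grassmann κ} {x : ι → ℝ} (hF : SmAt F x) (hG : SmAt G x) :
    SmAt (fun y => F y + G y) x := fun l => by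
  simpa only [map_add] using (hF l).add (hG l)

omit [Fintype κ] in
lemma SmAt.sum {J : Type*} {F : J → (ι → ℝ) → Grassmann κ} {x : ι → ℝ} {A : Finset J}
    (hF : ∀ j ∈ A, SmAt (F j) x) : SmAt (fun y => ∑ j ∈ A, F j y) x := fun l => by
  simpa only [map_sum] using ContDiffAt.sum fun j hj => hF j hj l

omit [Fintype κ] [Fintype κ'] in
lemma SmAt.map {F : (ι → ℝ) → Grassmann κ} {x : ι → ℝ} (hF : SmAt F x)
    (T : Grassmann κ →ₗ[ℂ] Grassmann κ') : SmAt (fun y => T (F y)) x := fun l => hF (l.comp T)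

omit [Fintype κ] in
lemma SmAt.smul {c : (ι → ℝ) → ℂ} {F : (ι → ℝ) → Grassmann κ} {x : ι → ℝ}
    (hc : ContDiffAt ℝ ∞ c x) (hF : SmAt F x) : SmAt (fun y => c y • F y) x := fun l => by
  simpa only [map_smul, smul_eq_mul] using hc.mul (hF l)

lemma SmAt.mul {F G : (ι → ℝ) → Grassmann κ} {x : ι → ℝ} (hF : SmAt F x) (hG : SmAt G x) :
    SmAt (fun y => F y * G y) x := by
  intro l
  let b := Module.finBasis ℂ (Grassmann κ)
  have key : ∀ u v : Grassmann κ,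
      l (u * v) = ∑ i, ∑ j, b.coord i u * b.coord j v * l (b i * b j) := by
    intro u v
    conv_lhs => rw [← b.sum_repr u, ← b.sum_repr v]
    simp only [Finset.sum_mul, Finset.mul_sum, map_sum, smul_mul_smul_comm, map_smul, smul_eq_mul,
      Module.Basis.coord_apply]
    exact Finset.sum_comm
  have h : ContDiffAt ℝ ∞ (fun y => ∑ i, ∑ j,
      b.coord i (F y) * b.coord j (G y) * l (b i * b j)) x :=
    ContDiffAt.sum fun i _ => ContDiffAt.sum fun j _ =>
      ((hF (b.coord i)).mul (hG (b.coord j))).mul contDiffAt_const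
  exact h.congr_of_eventuallyEq (Filter.Eventually.of_forall fun y => key _ _)

lemma SmAt.pow {F : (ι → ℝ) → Grassmann κ} {x : ι → ℝ} (hF : SmAt F x) (k : ℕ) :
    SmAt (fun y => F y ^ k) x := by
  induction k with
  | zero => simpa only [pow_zero] using smAt_const 1 x
  | succ k ih => simpa only [pow_succ] using ih.mul hF

/-- The inverse of an element of the Grassmann algebra with nonzero augmentation. -/
def ginv (x : Grassmann κ) : Grassmann κ :=
  ∑ k ∈ Finset.range (Fintype.card κ + 1),
    ((aug κ x)⁻¹) ^ (k + 1) • (algebraMap ℂ _ (aug κ x) - x) ^ k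

lemma mul_ginv {x : Grassmann κ} (hx : aug κ x ≠ 0) : x * ginv x = 1 := by
  set c := aug κ x with hc
  set n := algebraMap ℂ (Grassmann κ) c - x with hn
  have h1 : ginv x = c⁻¹ • ∑ k ∈ Finset.range (Fintype.card κ + 1), (c⁻¹ • n) ^ k := by
    rw [ginv, Finset.smul_sum]
    refine Finset.sum_congr rfl fun k _ => ?_
    rw [← hc, ← hn, smul_pow, smul_smul, pow_succ']
  have h2 : x = c • (1 - c⁻¹ • n) := by
    rw [smul_sub, smul_smul, mul_inv_cancel₀ hx, one_smul, hn, ← Algebra.algebraMap_eq_smul_one]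
    abel
  have h3 : n ^ (Fintype.card κ + 1) = 0 := by
    have : n ∈ augIdeal κ := by simp [mem_augIdeal, hn, hc]
    have := Submodule.pow_mem_pow _ this (Fintype.card κ + 1)
    rwa [augIdeal_pow_eq_bot] at this
  rw [h1]
  nth_rw 1 [h2]
  rw [smul_mul_smul_comm, mul_inv_cancel₀ hx, one_smul, mul_neg_geom_sum, smul_pow, h3, smul_zero,
    sub_zero]

lemma SmAt.ginv {F : (ι → ℝ) → Grassmann κ} {x : ι → ℝ} (hF : SmAt F x) (h0 : aug κ (F x) ≠ 0) :
    SmAt (fun y => ginv (F y)) x := by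
  have ha : ContDiffAt ℝ ∞ (fun y => aug κ (F y)) x := hF (aug κ).toLinearMap
  refine SmAt.sum fun k _ => SmAt.smul ((ha.inv h0).pow (k + 1)) (SmAt.pow ?_ k)
  have h1 : SmAt (fun y => algebraMap ℂ (Grassmann κ) (aug κ (F y))) x := by
    simp only [Algebra.algebraMap_eq_smul_one]
    exact SmAt.smul ha (smAt_const _ _)
  have := h1.add (hF.map (-LinearMap.id))
  simpa [sub_eq_add_neg] using this

variable {X Y Z : SuperSpace}

/-- The base map of a morphism from a model space, as a map on `ℝ^ι`. -/
def Hom.pt (h : Hom (modelSpace ι κ) X) (v : ι → ℝ) : X.carrier := h.base v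

lemma Hom.continuous_pt (h : Hom (modelSpace ι κ) X) : Continuous h.pt := h.base.continuous

/-- The value at `v` of the pullback of a section along `h`; it is `0` if `h v` does not belong to
the domain of the section. -/
def rd (h : Hom (modelSpace ι κ) X) {U : Opens X.carrier} (s : X.sec U) (v : ι → ℝ) : Grassmann κ :=
  extend (h.pull U s).1 v

section
variable (h : Hom (modelSpace ι κ) X) {U V : Opens X.carrier} (s t : X.sec U) (v : ι → ℝ)

lemma rd_of_mem (hv : h.pt v ∈ U) : rd h s v = (h.pull U s).1 ⟨v, hv⟩ := extend_of_mem _ hv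

variable {v} in
lemma rd_of_not_mem (hv : h.pt v ∉ U) : rd h s v = 0 := by
  exact dif_neg hv

lemma rd_comp (f : Hom X Y) {U : Opens Y.carrier} (s : Y.sec U) :
    rd (h.comp f) s v = rd h (f.pull U s) v := rfl

lemma rd_add : rd h (s + t) v = rd h s v + rd h t v := by
  by_cases hv : h.pt v ∈ U
  · simp only [rd_of_mem h _ v hv, map_add]; rfl
  · simp [rd_of_not_mem h _ hv]

lemma rd_mul : rd h (s * t) v = rd h s v * rd h t v := by
  by_cases hv : h.pt v ∈ U
  · simp only [rd_of_mem h _ v hv, map_mul]; rfl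
  · simp [rd_of_not_mem h _ hv]

lemma rd_smul (c : ℂ) : rd h (c • s) v = c • rd h s v := by
  by_cases hv : h.pt v ∈ U
  · simp only [rd_of_mem h _ v hv, map_smul]; rfl
  · simp [rd_of_not_mem h _ hv]

/-- Reading at a point, as a linear map. -/
def rdₗ (U : Opens X.carrier) : X.sec U →ₗ[ℂ] Grassmann κ where
  toFun s := rd h s v
  map_add' s t := rd_add h s t v
  map_smul' c s := rd_smul h s v c

@[simp] lemma rd_zero : rd h (0 : X.sec U) v = 0 := map_zero (rdₗ h v U)
lemma rd_sub : rd h (s - t) v = rd h s v - rd h t v := map_sub (rdₗ h v U) s t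
lemma rd_sum {J : Type*} (A : Finset J) (f : J → X.sec U) :
    rd h (∑ j ∈ A, f j) v = ∑ j ∈ A, rd h (f j) v := map_sum (rdₗ h v U) f A

lemma rd_algebraMap (c : ℂ) (hv : h.pt v ∈ U) :
    rd h (algebraMap ℂ (X.sec U) c) v = algebraMap ℂ _ c := by
  rw [rd_of_mem h _ v hv, AlgHom.commutes]; rfl

lemma rd_one (hv : h.pt v ∈ U) : rd h (1 : X.sec U) v = 1 := by
  rw [← map_one (algebraMap ℂ (X.sec U)), rd_algebraMap h v 1 hv, map_one]

lemma rd_res (hVU : V ≤ U) (hv : h.pt v ∈ V) : rd h (X.res hVU s) v = rd h s v := by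
  rw [rd_of_mem h _ v hv, rd_of_mem h _ v (hVU hv), h.pull_res]; rfl

lemma rd_par {i : ZMod 2} (hs : s ∈ X.par U i) : rd h s v ∈ grassmannPar κ i := by
  by_cases hv : h.pt v ∈ U
  · rw [rd_of_mem h _ v hv]; exact h.pull_par U i s hs _
  · rw [rd_of_not_mem h _ hv]; exact zero_mem _

lemma smAt_rd (hv : h.pt v ∈ U) : SmAt (rd h s) v := fun l => (h.pull U s).2 l v hv

end

/-! Sheaf properties. -/

lemma sec_ext_local {U : Opens X.carrier} {s t : X.sec U}
    (H : ∀ x ∈ U, ∃ (V : Opens X.carrier) (h : V ≤ U), x ∈ V ∧ X.res h s = X.res h t) : s = t := by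
  choose V hV hx hst using fun x : U => H x x.2
  have h1 : (⨆ j, V j) ≤ U := iSup_le hV
  have h2 : U ≤ ⨆ j, V j := fun x hxU => Opens.mem_iSup.2 ⟨⟨x, hxU⟩, hx ⟨x, hxU⟩⟩
  have key : X.res h1 s = X.res h1 t := by
    refine (X.glue V (fun j => X.res (hV j) s) fun i j => ?_).unique (fun j => ?_) fun j => ?_
    · rw [X.res_res, X.res_res]
    · rw [X.res_res]
    · rw [X.res_res, hst j]
  have := congrArg (X.res h2) key
  rwa [X.res_res, X.res_res, X.res_refl, X.res_refl] at this

lemma sec_glue {J : Type} {U : Opens X.carrier} (V : J → Opens X.carrier) (hU : U ≤ ⨆ j, V j)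
    (s : ∀ j, X.sec (V j))
    (hs : ∀ i j, X.res (inf_le_left : V i ⊓ V j ≤ V i) (s i) =
      X.res (inf_le_right : V i ⊓ V j ≤ V j) (s j)) :
    ∃ t : X.sec U, ∀ j (W : Opens X.carrier) (hW : W ≤ U) (hW' : W ≤ V j),
      X.res hW t = X.res hW' (s j) := by
  obtain ⟨t, ht, -⟩ := X.glue V s hs
  refine ⟨X.res hU t, fun j W hW hW' => ?_⟩
  rw [X.res_res, ← ht j, X.res_res]

/-- Sections over an open part of a chart are determined by their expression in this chart. -/
lemma sec_ext_chart {h : Hom (modelSpace ι κ) X} (hh : h.IsOpenImmersion) {U : Opens X.carrier}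
    (hU : (U : Set X.carrier) ⊆ Set.range h.pt) {s t : X.sec U}
    (H : ∀ v, h.pt v ∈ U → rd h s v = rd h t v) : s = t := by
  apply (hh.bijective_pull U hU).1
  refine Subtype.ext (funext fun x => ?_)
  have := H x.1 x.2
  rwa [rd_of_mem h _ _ x.2, rd_of_mem h _ _ x.2] at this

lemma exists_push {h : Hom (modelSpace ι κ) X} (hh : h.IsOpenImmersion) {U : Opens X.carrier}
    (hU : (U : Set X.carrier) ⊆ Set.range h.pt) (F : (ι → ℝ) → Grassmann κ)
    (hF : ∀ v, h.pt v ∈ U → SmAt F v) :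
    ∃ s : X.sec U, ∀ v, h.pt v ∈ U → rd h s v = F v := by
  let f : (modelSpace ι κ).sec (Opens.comap h.base U) := ⟨fun x => F x.1, fun l x hx => by
    refine (hF x hx l).congr_of_eventuallyEq ?_
    filter_upwards [eventually_extend hx] with y hy
    rw [extend_of_mem _ hy]⟩
  obtain ⟨s, hs⟩ := (hh.bijective_pull U hU).2 f
  refine ⟨s, fun v hv => ?_⟩
  rw [rd_of_mem h _ _ hv, hs]

end Reading

section Manifold

open scoped ContDiff

variable {ι κ ι' κ' : Type} [Fintype ι] [Fintype κ] [Fintype ι'] [Fintype κ']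
variable {X Y : CSManifold}

lemma Chart.mem_image {φ : Chart X} {x : X.carrier} : x ∈ φ.image ↔ ∃ v, φ.hom.pt v = x := Iff.rfl

lemma Chart.base_mem (φ : Chart X) (v : Fin X.evenDim → ℝ) : φ.hom.pt v ∈ φ.image := ⟨v, rfl⟩

lemma Chart.injective (φ : Chart X) : Function.Injective φ.hom.pt :=
  φ.isOpenImmersion.isOpenEmbedding.injective

lemma exists_chart_at (x : X.carrier) : ∃ (φ : Chart X) (v : Fin X.evenDim → ℝ), φ.hom.pt v = x := by
  obtain ⟨φ, h, v, hv⟩ := X.exists_chart x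
  exact ⟨⟨φ, h⟩, v, hv⟩

/-- The image of an open set under a chart. -/
def Chart.map (φ : Chart X) (O : Opens (Fin X.evenDim → ℝ)) : Opens X.carrier :=
  ⟨φ.hom.pt '' O, φ.isOpenImmersion.isOpenEmbedding.isOpenMap _ O.2⟩

lemma Chart.base_mem_map {φ : Chart X} {O : Opens (Fin X.evenDim → ℝ)} {v : Fin X.evenDim → ℝ} :
    φ.hom.pt v ∈ φ.map O ↔ v ∈ O :=
  ⟨fun ⟨_, hw, hwv⟩ => φ.injective hwv ▸ hw, fun h => ⟨v, h, rfl⟩⟩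

lemma Chart.map_le_image (φ : Chart X) (O : Opens (Fin X.evenDim → ℝ)) : φ.map O ≤ φ.image := by
  rintro _ ⟨v, -, rfl⟩; exact ⟨v, rfl⟩

lemma sec_ext {U : Opens X.carrier} {s t : X.sec U}
    (H : ∀ (φ : Chart X) v, φ.hom.pt v ∈ U → rd φ.hom s v = rd φ.hom t v) : s = t := by
  apply sec_ext_local
  intro x hx
  obtain ⟨φ, v, rfl⟩ := exists_chart_at x
  refine ⟨U ⊓ φ.image, inf_le_left, ⟨hx, φ.base_mem v⟩, ?_⟩
  apply sec_ext_chart φ.isOpenImmersion (fun y (hy : y ∈ U ⊓ φ.image) => hy.2)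
  intro w hw
  rw [rd_res _ _ _ _ hw, rd_res _ _ _ _ hw, H φ w hw.1]

/-- The value of a section at a point (zero outside of its domain). -/
def val {U : Opens X.carrier} (s : X.sec U) (x : X.carrier) : ℂ :=
  aug _ (rd (exists_chart_at x).choose.hom s (exists_chart_at x).choose_spec.choose)

lemma exists_inverse_chart (φ : Chart X) {U : Opens X.carrier} (hU : U ≤ φ.image) (s : X.sec U)
    (hs : ∀ v, φ.hom.pt v ∈ U → aug _ (rd φ.hom s v) ≠ 0) : IsUnit s := by
  obtain ⟨t, ht⟩ := exists_push φ.isOpenImmersion hU (fun v => ginv (rd φ.hom s v))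
    fun v hv => (smAt_rd _ _ _ hv).ginv (hs v hv)
  refine isUnit_iff_exists.2 ⟨t, ?_, ?_⟩ <;>
  refine sec_ext_chart φ.isOpenImmersion hU fun v hv => ?_
  · rw [rd_mul, ht v hv, mul_ginv (hs v hv), rd_one _ _ hv]
  · have h1 := mul_ginv (hs v hv)
    obtain ⟨u, hu⟩ := isUnit_of_aug_ne_zero (hs v hv)
    rw [rd_mul, ht v hv, rd_one _ _ hv]
    rw [← hu] at h1 ⊢
    rw [(Units.mul_right_inj u).1 (h1.trans (Units.mul_inv u).symm), Units.inv_mul]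

/-- Values do not depend on the coordinates: a morphism maps the value at a point to the value at
the image of this point, because it maps invertible functions to invertible functions. -/
lemma aug_rd (h : Hom (modelSpace ι κ) X.toSuperSpace) {U : Opens X.carrier} (s : X.sec U) (w : ι → ℝ) :
    aug _ (rd h s w) = val s (h.pt w) := by
  by_cases hw : h.pt w ∈ U
  swap
  · rw [rd_of_not_mem h s hw, map_zero, val, rd_of_not_mem, map_zero]
    rw [(exists_chart_at (h.pt w)).choose_spec.choose_spec]
    exact hw
  rw [val]
  set φ := (exists_chart_at (h.pt w)).choose
  set v := (exists_chart_at (h.pt w)).choose_spec.choose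
  have hv : φ.hom.pt v = h.pt w := (exists_chart_at (h.pt w)).choose_spec.choose_spec
  by_contra hne
  set c := aug _ (rd h s w)
  let t := s - algebraMap ℂ _ c
  have hvU : φ.hom.pt v ∈ U := hv ▸ hw
  have ht : aug _ (rd φ.hom t v) ≠ 0 := by
    rw [rd_sub, rd_algebraMap _ _ _ hvU, map_sub, aug_algebraMap, sub_ne_zero]
    exact Ne.symm hne
  have hcont : ContinuousAt (fun y => aug _ (rd φ.hom t y)) v :=
    (smAt_rd φ.hom t v hvU (aug _).toLinearMap).continuousAt
  have hev : ∀ᶠ y in nhds v, aug _ (rd φ.hom t y) ≠ 0 := hcont.eventually_ne ht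
  have hev2 : ∀ᶠ y in nhds v, φ.hom.pt y ∈ U :=
    φ.hom.continuous_pt.continuousAt.eventually (U.2.mem_nhds hvU)
  obtain ⟨O, hO, hO', hvO⟩ := eventually_nhds_iff.1 (hev.and hev2)
  let V := φ.map ⟨O, hO'⟩
  have hVU : V ≤ U := by
    rintro _ ⟨y, hy, rfl⟩
    exact (hO y hy).2
  have hu : IsUnit (X.res hVU t) := by
    refine exists_inverse_chart φ (φ.map_le_image _) _ fun y hy => ?_
    rw [rd_res _ _ _ _ hy]
    exact (hO y (Chart.base_mem_map.1 hy)).1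
  have hwV : h.pt w ∈ V := by rw [← hv]; exact Chart.base_mem_map.2 hvO
  obtain ⟨t', ht', -⟩ := isUnit_iff_exists.1 hu
  have := congrArg (fun f => aug _ (rd h f w)) ht'
  simp only [rd_mul, map_mul, rd_one _ _ hwV, map_one] at this
  rw [rd_res _ _ _ _ hwV, rd_sub, rd_algebraMap _ _ _ hw, map_sub, aug_algebraMap] at this
  simp [c] at this

section
variable {U V : Opens X.carrier} (s t : X.sec U) (x : X.carrier)

/-- The value at a point, as a linear map. -/
def valₗ (U : Opens X.carrier) : X.sec U →ₗ[ℂ] ℂ :=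
  (aug _).toLinearMap.comp
    (rdₗ (exists_chart_at x).choose.hom (exists_chart_at x).choose_spec.choose U)

lemma val_add : val (s + t) x = val s x + val t x := map_add (valₗ x U) s t
lemma val_sub : val (s - t) x = val s x - val t x := map_sub (valₗ x U) s t
lemma val_smul (c : ℂ) : val (c • s) x = c * val s x := map_smul (valₗ x U) c s
lemma val_zero : val (0 : X.sec U) x = 0 := map_zero (valₗ x U)
lemma val_sum {J : Type*} (A : Finset J) (f : J → X.sec U) :
    val (∑ j ∈ A, f j) x = ∑ j ∈ A, val (f j) x := map_sum (valₗ x U) f A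
lemma val_mul : val (s * t) x = val s x * val t x := by rw [val, rd_mul, map_mul]; rfl

variable {x} in
lemma val_of_not_mem (hx : x ∉ U) : val s x = 0 := by
  obtain ⟨φ, v, rfl⟩ := exists_chart_at x
  rw [← aug_rd, rd_of_not_mem _ _ hx, map_zero]

variable {x} in
lemma val_algebraMap (c : ℂ) (hx : x ∈ U) : val (algebraMap ℂ (X.sec U) c) x = c := by
  obtain ⟨φ, v, rfl⟩ := exists_chart_at x
  rw [← aug_rd, rd_algebraMap _ _ _ hx, aug_algebraMap]

variable {x} in
lemma val_one (hx : x ∈ U) : val (1 : X.sec U) x = 1 := by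
  rw [← map_one (algebraMap ℂ (X.sec U)), val_algebraMap 1 hx]

variable {x} in
lemma val_res (h : V ≤ U) (hx : x ∈ V) : val (X.res h s) x = val s x := by
  obtain ⟨φ, v, rfl⟩ := exists_chart_at x
  rw [← aug_rd, ← aug_rd, rd_res _ _ _ _ hx]

variable {s} in
lemma val_of_odd (hs : s ∈ X.par U 1) : val s x = 0 := by
  obtain ⟨φ, v, rfl⟩ := exists_chart_at x
  rw [← aug_rd, aug_of_odd (rd_par _ _ _ hs)]

lemma val_pull (f : Mor X Y) {U : Opens Y.carrier} (s : Y.sec U) :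
    val (f.pull U s) x = val s (f.base x) := by
  obtain ⟨φ, v, rfl⟩ := exists_chart_at x
  rw [← aug_rd, ← rd_comp, aug_rd]; rfl

end

/-- A section is even or odd if its values in charts are. -/
lemma mem_par_iff {U : Opens X.carrier} {s : X.sec U} {i : ZMod 2} :
    s ∈ X.par U i ↔ ∀ (φ : Chart X) v, φ.hom.pt v ∈ U → rd φ.hom s v ∈ grassmannPar _ i := by
  refine ⟨fun h φ v _ => rd_par _ _ _ h, fun H => ?_⟩
  have hc : IsCompl (X.par U i) (X.par U (i + 1)) := by
    rcases zmod2_cases i with rfl | rfl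
    · exact X.isCompl_par U
    · exact (X.isCompl_par U).symm
  have hcΛ : IsCompl (grassmannPar (Fin X.oddDim) i) (grassmannPar (Fin X.oddDim) (i + 1)) := by
    have := CliffordAlgebra.evenOdd_isCompl (0 : QuadraticForm ℂ (Fin X.oddDim → ℂ))
    rcases zmod2_cases i with rfl | rfl
    · exact this
    · exact this.symm
  obtain ⟨a, ha, b, hb, rfl⟩ := Submodule.mem_sup.1 (hc.codisjoint.eq_top ▸ Submodule.mem_top : s ∈ _)
  have : b = 0 := by
    apply sec_ext
    intro φ v hv
    rw [rd_zero]
    refine Submodule.disjoint_def.1 hcΛ.disjoint _ ?_ (rd_par _ _ _ hb)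
    have := sub_mem (H φ v hv) (rd_par φ.hom a v ha)
    rwa [rd_add, add_sub_cancel_left] at this
  rw [this, add_zero]; exact ha

/-- A function is invertible if its values are nonzero. -/
lemma isUnit_of_val_ne_zero {U : Opens X.carrier} (s : X.sec U) (hs : ∀ x ∈ U, val s x ≠ 0) :
    IsUnit s := by
  have hloc : ∀ φ : Chart X, IsUnit (X.res (inf_le_left : U ⊓ φ.image ≤ U) s) := fun φ =>
    exists_inverse_chart φ inf_le_right _ fun v hv => by
      rw [aug_rd, val_res _ _ hv]; exact hs _ hv.1
  choose t ht ht' using fun φ => isUnit_iff_exists.1 (hloc φ)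
  have hinv : ∀ φ (W : Opens X.carrier) (h : W ≤ U ⊓ φ.image),
      X.res (h.trans inf_le_left) s * X.res h (t φ) = 1 ∧
      X.res h (t φ) * X.res (h.trans inf_le_left) s = 1 := fun φ W h => by
    have h1 := congrArg (X.res h) (ht φ)
    have h2 := congrArg (X.res h) (ht' φ)
    rw [map_mul, map_one, X.res_res] at h1 h2
    exact ⟨h1, h2⟩
  obtain ⟨r, hr⟩ := sec_glue (U := U) (fun x : U => U ⊓ (exists_chart_at x.1).choose.image)
    (fun x hx => Opens.mem_iSup.2 ⟨⟨x, hx⟩, hx, (exists_chart_at x).choose_spec⟩)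
    (fun x => t _) (fun i j => by
      obtain ⟨h1, h2⟩ := hinv _ _ (inf_le_left : (U ⊓ (exists_chart_at i.1).choose.image) ⊓
        (U ⊓ (exists_chart_at j.1).choose.image) ≤ _)
      obtain ⟨h3, h4⟩ := hinv _ _ (inf_le_right : (U ⊓ (exists_chart_at i.1).choose.image) ⊓
        (U ⊓ (exists_chart_at j.1).choose.image) ≤ _)
      exact left_inv_eq_right_inv h2 h3)
  refine isUnit_iff_exists.2 ⟨r, ?_, ?_⟩ <;>
  refine sec_ext_local fun x hx => ⟨U ⊓ (exists_chart_at x).choose.image, inf_le_left,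
    ⟨hx, (exists_chart_at x).choose_spec⟩, ?_⟩
  · rw [map_mul, map_one, hr ⟨x, hx⟩ _ _ le_rfl]
    exact (hinv _ _ le_rfl).1
  · rw [map_mul, map_one, hr ⟨x, hx⟩ _ _ le_rfl]
    exact (hinv _ _ le_rfl).2

end Manifold

/-! ### Constructions with morphisms -/

section Morphisms

open scoped ContDiff

variable {ι κ ι' κ' : Type} [Fintype ι] [Fintype κ] [Fintype ι'] [Fintype κ']
variable {X Y Z : SuperSpace}

lemma Hom.ext_of_res {f g : Hom X Y} (hb : f.base = g.base)
    (hp : ∀ (V : Opens Y.carrier) (s : Y.sec V) (W : Opens X.carrier) (h1 : W ≤ Opens.comap f.base V)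
      (h2 : W ≤ Opens.comap g.base V), X.res h1 (f.pull V s) = X.res h2 (g.pull V s)) : f = g := by
  obtain ⟨fb, fp, f1, f2⟩ := f
  obtain ⟨gb, gp, g1, g2⟩ := g
  obtain rfl : fb = gb := hb
  congr
  funext V
  apply AlgHom.ext
  intro s
  have := hp V s _ le_rfl le_rfl
  rwa [X.res_refl, X.res_refl] at this

lemma Hom.ext_of_rd {f g : Hom (modelSpace ι κ) X} (hb : ∀ v, f.pt v = g.pt v)
    (hp : ∀ (V : Opens X.carrier) (s : X.sec V) v, f.pt v ∈ V → rd f s v = rd g s v) : f = g := by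
  refine Hom.ext_of_res (ContinuousMap.ext hb) fun V s W h1 h2 => ?_
  refine Subtype.ext (funext fun x => ?_)
  have h1' : f.pt x.1 ∈ V := h1 x.2
  have h2' : g.pt x.1 ∈ V := h2 x.2
  have := hp V s x.1 h1'
  rw [rd_of_mem _ _ _ h1', rd_of_mem _ _ _ h2'] at this
  exact this

lemma res_pull_of_eq_id {f : Hom X X} (hf : f = Hom.id X) {V W : Opens X.carrier} (s : X.sec V)
    (h1 : W ≤ Opens.comap f.base V) (h2 : W ≤ V) : X.res h1 (f.pull V s) = X.res h2 s := by
  subst hf; rfl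

lemma isOpenImmersion_of_inverse (f : Hom X Y) (g : Hom Y X) (hfg : f.comp g = Hom.id X)
    (hgf : g.comp f = Hom.id Y) : f.IsOpenImmersion := by
  have h1 : ∀ x, g.base (f.base x) = x := fun x => congrArg (fun h : Hom X X => h.base x) hfg
  have h2 : ∀ y, f.base (g.base y) = y := fun y => congrArg (fun h : Hom Y Y => h.base y) hgf
  refine ⟨(Homeomorph.mk ⟨f.base, g.base, h1, h2⟩ f.base.continuous g.base.continuous).isOpenEmbedding,
    fun V _ => ⟨fun s t hst => ?_, fun t => ?_⟩⟩
  · have hV : V ≤ Opens.comap (g.comp f).base V := fun y hy => by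
      change f.base (g.base y) ∈ V; rwa [h2]
    have hs := res_pull_of_eq_id hgf s hV le_rfl
    have ht := res_pull_of_eq_id hgf t hV le_rfl
    rw [Y.res_refl] at hs ht
    rw [← hs, ← ht]
    change Y.res _ (g.pull _ (f.pull V s)) = Y.res _ (g.pull _ (f.pull V t))
    rw [hst]
  · have hV : V ≤ Opens.comap g.base (Opens.comap f.base V) := fun y hy => by
      change f.base (g.base y) ∈ V; rwa [h2]
    refine ⟨Y.res hV (g.pull _ t), ?_⟩
    rw [f.pull_res]
    have := res_pull_of_eq_id hfg t (W := Opens.comap f.base V) (fun x hx => by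
      change f.base (g.base (f.base x)) ∈ V; rwa [h1]) le_rfl
    rw [X.res_refl] at this
    exact this

lemma Hom.IsOpenImmersion.comp {f : Hom X Y} {g : Hom Y Z} (hf : f.IsOpenImmersion)
    (hg : g.IsOpenImmersion) : (f.comp g).IsOpenImmersion := by
  refine ⟨hg.isOpenEmbedding.comp hf.isOpenEmbedding, fun V hV => ?_⟩
  have h1 : (V : Set Z.carrier) ⊆ Set.range g.base := fun z hz => by
    obtain ⟨x, rfl⟩ := hV hz; exact ⟨f.base x, rfl⟩
  have h2 : (Opens.comap g.base V : Set Y.carrier) ⊆ Set.range f.base := fun y hy => by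
    obtain ⟨x, hx⟩ := hV hy
    exact ⟨x, hg.isOpenEmbedding.injective hx⟩
  have h3 : Function.Bijective ((f.pull _ : _ → _) ∘ (g.pull V : _ → _)) :=
    (hf.bijective_pull _ h2).comp (hg.bijective_pull V h1)
  exact h3

/-- A morphism with values in the image of an open immersion factors through it. -/
lemma exists_lift {φ : Hom X Y} (hφ : φ.IsOpenImmersion) (g : Hom Z Y)
    (hg : ∀ z, g.base z ∈ Set.range φ.base) : ∃ g' : Hom Z X, g'.comp φ = g := by
  let e := hφ.isOpenEmbedding.isEmbedding.toHomeomorph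
  let b : C(Z.carrier, X.carrier) :=
    ⟨fun z => e.symm ⟨g.base z, hg z⟩, e.symm.continuous.comp (g.base.continuous.subtype_mk hg)⟩
  have hb : ∀ z, φ.base (b z) = g.base z := fun z =>
    congrArg Subtype.val (e.apply_symm_apply ⟨g.base z, hg z⟩)
  let im : Opens X.carrier → Opens Y.carrier := fun V => ⟨φ.base '' V, hφ.isOpenEmbedding.isOpenMap _ V.2⟩
  have him : ∀ V x, φ.base x ∈ im V ↔ x ∈ V := fun V x =>
    ⟨fun ⟨_, hw, hwv⟩ => hφ.isOpenEmbedding.injective hwv ▸ hw, fun h => ⟨x, h, rfl⟩⟩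
  have hr : ∀ V, (im V : Set Y.carrier) ⊆ Set.range φ.base := fun V => by
    rintro _ ⟨x, -, rfl⟩; exact ⟨x, rfl⟩
  have h1 : ∀ V, Opens.comap φ.base (im V) ≤ V := fun V x hx => (him V x).1 hx
  have h2 : ∀ V, Opens.comap b V ≤ Opens.comap g.base (im V) := fun V z hz => by
    change g.base z ∈ im V
    rw [← hb z, him]; exact hz
  let E : ∀ V, Y.sec (im V) ≃ₐ[ℂ] X.sec (Opens.comap φ.base (im V)) := fun V =>
    AlgEquiv.ofBijective (φ.pull (im V)) (hφ.bijective_pull _ (hr V))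
  have hE : ∀ V t, φ.pull (im V) ((E V).symm t) = t := fun V t => (E V).apply_symm_apply t
  have hEu : ∀ V t s, φ.pull (im V) s = t → (E V).symm t = s := fun V t s h => by
    rw [← h]; exact (E V).symm_apply_apply s
  refine ⟨⟨b, fun V => (Z.res (h2 V)).comp ((g.pull (im V)).comp ((E V).symm.toAlgHom.comp (X.res (h1 V)))),
    fun V i f hf => ?_, fun {V' V} h f => ?_⟩, ?_⟩
  · refine Z.res_par _ i _ (g.pull_par _ i _ ?_)
    have hc : IsCompl (Y.par (im V) i) (Y.par (im V) (i + 1)) := by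
      rcases zmod2_cases i with rfl | rfl
      · exact Y.isCompl_par _
      · exact (Y.isCompl_par _).symm
    have hcX : IsCompl (X.par (Opens.comap φ.base (im V)) i) (X.par (Opens.comap φ.base (im V)) (i + 1)) := by
      rcases zmod2_cases i with rfl | rfl
      · exact X.isCompl_par _
      · exact (X.isCompl_par _).symm
    obtain ⟨s, hs⟩ : ∃ s, s = (E V).symm (X.res (h1 V) f) := ⟨_, rfl⟩
    have hs' : φ.pull (im V) s = X.res (h1 V) f := by rw [hs, hE]
    change (E V).symm (X.res (h1 V) f) ∈ _
    rw [← hs]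
    obtain ⟨a, ha, c, hcc, hac⟩ := Submodule.mem_sup.1 (hc.codisjoint.eq_top ▸ Submodule.mem_top : s ∈ _)
    have : c = 0 := by
      apply (hφ.bijective_pull _ (hr V)).1
      rw [map_zero]
      refine Submodule.disjoint_def.1 hcX.disjoint _ ?_ (φ.pull_par _ _ _ hcc)
      have := sub_mem (X.res_par (h1 V) i f hf) (φ.pull_par _ _ _ ha)
      rwa [← hs', ← hac, map_add, add_sub_cancel_left] at this
    rw [← hac, this, add_zero]; exact ha
  · have him' : im V' ≤ im V := by
      rintro _ ⟨x, hx, rfl⟩; exact ⟨x, h hx, rfl⟩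
    change Z.res _ (g.pull _ ((E V').symm (X.res _ (X.res _ f)))) =
      Z.res _ (Z.res _ (g.pull _ ((E V).symm (X.res _ f))))
    rw [hEu V' _ (Y.res him' ((E V).symm (X.res (h1 V) f))), g.pull_res, Z.res_res, Z.res_res]
    rw [φ.pull_res, hE, X.res_res, X.res_res]
  · refine Hom.ext_of_res (ContinuousMap.ext hb) fun V s W hW1 hW2 => ?_
    change Z.res hW1 (Z.res _ (g.pull _ ((E _).symm (X.res _ (φ.pull V s))))) = _
    have hle : im (Opens.comap φ.base V) ≤ V := by
      rintro _ ⟨x, hx, rfl⟩; exact hx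
    rw [hEu _ _ (Y.res hle s) (φ.pull_res _ _), g.pull_res]
    exact (congrArg (Z.res hW1) (Z.res_res _ _ _)).trans (Z.res_res _ _ _)

/-- The morphism of model spaces given by a smooth map on the even coordinates and a linear pullback
of the odd coordinates. -/
def smoothHom (p : (ι → ℝ) → (ι' → ℝ)) (hp : ContDiff ℝ ∞ p) (q : (κ' → ℂ) →ₗ[ℂ] (κ → ℂ)) :
    Hom (modelSpace ι κ) (modelSpace ι' κ') where
  base := ⟨p, hp.continuous⟩
  pull V :=
    { toFun := fun f => ⟨fun x => ExteriorAlgebra.map q (f.1 ⟨p x.1, x.2⟩), fun l x hx => by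
        refine ((f.2 (l.comp (ExteriorAlgebra.map q).toLinearMap) (p x) hx).comp x
          hp.contDiffAt).congr_of_eventuallyEq ?_
        filter_upwards [eventually_extend hx] with y hy
        rw [extend_of_mem _ hy]
        simp only [Function.comp_apply]
        rw [extend_of_mem _ (show p y ∈ V from hy)]
        rfl⟩
      map_one' := Subtype.ext (funext fun _ => map_one _)
      map_mul' := fun _ _ => Subtype.ext (funext fun _ => map_mul _ _ _)
      map_zero' := Subtype.ext (funext fun _ => map_zero _)
      map_add' := fun _ _ => Subtype.ext (funext fun _ => map_add _ _ _)
      commutes' := fun c => Subtype.ext (funext fun _ => AlgHom.commutes _ c) }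
  pull_par _ i _ hf _ := map_mem_grassmannPar q i _ (hf _)
  pull_res _ _ := rfl

lemma rd_smoothHom_comp (p : (ι → ℝ) → (ι' → ℝ)) (hp : ContDiff ℝ ∞ p) (q : (κ' → ℂ) →ₗ[ℂ] (κ → ℂ))
    (h : Hom (modelSpace ι' κ') X) {U : Opens X.carrier} (s : X.sec U) (v : ι → ℝ) :
    rd ((smoothHom p hp q).comp h) s v = ExteriorAlgebra.map q (rd h s (p v)) := by
  by_cases hv : h.pt (p v) ∈ U
  · rw [rd_of_mem h s _ hv, rd_of_mem ((smoothHom p hp q).comp h) s v hv]; rfl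
  · rw [rd_of_not_mem h s hv, map_zero]
    exact rd_of_not_mem ((smoothHom p hp q).comp h) s hv

lemma rd_modelFst_comp (h : Hom (modelSpace ι κ) X) {U : Opens X.carrier} (s : X.sec U)
    (v : ι ⊕ ι' → ℝ) : rd ((modelFst ι κ ι' κ').comp h) s v =
      ExteriorAlgebra.map (LinearMap.pi (Sum.elim (fun k => LinearMap.proj k) 0))
        (rd h s fun i => v (Sum.inl i)) := 
  rd_smoothHom_comp (fun v i => v (Sum.inl i)) (by fun_prop) _ h s v

lemma rd_modelSnd_comp (h : Hom (modelSpace ι' κ') X) {U : Opens X.carrier} (s : X.sec U)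
    (v : ι ⊕ ι' → ℝ) : rd ((modelSnd ι κ ι' κ').comp h) s v =
      inclInr κ κ' (rd h s fun i => v (Sum.inr i)) := 
  rd_smoothHom_comp (fun v i => v (Sum.inr i)) (by fun_prop) _ h s v

lemma smoothHom_comp_smoothHom {ι'' κ'' : Type} [Fintype ι''] [Fintype κ'']
    (p : (ι → ℝ) → (ι' → ℝ)) (hp : ContDiff ℝ ∞ p) (q : (κ' → ℂ) →ₗ[ℂ] (κ → ℂ))
    (p' : (ι' → ℝ) → (ι'' → ℝ)) (hp' : ContDiff ℝ ∞ p') (q' : (κ'' → ℂ) →ₗ[ℂ] (κ' → ℂ)) :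
    (smoothHom p hp q).comp (smoothHom p' hp' q') = smoothHom (p' ∘ p) (hp'.comp hp) (q ∘ₗ q') := by
  refine Hom.ext_of_rd (fun _ => rfl) fun V s v hv => ?_
  have hv' : p' (p v) ∈ V := hv
  rw [rd_of_mem _ s v hv, rd_of_mem (smoothHom (p' ∘ p) (hp'.comp hp) (q ∘ₗ q')) s v hv']
  exact DFunLike.congr_fun (ExteriorAlgebra.map_comp_map q' q) (s.1 ⟨_, hv'⟩)

lemma smoothHom_id {p : (ι → ℝ) → (ι → ℝ)} (hp : ContDiff ℝ ∞ p) {q : (κ → ℂ) →ₗ[ℂ] (κ → ℂ)}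
    (h1 : p = id) (h2 : q = LinearMap.id) : smoothHom p hp q = Hom.id _ := by
  subst h1 h2
  refine Hom.ext_of_rd (fun _ => rfl) fun V s v hv => ?_
  rw [rd_of_mem _ s v hv, rd_of_mem (Hom.id (modelSpace ι κ)) s v hv]
  exact DFunLike.congr_fun ExteriorAlgebra.map_id (s.1 ⟨v, hv⟩)

/-- Renaming coordinates is an isomorphism of model spaces. -/
def reindexHom (e : ι' ≃ ι) (f : κ' ≃ κ) : Hom (modelSpace ι κ) (modelSpace ι' κ') :=
  smoothHom (fun v i => v (e i)) (by fun_prop) (LinearMap.funLeft ℂ ℂ f.symm)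

lemma isOpenImmersion_reindexHom (e : ι' ≃ ι) (f : κ' ≃ κ) : (reindexHom e f).IsOpenImmersion := by
  refine isOpenImmersion_of_inverse _ (reindexHom e.symm f.symm) ?_ ?_ <;>
  · rw [reindexHom, reindexHom, smoothHom_comp_smoothHom]
    refine smoothHom_id _ ?_ ?_
    · funext v i; simp
    · ext w k; simp [LinearMap.funLeft]

/-- The model space `ℝ^{ι|κ}` as a CS manifold. -/
def modelMfd (ι κ : Type) [Fintype ι] [Fintype κ] : CSManifold where
  toSuperSpace := modelSpace ι κ
  t2 := inferInstanceAs (T2Space (ι → ℝ))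
  secondCountable := inferInstanceAs (SecondCountableTopology (ι → ℝ))
  evenDim := Fintype.card ι
  oddDim := Fintype.card κ
  exists_chart x := ⟨reindexHom (Fintype.equivFin ι) (Fintype.equivFin κ),
    isOpenImmersion_reindexHom _ _, fun i => x ((Fintype.equivFin ι).symm i), by
      funext i
      change x ((Fintype.equivFin ι).symm (Fintype.equivFin ι i)) = x i
      simp⟩

end Morphisms

section Bumps

open scoped ContDiff

variable {X : CSManifold}

lemma exists_parts {X : SuperSpace} {U : Opens X.carrier} (i : ZMod 2) (s : X.sec U) :
    ∃ a ∈ X.par U i, ∃ b ∈ X.par U (i + 1), a + b = s := by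
  have hc : IsCompl (X.par U i) (X.par U (i + 1)) := by
    rcases zmod2_cases i with rfl | rfl
    · exact X.isCompl_par U
    · exact (X.isCompl_par U).symm
  exact Submodule.mem_sup.1 (hc.codisjoint.eq_top ▸ Submodule.mem_top : s ∈ _)

lemma disjoint_grassmannPar {κ : Type} (i : ZMod 2) {x : Grassmann κ} (h1 : x ∈ grassmannPar κ i)
    (h2 : x ∈ grassmannPar κ (i + 1)) : x = 0 := by
  have hc : IsCompl (grassmannPar κ i) (grassmannPar κ (i + 1)) := by
    have := CliffordAlgebra.evenOdd_isCompl (0 : QuadraticForm ℂ (κ → ℂ))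
    rcases zmod2_cases i with rfl | rfl
    · exact this
    · exact this.symm
  exact Submodule.disjoint_def.1 hc.disjoint _ h1 h2

lemma mem_par_of_chart {U : Opens X.carrier} {s : X.sec U} {i : ZMod 2} (φ : Chart X)
    (hU : U ≤ φ.image) (H : ∀ v, φ.hom.pt v ∈ U → rd φ.hom s v ∈ grassmannPar _ i) :
    s ∈ X.par U i := by
  obtain ⟨a, ha, b, hb, rfl⟩ := exists_parts i s
  have : b = 0 := by
    apply sec_ext_chart φ.isOpenImmersion hU
    intro v hv
    rw [rd_zero]
    refine disjoint_grassmannPar i ?_ (rd_par _ _ _ hb)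
    have := sub_mem (H v hv) (rd_par φ.hom a v ha)
    rwa [rd_add, add_sub_cancel_left] at this
  rw [this, add_zero]; exact ha

lemma mem_par_local {U : Opens X.carrier} {s : X.sec U} {i : ZMod 2}
    (H : ∀ x ∈ U, ∃ (V : Opens X.carrier) (h : V ≤ U), x ∈ V ∧ X.res h s ∈ X.par V i) :
    s ∈ X.par U i := by
  rw [mem_par_iff]
  intro φ v hv
  obtain ⟨V, h, hx, hs⟩ := H _ hv
  rw [← rd_res φ.hom s v h hx]
  exact rd_par _ _ _ hs

/-- Extension by zero of a smooth function with compact support in a chart. -/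
lemma exists_extZero (φ : Chart X) (F : (Fin X.evenDim → ℝ) → Grassmann (Fin X.oddDim))
    (hF : ∀ v, SmAt F v) {K : Set (Fin X.evenDim → ℝ)} (hK : IsCompact K) (hFK : ∀ v, v ∉ K → F v = 0) :
    ∃ s : X.sec ⊤, (∀ v, rd φ.hom s v = F v) ∧
      (∀ V : Opens X.carrier, (∀ x ∈ V, x ∉ φ.hom.pt '' K) → X.res (le_top : V ≤ ⊤) s = 0) ∧
      ∀ i, (∀ v, F v ∈ grassmannPar _ i) → s ∈ X.par ⊤ i := by
  obtain ⟨s₀, hs₀⟩ := exists_push φ.isOpenImmersion (U := φ.image) subset_rfl F fun v _ => hF v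
  have hK' : IsClosed (φ.hom.pt '' K) := (hK.image φ.hom.continuous_pt).isClosed
  let C : Opens X.carrier := ⟨(φ.hom.pt '' K)ᶜ, hK'.isOpen_compl⟩
  let V : Bool → Opens X.carrier := fun b => bif b then φ.image else C
  let f : ∀ b, X.sec (V b) := fun b => match b with
    | true => s₀
    | false => 0
  have hz : ∀ (W : Opens X.carrier) (h1 : W ≤ φ.image) (h2 : W ≤ C), X.res h1 s₀ = 0 := by
    intro W h1 h2
    refine sec_ext_chart φ.isOpenImmersion h1 fun v hv => ?_
    rw [rd_zero, rd_res _ _ _ _ hv, hs₀ v (φ.base_mem v)]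
    exact hFK v fun hvK => h2 hv ⟨v, hvK, rfl⟩
  obtain ⟨s, hs⟩ := sec_glue (U := ⊤) V (fun x _ => by
      by_cases hx : x ∈ φ.hom.pt '' K
      · obtain ⟨v, -, rfl⟩ := hx
        exact Opens.mem_iSup.2 ⟨true, φ.base_mem v⟩
      · exact Opens.mem_iSup.2 ⟨false, hx⟩) f (by
    rintro (_ | _) (_ | _)
    · rfl
    · change X.res _ 0 = X.res _ s₀
      rw [map_zero, hz _ _ inf_le_left]
    · change X.res _ s₀ = X.res _ 0
      rw [map_zero, hz _ _ inf_le_right]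
    · rfl)
  have hs1 : X.res le_top s = s₀ := (hs true φ.image le_top le_rfl).trans (X.res_refl _ _)
  have hs2 : ∀ V : Opens X.carrier, (∀ x ∈ V, x ∉ φ.hom.pt '' K) → X.res (le_top : V ≤ ⊤) s = 0 :=
    fun W hW => (hs false W le_top hW).trans (map_zero _)
  refine ⟨s, fun v => ?_, hs2, fun i hi => ?_⟩
  · rw [← hs₀ v (φ.base_mem v), ← hs1, rd_res _ _ _ _ (φ.base_mem v)]
  · refine mem_par_local fun x _ => ?_
    by_cases hx : x ∈ φ.image
    · refine ⟨φ.image, le_top, hx, ?_⟩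
      rw [hs1]
      refine mem_par_of_chart φ le_rfl fun v hv => ?_
      rw [hs₀ v hv]; exact hi v
    · refine ⟨C, le_top, ?_, ?_⟩
      · rintro ⟨v, -, rfl⟩; exact hx (φ.base_mem v)
      · rw [hs2 C fun _ h => h]; exact zero_mem _

lemma smAt_ofReal {ι κ : Type} [Fintype ι] {f : (ι → ℝ) → ℝ} {v : ι → ℝ} (hf : ContDiffAt ℝ ∞ f v) :
    SmAt (fun v => algebraMap ℂ (Grassmann κ) (f v : ℂ)) v := by
  simp only [Algebra.algebraMap_eq_smul_one]
  exact SmAt.smul (Complex.ofRealCLM.contDiff.contDiffAt.comp v hf) (smAt_const _ _)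

lemma algebraMap_mem_grassmannPar {κ : Type} (c : ℂ) : algebraMap ℂ (Grassmann κ) c ∈ grassmannPar κ 0 :=
  SetLike.algebraMap_mem_graded (CliffordAlgebra.evenOdd (0 : QuadraticForm ℂ (κ → ℂ))) c

lemma exists_smooth_bump {ι : Type} [Fintype ι] (O : Set (ι → ℝ)) (v₀ : ι → ℝ) (hO : O ∈ nhds v₀) :
    ∃ f : (ι → ℝ) → ℝ, ContDiff ℝ ∞ f ∧ (∀ v, 0 ≤ f v) ∧ (∀ᶠ v in nhds v₀, f v = 1) ∧
      IsCompact (tsupport f) ∧ tsupport f ⊆ O := by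
  obtain ⟨r, hr, hrO⟩ := Metric.nhds_basis_closedBall.mem_iff.1 hO
  let f : ContDiffBump v₀ := ⟨r / 2, r, by positivity, by linarith⟩
  exact ⟨f, f.contDiff, fun v => f.nonneg' v, f.eventuallyEq_one, f.hasCompactSupport, by
    rw [f.tsupport_eq]; exact hrO⟩

/-- Bump functions on a CS manifold. -/
lemma exists_bump (φ : Chart X) (v₀ : Fin X.evenDim → ℝ) {O : Set (Fin X.evenDim → ℝ)} (hO : O ∈ nhds v₀) :
    ∃ (b : X.sec ⊤) (K : Set (Fin X.evenDim → ℝ)), IsCompact K ∧ K ⊆ O ∧ b ∈ X.par ⊤ 0 ∧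
      (∀ x, ∃ r : ℝ, 0 ≤ r ∧ val b x = r) ∧
      (∃ W : Opens X.carrier, φ.hom.pt v₀ ∈ W ∧ X.res (le_top : W ≤ ⊤) b = 1) ∧
      (∀ v, rd φ.hom b v = algebraMap ℂ _ (val b (φ.hom.pt v))) ∧
      ∀ V : Opens X.carrier, (∀ x ∈ V, x ∉ φ.hom.pt '' K) → X.res (le_top : V ≤ ⊤) b = 0 := by
  obtain ⟨f, hf, h0, h1, hc, hsub⟩ := exists_smooth_bump O v₀ hO
  obtain ⟨b, hb1, hb2, hb3⟩ := exists_extZero φ (fun v => algebraMap ℂ _ (f v : ℂ))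
    (fun v => smAt_ofReal hf.contDiffAt) hc (fun v hv => by rw [image_eq_zero_of_notMem_tsupport hv]; simp)
  have hval : ∀ v, val b (φ.hom.pt v) = f v := fun v => by rw [← aug_rd, hb1, aug_algebraMap]
  refine ⟨b, tsupport f, hc, hsub, hb3 0 fun v => algebraMap_mem_grassmannPar _, fun x => ?_, ?_,
    fun v => by rw [hb1, hval], hb2⟩
  · by_cases hx : x ∈ φ.image
    · obtain ⟨v, rfl⟩ := hx
      exact ⟨f v, h0 v, hval v⟩
    · refine ⟨0, le_rfl, ?_⟩
      have hK' : IsClosed (φ.hom.pt '' tsupport f) := (hc.image φ.hom.continuous_pt).isClosed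
      let C : Opens X.carrier := ⟨(φ.hom.pt '' tsupport f)ᶜ, hK'.isOpen_compl⟩
      have hxC : x ∈ C := by rintro ⟨v, -, rfl⟩; exact hx (φ.base_mem v)
      rw [← val_res b (le_top : C ≤ ⊤) hxC, hb2 C fun _ h => h, val_zero]; simp
  · obtain ⟨O', hO', hO'1, hv⟩ := eventually_nhds_iff.1 h1
    refine ⟨φ.map ⟨O', hO'1⟩, Chart.base_mem_map.2 hv, ?_⟩
    refine sec_ext_chart φ.isOpenImmersion (φ.map_le_image _) fun v hv => ?_
    rw [rd_res _ _ _ _ hv, hb1, rd_one _ _ hv, hO' v (Chart.base_mem_map.1 hv)]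
    simp

end Bumps

/-! ### Families of smooth functions and parametric integrals -/

section Families

open scoped ContDiff
open MeasureTheory Filter Topology

variable {ι : Type} [Fintype ι] {Γ Γ' T : Type} [TopologicalSpace Γ] [TopologicalSpace Γ']
  [TopologicalSpace T]

open Classical in
/-- The partial derivative `∂f/∂v_i`. -/
def pd (i : ι) (f : (ι → ℝ) → ℂ) (v : ι → ℝ) : ℂ := fderiv ℝ f v (Pi.single i 1)

lemma fderiv_eq_sum_pd (f : (ι → ℝ) → ℂ) (v w : ι → ℝ) :
    fderiv ℝ f v w = ∑ i, (w i : ℂ) * pd i f v := by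
  classical
  conv_lhs => rw [pi_eq_sum_univ' w, map_sum]
  refine Finset.sum_congr rfl fun i _ => ?_
  rw [map_smul, Complex.real_smul]
  simp only [pd]

/-- A family `H` of functions on `ℝ^ι` with parameters in a topological space all of whose partial
derivatives of order at most `k` are jointly continuous. -/
def Nice : ℕ → (Γ → (ι → ℝ) → ℂ) → Prop
  | 0, H => Continuous (Function.uncurry H)
  | k + 1, H => Continuous (Function.uncurry H) ∧ (∀ g, Differentiable ℝ (H g)) ∧
      ∀ i, Nice k fun g v => pd i (H g) v

lemma Nice.continuous {k : ℕ} {H : Γ → (ι → ℝ) → ℂ} (h : Nice k H) :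
    Continuous (Function.uncurry H) := by
  cases k with
  | zero => exact h
  | succ k => exact h.1

lemma Nice.comp_param {k : ℕ} {H : Γ → (ι → ℝ) → ℂ} (h : Nice k H) {p : Γ' → Γ}
    (hp : Continuous p) : Nice k fun g => H (p g) := by
  induction k generalizing H with
  | zero => exact Continuous.comp h (hp.prodMap continuous_id)
  | succ k ih => exact ⟨h.1.comp (hp.prodMap continuous_id), fun g => h.2.1 _, fun i => ih (h.2.2 i)⟩

lemma nice_const {c : Γ → ℂ} (hc : Continuous c) (k : ℕ) : Nice k fun g (_ : ι → ℝ) => c g := by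
  have h0 : ∀ k, Nice k fun (_ : Γ) (_ : ι → ℝ) => (0 : ℂ) := by
    intro k
    induction k with
    | zero => exact continuous_const
    | succ k ih =>
      refine ⟨continuous_const, fun _ => differentiable_const _, fun i => ?_⟩
      convert ih using 3
      simp [pd]
  cases k with
  | zero => exact hc.comp continuous_fst
  | succ k =>
    refine ⟨hc.comp continuous_fst, fun _ => differentiable_const _, fun i => ?_⟩
    convert h0 k using 3
    simp [pd]

lemma pd_const_mul (i : ι) (c : ℂ) {f : (ι → ℝ) → ℂ} {v : ι → ℝ} (hf : DifferentiableAt ℝ f v) :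
    pd i (fun v => c * f v) v = c * pd i f v := by
  rw [pd, fderiv_const_mul hf]; rfl

lemma Nice.const_mul {k : ℕ} {H : Γ → (ι → ℝ) → ℂ} (h : Nice k H) {c : Γ → ℂ}
    (hc : Continuous c) : Nice k fun g v => c g * H g v := by
  induction k generalizing H with
  | zero => exact (hc.comp continuous_fst).mul h
  | succ k ih =>
    refine ⟨(hc.comp continuous_fst).mul h.1, fun g => (h.2.1 g).const_mul _, fun i => ?_⟩
    simp only [pd_const_mul i _ (h.2.1 _ _)]
    exact ih (h.2.2 i)

lemma Nice.sum {k : ℕ} {J : Type*} {A : Finset J} {H : J → Γ → (ι → ℝ) → ℂ}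
    (h : ∀ j ∈ A, Nice k (H j)) : Nice k fun g v => ∑ j ∈ A, H j g v := by
  induction k generalizing H with
  | zero => exact continuous_finsetSum _ h
  | succ k ih =>
    refine ⟨continuous_finsetSum _ fun j hj => (h j hj).1,
      fun g => Differentiable.fun_sum fun j hj => (h j hj).2.1 g, fun i => ?_⟩
    have : (fun g v => pd i (fun v => ∑ j ∈ A, H j g v) v) = fun g v => ∑ j ∈ A, pd i (H j g) v := by
      funext g v
      rw [pd, fderiv_fun_sum fun j hj => (h j hj).2.1 g v]
      simp only [FunLike.coe_sum, Finset.sum_apply]; rfl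
    rw [this]
    exact ih fun j hj => (h j hj).2.2 i

lemma Nice.contDiff {k : ℕ} {H : Γ → (ι → ℝ) → ℂ} (h : Nice k H) (g : Γ) :
    ContDiff ℝ k (H g) := by
  induction k generalizing H with
  | zero =>
    exact contDiff_zero.2 (h.continuous.comp (Continuous.prodMk_right g))
  | succ k ih =>
    push_cast
    rw [contDiff_succ_iff_fderiv_apply]
    refine ⟨h.2.1 g, by simp, fun y => ?_⟩
    simp only [fderiv_eq_sum_pd]
    exact ContDiff.sum fun i _ => contDiff_const.mul (ih (h.2.2 i))

lemma contDiff_of_nice {H : Γ → (ι → ℝ) → ℂ} (h : ∀ k, Nice k H) (g : Γ) : ContDiff ℝ ∞ (H g) :=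
  contDiff_infty.2 fun k => (h k).contDiff g

lemma nice_of_contDiff {E : Type} [NormedAddCommGroup E] [NormedSpace ℝ E] {F : E × (ι → ℝ) → ℂ}
    (hF : ContDiff ℝ ∞ F) (k : ℕ) : Nice k fun u v => F (u, v) := by
  classical
  induction k generalizing F with
  | zero => exact hF.continuous
  | succ k ih =>
    refine ⟨hF.continuous, fun u => (hF.comp (contDiff_prodMk_right u)).differentiable (by simp),
      fun i => ?_⟩
    have : (fun u v => pd i (fun v => F (u, v)) v) =
        fun u v => (fun x => fderiv ℝ F x (0, Pi.single i 1)) (u, v) := by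
      funext u v
      have h1 : HasFDerivAt F (fderiv ℝ F (u, v)) (u, v) :=
        ((hF.differentiable (by simp)) _).hasFDerivAt
      have h2 := h1.comp v (hasFDerivAt_prodMk_right u v)
      have h3 : fderiv ℝ (fun v => F (u, v)) v = _ := h2.fderiv
      rw [pd, h3]
      simp only [ContinuousLinearMap.comp_apply, ContinuousLinearMap.inr_apply]
    rw [this]
    refine ih (F := fun x => fderiv ℝ F x (0, Pi.single i 1)) ?_
    exact (hF.fderiv_right (m := ∞) (by simp)).clm_apply contDiff_const

/-- Being nice is local in the parameter. -/
lemma nice_of_local {k : ℕ} {H : Γ → (ι → ℝ) → ℂ}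
    (h : ∀ g, ∃ p : Γ' → Γ, IsOpenEmbedding p ∧ g ∈ Set.range p ∧ Nice k fun u => H (p u)) :
    Nice k H := by
  have hc : ∀ {H : Γ → (ι → ℝ) → ℂ}, (∀ g, ∃ p : Γ' → Γ, IsOpenEmbedding p ∧ g ∈ Set.range p ∧
      Continuous (Function.uncurry fun u => H (p u))) → Continuous (Function.uncurry H) := by
    intro H h
    rw [continuous_iff_continuousAt]
    rintro ⟨g, v⟩
    obtain ⟨p, hp, ⟨u, rfl⟩, hc⟩ := h g
    have h2 : IsOpenEmbedding (Prod.map p (id : (ι → ℝ) → (ι → ℝ))) := hp.prodMap .id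
    exact (h2.continuousAt_iff (x := (u, v))).1 hc.continuousAt
  induction k generalizing H with
  | zero => exact hc h
  | succ k ih =>
    refine ⟨hc fun g => ?_, fun g => ?_, fun i => ih fun g => ?_⟩
    · obtain ⟨p, hp, hg, hn⟩ := h g
      exact ⟨p, hp, hg, hn.1⟩
    · obtain ⟨p, hp, ⟨u, rfl⟩, hn⟩ := h g
      exact hn.2.1 u
    · obtain ⟨p, hp, hg, hn⟩ := h g
      exact ⟨p, hp, hg, hn.2.2 i⟩

variable [MeasurableSpace T] [BorelSpace T] [CompactSpace T]

lemma pd_integral (μ : Measure T) [IsFiniteMeasure μ] {H : T → (ι → ℝ) → ℂ}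
    (h : Nice 1 H) (v : ι → ℝ) :
    DifferentiableAt ℝ (fun v => ∫ t, H t v ∂μ) v ∧
      ∀ i, pd i (fun v => ∫ t, H t v ∂μ) v = ∫ t, pd i (H t) v ∂μ := by
  classical
  obtain ⟨h0, h1, h2⟩ := h
  let D : (ι → ℝ) → T → ((ι → ℝ) →L[ℝ] ℂ) := fun v t =>
    ∑ i, (ContinuousLinearMap.proj i : (ι → ℝ) →L[ℝ] ℝ).smulRight (pd i (H t) v)
  have hD : ∀ v t, fderiv ℝ (H t) v = D v t := fun v t => by
    ext w
    rw [fderiv_eq_sum_pd]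
    simp [D]
  have hDc : Continuous (Function.uncurry D) := by
    refine continuous_finsetSum _ fun i _ => ?_
    have h3 : Continuous fun p : (ι → ℝ) × T => pd i (H p.2) p.1 :=
      (h2 i).continuous.comp (continuous_swap)
    exact (ContinuousLinearMap.smulRightL ℝ (ι → ℝ) ℂ (ContinuousLinearMap.proj i)).continuous.comp h3
  have hfin : ∀ {E : Type} [NormedAddCommGroup E] (f : T → E), Continuous f → 
      AEStronglyMeasurable f μ → Integrable f μ := by
    intro E _ f hf hm
    obtain ⟨C, hC⟩ := (isCompact_range hf).isBounded.exists_norm_le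
    exact Integrable.of_bound hm C (Eventually.of_forall fun t => hC _ ⟨t, rfl⟩)
  obtain ⟨C, hC⟩ := (((isCompact_closedBall v 1).prod isCompact_univ).image hDc).isBounded.exists_norm_le
  have hHt : ∀ w, Continuous fun t => H t w := fun w => h0.comp (Continuous.prodMk_left w)
  have hDt : ∀ w, Continuous (D w) := fun w => hDc.comp (Continuous.prodMk_right w)
  have key := hasFDerivAt_integral_of_dominated_of_fderiv_le (𝕜 := ℝ) (μ := μ) (F := fun v t => H t v)
    (F' := D) (x₀ := v) (bound := fun _ => C) (s := Metric.closedBall v 1)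
    (Metric.closedBall_mem_nhds v one_pos)
    (Eventually.of_forall fun w => (hHt w).aestronglyMeasurable)
    (hfin _ (hHt v) (hHt v).aestronglyMeasurable)
    (hDt v).aestronglyMeasurable
    (Eventually.of_forall fun t w hw => hC _ ⟨(w, t), ⟨hw, trivial⟩, rfl⟩)
    (integrable_const _)
    (Eventually.of_forall fun t w _ => by
      change HasFDerivAt (H t) (D w t) w
      rw [← hD]; exact (h1 t w).hasFDerivAt)
  refine ⟨key.differentiableAt, fun i => ?_⟩
  have hint : Integrable (D v) μ := hfin _ (hDt v) (hDt v).aestronglyMeasurable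
  rw [pd, key.fderiv, ContinuousLinearMap.integral_apply hint]
  simp only [← hD]; rfl

lemma Nice.integral [FirstCountableTopology Γ] [LocallyCompactSpace Γ]
    (μ : Measure T) [IsFiniteMeasure μ] {k : ℕ} {H : Γ → T → (ι → ℝ) → ℂ}
    (h : Nice k fun p : Γ × T => H p.1 p.2) : Nice k fun g v => ∫ t, H g t v ∂μ := by
  have hc : ∀ {H : Γ → T → (ι → ℝ) → ℂ}, (Continuous (Function.uncurry fun p : Γ × T => H p.1 p.2)) →
      Continuous (Function.uncurry fun g v => ∫ t, H g t v ∂μ) := by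
    intro H hH
    have := continuous_parametric_integral_of_continuous (μ := μ)
      (f := fun (p : Γ × (ι → ℝ)) (t : T) => H p.1 t p.2) (by
        exact hH.comp (g := Function.uncurry fun p : Γ × T => H p.1 p.2)
          (f := fun q : (Γ × (ι → ℝ)) × T => ((q.1.1, q.2), q.1.2)) (by fun_prop)) isCompact_univ
    simp only [Measure.restrict_univ] at this
    exact this
  induction k generalizing H with
  | zero => exact hc h
  | succ k ih =>
    have h1 : ∀ g, Nice 1 (H g) := fun g => by
      have := h.comp_param (p := fun t : T => (g, t)) (by fun_prop)
      exact ⟨this.1, this.2.1, fun i => (this.2.2 i).continuous⟩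
    refine ⟨hc h.1, fun g v => (pd_integral μ (h1 g) v).1, fun i => ?_⟩
    simp only [(pd_integral μ (h1 _) _).2 i]
    exact ih (h.2.2 i)

/-- Contraction towards `u`. -/
lemma Nice.contract {k : ℕ} {H : Γ → (ι → ℝ) → ℂ} (h : Nice k H) (u : ι → ℝ) :
    Nice k fun (p : Γ × unitInterval) v => H p.1 (u + (p.2 : ℝ) • (v - u)) := by
  have hc : ∀ {H : Γ → (ι → ℝ) → ℂ}, Continuous (Function.uncurry H) → Continuous (Function.uncurry
      fun (p : Γ × unitInterval) v => H p.1 (u + (p.2 : ℝ) • (v - u))) := fun hH =>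
    hH.comp (g := Function.uncurry _) (f := fun q : (Γ × unitInterval) × (ι → ℝ) =>
      (q.1.1, u + (q.1.2 : ℝ) • (q.2 - u))) (by fun_prop)
  induction k generalizing H with
  | zero => exact hc h
  | succ k ih =>
    refine ⟨hc h.1, fun p => (h.2.1 p.1).comp (by fun_prop), fun i => ?_⟩
    have : (fun (p : Γ × unitInterval) v => pd i (fun v => H p.1 (u + (p.2 : ℝ) • (v - u))) v) =
        fun p v => ((p.2 : ℝ) : ℂ) * pd i (H p.1) (u + (p.2 : ℝ) • (v - u)) := by
      funext p v
      have h2 : HasFDerivAt (fun v : ι → ℝ => u + (p.2 : ℝ) • (v - u))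
          ((p.2 : ℝ) • ContinuousLinearMap.id ℝ (ι → ℝ)) v :=
        (((hasFDerivAt_id v).sub_const u).const_smul (p.2 : ℝ)).const_add u
      have h3 := ((h.2.1 p.1 (u + (p.2 : ℝ) • (v - u))).hasFDerivAt).comp v h2
      have h4 : fderiv ℝ (fun v => H p.1 (u + (p.2 : ℝ) • (v - u))) v = _ := h3.fderiv
      rw [pd, h4, pd]
      simp
    rw [this]
    exact (ih (h.2.2 i)).const_mul (by fun_prop)

/-- Hadamard's lemma for families. -/
lemma Nice.hadamard [FirstCountableTopology Γ] [LocallyCompactSpace Γ] {H : Γ → (ι → ℝ) → ℂ}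
    (h : ∀ k, Nice k H) (u : ι → ℝ) : ∃ R : ι → Γ → (ι → ℝ) → ℂ, (∀ i k, Nice k (R i)) ∧
      ∀ g v, H g v = H g u + ∑ i, ((v i - u i : ℝ) : ℂ) * R i g v := by
  refine ⟨fun i g v => ∫ t : unitInterval, pd i (H g) (u + (t : ℝ) • (v - u)), fun i k => ?_,
    fun g v => ?_⟩
  · exact Nice.integral (H := fun g (t : unitInterval) v => pd i (H g) (u + (t : ℝ) • (v - u))) volume
      (((h (k + 1)).2.2 i).contract u)
  · have hd : ∀ t : ℝ, HasDerivAt (fun t : ℝ => H g (u + t • (v - u)))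
        (∑ i, ((v i - u i : ℝ) : ℂ) * pd i (H g) (u + t • (v - u))) t := by
      intro t
      have h1 := ((h 1).2.1 g (u + t • (v - u))).hasFDerivAt
      have h2 : HasDerivAt (fun t : ℝ => u + t • (v - u)) (v - u) t := by
        simpa using ((hasDerivAt_id t).smul_const (v - u)).const_add u
      have := h1.comp_hasDerivAt t h2
      rw [fderiv_eq_sum_pd] at this
      exact this
    have hcont : ∀ i, Continuous fun t : ℝ => pd i (H g) (u + t • (v - u)) := fun i =>
      ((h 1).2.2 i).continuous.comp (g := Function.uncurry _)
        (f := fun t : ℝ => (g, u + t • (v - u))) (by fun_prop)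
    have hI : ∀ i, ∫ t : unitInterval, pd i (H g) (u + (t : ℝ) • (v - u)) =
        ∫ t in (0 : ℝ)..1, pd i (H g) (u + t • (v - u)) := fun i => by
      rw [intervalIntegral.integral_of_le zero_le_one, ← integral_Icc_eq_integral_Ioc]
      exact integral_subtype_comap measurableSet_Icc (fun t : ℝ => pd i (H g) (u + t • (v - u)))
    have hftc := intervalIntegral.integral_eq_sub_of_hasDerivAt (a := 0) (b := 1) (fun t _ => hd t)
      (Continuous.intervalIntegrable (by fun_prop) _ _)
    rw [intervalIntegral.integral_finsetSum fun i _ => 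
      (Continuous.intervalIntegrable (by fun_prop) _ _)] at hftc
    simp only [intervalIntegral.integral_const_mul, one_smul, zero_smul, add_zero,
      add_sub_cancel] at hftc
    simp only [hI]
    rw [hftc]; ring

end Families

/-! ### Jets of superfunctions -/

section Jets

open scoped ContDiff
open MeasureTheory Filter Topology

variable {ι κ κ' : Type} [Fintype ι] [Fintype κ] [Fintype κ']

/-- The algebra of superfunctions on `ℝ^{ι|κ}`. -/
def SF (ι κ : Type) [Fintype ι] [Fintype κ] : Subalgebra ℂ ((ι → ℝ) → Grassmann κ) where
  carrier := {F | ∀ v, SmAt F v}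
  mul_mem' hF hG v := (hF v).mul (hG v)
  add_mem' hF hG v := (hF v).add (hG v)
  algebraMap_mem' _c v := smAt_const _ v

/-- Evaluation at a point. -/
def sfe (v : ι → ℝ) : SF ι κ →ₐ[ℂ] Grassmann κ :=
  (Pi.evalAlgHom ℂ (fun _ => Grassmann κ) v).comp (SF ι κ).val

lemma sf_ext {F G : SF ι κ} (h : ∀ v, sfe v F = sfe v G) : F = G := Subtype.ext (funext h)

/-- The coordinate functions, shifted so as to vanish at `u`. -/
def zs (u : ι → ℝ) : ι ⊕ κ → SF ι κ :=
  Sum.elim (fun i => ⟨fun v => algebraMap ℂ _ ((v i - u i : ℝ) : ℂ),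
      fun _ => smAt_ofReal (f := fun v => v i - u i) (by fun_prop)⟩)
    (fun k => ⟨fun _ => theta k, fun v => smAt_const _ v⟩)

lemma eval_zs_inl (u v : ι → ℝ) (i : ι) :
    sfe v (zs u (Sum.inl i) : SF ι κ) = algebraMap ℂ _ ((v i - u i : ℝ) : ℂ) := rfl

lemma eval_zs_inr (u v : ι → ℝ) (k : κ) : sfe v (zs u (Sum.inr k) : SF ι κ) = theta k := rfl

variable {Γ T : Type} [TopologicalSpace Γ] [TopologicalSpace T]

/-- A family of superfunctions all of whose partial derivatives are jointly continuous. -/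
def NiceFam (F : Γ → SF ι κ) : Prop :=
  ∀ (l : Grassmann κ →ₗ[ℂ] ℂ) (k : ℕ), Nice k fun g v => l (sfe v (F g))

/-- Integration of functions with values in the Grassmann algebra. -/
def gint [MeasurableSpace T] (μ : Measure T) (f : T → Grassmann κ) : Grassmann κ :=
  ∑ j, (∫ t, (Module.finBasis ℂ (Grassmann κ)).coord j (f t) ∂μ) • Module.finBasis ℂ (Grassmann κ) j

lemma apply_gint [MeasurableSpace T] (μ : Measure T) (f : T → Grassmann κ)
    (hf : ∀ l : Grassmann κ →ₗ[ℂ] ℂ, Integrable (fun t => l (f t)) μ) (l : Grassmann κ →ₗ[ℂ] ℂ) :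
    l (gint μ f) = ∫ t, l (f t) ∂μ := by
  have : ∀ t, l (f t) = ∑ j, (Module.finBasis ℂ (Grassmann κ)).coord j (f t) *
      l (Module.finBasis ℂ (Grassmann κ) j) := fun t => by
    conv_lhs => rw [← (Module.finBasis ℂ (Grassmann κ)).sum_repr (f t), map_sum]
    simp
  simp only [this]
  rw [integral_finsetSum _ fun j _ => (hf _).mul_const _, gint, map_sum]
  simp only [integral_mul_const, map_smul, smul_eq_mul]

lemma exists_SF_of_coord (R : Fin (Module.finrank ℂ (Grassmann κ)) → Γ → (ι → ℝ) → ℂ)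
    (hR : ∀ j k, Nice k (R j)) : ∃ F : Γ → SF ι κ, NiceFam F ∧
      ∀ g v, sfe v (F g) = ∑ j, R j g v • Module.finBasis ℂ (Grassmann κ) j := by
  refine ⟨fun g => ⟨fun v => ∑ j, R j g v • Module.finBasis ℂ (Grassmann κ) j, fun v =>
    SmAt.sum fun j _ => SmAt.smul (contDiff_of_nice (hR j) g).contDiffAt (smAt_const _ _)⟩, ?_,
    fun g v => rfl⟩
  intro l k
  have : (fun g v => l (∑ j, R j g v • Module.finBasis ℂ (Grassmann κ) j)) =
      fun g v => ∑ j, l (Module.finBasis ℂ (Grassmann κ) j) * R j g v := by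
    funext g v
    simp [map_sum, mul_comm]
  change Nice k (fun g v => l (∑ j, R j g v • Module.finBasis ℂ (Grassmann κ) j))
  rw [this]
  exact Nice.sum fun j _ => (hR j k).const_mul continuous_const

lemma NiceFam.continuous {F : Γ → SF ι κ} (hF : NiceFam F) (l : Grassmann κ →ₗ[ℂ] ℂ) (v : ι → ℝ) :
    Continuous fun g => l (sfe v (F g)) :=
  (hF l 0).continuous.comp (Continuous.prodMk_left v)

lemma integrable_of_continuous [CompactSpace T] [MeasurableSpace T] [BorelSpace T] (μ : Measure T)
    [IsFiniteMeasure μ] {f : T → ℂ} (hf : Continuous f) : Integrable f μ := by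
  obtain ⟨C, hC⟩ := (isCompact_range hf).isBounded.exists_norm_le
  exact Integrable.of_bound hf.aestronglyMeasurable C (Eventually.of_forall fun t => hC _ ⟨t, rfl⟩)

/-- The mean of a family of superfunctions. -/
lemma NiceFam.exists_mean [CompactSpace T] [MeasurableSpace T] [BorelSpace T] (μ : Measure T)
    [IsFiniteMeasure μ] {F : T → SF ι κ} (hF : NiceFam F) :
    ∃ G : SF ι κ, ∀ v, sfe v G = gint μ fun t => sfe v (F t) := by
  obtain ⟨G, -, hG⟩ := exists_SF_of_coord (Γ := Unit) (κ := κ)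
    (fun j _ v => ∫ t, (Module.finBasis ℂ (Grassmann κ)).coord j (sfe v (F t)) ∂μ) (fun j k => by
      refine Nice.integral (H := fun _ t v => (Module.finBasis ℂ (Grassmann κ)).coord j (sfe v (F t))) μ ?_
      exact (hF ((Module.finBasis ℂ (Grassmann κ)).coord j) k).comp_param continuous_snd)
  exact ⟨G (), fun v => hG () v⟩

lemma NiceFam.hadamard [FirstCountableTopology Γ] [LocallyCompactSpace Γ] {F : Γ → SF ι κ}
    (hF : NiceFam F) (u : ι → ℝ) : ∃ R : ι ⊕ κ → Γ → SF ι κ, (∀ a, NiceFam (R a)) ∧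
      ∀ g, F g = algebraMap ℂ _ (aug κ (sfe u (F g))) + ∑ a, zs u a * R a g := by
  choose R hR hFR using fun j => Nice.hadamard (fun k => hF ((Module.finBasis ℂ (Grassmann κ)).coord j) k) u
  choose S hS hRS using fun i => exists_SF_of_coord (κ := κ) (fun j => R j i) (fun j k => hR j i k)
  obtain ⟨r, hr⟩ := exists_aug_decomp (κ := κ)
  let C : κ → Γ → SF ι κ := fun k g => ⟨fun _ => r k (sfe u (F g)), fun v => smAt_const _ v⟩
  refine ⟨Sum.elim S C, ?_, fun g => sf_ext fun v => ?_⟩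
  · rintro (i | k)
    · exact hS i
    · intro l m
      exact nice_const (c := fun g => l (r k (sfe u (F g)))) (hF.continuous (l.comp (r k)) u) m
  · rw [map_add, map_sum, Fintype.sum_sum_type]
    simp only [map_mul, Sum.elim_inl, Sum.elim_inr, eval_zs_inl, eval_zs_inr, hRS, AlgHom.commutes]
    change _ = _ + (_ + ∑ k, theta k * r k (sfe u (F g)))
    have e1 := hr (sfe u (F g))
    have e2 : sfe v (F g) = sfe u (F g) + ∑ i, algebraMap ℂ (Grassmann κ) ((v i - u i : ℝ) : ℂ) *
        ∑ j, R j i g v • Module.finBasis ℂ (Grassmann κ) j := by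
      conv_lhs => rw [← (Module.finBasis ℂ (Grassmann κ)).sum_repr (sfe v (F g))]
      conv_rhs => rw [← (Module.finBasis ℂ (Grassmann κ)).sum_repr (sfe u (F g))]
      simp only [← Algebra.smul_def, Finset.smul_sum]
      rw [Finset.sum_comm, ← Finset.sum_add_distrib]
      refine Finset.sum_congr rfl fun j _ => ?_
      have := hFR j g v
      simp only [Module.Basis.coord_apply] at this
      rw [this, add_smul, Finset.sum_smul]
      simp only [smul_smul]
    rw [e2]
    nth_rw 1 [e1]
    abel

lemma sf_hadamard (F : SF ι κ) (u : ι → ℝ) : ∃ R : ι ⊕ κ → SF ι κ,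
    F = algebraMap ℂ _ (aug κ (sfe u F)) + ∑ a, zs u a * R a := by
  have hF : NiceFam fun _ : Unit => F := by
    intro l k
    have h1 : ContDiff ℝ ∞ fun v => l (sfe v F) := contDiff_iff_contDiffAt.2 fun v => F.2 v l
    have h2 : ContDiff ℝ ∞ fun p : ℝ × (ι → ℝ) => l (sfe p.2 F) := h1.comp contDiff_snd
    exact (nice_of_contDiff h2 k).comp_param (p := fun _ : Unit => (0 : ℝ)) continuous_const
  obtain ⟨R, -, hR⟩ := hF.hadamard u
  exact ⟨fun a => R a (), hR ()⟩

/-- A linear functional on superfunctions depends only on the `N`-jet at `u` if it vanishes on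
products with `N` factors among the shifted coordinates. -/
def IsJet (u : ι → ℝ) : ℕ → (SF ι κ →ₗ[ℂ] ℂ) → Prop
  | 0, L => L = 0
  | N + 1, L => ∀ a, IsJet u N (L.comp (LinearMap.mulLeft ℂ (zs u a)))

lemma isJet_zero (u : ι → ℝ) (N : ℕ) : IsJet u N (0 : SF ι κ →ₗ[ℂ] ℂ) := by
  induction N with
  | zero => rfl
  | succ N ih => intro a; rw [LinearMap.zero_comp]; exact ih

lemma IsJet.succ {u : ι → ℝ} {N : ℕ} {L : SF ι κ →ₗ[ℂ] ℂ} (h : IsJet u N L) : IsJet u (N + 1) L := by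
  induction N generalizing L with
  | zero => rw [show L = 0 from h]; exact isJet_zero _ _
  | succ N ih => exact fun a => ih (h a)

lemma IsJet.mono {u : ι → ℝ} {N M : ℕ} {L : SF ι κ →ₗ[ℂ] ℂ} (h : IsJet u N L) (hNM : N ≤ M) :
    IsJet u M L := by
  induction hNM with
  | refl => exact h
  | step _ ih => exact ih.succ

lemma IsJet.add {u : ι → ℝ} {N : ℕ} {L L' : SF ι κ →ₗ[ℂ] ℂ} (h : IsJet u N L) (h' : IsJet u N L') :
    IsJet u N (L + L') := by
  induction N generalizing L L' with
  | zero => rw [show L = 0 from h, show L' = 0 from h', add_zero]; rfl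
  | succ N ih => exact fun a => ih (h a) (h' a)

lemma IsJet.continuous [FirstCountableTopology Γ] [LocallyCompactSpace Γ] {u : ι → ℝ} {N : ℕ}
    {L : SF ι κ →ₗ[ℂ] ℂ} (h : IsJet u N L) {F : Γ → SF ι κ} (hF : NiceFam F) :
    Continuous fun g => L (F g) := by
  induction N generalizing L F with
  | zero => rw [show L = 0 from h]; exact continuous_const
  | succ N ih =>
    obtain ⟨R, hR, hFR⟩ := hF.hadamard u
    have : (fun g => L (F g)) = fun g => aug κ (sfe u (F g)) * L 1 +
        ∑ a, (L.comp (LinearMap.mulLeft ℂ (zs u a))) (R a g) := by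
      funext g
      conv_lhs => rw [hFR g]
      simp [Algebra.algebraMap_eq_smul_one]
    rw [this]
    exact ((hF.continuous (aug κ).toLinearMap u).mul continuous_const).add
      (continuous_finsetSum _ fun a _ => ih (h a) (hR a))

/-- Functionals depending on a jet commute with integrals. -/
lemma IsJet.integral [CompactSpace T] [MeasurableSpace T] [BorelSpace T] [FirstCountableTopology T]
    [LocallyCompactSpace T] (μ : Measure T) [IsFiniteMeasure μ] {u : ι → ℝ} {N : ℕ}
    {L : SF ι κ →ₗ[ℂ] ℂ} (h : IsJet u N L) {F : T → SF ι κ} (hF : NiceFam F) {G : SF ι κ}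
    (hG : ∀ v, sfe v G = gint μ fun t => sfe v (F t)) : L G = ∫ t, L (F t) ∂μ := by
  have hGl : ∀ {F : T → SF ι κ} (_ : NiceFam F) (G : SF ι κ)
      (_ : ∀ v, sfe v G = gint μ fun t => sfe v (F t)) (l : Grassmann κ →ₗ[ℂ] ℂ) (v : ι → ℝ),
      l (sfe v G) = ∫ t, l (sfe v (F t)) ∂μ := by
    intro F hF G hG l v
    rw [hG]
    exact apply_gint _ _ (fun l => integrable_of_continuous μ (hF.continuous l v)) l
  induction N generalizing L F G with
  | zero => rw [show L = 0 from h]; simp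
  | succ N ih =>
    obtain ⟨R, hR, hFR⟩ := hF.hadamard u
    choose S hS using fun a => (hR a).exists_mean μ
    have e1 : ∀ t, L (F t) = aug κ (sfe u (F t)) * L 1 +
        ∑ a, (L.comp (LinearMap.mulLeft ℂ (zs u a))) (R a t) := by
      intro t
      conv_lhs => rw [hFR t]
      simp [Algebra.algebraMap_eq_smul_one]
    have hsep : ∀ x y : Grassmann κ, (∀ l : Grassmann κ →ₗ[ℂ] ℂ, l x = l y) → x = y := by
      intro x y hxy
      apply (Module.finBasis ℂ (Grassmann κ)).ext_elem
      intro j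
      exact hxy ((Module.finBasis ℂ (Grassmann κ)).coord j)
    have e2 : G = algebraMap ℂ _ (aug κ (sfe u G)) + ∑ a, zs u a * S a := by
      refine sf_ext fun v => hsep _ _ fun l => ?_
      rw [hGl hF G hG l v]
      simp only [map_add, map_sum, map_mul, AlgHom.commutes]
      have e3 : ∀ t, l (sfe v (F t)) = aug κ (sfe u (F t)) * l 1 +
          ∑ a, (l.comp (LinearMap.mulLeft ℂ (sfe v (zs u a)))) (sfe v (R a t)) := by
        intro t
        conv_lhs => rw [hFR t]
        simp [Algebra.algebraMap_eq_smul_one]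
      simp only [e3]
      rw [integral_add, integral_mul_const, integral_finsetSum]
      · have e4 : aug κ (sfe u G) = ∫ t, aug κ (sfe u (F t)) ∂μ := hGl hF G hG (aug κ).toLinearMap u
        rw [e4, Algebra.algebraMap_eq_smul_one, map_smul, smul_eq_mul]
        congr 1
        exact Finset.sum_congr rfl fun a _ =>
          (hGl (hR a) (S a) (hS a) (l.comp (LinearMap.mulLeft ℂ (sfe v (zs u a)))) v).symm
      · exact fun a _ => integrable_of_continuous μ ((hR a).continuous _ _)
      · exact (integrable_of_continuous μ (hF.continuous (aug κ).toLinearMap u)).mul_const _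
      · exact integrable_finsetSum _ fun a _ => integrable_of_continuous μ ((hR a).continuous _ _)
    conv_lhs => rw [e2]
    simp only [e1]
    rw [integral_add, integral_mul_const, integral_finsetSum]
    · have e4 : aug κ (sfe u G) = ∫ t, aug κ (sfe u (F t)) ∂μ := hGl hF G hG (aug κ).toLinearMap u
      rw [← e4, Algebra.algebraMap_eq_smul_one, map_add, map_smul, smul_eq_mul, map_sum]
      congr 1
      exact Finset.sum_congr rfl fun a _ => ih (h a) (hR a) (hS a)
    · exact fun a _ => integrable_of_continuous μ ((h a).continuous (hR a))
    · exact (integrable_of_continuous μ (hF.continuous (aug κ).toLinearMap u)).mul_const _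
    · exact integrable_finsetSum _ fun a _ => integrable_of_continuous μ ((h a).continuous (hR a))

lemma isJet_comp_algHom {u : ι → ℝ} {H : SF ι κ →ₐ[ℂ] Grassmann κ'}
    (hH : ∀ a, aug κ' (H (zs u a)) = 0) (k : ℕ) (l : Grassmann κ' →ₗ[ℂ] ℂ)
    (hl : ∀ y ∈ augIdeal κ' ^ k, ∀ x, l (y * x) = 0) : IsJet u k (l.comp H.toLinearMap) := by
  induction k generalizing l with
  | zero =>
    have : l = 0 := LinearMap.ext fun x => by simpa using hl 1 (by simp) x
    rw [this]; exact isJet_zero _ _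
  | succ k ih =>
    intro a
    have : (l.comp H.toLinearMap).comp (LinearMap.mulLeft ℂ (zs u a)) =
        (l.comp (LinearMap.mulLeft ℂ (H (zs u a)))).comp H.toLinearMap :=
      LinearMap.ext fun F => by simp
    rw [this]
    refine ih _ fun y hy x => ?_
    change l (H (zs u a) * (y * x)) = 0
    rw [← mul_assoc]
    exact hl _ (by rw [pow_succ']; exact Submodule.mul_mem_mul (hH a) hy) x

lemma vanish_top (l : Grassmann κ' →ₗ[ℂ] ℂ) :
    ∀ y ∈ augIdeal κ' ^ (Fintype.card κ' + 1), ∀ x, l (y * x) = 0 := fun y hy x => by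
  rw [augIdeal_pow_eq_bot] at hy
  rw [(Submodule.mem_bot ℂ).1 hy, zero_mul, map_zero]

/-- Functionals obtained from a derivation along a homomorphism depend on a jet. -/
lemma isJet_comp_deriv {u : ι → ℝ} {H : SF ι κ →ₐ[ℂ] Grassmann κ'}
    (hH : ∀ a, aug κ' (H (zs u a)) = 0) {Δ : SF ι κ →ₗ[ℂ] Grassmann κ'} {y : ι ⊕ κ → Grassmann κ'}
    {s : ι ⊕ κ → ℂ} (hΔ : ∀ a F, Δ (zs u a * F) = y a * H F + s a • (H (zs u a) * Δ F))
    (k : ℕ) (l : Grassmann κ' →ₗ[ℂ] ℂ)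
    (hl : ∀ y ∈ augIdeal κ' ^ k, ∀ x, l (y * x) = 0) :
    IsJet u (k + (Fintype.card κ' + 1)) (l.comp Δ) := by
  induction k generalizing l with
  | zero =>
    have : l = 0 := LinearMap.ext fun x => by simpa using hl 1 (by simp) x
    rw [this]; exact isJet_zero _ _
  | succ k ih =>
    rw [add_right_comm]
    intro a
    have : (l.comp Δ).comp (LinearMap.mulLeft ℂ (zs u a)) =
        (l.comp (LinearMap.mulLeft ℂ (y a))).comp H.toLinearMap +
        ((s a • l).comp (LinearMap.mulLeft ℂ (H (zs u a)))).comp Δ :=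
      LinearMap.ext fun F => by simp [hΔ]
    rw [this]
    refine IsJet.add ((isJet_comp_algHom hH _ _ (vanish_top _)).mono (by omega)) (ih _ fun y hy x => ?_)
    change s a • l (H (zs u a) * (y * x)) = 0
    rw [← mul_assoc, hl _ (by rw [pow_succ']; exact Submodule.mul_mem_mul (hH a) hy) x, smul_zero]

lemma grassmann_sep {x y : Grassmann κ} (hxy : ∀ l : Grassmann κ →ₗ[ℂ] ℂ, l x = l y) : x = y := by
  apply (Module.finBasis ℂ (Grassmann κ)).ext_elem
  intro j
  exact hxy ((Module.finBasis ℂ (Grassmann κ)).coord j)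

/-- A derivation that kills the coordinates vanishes. -/
lemma deriv_eq_zero {u : ι → ℝ} {Δ : SF ι κ →ₗ[ℂ] Grassmann κ'} {y : ι ⊕ κ → Grassmann κ'}
    (hy : ∀ a, aug κ' (y a) = 0) {s : ι ⊕ κ → ℂ} (h1 : Δ 1 = 0)
    (hΔ : ∀ a F, Δ (zs u a * F) = s a • (y a * Δ F)) : Δ = 0 := by
  -- induction on the power of the augmentation ideal that `l` kills: by Hadamard's lemma `Δ F` is a
  -- combination of products of the nilpotent `y a` with values of `Δ`
  have key : ∀ (k : ℕ) (l : Grassmann κ' →ₗ[ℂ] ℂ) (_ : ∀ y ∈ augIdeal κ' ^ k, ∀ x, l (y * x) = 0)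
      (F : SF ι κ), l (Δ F) = 0 := by
    intro k
    induction k with
    | zero => intro l hl F; simpa using hl 1 (by simp) (Δ F)
    | succ k ih =>
      intro l hl F
      obtain ⟨R, hR⟩ := sf_hadamard F u
      rw [hR, Algebra.algebraMap_eq_smul_one, map_add, map_smul, h1, smul_zero, zero_add, map_sum,
        map_sum]
      refine Finset.sum_eq_zero fun a _ => ?_
      rw [hΔ, map_smul]
      refine smul_eq_zero_of_right _ (ih (l.comp (LinearMap.mulLeft ℂ (y a))) (fun z hz x => ?_) (R a))
      change l (y a * (z * x)) = 0
      rw [← mul_assoc]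
      exact hl _ (by rw [pow_succ']; exact Submodule.mul_mem_mul (hy a) hz) x
  refine LinearMap.ext fun F => grassmann_sep fun l => ?_
  rw [key _ l (vanish_top l) F, LinearMap.zero_apply, map_zero]

end Jets

section Sections

open scoped ContDiff
open MeasureTheory Filter Topology

variable {X : CSManifold}

/-- A superfunction on a chart. -/
def toSec (φ : Chart X) : SF (Fin X.evenDim) (Fin X.oddDim) →ₐ[ℂ] X.sec φ.image :=
  have hs := fun F : SF (Fin X.evenDim) (Fin X.oddDim) =>
    exists_push φ.isOpenImmersion (U := φ.image) subset_rfl (fun v => sfe v F) fun v _ => F.2 v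
  have hrd : ∀ F v, rd φ.hom (hs F).choose v = sfe v F := fun F v => (hs F).choose_spec v (φ.base_mem v)
  have hext : ∀ {s t : X.sec φ.image}, (∀ v, rd φ.hom s v = rd φ.hom t v) → s = t := fun h =>
    sec_ext_chart φ.isOpenImmersion subset_rfl fun v _ => h v
  { toFun := fun F => (hs F).choose
    map_one' := hext fun v => by rw [hrd, rd_one _ _ (φ.base_mem v), map_one]
    map_mul' := fun F G => hext fun v => by rw [rd_mul, hrd, hrd, hrd, map_mul]
    map_zero' := hext fun v => by rw [hrd, rd_zero, map_zero]
    map_add' := fun F G => hext fun v => by rw [rd_add, hrd, hrd, hrd, map_add]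
    commutes' := fun c => hext fun v => by
      rw [hrd, rd_algebraMap _ _ _ (φ.base_mem v), AlgHom.commutes] }

lemma rd_toSec (φ : Chart X) (F : SF (Fin X.evenDim) (Fin X.oddDim)) (v : Fin X.evenDim → ℝ) :
    rd φ.hom (toSec φ F) v = sfe v F :=
  (exists_push φ.isOpenImmersion (U := φ.image) subset_rfl (fun v => sfe v F)
    fun v _ => F.2 v).choose_spec v (φ.base_mem v)

lemma exists_toSec (φ : Chart X) {U : Opens X.carrier} (hU : φ.image ≤ U) (s : X.sec U) :
    ∃ F, toSec φ F = X.res hU s := by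
  refine ⟨⟨fun v => rd φ.hom s v, fun v => smAt_rd _ _ _ (hU (φ.base_mem v))⟩, ?_⟩
  refine sec_ext_chart φ.isOpenImmersion subset_rfl fun v hv => ?_
  rw [rd_toSec, rd_res _ _ _ _ hv]; rfl

/-- The parity of a coordinate function. -/
def cpar {ι κ : Type} : ι ⊕ κ → ZMod 2 := Sum.elim (fun _ => 0) (fun _ => 1)

lemma toSec_zs_mem (φ : Chart X) (u : Fin X.evenDim → ℝ) (a : Fin X.evenDim ⊕ Fin X.oddDim) :
    toSec φ (zs u a) ∈ X.par φ.image (cpar a) := by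
  refine mem_par_of_chart φ le_rfl fun v _ => ?_
  rw [rd_toSec]
  rcases a with i | k
  · exact algebraMap_mem_grassmannPar _
  · exact theta_odd k

variable {ι κ : Type} [Fintype ι] [Fintype κ]

/-- Reading at a point, as a homomorphism. -/
def rdHom (h : Hom (modelSpace ι κ) X.toSuperSpace) {U : Opens X.carrier} (w : ι → ℝ) (hw : h.pt w ∈ U) :
    X.sec U →ₐ[ℂ] Grassmann κ where
  toFun s := rd h s w
  map_one' := rd_one _ _ hw
  map_mul' _ _ := rd_mul _ _ _ _
  map_zero' := rd_zero _ _
  map_add' _ _ := rd_add _ _ _ _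
  commutes' _ := rd_algebraMap _ _ _ hw

lemma aug_rd_toSec_zs (φ : Chart X) (h : Hom (modelSpace ι κ) X.toSuperSpace) {u : Fin X.evenDim → ℝ}
    {w : ι → ℝ} (huw : φ.hom.pt u = h.pt w) (a : Fin X.evenDim ⊕ Fin X.oddDim) :
    aug κ (rd h (toSec φ (zs u a)) w) = 0 := by
  rw [aug_rd, ← huw, ← aug_rd, rd_toSec]
  rcases a with i | k
  · simp [eval_zs_inl]
  · rw [eval_zs_inr, aug_theta]

variable {T : Type} [TopologicalSpace T] [CompactSpace T] [MeasurableSpace T] [BorelSpace T]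
  [FirstCountableTopology T] [LocallyCompactSpace T]

/-- A family of global sections that depends continuously on the parameter, with all derivatives. -/
def NiceSec (f : T → X.sec ⊤) : Prop :=
  ∀ (φ : Chart X) (l : Grassmann (Fin X.oddDim) →ₗ[ℂ] ℂ) (k : ℕ), Nice k fun t v => l (rd φ.hom (f t) v)

/-- A linear functional on sections near the image of a point that depends only on a jet. -/
def JetAt (φ : Chart X) (u : Fin X.evenDim → ℝ) (L : X.sec φ.image →ₗ[ℂ] ℂ) : Prop :=
  ∃ N, IsJet u N (L.comp (toSec φ).toLinearMap)

lemma NiceSec.exists_fam {f : T → X.sec ⊤} (hf : NiceSec f) (φ : Chart X) :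
    ∃ F : T → SF (Fin X.evenDim) (Fin X.oddDim), NiceFam F ∧
      ∀ t, toSec φ (F t) = X.res le_top (f t) := by
  choose F hF using fun t => exists_toSec φ le_top (f t)
  refine ⟨F, fun l k => ?_, hF⟩
  convert hf φ l k using 4 with t v
  rw [← rd_toSec, hF, rd_res _ _ _ _ (φ.base_mem _)]

lemma NiceSec.continuous {f : T → X.sec ⊤} (hf : NiceSec f) {φ : Chart X} {u : Fin X.evenDim → ℝ}
    {L : X.sec φ.image →ₗ[ℂ] ℂ} (hL : JetAt φ u L) : Continuous fun t => L (X.res le_top (f t)) := by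
  obtain ⟨F, hF, hFf⟩ := hf.exists_fam φ
  obtain ⟨N, hN⟩ := hL
  simp only [← hFf]
  exact hN.continuous hF

lemma jetAt_rd (φ : Chart X) (h : Hom (modelSpace ι κ) X.toSuperSpace) {u : Fin X.evenDim → ℝ}
    {w : ι → ℝ} (huw : φ.hom.pt u = h.pt w) (l : Grassmann κ →ₗ[ℂ] ℂ) :
    JetAt φ u (l.comp (rdₗ h w φ.image)) := by
  have hw : h.pt w ∈ φ.image := huw ▸ φ.base_mem u
  exact ⟨_, isJet_comp_algHom (H := (rdHom h w hw).comp (toSec φ))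
    (fun a => aug_rd_toSec_zs φ h huw a) _ l (vanish_top l)⟩

lemma jetAt_rd_app (φ : Chart X) (h : Hom (modelSpace ι κ) X.toSuperSpace) {u : Fin X.evenDim → ℝ}
    {w : ι → ℝ} (huw : φ.hom.pt u = h.pt w) (l : Grassmann κ →ₗ[ℂ] ℂ) {p : ZMod 2}
    (D : VectorField X.toSuperSpace ⊤ p) :
    JetAt φ u ((l.comp (rdₗ h w φ.image)).comp (D.app φ.image le_top)) := by
  have hw : h.pt w ∈ φ.image := huw ▸ φ.base_mem u
  refine ⟨_, isJet_comp_deriv (H := (rdHom h w hw).comp (toSec φ)) (s := fun a => sgn (p * cpar a))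
    (Δ := ((rdₗ h w φ.image).comp (D.app φ.image le_top)).comp (toSec φ).toLinearMap)
    (y := fun a => rd h (D.app φ.image le_top (toSec φ (zs u a))) w)
    (fun a => aug_rd_toSec_zs φ h huw a) (fun a F => ?_) _ l (vanish_top l)⟩
  change rd h (D.app φ.image le_top (toSec φ (zs u a * F))) w = _ * rd h (toSec φ F) w +
    _ • (rd h (toSec φ (zs u a)) w * rd h (D.app φ.image le_top (toSec φ F)) w)
  rw [map_mul, D.leibniz _ _ _ _ _ (toSec_zs_mem φ u a), rd_add, rd_mul, rd_smul, rd_mul]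

/-- The mean of a family of sections. -/
lemma NiceSec.exists_mean {f : T → X.sec ⊤} (hf : NiceSec f) (μ : Measure T) [IsFiniteMeasure μ] :
    ∃ F : X.sec ⊤, ∀ (φ : Chart X) u (L : X.sec φ.image →ₗ[ℂ] ℂ), JetAt φ u L →
      L (X.res le_top F) = ∫ t, L (X.res le_top (f t)) ∂μ := by
  choose Fam hFam hFf using fun φ : Chart X => hf.exists_fam φ
  choose M hM using fun φ : Chart X => (hFam φ).exists_mean μ
  have key : ∀ (φ : Chart X) u (L : X.sec φ.image →ₗ[ℂ] ℂ), JetAt φ u L →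
      L (toSec φ (M φ)) = ∫ t, L (X.res le_top (f t)) ∂μ := by
    rintro φ u L ⟨N, hL⟩
    have := hL.integral μ (hFam φ) (hM φ)
    simp only [← hFf]
    exact this
  choose ch v hv using fun x : X.carrier => exists_chart_at x
  have hloc : ∀ (φ ψ : Chart X) (W : Opens X.carrier) (h1 : W ≤ φ.image) (h2 : W ≤ ψ.image),
      X.res h1 (toSec φ (M φ)) = X.res h2 (toSec ψ (M ψ)) := by
    intro φ ψ W h1 h2
    refine sec_ext fun χ w hw => grassmann_sep fun l => ?_
    rw [rd_res _ _ _ _ hw, rd_res _ _ _ _ hw]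
    obtain ⟨u1, hu1⟩ := h1 hw
    obtain ⟨u2, hu2⟩ := h2 hw
    have e1 := key φ u1 _ (jetAt_rd φ χ.hom hu1 l)
    have e2 := key ψ u2 _ (jetAt_rd ψ χ.hom hu2 l)
    refine e1.trans (Eq.trans ?_ e2.symm)
    refine integral_congr_ae (Eventually.of_forall fun t => ?_)
    change l (rd _ _ _) = l (rd _ _ _)
    rw [rd_res _ _ _ _ (h1 hw), rd_res _ _ _ _ (h2 hw)]
  obtain ⟨F, hF⟩ := sec_glue (U := ⊤) (fun x : X.carrier => (ch x).image) (fun x _ =>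
    Opens.mem_iSup.2 ⟨x, v x, hv x⟩) (fun x => toSec (ch x) (M (ch x))) fun x y => hloc _ _ _ _ _
  have hFφ : ∀ φ : Chart X, X.res le_top F = toSec φ (M φ) := by
    intro φ
    refine sec_ext_local fun x hx => ⟨φ.image ⊓ (ch x).image, inf_le_left, ⟨hx, v x, hv x⟩, ?_⟩
    rw [X.res_res, hF x _ le_top inf_le_right]
    exact hloc _ _ _ _ _
  exact ⟨F, fun φ u L hL => by rw [hFφ]; exact key φ u L hL⟩

/-- A section near a point agrees there with a superfunction on the whole chart. -/
lemma exists_toSec_germ (φ : Chart X) {V : Opens X.carrier} (s : X.sec V) {v₀ : Fin X.evenDim → ℝ}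
    (hv : φ.hom.pt v₀ ∈ V) : ∃ (F : SF (Fin X.evenDim) (Fin X.oddDim)) (W : Opens X.carrier)
      (h1 : W ≤ φ.image) (h2 : W ≤ V), φ.hom.pt v₀ ∈ W ∧ X.res h1 (toSec φ F) = X.res h2 s := by
  obtain ⟨f, hf, h0, h1, hc, hsub⟩ := exists_smooth_bump (φ.hom.pt ⁻¹' V) v₀
    ((V.2.preimage φ.hom.continuous_pt).mem_nhds hv)
  have hsm : ∀ v, SmAt (fun v => algebraMap ℂ (Grassmann (Fin X.oddDim)) (f v : ℂ) * rd φ.hom s v) v := by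
    intro v
    by_cases hvV : φ.hom.pt v ∈ V
    · exact (smAt_ofReal hf.contDiffAt).mul (smAt_rd _ _ _ hvV)
    · refine (smAt_const 0 v).congr ?_
      have : (tsupport f)ᶜ ∈ 𝓝 v := (isClosed_tsupport f).isOpen_compl.mem_nhds fun h => hvV (hsub h)
      filter_upwards [this] with w hw
      rw [image_eq_zero_of_notMem_tsupport hw]; simp
  obtain ⟨O, hO, hO1, hvO⟩ := eventually_nhds_iff.1 h1
  refine ⟨⟨_, hsm⟩, φ.map ⟨O, hO1⟩ ⊓ V, inf_le_left.trans (φ.map_le_image _), inf_le_right,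
    ⟨Chart.base_mem_map.2 hvO, hv⟩, ?_⟩
  refine sec_ext_chart φ.isOpenImmersion (U := φ.map ⟨O, hO1⟩ ⊓ V)
    (fun x (hx : x ∈ φ.map ⟨O, hO1⟩ ⊓ V) => φ.map_le_image _ hx.1) fun w hw => ?_
  rw [rd_res _ _ _ _ hw, rd_res _ _ _ _ hw, rd_toSec]
  change algebraMap ℂ (Grassmann (Fin X.oddDim)) ((f w : ℝ) : ℂ) * _ = _
  rw [hO w (Chart.base_mem_map.1 hw.1)]
  simp

end Sections

/-! ### Points of a CS Lie group -/

section Points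

open scoped ContDiff

lemma sec_eq_of_empty {X : SuperSpace} {U : Opens X.carrier} (hU : ∀ x, x ∉ U) (s t : X.sec U) : s = t :=
  sec_ext_local fun x hx => (hU x hx).elim

/-- The constant morphism with value `x`. -/
def constHom (S : SuperSpace) {X : CSManifold} (x : X.carrier) : Hom S X.toSuperSpace where
  base := ContinuousMap.const _ x
  pull V :=
    { toFun := fun f => algebraMap ℂ _ (val f x)
      map_one' := by
        by_cases hx : x ∈ V
        · rw [val_one hx, map_one]
        · exact sec_eq_of_empty (fun _ h => hx h) _ _
      map_mul' := fun f g => by rw [val_mul, map_mul]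
      map_zero' := by rw [val_zero, map_zero]
      map_add' := fun f g => by rw [val_add, map_add]
      commutes' := fun c => by
        by_cases hx : x ∈ V
        · rw [val_algebraMap c hx]
        · exact sec_eq_of_empty (fun _ h => hx h) _ _ }
  pull_par V i f hf := by
    change algebraMap ℂ _ (val f x) ∈ _
    rcases zmod2_cases i with rfl | rfl
    · rw [Algebra.algebraMap_eq_smul_one]
      exact Submodule.smul_mem _ _ (S.one_mem_par _)
    · rw [val_of_odd (X := X) x hf, map_zero]; exact zero_mem _
  pull_res {V' V} h f := by
    by_cases hx : x ∈ V'
    · change algebraMap ℂ _ (val _ x) = S.res _ (algebraMap ℂ _ (val _ x))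
      rw [val_res f h hx, AlgHom.commutes]
    · exact sec_eq_of_empty (fun _ h => hx h) _ _

variable {X Y : CSManifold}

lemma constHom_pull (S : SuperSpace) (x : X.carrier) {V : Opens X.carrier} (f : X.sec V) :
    (constHom S x).pull V f = algebraMap ℂ _ (val f x) := rfl

lemma rd_comp_constHom {ι κ : Type} [Fintype ι] [Fintype κ] {S : SuperSpace} (h : Hom (modelSpace ι κ) S)
    (x : X.carrier) {V : Opens X.carrier} (f : X.sec V) (w : ι → ℝ) :
    rd (h.comp (constHom S x)) f w = algebraMap ℂ _ (val f x) := by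
  by_cases hx : x ∈ V
  · rw [rd_comp, constHom_pull, rd_algebraMap]; exact hx
  · rw [rd_of_not_mem _ _ (show (h.comp (constHom S x)).pt w ∉ V from hx), val_of_not_mem f hx, map_zero]

lemma comp_constHom {S S' : SuperSpace} (f : Hom S' S) (x : X.carrier) :
    f.comp (constHom S x) = constHom S' x :=
  Hom.ext_of_res rfl fun V s W h1 h2 => by
    have e : (f.comp (constHom S x)).pull V s = algebraMap ℂ _ (val s x) := AlgHom.commutes (f.pull _) _
    rw [e, constHom_pull, AlgHom.commutes, AlgHom.commutes]

lemma constHom_comp (S : SuperSpace) (x : X.carrier) (f : Mor X Y) :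
    (constHom S x).comp f = constHom S (f.base x) :=
  Hom.ext_of_res rfl fun V s W h1 h2 => by
    change S.res _ (algebraMap ℂ _ (val (f.pull V s) x)) = S.res _ (algebraMap ℂ _ (val s _))
    rw [val_pull, AlgHom.commutes, AlgHom.commutes]

/-- The one-point manifold. -/
def ptMfd : CSManifold := modelMfd Empty Empty

/-- The point of the one-point manifold. -/
def star : ptMfd.carrier := (0 : Empty → ℝ)

lemma eq_constHom (m : Mor ptMfd X) : m = constHom _ (m.base star) := by
  change Hom (modelSpace Empty Empty) X.toSuperSpace at m
  change m = constHom (modelSpace Empty Empty) (m.pt (0 : Empty → ℝ))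
  refine Hom.ext_of_rd (fun v => ?_) fun V s v hv => ?_
  · rw [Subsingleton.elim v (0 : Empty → ℝ)]; rfl
  · obtain ⟨r, hr⟩ := exists_aug_decomp (κ := Empty)
    have h1 := hr (rd m s v)
    rw [Finset.univ_eq_empty, Finset.sum_empty, add_zero, aug_rd, Subsingleton.elim v (0 : Empty → ℝ)] at h1
    rw [Subsingleton.elim v (0 : Empty → ℝ), h1]
    exact (rd_comp_constHom (Hom.id _) (m.pt (0 : Empty → ℝ)) s _).symm

/-- The points of `X` as morphisms. -/
def ptEquiv (X : CSManifold) : X.carrier ≃ Mor ptMfd X where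
  toFun x := constHom _ x
  invFun m := m.base star
  left_inv _ := rfl
  right_inv m := (eq_constHom m).symm

variable {G : CSManifold} [SuperLieGroup G]

/-- The group structure on the points of a CS Lie group. -/
instance : Group G.carrier := (ptEquiv G).group

lemma constHom_mul (S : CSManifold) (g h : G.carrier) :
    (constHom S.toSuperSpace (g * h) : Mor S G) = constHom _ g * constHom _ h := by
  have h1 : constHom ptMfd.toSuperSpace (g * h) = (constHom _ g * constHom _ h : Mor ptMfd G) :=
    (ptEquiv G).apply_symm_apply _
  have h2 := congrArg (fun m => (constHom S.toSuperSpace star).comp m) h1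
  change (constHom S.toSuperSpace star).comp _ = (constHom S.toSuperSpace star).comp _ at h2
  rw [SuperLieGroup.comp_mul, comp_constHom, comp_constHom, comp_constHom] at h2
  exact h2

/-- The points of a CS Lie group, as constant morphisms. -/
def constMonoidHom (S : CSManifold) : G.carrier →* Mor S G :=
  MonoidHom.mk' (fun g => constHom S.toSuperSpace g) (constHom_mul S)

lemma constHom_one (S : CSManifold) : (constHom S.toSuperSpace (1 : G.carrier) : Mor S G) = 1 :=
  map_one (constMonoidHom S)

lemma constHom_inv (S : CSManifold) (g : G.carrier) :
    (constHom S.toSuperSpace g⁻¹ : Mor S G) = (constHom _ g)⁻¹ :=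
  map_inv (constMonoidHom S) g

/-- Composition with a morphism, as a homomorphism of groups. -/
def compMonoidHom {S S' : CSManifold} (f : Mor S' S) : Mor S G →* Mor S' G :=
  MonoidHom.mk' (fun g => f.comp g) (SuperLieGroup.comp_mul f)

lemma comp_one {S S' : CSManifold} (f : Mor S' S) : f.comp (1 : Mor S G) = 1 := map_one (compMonoidHom f)

lemma comp_inv {S S' : CSManifold} (f : Mor S' S) (g : Mor S G) : f.comp g⁻¹ = (f.comp g)⁻¹ :=
  map_inv (compMonoidHom f) g

lemma constHom_injective (S : SuperSpace) (s : S.carrier) {x y : X.carrier}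
    (h : constHom S x = constHom S y) : x = y :=
  congrArg (fun m : Hom S X.toSuperSpace => m.base s) h

lemma base_mul {S : CSManifold} (g h : Mor S G) (s : S.carrier) :
    (g * h).base s = g.base s * h.base s := by
  apply constHom_injective ptMfd.toSuperSpace star
  rw [constHom_mul ptMfd, ← constHom_comp, ← constHom_comp, ← constHom_comp, SuperLieGroup.comp_mul]

lemma base_inv {S : CSManifold} (g : Mor S G) (s : S.carrier) : g⁻¹.base s = (g.base s)⁻¹ := by
  apply constHom_injective ptMfd.toSuperSpace star
  rw [constHom_inv ptMfd, ← constHom_comp, ← constHom_comp, comp_inv]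

instance : IsTopologicalGroup G.carrier where
  continuous_inv := by
    have h : (fun g : G.carrier => g⁻¹) = (Hom.id G.toSuperSpace : Mor G G)⁻¹.base := by
      funext g; rw [base_inv]; rfl
    rw [h]; exact ContinuousMap.continuous _
  continuous_mul := by
    rw [continuous_iff_continuousAt]
    rintro ⟨g, h⟩
    obtain ⟨φ, u, rfl⟩ := exists_chart_at g
    obtain ⟨ψ, v, rfl⟩ := exists_chart_at h
    have hE := φ.isOpenImmersion.isOpenEmbedding.prodMap ψ.isOpenImmersion.isOpenEmbedding
    refine (hE.continuousAt_iff (x := (u, v))).1 ?_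
    let S : CSManifold := modelMfd (Fin G.evenDim ⊕ Fin G.evenDim) (Fin G.oddDim ⊕ Fin G.oddDim)
    let m1 : Mor S G := (modelFst _ _ _ _).comp φ.hom
    let m2 : Mor S G := (modelSnd _ _ _ _).comp ψ.hom
    have hc : Continuous fun p : (Fin G.evenDim → ℝ) × (Fin G.evenDim → ℝ) =>
        (m1 * m2).pt (Sum.elim p.1 p.2) := (m1 * m2).continuous_pt.comp (by
          refine continuous_pi fun i => ?_
          rcases i with i | i
          · exact (continuous_apply i).comp continuous_fst
          · exact (continuous_apply i).comp continuous_snd)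
    have : ((fun p : G.carrier × G.carrier => p.1 * p.2) ∘ Prod.map φ.hom.base ψ.hom.base) =
        fun p : (Fin G.evenDim → ℝ) × (Fin G.evenDim → ℝ) => (m1 * m2).pt (Sum.elim p.1 p.2) := by
      funext p
      exact (base_mul m1 m2 (Sum.elim p.1 p.2 : Fin G.evenDim ⊕ Fin G.evenDim → ℝ)).symm
    rw [this]
    exact hc.continuousAt

end Points

/-! ### Infinitesimal displacements -/

section Perturb

variable {S S' Y Z : SuperSpace}

lemma odd_mul_self {U : Opens S.carrier} {t : S.sec U} (ht : t ∈ S.par U 1) (x : S.sec U) :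
    t * x * t = 0 := by
  have h1 : ∀ y ∈ S.par U 1, t * y = -(y * t) := fun y hy => by
    rw [S.supercomm U 1 1 t y ht hy]; simp [sgn]
  have h2 : t * t = 0 := by
    have := h1 t ht
    have h3 : (2 : ℂ) • (t * t) = 0 := by
      rw [two_smul]; nth_rw 1 [this]; simp
    simpa using h3
  obtain ⟨a, ha, b, hb, rfl⟩ := exists_parts 0 x
  have h3 : t * a = a * t := by rw [S.supercomm U 1 0 t a ht ha]; simp [sgn]
  rw [mul_add, h3, h1 b hb, add_mul, neg_mul, mul_assoc, mul_assoc, h2]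
  simp

/-- The displacement of a morphism `z` along the odd vector field `D` by the odd parameter `τ`, with
pullback `f ↦ z^* f + τ z^* (D f)`. -/
def perturb (z : Hom S Y) (D : VectorField Y ⊤ 1) {τ : S.sec ⊤} (hτ : τ ∈ S.par ⊤ 1) : Hom S Y where
  base := z.base
  pull V := AlgHom.ofLinearMap
      ((z.pull V).toLinearMap + (LinearMap.mulLeft ℂ (S.res le_top τ)).comp
        ((z.pull V).toLinearMap.comp (D.app V le_top))) (by
      have h1 : D.app V le_top 1 = 0 := by
        have := D.leibniz V le_top 0 1 1 (Y.one_mem_par V)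
        simpa [sgn] using this
      simp [h1]) (fun f g => by
      set t : S.sec (Opens.comap z.base V) := S.res le_top τ with ht_def
      have ht : t ∈ S.par _ 1 := S.res_par _ _ _ hτ
      change z.pull V (f * g) + t * z.pull V (D.app V le_top (f * g)) =
        (z.pull V f + t * z.pull V (D.app V le_top f)) * (z.pull V g + t * z.pull V (D.app V le_top g))
      have hhom : ∀ (i : ZMod 2) (f : Y.sec V), f ∈ Y.par V i →
          z.pull V (f * g) + t * z.pull V (D.app V le_top (f * g)) =
          (z.pull V f + t * z.pull V (D.app V le_top f)) *
            (z.pull V g + t * z.pull V (D.app V le_top g)) := by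
        intro i f hf
        rw [D.leibniz V le_top i f g hf, map_add, map_smul, map_mul, map_mul, map_mul, mul_add, add_mul,
          mul_add, mul_add]
        have e1 : z.pull V f * (t * z.pull V (D.app V le_top g)) =
            t * (sgn (1 * i) • (z.pull V f * z.pull V (D.app V le_top g))) := by
          rw [← mul_assoc, S.supercomm _ i 1 _ t (z.pull_par V i f hf) ht, mul_comm i 1]
          simp [mul_assoc]
        have e2 : t * z.pull V (D.app V le_top f) * (t * z.pull V (D.app V le_top g)) = 0 := by
          rw [← mul_assoc, odd_mul_self ht, zero_mul]
        rw [e1, e2, mul_assoc]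
        abel
      obtain ⟨a, ha, b, hb, rfl⟩ := exists_parts 0 f
      have ea := hhom _ a ha
      have eb := hhom _ b hb
      simp only [map_add, add_mul, mul_add] at ea eb ⊢
      have := congrArg₂ (· + ·) ea eb
      convert this using 1 <;> abel)
  pull_par V i f hf := by
    refine add_mem (z.pull_par V i f hf) ?_
    have := S.mul_mem_par _ 1 (1 + i) _ _ (S.res_par (le_top : Opens.comap z.base V ≤ ⊤) _ _ hτ)
      (z.pull_par V _ _ (D.app_par V le_top i f hf))
    have e : (1 : ZMod 2) + (1 + i) = i := by
      rw [← add_assoc, show (1 : ZMod 2) + 1 = 0 from rfl, zero_add]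
    rwa [e] at this
  pull_res {V' V} h f := by
    change z.pull V' (Y.res h f) + S.res _ τ * z.pull V' (D.app V' _ (Y.res h f)) =
      S.res _ (z.pull V f + S.res _ τ * z.pull V (D.app V _ f))
    rw [← D.res_app h le_top, z.pull_res, z.pull_res, map_add, map_mul, S.res_res]

lemma perturb_comp_of_related (z : Hom S Y) {D' : VectorField Y ⊤ 1} {D : VectorField Z ⊤ 1}
    {f : Hom Y Z} (hD : D'.Related f D) {τ : S.sec ⊤} (hτ : τ ∈ S.par ⊤ 1) :
    (perturb z D' hτ).comp f = perturb (z.comp f) D hτ :=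
  Hom.ext_of_res rfl fun V s W h1 h2 => by
    change S.res h1 (z.pull _ (f.pull V s) + S.res _ τ * z.pull _ (D'.app _ _ (f.pull V s))) =
      S.res h2 (z.pull _ (f.pull V s) + S.res _ τ * z.pull _ (f.pull V (D.app V _ s)))
    rw [hD V s]; rfl

lemma perturb_comp_of_relatedZero (z : Hom S Y) {D' : VectorField Y ⊤ 1} {f : Hom Y Z}
    (hD : D'.RelatedZero f) {τ : S.sec ⊤} (hτ : τ ∈ S.par ⊤ 1) :
    (perturb z D' hτ).comp f = z.comp f :=
  Hom.ext_of_res rfl fun V s W h1 h2 => by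
    have e : z.pull _ (f.pull V s) + S.res le_top τ * z.pull _ (D'.app _ le_top (f.pull V s)) =
        z.pull _ (f.pull V s) := by
      rw [hD V s, map_zero, mul_zero, add_zero]
    exact congrArg (S.res h1) e

/-- The vector field `f_* D` for an isomorphism `f`. -/
def transport (f : Hom Y Z) (g : Hom Z Y) (hgf : g.comp f = Hom.id Z)
    {p : ZMod 2} (D : VectorField Y ⊤ p) : VectorField Z ⊤ p :=
  have h : ∀ V : Opens Z.carrier, V ≤ Opens.comap g.base (Opens.comap f.base V) := fun V z hz => by
    have : f.base (g.base z) = z := congrArg (fun h : Hom Z Z => h.base z) hgf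
    change f.base (g.base z) ∈ V
    rwa [this]
  have hid : ∀ {V W : Opens Z.carrier} (s : Z.sec V) (h1 : W ≤ Opens.comap g.base (Opens.comap f.base V))
      (h2 : W ≤ V), Z.res h1 (g.pull _ (f.pull V s)) = Z.res h2 s := fun s h1 h2 =>
    res_pull_of_eq_id hgf s h1 h2
  { app := fun V _ => (Z.res (h V)).toLinearMap.comp ((g.pull _).toLinearMap.comp
      ((D.app (Opens.comap f.base V) le_top).comp (f.pull V).toLinearMap))
    app_par := fun V _ i s hs => Z.res_par _ _ _ (g.pull_par _ _ _ (D.app_par _ _ _ _ (f.pull_par _ _ _ hs)))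
    res_app := fun {W V} hW _ s => by
      change Z.res _ (Z.res _ (g.pull _ (D.app _ _ (f.pull V s)))) =
        Z.res _ (g.pull _ (D.app _ _ (f.pull W (Z.res hW s))))
      rw [f.pull_res, ← D.res_app (Opens.comap_mono f.base hW) le_top, g.pull_res, Z.res_res, Z.res_res]
    leibniz := fun V _ i s t hs => by
      change Z.res _ (g.pull _ (D.app _ _ (f.pull V (s * t)))) =
        Z.res _ (g.pull _ (D.app _ _ (f.pull V s))) * t + _ • (s * Z.res _ (g.pull _ (D.app _ _ (f.pull V t))))
      rw [map_mul, D.leibniz _ _ _ _ _ (f.pull_par _ _ _ hs), map_add, map_smul, map_mul, map_mul,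
        map_add, map_smul, map_mul, map_mul, hid s (h V) le_rfl, hid t (h V) le_rfl, Z.res_refl,
        Z.res_refl] }

lemma related_transport (f : Hom Y Z) (g : Hom Z Y) (hgf : g.comp f = Hom.id Z) (hfg : f.comp g = Hom.id Y)
    {p : ZMod 2} (D : VectorField Y ⊤ p) : D.Related f (transport f g hgf D) := by
  intro V s
  have h2 : Opens.comap f.base V ≤ Opens.comap f.base
      (Opens.comap g.base (Opens.comap f.base V)) := fun y hy => by
    have : f.base (g.base (f.base y)) = f.base y := congrArg (fun h : Hom Z Z => h.base (f.base y)) hgf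
    change f.base (g.base (f.base y)) ∈ V
    rwa [this]
  change _ = f.pull V (Z.res _ (g.pull _ (D.app _ _ (f.pull V s))))
  rw [f.pull_res]
  have := res_pull_of_eq_id hfg (D.app _ le_top (f.pull V s)) h2 le_rfl
  rw [Y.res_refl] at this
  exact this.symm

end Perturb

/-! ### Odd displacements in a CS Lie group -/

section Displacements

lemma comp_assoc {S T U V : SuperSpace} (f : Hom S T) (g : Hom T U) (h : Hom U V) :
    (f.comp g).comp h = f.comp (g.comp h) := rfl

lemma comp_id {S T : SuperSpace} (f : Hom S T) : f.comp (Hom.id T) = f := rfl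

variable {G : CSManifold} [SuperLieGroup G] {Q : VectorField G.toSuperSpace ⊤ 1} {S : CSManifold}

/-- The displacement of the unit of a CS Lie group along `Q`. -/
def disp (S : CSManifold) (Q : VectorField G.toSuperSpace ⊤ 1) {τ : S.sec ⊤} (hτ : τ ∈ S.par ⊤ 1) : Mor S G :=
  perturb (1 : Mor S G) Q hτ

/-- A vector field on `G × G` that lifts `Q` along the second factor and is related to `Q` by the
multiplication carries displacements of the right factor to displacements of the product. -/
lemma mul_perturb {P : CSManifold} {pr₁ pr₂ : Mor P G} {D' : VectorField P.toSuperSpace ⊤ 1}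
    (h1 : D'.RelatedZero pr₁) (h2 : D'.Related pr₂ Q) (h3 : D'.Related (pr₁ * pr₂) Q) (z : Mor S P)
    {τ : S.sec ⊤} (hτ : τ ∈ S.par ⊤ 1) : (z.comp pr₁ : Mor S G) * perturb (z.comp pr₂) Q hτ =
      perturb (z.comp pr₁ * z.comp pr₂ : Mor S G) Q hτ := by
  rw [← perturb_comp_of_related z h2, ← perturb_comp_of_relatedZero z h1 hτ, ← SuperLieGroup.comp_mul,
    perturb_comp_of_related z h3, SuperLieGroup.comp_mul, perturb_comp_of_relatedZero z h1]

lemma IsProduct.exists_pt {P X Y : CSManifold} {p : Mor P X} {q : Mor P Y} (h : IsProduct p q)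
    (x : X.carrier) (y : Y.carrier) : ∃ z, p.base z = x ∧ q.base z = y := by
  obtain ⟨z, hz⟩ := h.bijective.2 (x, y)
  exact ⟨z, congrArg Prod.fst hz, congrArg Prod.snd hz⟩

/-- Left invariance of `Q`, in terms of points: the displacement of `g` is `g` times that of the unit. -/
lemma constHom_mul_disp (hQ : IsLeftInvariant Q) (g : G.carrier) {τ : S.sec ⊤} (hτ : τ ∈ S.par ⊤ 1) :
    (constHom _ g : Mor S G) * disp S Q hτ = perturb (constHom _ g) Q hτ := by
  obtain ⟨P, pr₁, pr₂, D', hP, h1, h2, h3⟩ := hQ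
  obtain ⟨z, hz1, hz2⟩ := hP.exists_pt g 1
  have := mul_perturb h1 h2 h3 (constHom _ z : Mor S P) hτ
  rwa [constHom_comp, constHom_comp, hz1, hz2, constHom_one, mul_one] at this

/-- The interchange of the two factors of the product of a model space with itself. -/
lemma exists_swap (ι κ : Type) [Fintype ι] [Fintype κ] :
    ∃ s : Hom (modelSpace (ι ⊕ ι) (κ ⊕ κ)) (modelSpace (ι ⊕ ι) (κ ⊕ κ)),
      s.comp (modelFst ι κ ι κ) = modelSnd ι κ ι κ ∧ s.comp (modelSnd ι κ ι κ) = modelFst ι κ ι κ := by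
  refine ⟨reindexHom (Equiv.sumComm _ _) (Equiv.sumComm _ _), ?_, ?_⟩
  · refine (smoothHom_comp_smoothHom _ _ _ (fun v i => v (Sum.inl i)) (by fun_prop) _).trans ?_
    change smoothHom _ _ _ = smoothHom (fun v i => v (Sum.inr i)) (by fun_prop) _
    congr 1
    refine LinearMap.ext fun w => funext fun k => ?_
    rcases k with k | k <;> rfl
  · refine (smoothHom_comp_smoothHom _ _ _ (fun v i => v (Sum.inr i)) (by fun_prop) _).trans ?_
    change smoothHom _ _ _ = smoothHom (fun v i => v (Sum.inl i)) (by fun_prop) _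
    congr 1
    refine LinearMap.ext fun w => funext fun k => ?_
    rcases k with k | k <;> rfl

/-- The product of two odd displacements is an iterated displacement. Left invariance is applied to the
superpoint `(disp τ', 1)` of `G × G`; such a pair exists although `IsProduct` gives no general pairing
of morphisms, because `(1, disp τ')` is a displacement and the factors can be exchanged in a chart. -/
lemma disp_mul_disp (hQ : IsLeftInvariant Q) {τ τ' : S.sec ⊤} (hτ : τ ∈ S.par ⊤ 1) (hτ' : τ' ∈ S.par ⊤ 1) :
    disp S Q hτ' * disp S Q hτ = perturb (disp S Q hτ') Q hτ := by
  obtain ⟨P, pr₁, pr₂, D', hP, h1, h2, h3⟩ := hQ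
  obtain ⟨p, hp1, hp2⟩ := hP.exists_pt 1 1
  -- `w = (1, disp τ')`, lifted through a product chart around `(1, 1)`; `z` exchanges its components
  let w : Mor S P := perturb (constHom _ p : Mor S P) D' hτ'
  have hw1 : w.comp pr₁ = (1 : Mor S G) := by
    rw [perturb_comp_of_relatedZero _ h1, constHom_comp, hp1, constHom_one]
  have hw2 : w.comp pr₂ = disp S Q hτ' := by
    rw [perturb_comp_of_related _ h2, constHom_comp, hp2, constHom_one]; rfl
  obtain ⟨φ, u, hu⟩ := exists_chart_at (1 : G.carrier)
  obtain ⟨χ, hχ, hχ1, hχ2⟩ := hP.exists_chart φ φ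
  have hpχ : χ.pt (Sum.elim u u) = p := by
    apply hP.bijective.1
    have e1 : pr₁.base (χ.pt (Sum.elim u u)) = φ.hom.pt u :=
      congrArg (fun h : Hom _ G.toSuperSpace => h.base (Sum.elim u u : _ → ℝ)) hχ1
    have e2 : pr₂.base (χ.pt (Sum.elim u u)) = φ.hom.pt u :=
      congrArg (fun h : Hom _ G.toSuperSpace => h.base (Sum.elim u u : _ → ℝ)) hχ2
    exact Prod.ext (e1.trans (hu.trans hp1.symm)) (e2.trans (hu.trans hp2.symm))
  obtain ⟨l, hl⟩ := exists_lift hχ w fun s => ⟨_, hpχ⟩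
  obtain ⟨σ, hσ1, hσ2⟩ := exists_swap (Fin G.evenDim) (Fin G.oddDim)
  let z : Mor S P := l.comp (σ.comp χ)
  have hz1 : z.comp pr₁ = disp S Q hτ' := by
    change l.comp (σ.comp (χ.comp pr₁)) = _
    rw [hχ1, ← comp_assoc σ, hσ1, ← hχ2, ← hw2, ← hl]; rfl
  have hz2 : z.comp pr₂ = (1 : Mor S G) := by
    change l.comp (σ.comp (χ.comp pr₂)) = _
    rw [hχ2, ← comp_assoc σ, hσ2, ← hχ1, ← hw1, ← hl]; rfl
  have := mul_perturb h1 h2 h3 z hτ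
  rwa [hz1, hz2, mul_one] at this

/-- A product remains one when its second projection is followed by an automorphism. -/
lemma isProduct_comp {P X Y : CSManifold} {p : Mor P X} {q : Mor P Y} (h : IsProduct p q) (f g : Mor Y Y)
    (hfg : f.comp g = Hom.id _) (hgf : g.comp f = Hom.id _) : IsProduct p (q.comp f : Mor P Y) := by
  have hf : Function.Bijective f.base := by
    refine Function.bijective_iff_has_inverse.2 ⟨g.base, fun x => ?_, fun x => ?_⟩
    · exact congrArg (fun h : Mor Y Y => h.base x) hfg
    · exact congrArg (fun h : Mor Y Y => h.base x) hgf
  refine ⟨?_, fun φ ψ => ?_⟩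
  · have h2 : Function.Bijective (Prod.map (id : X.carrier → X.carrier) f.base) :=
      Function.Bijective.prodMap Function.bijective_id hf
    exact h2.comp h.bijective
  · let ψ' : Chart Y := ⟨ψ.hom.comp g, ψ.isOpenImmersion.comp (isOpenImmersion_of_inverse g f hgf hfg)⟩
    obtain ⟨χ, hχ, h1, h2⟩ := h.exists_chart φ ψ'
    refine ⟨χ, hχ, h1, ?_⟩
    rw [← comp_assoc, h2]
    change (modelSnd _ _ _ _).comp (ψ.hom.comp (g.comp f)) = _
    rw [hgf]
    rfl

/-- Right translation by a point. -/
def rightMul (g : G.carrier) : Mor G G := (Hom.id G.toSuperSpace : Mor G G) * constHom _ g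

lemma comp_rightMul (f : Mor S G) (g : G.carrier) : f.comp (rightMul g) = f * constHom _ g := by
  rw [rightMul, SuperLieGroup.comp_mul, comp_constHom]; rfl

lemma rightMul_comp (g h : G.carrier) (hgh : g * h = 1) :
    (rightMul g).comp (rightMul h) = Hom.id G.toSuperSpace := by
  rw [comp_rightMul, rightMul, mul_assoc, ← constHom_mul, hgh, constHom_one, mul_one]

lemma perturb_smul {S Y : SuperSpace} (z : Hom S Y) {D E : VectorField Y ⊤ 1} {c : ℂ}
    (hE : ∀ V f, E.app V le_top f = c • D.app V le_top f) {τ : S.sec ⊤} (hτ : τ ∈ S.par ⊤ 1) :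
    perturb z E hτ = perturb z D (Submodule.smul_mem _ c hτ) :=
  Hom.ext_of_res rfl fun V s W h1 h2 => by
    have e : z.pull V s + S.res le_top τ * z.pull V (E.app V le_top s) =
        z.pull V s + S.res le_top (c • τ) * z.pull V (D.app V le_top s) := by
      rw [hE, map_smul, map_smul, mul_smul_comm, smul_mul_assoc]
    exact congrArg (S.res h1) e

lemma perturb_congr {S Y : SuperSpace} {z z' : Hom S Y} (h : z = z') (D : VectorField Y ⊤ 1)
    {τ : S.sec ⊤} (hτ : τ ∈ S.par ⊤ 1) : perturb z D hτ = perturb z' D hτ := by rw [h]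

/-- Conjugation by a point multiplies the odd direction `Q` by a scalar: the transport of `Q` by a right
translation is again left invariant. -/
lemma exists_disp_mul_constHom (hQ : IsLeftInvariant Q)
    (hspan : ∀ E : VectorField G.toSuperSpace ⊤ 1, IsLeftInvariant E →
      ∃ c : ℂ, ∀ V f, E.app V le_top f = c • Q.app V le_top f) (g : G.carrier) :
    ∃ c : ℂ, ∀ (S : CSManifold) (τ : S.sec ⊤) (hτ : τ ∈ S.par ⊤ 1),
      disp S Q hτ * constHom _ g = constHom _ g * disp S Q (Submodule.smul_mem _ c hτ) := by
  have hgf := rightMul_comp g⁻¹ g (inv_mul_cancel g)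
  have hfg := rightMul_comp g g⁻¹ (mul_inv_cancel g)
  let E := transport (rightMul g) (rightMul g⁻¹) hgf Q
  have hE : (Q).Related (rightMul g) E := related_transport (rightMul g) (rightMul g⁻¹) hgf hfg Q
  have hEinv : IsLeftInvariant E := by
    obtain ⟨P, pr₁, pr₂, D', hP, h1, h2, h3⟩ := hQ
    have hcomp : ∀ {f : Mor P G}, D'.Related f Q → D'.Related (f.comp (rightMul g)) E := by
      intro f hf V s
      change D'.app _ _ (f.pull _ ((rightMul g).pull V s)) = f.pull _ ((rightMul g).pull V (E.app V _ s))
      rw [← hE V s, ← hf]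
    refine ⟨P, pr₁, pr₂.comp (rightMul g), D', isProduct_comp hP _ _ hfg hgf, h1, hcomp h2, ?_⟩
    have e : pr₁ * (pr₂.comp (rightMul g) : Mor P G) = (pr₁ * pr₂).comp (rightMul g) := by
      rw [comp_rightMul, comp_rightMul, mul_assoc]
    rw [e]
    exact hcomp h3
  obtain ⟨c, hc⟩ := hspan E hEinv
  refine ⟨c, fun S τ hτ => ?_⟩
  rw [constHom_mul_disp hQ, ← comp_rightMul, disp, perturb_comp_of_related _ hE, perturb_smul _ hc]
  refine perturb_congr ?_ Q _
  rw [comp_rightMul, one_mul]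

end Displacements

/-! ### Odd displacements and actions -/

section ActionDisp

variable {G : CSManifold} [SuperLieGroup G] {Q : VectorField G.toSuperSpace ⊤ 1}
  {X : CSManifold} {a : Action G X} {QX : VectorField X.toSuperSpace ⊤ 1}

/-- Displacement by elements of `G` in the odd direction `Q` is displacement along the vector field by
which `Q` acts. -/
lemma act_disp (hQX : a.IsFundamental Q QX) {S : CSManifold} {τ : S.sec ⊤} (hτ : τ ∈ S.par ⊤ 1)
    (x : Mor S X) : a.act (disp S Q hτ) x = perturb x QX hτ := by
  obtain ⟨P, pr₁, pr₂, D', j, hP, h1, h2, hj1, hj2, hf⟩ := hQX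
  have hja : j.comp (a.act pr₁ pr₂) = Hom.id _ := by rw [a.comp_act, hj1, hj2, a.one_act]
  have e1 : (perturb (x.comp j) D' hτ).comp pr₁ = disp S Q hτ := by
    rw [perturb_comp_of_related _ h1]
    refine perturb_congr ?_ Q hτ
    change x.comp (j.comp pr₁) = _
    rw [hj1, comp_one]
  have e2 : (perturb (x.comp j) D' hτ).comp pr₂ = x := by
    rw [perturb_comp_of_relatedZero _ h2]
    change x.comp (j.comp pr₂) = _
    rw [hj2]; rfl
  have e3 : a.act (disp S Q hτ) x = (perturb (x.comp j) D' hτ).comp (a.act pr₁ pr₂) := by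
    rw [a.comp_act, e1, e2]
  rw [e3]
  have hb : (x.comp j).comp (a.act pr₁ pr₂) = x := by
    rw [comp_assoc, hja]; rfl
  have hb' : ((perturb (x.comp j) D' hτ).comp (a.act pr₁ pr₂)).base = (perturb x QX hτ).base :=
    (congrArg (fun m : Mor S X => m.base) hb :)
  refine Hom.ext_of_res hb' fun V s W hW1 hW2 => ?_
  obtain ⟨h, hh⟩ := hf V s
  have hh' := res_pull_of_eq_id hja s le_rfl h
  rw [X.res_refl] at hh'
  have e4 : x.pull _ (j.pull _ ((a.act pr₁ pr₂).pull V s)) + S.res le_top τ *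
      x.pull _ (j.pull _ (D'.app _ le_top ((a.act pr₁ pr₂).pull V s))) =
      S.res (Opens.comap_mono x.base h) (x.pull V s + S.res le_top τ * x.pull V (QX.app V le_top s)) := by
    rw [← hh, x.pull_res, map_add, map_mul, S.res_res, ← x.pull_res h s, show X.res h s = j.pull _ ((a.act pr₁ pr₂).pull V s) from hh'.symm]
  exact (congrArg (S.res hW1) e4).trans (S.res_res _ _ _)

variable {ι κ : Type} [Fintype ι] [Fintype κ]

lemma theta_mem (k : κ) : (⟨fun _ => theta k, isSmooth_const _ _⟩ : (modelSpace ι κ).sec ⊤) ∈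
    (modelSpace ι κ).par ⊤ 1 := fun _ => theta_odd k

lemma rd_perturb {Y : SuperSpace} (z : Hom (modelSpace ι κ) Y) (D : VectorField Y ⊤ 1)
    {τ : (modelSpace ι κ).sec ⊤} (hτ : τ ∈ (modelSpace ι κ).par ⊤ 1) {V : Opens Y.carrier} (s : Y.sec V)
    (w : ι → ℝ) : rd (perturb z D hτ) s w =
      rd z s w + τ.1 ⟨w, trivial⟩ * rd z (D.app V le_top s) w := by
  by_cases hw : z.pt w ∈ V
  · have hw' : (perturb z D hτ).pt w ∈ V := hw
    rw [rd_of_mem z s w hw, rd_of_mem z _ w hw, rd_of_mem (perturb z D hτ) s w hw']; rfl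
  · have hw' : (perturb z D hτ).pt w ∉ V := hw
    rw [rd_of_not_mem z _ hw, rd_of_not_mem z _ hw, rd_of_not_mem (perturb z D hτ) s hw']; simp

lemma contr_inclInr {κ κ' : Type} (k : κ) (x : Grassmann κ') :
    contr (Sum.inl k) (inclInr κ κ' x) = 0 := by
  induction x using CliffordAlgebra.left_induction with
  | algebraMap r =>
    have : inclInr κ κ' (algebraMap ℂ (Grassmann κ') r) = algebraMap ℂ _ r := AlgHom.commutes _ _
    exact (congrArg _ this).trans (contr_algebraMap _ _)
  | add x y hx hy => rw [map_add, map_add, hx, hy, add_zero]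
  | ι_mul x w hx =>
    have : inclInr κ κ' (ExteriorAlgebra.ι ℂ w * x) = ExteriorAlgebra.ι ℂ
        ((LinearMap.pi (Sum.elim 0 fun k => LinearMap.proj k) : (κ' → ℂ) →ₗ[ℂ] (κ ⊕ κ' → ℂ)) w) * inclInr κ κ' x := by
      rw [map_mul, inclInr, ExteriorAlgebra.map_apply_ι]
    refine (congrArg _ this).trans ?_
    rw [contr_ι_mul, hx]
    simp

lemma eq_zero_of_theta_mul {κ κ' : Type} (k : κ) {x : Grassmann κ'}
    (h : theta (Sum.inl k) * inclInr κ κ' x = 0) : x = 0 := by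
  have h1 := congrArg (contr (Sum.inl k)) h
  rw [theta, contr_ι_mul, contr_inclInr, map_zero] at h1
  have h2 := congrArg (killInl κ κ') h1
  simpa [killInl_inclInr] using h2

lemma eq_zero_of_theta_mul_theta_mul {κ κ' : Type} (k l : κ) (hkl : k ≠ l) {x : Grassmann κ'}
    (h : theta (Sum.inl k) * (theta (Sum.inl l) * inclInr κ κ' x) = 0) : x = 0 := by
  have h1 := congrArg (contr (Sum.inl k)) h
  rw [theta, contr_ι_mul, theta, contr_ι_mul, contr_inclInr, map_zero] at h1
  refine eq_zero_of_theta_mul l (κ := κ) ?_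
  rw [theta]
  simpa [hkl] using h1

/-- The morphism `X → X` by which a point of `G` acts. -/
def actPt (a : Action G X) (g : G.carrier) : Mor X X := a.act (constHom _ g) (Hom.id _)

lemma act_constHom {S : CSManifold} (g : G.carrier) (x : Mor S X) :
    a.act (constHom _ g) x = x.comp (actPt a g) := by
  rw [actPt, a.comp_act, comp_constHom]; rfl

lemma actPt_mul (g h : G.carrier) : actPt a (g * h) = (actPt a h).comp (actPt a g) := by
  rw [← act_constHom, actPt, constHom_mul, a.mul_act]; rfl

lemma perturb_comp_actPt (hQX : a.IsFundamental Q QX) {g : G.carrier} {c : ℂ}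
    (hc : ∀ (S : CSManifold) (τ : S.sec ⊤) (hτ : τ ∈ S.par ⊤ 1),
      disp S Q hτ * constHom _ g = constHom _ g * disp S Q (Submodule.smul_mem _ c hτ))
    {S : CSManifold} (x : Mor S X) {τ : S.sec ⊤} (hτ : τ ∈ S.par ⊤ 1) :
    perturb (x.comp (actPt a g)) QX hτ = (perturb x QX (Submodule.smul_mem _ c hτ)).comp (actPt a g) := by
  have e1 : a.act (disp S Q hτ) (a.act (constHom _ g) x) =
      a.act (constHom _ g) (a.act (disp S Q (Submodule.smul_mem _ c hτ)) x) := by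
    rw [← a.mul_act, ← a.mul_act, hc S _ hτ]
  rwa [act_constHom, act_constHom, act_disp hQX, act_disp hQX] at e1

/-- How a point of the group conjugates `Q` on `X`: the coefficients of an auxiliary odd parameter in
`perturb_comp_actPt` are compared. -/
lemma actPt_pull_app (hQX : a.IsFundamental Q QX) {g : G.carrier} {c : ℂ}
    (hc : ∀ (S : CSManifold) (τ : S.sec ⊤) (hτ : τ ∈ S.par ⊤ 1),
      disp S Q hτ * constHom _ g = constHom _ g * disp S Q (Submodule.smul_mem _ c hτ))
    {V : Opens X.carrier} (s : X.sec V) : (actPt a g).pull V (QX.app V le_top s) =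
      c • QX.app _ le_top ((actPt a g).pull V s) := by
  refine sec_ext fun ψ v hv => ?_
  let x : Hom (modelSpace (Empty ⊕ Fin X.evenDim) (Unit ⊕ Fin X.oddDim)) X.toSuperSpace :=
    (modelSnd _ _ _ _).comp ψ.hom
  have hθ := theta_mem (ι := Empty ⊕ Fin X.evenDim) (κ := Unit ⊕ Fin X.oddDim) (Sum.inl ())
  have e : (perturb (x.comp (actPt a g)) QX hθ) =
      (perturb x QX (Submodule.smul_mem _ c hθ)).comp (actPt a g) :=
    perturb_comp_actPt (S := modelMfd (Empty ⊕ Fin X.evenDim) (Unit ⊕ Fin X.oddDim)) hQX hc x hθ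
  obtain ⟨w, hw⟩ : ∃ w : Empty ⊕ Fin X.evenDim → ℝ, (fun i => w (Sum.inr i)) = v :=
    ⟨Sum.elim Empty.elim v, rfl⟩
  have l1 := rd_perturb (x.comp (actPt a g)) QX hθ s w
  have l2 := rd_perturb x QX (Submodule.smul_mem _ c hθ) ((actPt a g).pull V s) w
  have e2 : rd (perturb (x.comp (actPt a g)) QX hθ) s w =
    rd (perturb x QX (Submodule.smul_mem _ c hθ)) ((actPt a g).pull V s) w := by rw [e]; rfl
  have e3 := l1.symm.trans (e2.trans l2)
  rw [rd_comp (h := x) (f := actPt a g) (s := s), rd_comp (h := x) (f := actPt a g) (s := QX.app V le_top s)] at e3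
  change _ + theta (Sum.inl ()) * _ = _ + (c • theta (Sum.inl ())) * _ at e3
  rw [add_right_inj, smul_mul_assoc, ← sub_eq_zero, ← mul_smul_comm, ← mul_sub] at e3
  rw [← sub_eq_zero, rd_smul]
  refine eq_zero_of_theta_mul (κ := Unit) () ?_
  rw [map_sub, map_smul]
  rwa [rd_modelSnd_comp, rd_modelSnd_comp, hw] at e3

/-- Acting by a product of two displacements of the unit: the iterated displacement along the lift `D'` of
`Q` to `G × X` becomes one along `QX`, in the opposite order. -/
lemma perturb_perturb (hQ : IsLeftInvariant Q) (hQX : a.IsFundamental Q QX) {P : CSManifold}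
    {pr₁ : Mor P G} {pr₂ : Mor P X} {D' : VectorField P.toSuperSpace ⊤ 1} {j : Mor X P}
    (h1 : D'.Related pr₁ Q) (h2 : D'.RelatedZero pr₂) (hj1 : j.comp pr₁ = 1) (hj2 : j.comp pr₂ = Hom.id _)
    {S : CSManifold} (x : Mor S X) {τ τ' : S.sec ⊤} (hτ : τ ∈ S.par ⊤ 1) (hτ' : τ' ∈ S.par ⊤ 1) :
    (perturb (perturb (x.comp j) D' hτ') D' hτ).comp (a.act pr₁ pr₂) =
      perturb (perturb x QX hτ) QX hτ' := by
  have e1 : (perturb (x.comp j) D' hτ').comp pr₁ = disp S Q hτ' := by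
    rw [perturb_comp_of_related _ h1]
    refine perturb_congr ?_ Q hτ'
    rw [comp_assoc, hj1, comp_one]
  have e2 : (perturb (x.comp j) D' hτ').comp pr₂ = x := by
    rw [perturb_comp_of_relatedZero _ h2, comp_assoc, hj2]; rfl
  rw [a.comp_act, perturb_comp_of_related _ h1, perturb_comp_of_relatedZero _ h2, e2, e1,
    ← disp_mul_disp hQ, a.mul_act, act_disp hQX, act_disp hQX]

/-- The square of `Q` on `X` comes, up to sign, from the square of `Q` on `G`. -/
lemma rd_app_app (hQ : IsLeftInvariant Q) (hQX : a.IsFundamental Q QX) {P : CSManifold}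
    {pr₁ : Mor P G} {pr₂ : Mor P X} {D' : VectorField P.toSuperSpace ⊤ 1} {j : Mor X P}
    (h1 : D'.Related pr₁ Q) (h2 : D'.RelatedZero pr₂) (hj1 : j.comp pr₁ = 1) (hj2 : j.comp pr₂ = Hom.id _)
    {V : Opens X.carrier} (s : X.sec V) (ψ : Chart X) (v : Fin X.evenDim → ℝ) :
    rd ψ.hom (QX.app V le_top (QX.app V le_top s)) v = - rd (ψ.hom.comp j)
      (D'.app _ le_top (D'.app _ le_top ((a.act pr₁ pr₂).pull V s))) v := by
  let x : Hom (modelSpace (Empty ⊕ Fin X.evenDim) (Bool ⊕ Fin X.oddDim)) X.toSuperSpace :=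
    (modelSnd _ _ _ _).comp ψ.hom
  obtain ⟨w, hw⟩ : ∃ w : Empty ⊕ Fin X.evenDim → ℝ, (fun i => w (Sum.inr i)) = v :=
    ⟨Sum.elim Empty.elim v, rfl⟩
  let b := (a.act pr₁ pr₂).pull V s
  -- `perturb_perturb` read at a point, for all values of the odd parameters `τ` and `τ'`
  have key : ∀ (τ τ' : (modelSpace (Empty ⊕ Fin X.evenDim) (Bool ⊕ Fin X.oddDim)).sec ⊤)
      (hτ : τ ∈ (modelSpace (Empty ⊕ Fin X.evenDim) (Bool ⊕ Fin X.oddDim)).par ⊤ 1)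
      (hτ' : τ' ∈ (modelSpace (Empty ⊕ Fin X.evenDim) (Bool ⊕ Fin X.oddDim)).par ⊤ 1),
      rd (x.comp j) b w + τ'.1 ⟨w, trivial⟩ * rd (x.comp j) (D'.app _ le_top b) w +
        τ.1 ⟨w, trivial⟩ * (rd (x.comp j) (D'.app _ le_top b) w + τ'.1 ⟨w, trivial⟩ *
          rd (x.comp j) (D'.app _ le_top (D'.app _ le_top b)) w) =
      rd x s w + τ.1 ⟨w, trivial⟩ * rd x (QX.app V le_top s) w + τ'.1 ⟨w, trivial⟩ *
        (rd x (QX.app V le_top s) w + τ.1 ⟨w, trivial⟩ * rd x (QX.app V le_top (QX.app V le_top s)) w) := by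
    intro τ τ' hτ hτ'
    have e : (perturb (perturb (x.comp j) D' hτ') D' hτ).comp (a.act pr₁ pr₂) =
        perturb (perturb x QX hτ) QX hτ' :=
      perturb_perturb (S := modelMfd (Empty ⊕ Fin X.evenDim) (Bool ⊕ Fin X.oddDim)) hQ hQX h1 h2
        hj1 hj2 x hτ hτ'
    have l1 := rd_perturb (perturb (x.comp j) D' hτ') D' hτ b w
    have l2 := rd_perturb (perturb x QX hτ) QX hτ' s w
    have e2 : rd (perturb (perturb (x.comp j) D' hτ') D' hτ) b w =
      rd (perturb (perturb x QX hτ) QX hτ') s w := by rw [← e]; rfl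
    rw [l1, l2, rd_perturb (x.comp j) D' hτ' b, rd_perturb (x.comp j) D' hτ' (D'.app _ le_top b),
      rd_perturb x QX hτ s, rd_perturb x QX hτ (QX.app V le_top s)] at e2
    exact e2
  have hθ := theta_mem (ι := Empty ⊕ Fin X.evenDim) (κ := Bool ⊕ Fin X.oddDim) (Sum.inl true)
  have hθ' := theta_mem (ι := Empty ⊕ Fin X.evenDim) (κ := Bool ⊕ Fin X.oddDim) (Sum.inl false)
  -- comparing the coefficients of the products of two independent odd parameters, which anticommute
  have k00 := key 0 0 (zero_mem _) (zero_mem _)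
  have k01 := key 0 _ (zero_mem _) hθ'
  have k10 := key _ 0 hθ (zero_mem _)
  have k11 := key _ _ hθ hθ'
  set Y := rd (x.comp j) (D'.app _ le_top (D'.app _ le_top b)) w with hY
  set Z := rd x (QX.app V le_top (QX.app V le_top s)) w with hZ
  have hY' : Y = inclInr _ _ (rd (ψ.hom.comp j) (D'.app _ le_top (D'.app _ le_top b)) v) := by
    rw [← hw]; exact rd_modelSnd_comp (ψ.hom.comp j) _ w
  have hZ' : Z = inclInr _ _ (rd ψ.hom (QX.app V le_top (QX.app V le_top s)) v) := by
    rw [← hw]; exact rd_modelSnd_comp ψ.hom _ w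
  have h0 : (0 : (modelSpace (Empty ⊕ Fin X.evenDim) (Bool ⊕ Fin X.oddDim)).sec ⊤).1 ⟨w, trivial⟩ = 0 := rfl
  rw [h0] at k00 k01 k10
  simp only [zero_mul, add_zero] at k00 k01 k10
  rw [k00, add_right_inj] at k01 k10
  rw [k00, k01, mul_add, k10, mul_add, add_assoc, add_assoc, add_right_inj] at k11
  have k : theta (Sum.inl true) * (theta (Sum.inl false) * (Y + Z)) = 0 := by
    have e1 : theta (Sum.inl false) * (theta (Sum.inl true) * Z) =
        -(theta (Sum.inl true) * (theta (Sum.inl false) * Z)) := by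
      rw [← mul_assoc, ← mul_assoc, grassmann_odd_odd _ _ (theta_odd _) (theta_odd _), neg_mul]
    have k' : theta (Sum.inl true) * (theta (Sum.inl false) * Y) =
        theta (Sum.inl false) * (theta (Sum.inl true) * Z) := by
      have : ∀ p q r t : Grassmann (Bool ⊕ Fin X.oddDim), p + (q + r) = q + (p + t) → r = t := by
        intro p q r t h
        have h' : (p + q) + r = (p + q) + t := by
          rw [add_assoc, h]; abel
        exact add_left_cancel h'
      exact this _ _ _ _ k11
    rw [mul_add, mul_add, k', e1, neg_add_cancel]
  rw [hY', hZ', ← map_add] at k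
  have := eq_zero_of_theta_mul_theta_mul true false (by decide) k
  rw [← sub_eq_zero, sub_neg_eq_add, add_comm]
  exact this

end ActionDisp

/-! ### Locally finite sums of sections -/

section Global

open scoped ContDiff
open Filter Topology

variable {X : CSManifold}

/-- A locally finite sum of global sections. -/
lemma exists_locallyFinite_sum {J : Type*} (s : J → X.sec ⊤) (B : J → Set X.carrier)
    (hB : LocallyFinite B) (hs : ∀ j (V : Opens X.carrier), Disjoint (V : Set X.carrier) (B j) →
      X.res (le_top : V ≤ ⊤) (s j) = 0) :
    ∃ t : X.sec ⊤, ∀ x, ∃ (V : Opens X.carrier) (A : Finset J), x ∈ V ∧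
      (∀ j, (V ∩ B j : Set X.carrier).Nonempty → j ∈ A) ∧
      X.res (le_top : V ≤ ⊤) t = X.res le_top (∑ j ∈ A, s j) := by
  classical
  have h1 : ∀ x, ∃ (V : Opens X.carrier) (A : Finset J), x ∈ V ∧
      (∀ j, (V ∩ B j : Set X.carrier).Nonempty → j ∈ A) := by
    intro x
    obtain ⟨t, ht, hfin⟩ := hB x
    obtain ⟨V, hVt, hV, hxV⟩ := mem_nhds_iff.1 ht
    refine ⟨⟨V, hV⟩, hfin.toFinset, hxV, fun j hj => hfin.mem_toFinset.2 ?_⟩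
    obtain ⟨y, hy1, hy2⟩ := hj
    exact ⟨y, hy2, hVt hy1⟩
  choose V A hV hA using h1
  have key : ∀ (W : Opens X.carrier) (A A' : Finset J), (∀ j, (W ∩ B j : Set X.carrier).Nonempty → j ∈ A) →
      (∀ j, (W ∩ B j : Set X.carrier).Nonempty → j ∈ A') →
      X.res (le_top : W ≤ ⊤) (∑ j ∈ A, s j) = X.res le_top (∑ j ∈ A', s j) := by
    intro W A A' hA hA'
    have : ∀ A A' : Finset J, (∀ j, (W ∩ B j : Set X.carrier).Nonempty → j ∈ A') →
        X.res (le_top : W ≤ ⊤) (∑ j ∈ A', s j) = X.res le_top (∑ j ∈ A ∪ A', s j) := by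
      intro A A' hA'
      rw [map_sum, map_sum]
      refine Finset.sum_subset Finset.subset_union_right fun j _ hj => hs j W ?_
      rw [Set.disjoint_iff_inter_eq_empty, ← Set.not_nonempty_iff_eq_empty]
      exact fun h => hj (hA' j h)
    rw [this A A' hA', this A' A hA, Finset.union_comm]
  obtain ⟨t, ht⟩ := sec_glue (U := ⊤) V (fun x _ => Opens.mem_iSup.2 ⟨x, hV x⟩)
    (fun x => X.res le_top (∑ j ∈ A x, s j)) fun x y => by
      rw [X.res_res, X.res_res]
      exact key _ _ _ (fun j hj => hA x j (hj.mono fun z hz => ⟨hz.1.1, hz.2⟩))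
        (fun j hj => hA y j (hj.mono fun z hz => ⟨hz.1.2, hz.2⟩))
  exact ⟨t, fun x => ⟨V x, A x, hV x, hA x, by rw [ht x _ le_top le_rfl, X.res_refl]⟩⟩

lemma VectorField.app_one {Y : SuperSpace} {U : Opens Y.carrier} {p : ZMod 2} (D : VectorField Y U p)
    {V : Opens Y.carrier} (h : V ≤ U) : D.app V h 1 = 0 := by
  have := D.leibniz V h 0 1 1 (Y.one_mem_par V)
  simpa [sgn] using this

lemma val_app (D : VectorField X.toSuperSpace ⊤ 1) {V W : Opens X.carrier} (h : W ≤ V) (s : X.sec V)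
    {x : X.carrier} (hx : x ∈ W) : val (D.app V le_top s) x = val (D.app W le_top (X.res h s)) x := by
  rw [← D.res_app h le_top, val_res _ h hx]

/-- An odd function `f` with `Qf` invertible can be normalized so that `Qf` has value `1`. -/
lemma val_app_mul_inv (D : VectorField X.toSuperSpace ⊤ 1) {V : Opens X.carrier} {s u : X.sec V}
    (hs : s ∈ X.par V 1) (hu : D.app V le_top s * u = 1) {x : X.carrier} (hx : x ∈ V) :
    val (D.app V le_top (s * u)) x = 1 := by
  rw [D.leibniz _ _ 1 _ _ hs, val_add, val_smul, val_mul s, val_of_odd x hs, zero_mul, mul_zero, add_zero,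
    hu, val_one hx]

lemma VectorField.NowhereVanishing.exists_local {D : VectorField X.toSuperSpace ⊤ 1} (hD : D.NowhereVanishing)
    (x : X.carrier) : ∃ (W : Opens X.carrier) (s : X.sec W), x ∈ W ∧ s ∈ X.par W 1 ∧
      ∀ y ∈ W, val (D.app W le_top s) y = 1 := by
  obtain ⟨V, f, hxV, W, hW, hxW, hu⟩ := hD x
  obtain ⟨a, ha, b, hb, rfl⟩ := exists_parts 0 f
  have hval : ∀ y ∈ W, val (D.app W le_top (X.res hW b)) y ≠ 0 := by
    intro y hy
    obtain ⟨u, hu, -⟩ := isUnit_iff_exists.1 hu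
    have := congrArg (fun s => val s y) hu
    simp only [val_mul, val_one hy] at this
    rw [D.res_app, map_add, map_add, val_add,
      val_of_odd y (by simpa using D.app_par _ _ _ _ (X.res_par hW _ _ ha)), zero_add] at this
    intro h0
    rw [h0, zero_mul] at this
    exact zero_ne_one this
  obtain ⟨u, hu, -⟩ := isUnit_iff_exists.1 (isUnit_of_val_ne_zero (s := D.app W le_top (X.res hW b)) hval)
  have hb' : X.res hW b ∈ X.par W 1 := X.res_par hW _ _ (by simpa using hb)
  obtain ⟨c, hc, d, hd, hcd⟩ := exists_parts 1 (X.res hW b * u)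
  refine ⟨W, c, hxW, hc, fun y hy => ?_⟩
  have := val_app_mul_inv D hb' hu hy
  rwa [← hcd, map_add, val_add, val_of_odd y (s := D.app W le_top d) (by
    have := D.app_par _ le_top _ _ hd
    rwa [← add_assoc, show (1 : ZMod 2) + 1 + 1 = 1 from by decide] at this), add_zero] at this

/-- Odd functions `s` with `Qs` nonnegative and arbitrarily small support. -/
lemma VectorField.NowhereVanishing.exists_piece {D : VectorField X.toSuperSpace ⊤ 1} (hD : D.NowhereVanishing)
    (x : X.carrier) {O : Set X.carrier} (hO : O ∈ 𝓝 x) : ∃ s ∈ X.par ⊤ 1,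
      (∀ y, ∃ r : ℝ, 0 ≤ r ∧ val (D.app ⊤ le_rfl s) y = r) ∧
      {y | val (D.app ⊤ le_rfl s) y ≠ 0} ∈ 𝓝 x ∧ {y | val (D.app ⊤ le_rfl s) y ≠ 0} ⊆ O ∧
      ∀ V : Opens X.carrier, Disjoint (V : Set X.carrier) (closure {y | val (D.app ⊤ le_rfl s) y ≠ 0}) →
        X.res (le_top : V ≤ ⊤) s = 0 := by
  obtain ⟨W, t, hxW, ht, hval⟩ := hD.exists_local x
  obtain ⟨φ, v₀, rfl⟩ := exists_chart_at x
  have hn : φ.hom.pt ⁻¹' (W ∩ O) ∈ 𝓝 v₀ :=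
    φ.hom.continuous_pt.continuousAt.preimage_mem_nhds (inter_mem (W.2.mem_nhds hxW) hO)
  obtain ⟨f, hf, h0, h1, hc, hsub⟩ := exists_smooth_bump _ v₀ hn
  have hsm : ∀ v, SmAt (fun v => algebraMap ℂ (Grassmann (Fin X.oddDim)) (f v : ℂ) * rd φ.hom t v) v := by
    intro v
    by_cases hvV : φ.hom.pt v ∈ W
    · exact (smAt_ofReal hf.contDiffAt).mul (smAt_rd _ _ _ hvV)
    · refine (smAt_const 0 v).congr ?_
      have : (tsupport f)ᶜ ∈ 𝓝 v := (isClosed_tsupport f).isOpen_compl.mem_nhds fun h => hvV (hsub h).1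
      filter_upwards [this] with w hw
      rw [image_eq_zero_of_notMem_tsupport hw]; simp
  obtain ⟨s, hs1, hs2, hs3⟩ := exists_extZero φ _ hsm hc fun v hv => by
    rw [image_eq_zero_of_notMem_tsupport hv]; simp
  have hodd : s ∈ X.par ⊤ 1 := hs3 1 fun v => by
    have := SetLike.mul_mem_graded (A := CliffordAlgebra.evenOdd (0 : QuadraticForm ℂ (Fin X.oddDim → ℂ)))
      (algebraMap_mem_grassmannPar (κ := Fin X.oddDim) (f v : ℂ)) (rd_par φ.hom t v ht)
    rwa [zero_add] at this
  have hK' : IsClosed (φ.hom.pt '' tsupport f) := (hc.image φ.hom.continuous_pt).isClosed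
  have hzero : ∀ y ∉ φ.hom.pt '' tsupport f, val (D.app ⊤ le_rfl s) y = 0 := by
    intro y hy
    let C : Opens X.carrier := ⟨(φ.hom.pt '' tsupport f)ᶜ, hK'.isOpen_compl⟩
    rw [val_app D (le_top : C ≤ ⊤) s hy, hs2 C fun _ h => h, map_zero, val_zero]
  have hone : ∀ v, φ.hom.pt v ∈ W → val (D.app ⊤ le_rfl s) (φ.hom.pt v) = f v := by
    intro v hv
    let W' : Opens X.carrier := W ⊓ φ.image
    have hvW : φ.hom.pt v ∈ W' := ⟨hv, φ.base_mem v⟩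
    obtain ⟨b, hb⟩ := exists_push φ.isOpenImmersion (U := W') (fun x (hx : x ∈ W') => hx.2)
      (fun v => algebraMap ℂ (Grassmann (Fin X.oddDim)) (f v : ℂ)) fun v _ => smAt_ofReal hf.contDiffAt
    have hb0 : b ∈ X.par W' 0 := mem_par_of_chart φ inf_le_right fun v hv => by
      rw [hb v hv]; exact algebraMap_mem_grassmannPar _
    have e : X.res (le_top : W' ≤ ⊤) s = b * X.res inf_le_left t := by
      refine sec_ext_chart φ.isOpenImmersion (U := W') (fun x (hx : x ∈ W') => hx.2) fun w hw => ?_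
      rw [rd_res _ _ _ _ hw, hs1, rd_mul, hb w hw, rd_res _ _ _ _ hw]
    rw [val_app D (le_top : W' ≤ ⊤) s hvW, e, D.leibniz _ _ 0 _ _ hb0, val_add, val_mul,
      val_of_odd _ (X.res_par _ _ _ ht), mul_zero, zero_add, val_smul, val_mul, ← val_app D _ t hvW,
      hval _ hv, ← aug_rd φ.hom b, hb v hvW, aug_algebraMap]
    simp [sgn]
  have hcl : φ.hom.pt '' tsupport f ⊆ closure {y | val (D.app ⊤ le_rfl s) y ≠ 0} := by
    refine (image_closure_subset_closure_image φ.hom.continuous_pt).trans (closure_mono ?_)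
    rintro _ ⟨v, hv, rfl⟩
    change val _ _ ≠ 0
    rw [hone v (hsub (subset_tsupport f hv)).1]
    exact Complex.ofReal_ne_zero.2 hv
  refine ⟨s, hodd, fun y => ?_, ?_, fun y hy => ?_, fun V hV => hs2 V fun x hx hxK => ?_⟩
  · by_cases hy : y ∈ φ.hom.pt '' tsupport f
    · obtain ⟨v, hv, rfl⟩ := hy
      exact ⟨f v, h0 v, hone v (hsub hv).1⟩
    · exact ⟨0, le_rfl, by rw [hzero y hy]; simp⟩
  · have : φ.hom.pt '' {v | φ.hom.pt v ∈ W ∧ f v = 1} ∈ 𝓝 (φ.hom.pt v₀) :=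
      φ.isOpenImmersion.isOpenEmbedding.isOpenMap.image_mem_nhds
        (inter_mem (φ.hom.continuous_pt.continuousAt.preimage_mem_nhds (W.2.mem_nhds hxW)) h1)
    refine mem_of_superset this ?_
    rintro _ ⟨v, ⟨hv1, hv2⟩, rfl⟩
    change val _ _ ≠ 0
    rw [hone v hv1, hv2]; simp
  · by_contra hyO
    refine hy (hzero y ?_)
    rintro ⟨v, hv, rfl⟩
    exact hyO (hsub hv).2
  · exact Set.disjoint_left.1 hV hx (hcl hxK)

instance : LocallyCompactSpace X.carrier := by
  refine ⟨fun x n hn => ?_⟩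
  obtain ⟨φ, v, rfl⟩ := exists_chart_at x
  obtain ⟨K, hK, hKn, hKc⟩ := local_compact_nhds (φ.hom.continuous_pt.continuousAt.preimage_mem_nhds hn)
  exact ⟨φ.hom.pt '' K, φ.isOpenImmersion.isOpenEmbedding.isOpenMap.image_mem_nhds hK,
    Set.image_subset_iff.2 hKn, hKc.image φ.hom.continuous_pt⟩

/-- A nowhere vanishing odd vector field `Q` has a global odd function `f` such that `Qf` has value `1`
everywhere. -/
lemma VectorField.NowhereVanishing.exists_global {D : VectorField X.toSuperSpace ⊤ 1}
    (hD : D.NowhereVanishing) : ∃ s ∈ X.par ⊤ 1, ∀ x, val (D.app ⊤ le_rfl s) x = 1 := by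
  classical
  have : SigmaCompactSpace X.carrier := inferInstance
  obtain ⟨α, c, r, hp, hcov, hfin⟩ := refinement_of_locallyCompact_sigmaCompact_of_nhds_basis
    (X := X.carrier) (ι := fun _ => X.sec ⊤) (B := fun _ s => {y | val (D.app ⊤ le_rfl s) y ≠ 0})
    (p := fun x s => s ∈ X.par ⊤ 1 ∧ (∀ y, ∃ r : ℝ, 0 ≤ r ∧ val (D.app ⊤ le_rfl s) y = r) ∧
      {y | val (D.app ⊤ le_rfl s) y ≠ 0} ∈ 𝓝 x ∧
      ∀ V : Opens X.carrier, Disjoint (V : Set X.carrier) (closure {y | val (D.app ⊤ le_rfl s) y ≠ 0}) →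
        X.res (le_top : V ≤ ⊤) s = 0) fun x => ⟨fun O => ⟨fun hO => by
      obtain ⟨s, h1, h2, h3, h4, h5⟩ := hD.exists_piece x hO
      exact ⟨s, ⟨h1, h2, h3, h5⟩, h4⟩, fun ⟨s, hs, hsO⟩ => mem_of_superset hs.2.2.1 hsO⟩⟩
  obtain ⟨t, ht⟩ := exists_locallyFinite_sum r
    (fun j => closure {y | val (D.app ⊤ le_rfl (r j)) y ≠ 0}) hfin.closure fun j V hV => (hp j).2.2.2 V hV
  have hne : ∀ x ∈ (⊤ : Opens X.carrier), val (D.app ⊤ le_rfl t) x ≠ 0 := by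
    intro x _
    obtain ⟨V, A, hxV, hA, hV⟩ := ht x
    rw [val_app D (le_top : V ≤ ⊤) t hxV, hV, ← val_app D _ _ hxV, map_sum, val_sum]
    choose q hq0 hq using fun j => (hp j).2.1 x
    simp only [hq]
    rw [← Complex.ofReal_sum, Complex.ofReal_ne_zero]
    obtain ⟨j, hj⟩ : ∃ j, x ∈ {y | val (D.app ⊤ le_rfl (r j)) y ≠ 0} := by
      have : x ∈ ⋃ j, {y | val (D.app ⊤ le_rfl (r j)) y ≠ 0} := hcov ▸ Set.mem_univ x
      exact Set.mem_iUnion.1 this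
    have hjA : j ∈ A := hA j ⟨x, hxV, subset_closure hj⟩
    refine (Finset.sum_pos' (fun i _ => hq0 i) ⟨j, hjA, lt_of_le_of_ne (hq0 j) fun h => ?_⟩).ne'
    apply hj
    rw [hq j, ← h]; simp
  have hodd : t ∈ X.par ⊤ 1 := by
    refine mem_par_local fun x _ => ?_
    obtain ⟨V, A, hxV, -, hV⟩ := ht x
    refine ⟨V, le_top, hxV, ?_⟩
    rw [hV]
    exact X.res_par _ _ _ (sum_mem fun j _ => (hp j).1)
  obtain ⟨u, hu, -⟩ := isUnit_iff_exists.1 (isUnit_of_val_ne_zero _ hne)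
  obtain ⟨c, hc, d, hd, hcd⟩ := exists_parts 1 (t * u)
  refine ⟨c, hc, fun y => ?_⟩
  have := val_app_mul_inv D hodd hu (x := y) trivial
  rwa [← hcd, map_add, val_add, val_of_odd y (s := D.app ⊤ le_top d) (by
    have := D.app_par _ le_top _ _ hd
    rwa [← add_assoc, show (1 : ZMod 2) + 1 + 1 = 1 from by decide] at this), add_zero] at this

end Global

/-! ### Averaging over the group -/

section Average

open scoped ContDiff
open MeasureTheory Filter Topology

variable {G : CSManifold} [SuperLieGroup G] {Q : VectorField G.toSuperSpace ⊤ 1}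
  {X : CSManifold} {a : Action G X} {QX : VectorField X.toSuperSpace ⊤ 1}

lemma top_le_comap {X Y : SuperSpace} (h : Hom X Y) :
    (⊤ : Opens X.carrier) ≤ Opens.comap h.base ⊤ := fun _ _ => trivial

/-- Pullback of global sections. -/
def pb (h : Mor X X) : X.sec ⊤ →ₐ[ℂ] X.sec ⊤ :=
  (X.res (top_le_comap h)).comp (h.pull ⊤)

variable {ι κ : Type} [Fintype ι] [Fintype κ]

lemma rd_pb (h : Mor X X) (s : X.sec ⊤) (m : Hom (modelSpace ι κ) X.toSuperSpace) (w : ι → ℝ) :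
    rd m (pb h s) w = rd (m.comp h) s w := rd_res m (h.pull ⊤ s) w _ trivial

lemma val_pb (h : Mor X X) (s : X.sec ⊤) (x : X.carrier) : val (pb h s) x = val s (h.base x) := by
  obtain ⟨φ, v, rfl⟩ := exists_chart_at x
  rw [← aug_rd, rd_pb, aug_rd]; rfl

lemma pb_par (h : Mor X X) {i : ZMod 2} {s : X.sec ⊤} (hs : s ∈ X.par ⊤ i) : pb h s ∈ X.par ⊤ i :=
  X.res_par _ _ _ (h.pull_par _ _ _ hs)

lemma pb_comp (h k : Mor X X) (s : X.sec ⊤) : pb (h.comp k) s = pb h (pb k s) :=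
  sec_ext fun φ v _ => by
    rw [rd_pb, rd_pb, rd_pb]; rfl

lemma pb_actPt_app (hQX : a.IsFundamental Q QX) {g : G.carrier} {c : ℂ}
    (hc : ∀ (S : CSManifold) (τ : S.sec ⊤) (hτ : τ ∈ S.par ⊤ 1),
      disp S Q hτ * constHom _ g = constHom _ g * disp S Q (Submodule.smul_mem _ c hτ))
    (s : X.sec ⊤) : pb (actPt a g) (QX.app ⊤ le_rfl s) = c • QX.app ⊤ le_rfl (pb (actPt a g) s) := by
  have := congrArg (X.res (top_le_comap (actPt a g)))
    (actPt_pull_app hQX hc s)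
  rw [map_smul, QX.res_app] at this
  exact this

lemma map_zero_eq {κ' : Type} (x : Grassmann κ') :
    ExteriorAlgebra.map (0 : (κ' → ℂ) →ₗ[ℂ] (κ → ℂ)) x = algebraMap ℂ _ (aug κ' x) := by
  have : ExteriorAlgebra.map (0 : (κ' → ℂ) →ₗ[ℂ] (κ → ℂ)) = (Algebra.ofId ℂ _).comp (aug κ') := by
    refine ExteriorAlgebra.hom_ext (LinearMap.ext fun w => ?_)
    simp only [LinearMap.comp_apply, AlgHom.toLinearMap_apply, AlgHom.comp_apply]
    rw [aug_ι, map_zero, ExteriorAlgebra.map_apply_ι]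
    simp
  rw [this]; rfl

/-- The slice `{u} × ℝ^{ι'|κ'}` of a product of model spaces. -/
def slice {ι ι' : Type} [Fintype ι] [Fintype ι'] (κ κ' : Type) [Fintype κ] [Fintype κ'] (u : ι → ℝ) :
    Hom (modelSpace ι' κ') (modelSpace (ι ⊕ ι') (κ ⊕ κ')) :=
  smoothHom (fun v => Sum.elim u v) (by
    refine contDiff_pi.2 fun i => ?_
    rcases i with i | i
    · exact contDiff_const
    · exact contDiff_apply ℝ ℝ i) (LinearMap.pi fun k => LinearMap.proj (Sum.inr k))

lemma rd_slice_comp {ι' κ' : Type} [Fintype ι'] [Fintype κ'] {Y : SuperSpace} (u : ι → ℝ)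
    (h : Hom (modelSpace (ι ⊕ ι') (κ ⊕ κ')) Y) {U : Opens Y.carrier} (s : Y.sec U) (v : ι' → ℝ) :
    rd ((slice κ κ' u).comp h) s v = killInl κ κ' (rd h s (Sum.elim u v)) :=
  rd_smoothHom_comp _ _ _ h s v

lemma slice_comp_fst {ι' κ' : Type} [Fintype ι'] [Fintype κ'] {Y : CSManifold} (u : ι → ℝ)
    (h : Hom (modelSpace ι κ) Y.toSuperSpace) :
    (slice (ι' := ι') κ κ' u).comp ((modelFst ι κ ι' κ').comp h) = constHom _ (h.pt u) := by
  refine Hom.ext_of_rd (fun _ => rfl) fun V s v _ => ?_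
  rw [rd_slice_comp, rd_modelFst_comp, killInl, ← AlgHom.comp_apply, ExteriorAlgebra.map_comp_map]
  refine Eq.trans ?_ (rd_comp_constHom (Hom.id _) (h.pt u) s v).symm
  rw [← aug_rd, ← map_zero_eq]
  congr 1

lemma slice_comp_snd {ι' κ' : Type} [Fintype ι'] [Fintype κ'] {Y : SuperSpace} (u : ι → ℝ)
    (h : Hom (modelSpace ι' κ') Y) :
    (slice κ κ' u).comp ((modelSnd ι κ ι' κ').comp h) = h := by
  refine Hom.ext_of_rd (fun _ => rfl) fun V s v _ => ?_
  rw [rd_slice_comp, rd_modelSnd_comp, killInl_inclInr]; rfl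

/-- The action in a product of charts. -/
def actChart (a : Action G X) (φ : Chart G) (ψ : Chart X) :
    Hom (modelSpace (Fin G.evenDim ⊕ Fin X.evenDim) (Fin G.oddDim ⊕ Fin X.oddDim)) X.toSuperSpace :=
  a.act (S := modelMfd (Fin G.evenDim ⊕ Fin X.evenDim) (Fin G.oddDim ⊕ Fin X.oddDim))
    ((modelFst _ _ _ _).comp φ.hom) ((modelSnd _ _ _ _).comp ψ.hom)

lemma slice_comp_actChart (a : Action G X) (φ : Chart G) (ψ : Chart X) (u : Fin G.evenDim → ℝ) :
    (slice _ _ u).comp (actChart a φ ψ) = ψ.hom.comp (actPt a (φ.hom.pt u)) := by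
  have := a.comp_act (S := modelMfd (Fin G.evenDim ⊕ Fin X.evenDim) (Fin G.oddDim ⊕ Fin X.oddDim))
    (S' := modelMfd (Fin X.evenDim) (Fin X.oddDim)) (slice _ _ u)
    ((modelFst _ _ _ _).comp φ.hom) ((modelSnd _ _ _ _).comp ψ.hom)
  refine this.trans ?_
  have e1 : (slice (Fin G.oddDim) (Fin X.oddDim) u).comp
    ((modelFst _ _ (Fin X.evenDim) (Fin X.oddDim)).comp φ.hom) = constHom _ (φ.hom.pt u) := slice_comp_fst u φ.hom
  have e2 := slice_comp_snd (κ := Fin G.oddDim) u ψ.hom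
  refine (congrArg₂ (fun g x => a.act (S := modelMfd (Fin X.evenDim) (Fin X.oddDim)) g x) e1 e2).trans ?_
  exact act_constHom (S := modelMfd (Fin X.evenDim) (Fin X.oddDim)) (φ.hom.pt u) ψ.hom

lemma rd_actPt (a : Action G X) (φ : Chart G) (ψ : Chart X) (u : Fin G.evenDim → ℝ) (s : X.sec ⊤)
    (v : Fin X.evenDim → ℝ) : rd (ψ.hom.comp (actPt a (φ.hom.pt u))) s v =
      killInl _ _ (rd (actChart a φ ψ) s (Sum.elim u v)) := by
  rw [← slice_comp_actChart, rd_slice_comp]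

lemma contDiff_killInl_rd (a : Action G X) (φ : Chart G) (ψ : Chart X) (s : X.sec ⊤)
    (l : Grassmann (Fin X.oddDim) →ₗ[ℂ] ℂ) :
    ContDiff ℝ ∞ fun p : (Fin G.evenDim → ℝ) × (Fin X.evenDim → ℝ) =>
      l (killInl _ _ (rd (actChart a φ ψ) s (Sum.elim p.1 p.2))) := by
  refine contDiff_iff_contDiffAt.2 fun p => ?_
  have h1 := smAt_rd (actChart a φ ψ) s (Sum.elim p.1 p.2) trivial
    (l.comp (killInl (Fin G.oddDim) (Fin X.oddDim)).toLinearMap)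
  have h2 : ContDiff ℝ ∞ fun p : (Fin G.evenDim → ℝ) × (Fin X.evenDim → ℝ) => (Sum.elim p.1 p.2 : _ ⊕ _ → ℝ) := by
    refine contDiff_pi.2 fun i => ?_
    rcases i with i | i
    · exact (contDiff_apply ℝ ℝ i).comp contDiff_fst
    · exact (contDiff_apply ℝ ℝ i).comp contDiff_snd
  exact ContDiffAt.comp p (g := fun y => (l.comp (killInl (Fin G.oddDim) (Fin X.oddDim)).toLinearMap)
    (rd (actChart a φ ψ) s y)) (f := fun p => Sum.elim p.1 p.2) h1 h2.contDiffAt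

lemma niceSec_actPt (a : Action G X) (s : X.sec ⊤) {c : G.carrier → ℂ} (hc : Continuous c) :
    NiceSec fun g => c g • pb (actPt a g) s := by
  intro ψ l k
  have : (fun g v => l (rd ψ.hom (c g • pb (actPt a g) s) v)) =
      fun g v => c g * l (rd (ψ.hom.comp (actPt a g)) s v) := by
    funext g v
    rw [rd_smul, map_smul, rd_pb, smul_eq_mul]
  rw [this]
  refine Nice.const_mul ?_ hc
  refine nice_of_local (Γ' := Fin G.evenDim → ℝ) fun g => ?_
  obtain ⟨φ, u, rfl⟩ := exists_chart_at g
  refine ⟨φ.hom.pt, φ.isOpenImmersion.isOpenEmbedding, ⟨u, rfl⟩, ?_⟩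
  simp only [rd_actPt]
  exact nice_of_contDiff (contDiff_killInl_rd a φ ψ s l) k

/-- The character by which the group acts on the odd direction, and its values. -/
lemma exists_character [CompactSpace G.carrier] (hQX : a.IsFundamental Q QX)
    (hconj : ∀ g : G.carrier, ∃ c : ℂ, ∀ (S : CSManifold) (τ : S.sec ⊤) (hτ : τ ∈ S.par ⊤ 1),
      disp S Q hτ * constHom _ g = constHom _ g * disp S Q (Submodule.smul_mem _ c hτ))
    {f : X.sec ⊤} (hf : ∀ x, val (QX.app ⊤ le_rfl f) x = 1) (x₀ : X.carrier) :
    ∃ c : G.carrier → ℂ, Continuous c ∧ (∀ g, c g ≠ 0) ∧ (∀ g h, c (g * h) = c g * c h) ∧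
      (∀ g s, QX.app ⊤ le_rfl (pb (actPt a g) s) = c g • pb (actPt a g) (QX.app ⊤ le_rfl s)) ∧
      ∀ g x, val (QX.app ⊤ le_rfl (pb (actPt a g) f)) x = c g := by
  choose d hd using hconj
  -- applied to `f`, whose derivative has value `1`, the conjugation rule shows that `Q (a_g^* f)` has the
  -- constant value `(d g)⁻¹`; this is the character
  have h1 : ∀ g x, 1 = d g * val (QX.app ⊤ le_rfl (pb (actPt a g) f)) x := by
    intro g x
    rw [← val_smul, ← pb_actPt_app hQX (hd g), val_pb, hf]
  have hd0 : ∀ g, d g ≠ 0 := fun g h => by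
    have := h1 g x₀
    rw [h, zero_mul] at this
    exact one_ne_zero this
  have hv : ∀ g x, val (QX.app ⊤ le_rfl (pb (actPt a g) f)) x = (d g)⁻¹ := fun g x =>
    eq_inv_of_mul_eq_one_right (h1 g x).symm
  have hQ : ∀ g s, QX.app ⊤ le_rfl (pb (actPt a g) s) = (d g)⁻¹ • pb (actPt a g) (QX.app ⊤ le_rfl s) := by
    intro g s
    rw [pb_actPt_app hQX (hd g), smul_smul, inv_mul_cancel₀ (hd0 g), one_smul]
  refine ⟨fun g => (d g)⁻¹, ?_, fun g => inv_ne_zero (hd0 g), fun g h => ?_, hQ, hv⟩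
  · let _ : MeasurableSpace G.carrier := borel _
    have : BorelSpace G.carrier := ⟨rfl⟩
    obtain ⟨φ, u, hu⟩ := exists_chart_at x₀
    have := (niceSec_actPt a f (c := fun _ => 1) continuous_const).continuous
      (jetAt_rd_app φ φ.hom rfl (aug _).toLinearMap QX (u := u))
    refine this.congr fun g => ?_
    rw [← hv g x₀, one_smul]
    change aug _ (rd φ.hom (QX.app φ.image le_top (X.res le_top (pb (actPt a g) f))) u) = _
    rw [aug_rd, hu, ← val_app QX (V := ⊤) le_top _ (hu ▸ φ.base_mem u)]
  · change (d (g * h))⁻¹ = (d g)⁻¹ * (d h)⁻¹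
    rw [← hv (g * h) x₀, actPt_mul, pb_comp, hQ, val_smul, val_pb, hv, mul_comm]

/-- A right invariant probability measure on a compact CS Lie group. -/
lemma exists_measure (G : CSManifold) [SuperLieGroup G] [CompactSpace G.carrier] [MeasurableSpace G.carrier]
    [BorelSpace G.carrier] : ∃ μ : Measure G.carrier, IsProbabilityMeasure μ ∧ μ.IsMulRightInvariant := by
  refine ⟨(Measure.haarMeasure ⊤).inv, ⟨?_⟩, inferInstance⟩
  rw [Measure.inv_apply, Set.inv_univ]
  exact Measure.haarMeasure_self (K₀ := (⊤ : PositiveCompacts G.carrier))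

/-- Averaging an odd function `f` with `Q f` of value `1` over the group: the mean of `c(g)⁻¹ a_g^* f` keeps
these properties and is an eigenfunction for the points of the group. -/
lemma exists_average (hQX : a.IsFundamental Q QX) [CompactSpace G.carrier]
    (hconj : ∀ g : G.carrier, ∃ c : ℂ, ∀ (S : CSManifold) (τ : S.sec ⊤) (hτ : τ ∈ S.par ⊤ 1),
      disp S Q hτ * constHom _ g = constHom _ g * disp S Q (Submodule.smul_mem _ c hτ))
    {f : X.sec ⊤} (hfodd : f ∈ X.par ⊤ 1) (hf : ∀ x, val (QX.app ⊤ le_rfl f) x = 1) (x₀ : X.carrier) :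
    ∃ (c : G.carrier → ℂ) (F : X.sec ⊤), F ∈ X.par ⊤ 1 ∧ (∀ x, val (QX.app ⊤ le_rfl F) x = 1) ∧
      ∀ g, pb (actPt a g) F = c g • F := by
  let _ : MeasurableSpace G.carrier := borel _
  have : BorelSpace G.carrier := ⟨rfl⟩
  obtain ⟨μ, hμ, hμr⟩ := exists_measure G
  obtain ⟨c, hc, hc0, hcm, hcQ, hcv⟩ := exists_character hQX hconj hf x₀
  obtain ⟨F, hF⟩ := (niceSec_actPt a f (c := fun g => (c g)⁻¹) (hc.inv₀ hc0)).exists_mean μ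
  -- evaluations and first derivatives commute with the mean, since both are jets
  have hF1 : ∀ (ι κ : Type) [Fintype ι] [Fintype κ] (m : Hom (modelSpace ι κ) X.toSuperSpace) (w : ι → ℝ)
      (l : Grassmann κ →ₗ[ℂ] ℂ), l (rd m F w) = ∫ g, (c g)⁻¹ * l (rd m (pb (actPt a g) f) w) ∂μ := by
    intro ι κ _ _ m w l
    obtain ⟨φ, u, hu⟩ := exists_chart_at (m.pt w)
    have hw : m.pt w ∈ φ.image := hu ▸ φ.base_mem u
    have := hF φ u _ (jetAt_rd φ m hu l)
    change l (rd m (X.res _ F) w) = ∫ g, l (rd m (X.res _ _) w) ∂μ at this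
    rw [rd_res _ _ _ _ hw] at this
    rw [this]
    refine integral_congr_ae (Eventually.of_forall fun g => ?_)
    change l (rd m (X.res _ ((c g)⁻¹ • pb (actPt a g) f)) w) = _
    rw [rd_res _ _ _ _ hw, rd_smul, map_smul, smul_eq_mul]
  have hF2 : ∀ x, val (QX.app ⊤ le_rfl F) x = 1 := by
    intro x
    obtain ⟨φ, u, hu⟩ := exists_chart_at x
    have hx : x ∈ φ.image := hu ▸ φ.base_mem u
    have := hF φ u _ (jetAt_rd_app φ φ.hom rfl (aug _).toLinearMap QX)
    change aug _ (rd φ.hom (QX.app φ.image le_top (X.res le_top F)) u) =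
      ∫ g, aug _ (rd φ.hom (QX.app φ.image le_top (X.res le_top ((c g)⁻¹ • pb (actPt a g) f))) u) ∂μ at this
    rw [aug_rd, hu, ← val_app QX (V := ⊤) le_top _ hx] at this
    rw [this]
    have h1 : ∀ g, aug _ (rd φ.hom (QX.app φ.image le_top (X.res le_top ((c g)⁻¹ • pb (actPt a g) f))) u) = 1 := by
      intro g
      rw [aug_rd, hu, ← val_app QX (V := ⊤) le_top _ hx, map_smul, val_smul, hcv,
        inv_mul_cancel₀ (hc0 g)]
    simp only [h1]
    simp
  refine ⟨c, F, ?_, hF2, fun h => sec_ext fun φ v _ => grassmann_sep fun l => ?_⟩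
  · rw [mem_par_iff]
    intro φ v _
    by_contra hnot
    obtain ⟨l, hl, hker⟩ := Submodule.exists_le_ker_of_notMem hnot
    refine hl ?_
    rw [hF1]
    have : ∀ g, l (rd φ.hom (pb (actPt a g) f) v) = 0 := fun g => hker (rd_par _ _ _ (pb_par _ hfodd))
    simp [this]
  -- the eigenfunction property is the right invariance of the measure
  · rw [rd_pb, hF1, rd_smul, map_smul, hF1, smul_eq_mul, ← integral_const_mul]
    have e := integral_mul_right_eq_self (μ := μ)
      (fun g => c h * ((c g)⁻¹ * l (rd φ.hom (pb (actPt a g) f) v))) h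
    rw [← e]
    refine integral_congr_ae (Eventually.of_forall fun g => ?_)
    change _ = c h * ((c (g * h))⁻¹ * l (rd φ.hom (pb (actPt a (g * h)) f) v))
    rw [actPt_mul, pb_comp, rd_pb (m := φ.hom) (h := actPt a h), hcm, mul_inv, mul_comm (c g)⁻¹, mul_assoc (c h)⁻¹, ← mul_assoc (c h),
      mul_inv_cancel₀ (hc0 h), one_mul]

end Average

/-! ### The square of the odd vector field -/

section Square

open scoped ContDiff
open Filter Topology

lemma VectorField.sq_mul {Y : SuperSpace} (D : VectorField Y ⊤ 1) {V : Opens Y.carrier} (s t : Y.sec V) :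
    D.app V le_top (D.app V le_top (s * t)) =
      D.app V le_top (D.app V le_top s) * t + s * D.app V le_top (D.app V le_top t) := by
  have hom : ∀ (i : ZMod 2) (s : Y.sec V), s ∈ Y.par V i → D.app V le_top (D.app V le_top (s * t)) =
      D.app V le_top (D.app V le_top s) * t + s * D.app V le_top (D.app V le_top t) := by
    intro i s hs
    rw [D.leibniz _ _ i _ _ hs, map_add, map_smul, D.leibniz _ _ _ _ _ (D.app_par _ _ i _ hs),
      D.leibniz _ _ i _ _ hs, smul_add, smul_smul]
    have h1 : sgn (1 * (1 + i)) = -sgn (1 * i) := by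
      rcases zmod2_cases i with rfl | rfl <;> simp [sgn, show (1 : ZMod 2) + 1 = 0 from rfl]
    have h2 : sgn (1 * i) * sgn (1 * i) = 1 := sgn_mul_self _
    rw [h1, h2, one_smul, neg_smul]
    abel
  obtain ⟨p, hp, q, hq, rfl⟩ := exists_parts 0 s
  rw [add_mul, map_add, map_add, hom _ p hp, hom _ q hq, map_add, map_add]
  simp only [add_mul]
  abel

lemma VectorField.sq_par {Y : SuperSpace} (D : VectorField Y ⊤ 1) {V : Opens Y.carrier} {i : ZMod 2} {s : Y.sec V}
    (hs : s ∈ Y.par V i) : D.app V le_top (D.app V le_top s) ∈ Y.par V i := by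
  have := D.app_par _ le_top _ _ (D.app_par _ le_top _ _ hs)
  rwa [← add_assoc, show (1 : ZMod 2) + 1 = 0 from rfl, zero_add] at this

variable {X : CSManifold}

lemma even_comm {Y : SuperSpace} {U : Opens Y.carrier} {s : Y.sec U} (hs : s ∈ Y.par U 0) (t : Y.sec U) :
    s * t = t * s := by
  obtain ⟨p, hp, q, hq, rfl⟩ := exists_parts 0 t
  rw [mul_add, add_mul, Y.supercomm _ _ _ _ _ hs hp, Y.supercomm _ _ _ _ _ hs hq]
  simp [sgn]

lemma VectorField.sq_pow {Y : SuperSpace} (D : VectorField Y ⊤ 1) {V : Opens Y.carrier} {n : Y.sec V}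
    (hn : n ∈ Y.par V 0) (k : ℕ) : D.app V le_top (D.app V le_top (n ^ (k + 1))) =
      (k + 1 : ℂ) • (n ^ k * D.app V le_top (D.app V le_top n)) := by
  induction k with
  | zero => simp
  | succ k ih =>
    rw [pow_succ n (k + 1), D.sq_mul, ih, smul_mul_assoc, mul_assoc,
      ← even_comm hn (D.app V le_top (D.app V le_top n)), ← mul_assoc, ← pow_succ, Nat.cast_succ,
      add_smul (k + 1 : ℂ), one_smul]

/-- The square of an odd vector field maps even functions with nilpotent values to functions with
nilpotent values. -/
lemma val_sq_of_val_eq_zero (D : VectorField X.toSuperSpace ⊤ 1) {n : X.sec ⊤} (hn : n ∈ X.par ⊤ 0)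
    (h0 : ∀ x, val n x = 0) (x : X.carrier) :
    val (D.app ⊤ le_rfl (D.app ⊤ le_rfl n)) x = 0 := by
  by_contra hx
  set E := D.app ⊤ le_rfl (D.app ⊤ le_rfl n) with hE
  obtain ⟨φ, v, rfl⟩ := exists_chart_at x
  have hsm := smAt_rd φ.hom E v trivial (aug _).toLinearMap
  have hev : ∀ᶠ w in 𝓝 v, aug _ (rd φ.hom E w) ≠ 0 :=
    hsm.continuousAt.eventually_ne (by
      change aug _ (rd φ.hom E v) ≠ 0
      rwa [aug_rd])
  obtain ⟨O, hO, hO1, hvO⟩ := eventually_nhds_iff.1 hev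
  let W := φ.map ⟨O, hO1⟩
  have hu : IsUnit (X.res (le_top : W ≤ ⊤) E) := isUnit_of_val_ne_zero _ fun y hy => by
    obtain ⟨w, hw, rfl⟩ := hy
    rw [val_res E le_top (Chart.base_mem_map.2 hw), ← aug_rd]
    exact hO w hw
  -- where `Q² n` is invertible, `n ^ (k + 1) = 0` forces `n ^ k = 0`, by the formula for `Q² (n ^ (k + 1))`
  have hnil : ∀ k, (X.res (le_top : W ≤ ⊤) n) ^ k ≠ 0 := by
    intro k
    induction k with
    | zero =>
      rw [pow_zero]
      intro h
      have := congrArg (fun s => val s (φ.hom.pt v)) h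
      simp only [val_zero, val_one (X := X) (x := φ.hom.pt v) (U := W) (Chart.base_mem_map.2 hvO)] at this
      exact one_ne_zero this
    | succ k ih =>
      intro h
      apply ih
      have h1 := D.sq_pow (X.res_par (le_top : W ≤ ⊤) _ _ hn) k
      rw [h, map_zero, map_zero, ← D.res_app le_top le_top, ← D.res_app le_top le_top] at h1
      have h2 := (smul_eq_zero.1 h1.symm).resolve_left (by exact_mod_cast k.succ_ne_zero)
      exact hu.mul_left_eq_zero.1 h2
  refine hnil (Fintype.card (Fin X.oddDim) + 1) (sec_ext fun ψ w hw => ?_)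
  have h1 : ∀ k, rd ψ.hom ((X.res (le_top : W ≤ ⊤) n) ^ k) w = (rd ψ.hom n w) ^ k := by
    intro k
    induction k with
    | zero => rw [pow_zero, pow_zero, rd_one _ _ hw]
    | succ k ih => rw [pow_succ, rd_mul, ih, pow_succ, rd_res _ _ _ _ hw]
  rw [h1, rd_zero]
  have h2 : rd ψ.hom n w ∈ augIdeal (Fin X.oddDim) := by rw [mem_augIdeal, aug_rd, h0]
  have h3 := Submodule.pow_mem_pow _ h2 (Fintype.card (Fin X.oddDim) + 1)
  rw [augIdeal_pow_eq_bot] at h3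
  exact (Submodule.mem_bot ℂ).1 h3

/-- An odd function `F` with `Q² F = λ F` and `Q F` of value `1` yields a function with `Q β = 1`. -/
lemma exists_primitive (D : VectorField X.toSuperSpace ⊤ 1) {F : X.sec ⊤} (hF : F ∈ X.par ⊤ 1)
    (hF1 : ∀ x, val (D.app ⊤ le_rfl F) x = 1) {c : ℂ}
    (hc : D.app ⊤ le_rfl (D.app ⊤ le_rfl F) = c • F) (x₀ : X.carrier) :
    ∃ β ∈ X.par ⊤ 1, D.app ⊤ le_rfl β = 1 := by
  set h := D.app ⊤ le_rfl F with hh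
  have hpar : h ∈ X.par ⊤ 0 := D.app_par _ le_top _ _ hF
  have hn : h - 1 ∈ X.par ⊤ 0 := sub_mem hpar (X.one_mem_par _)
  have h2 := val_sq_of_val_eq_zero D hn (fun x => by rw [val_sub, hF1, val_one (X := X) (U := ⊤) (show x ∈ (⊤ : Opens X.carrier) from trivial), sub_self]) x₀
  have h3 : D.app ⊤ le_rfl (D.app ⊤ le_rfl h) = c • h := by rw [hc, map_smul]
  -- `Q² (h - 1)` has value `0`, but also value `c`
  have hc0 : c = 0 := by
    rw [map_sub, map_sub, D.app_one, map_zero, sub_zero, h3, val_smul, hF1, mul_one] at h2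
    exact h2
  rw [hc0, zero_smul] at hc
  obtain ⟨u, hu, hu'⟩ := isUnit_iff_exists.1 (isUnit_of_val_ne_zero h fun x _ => by
    rw [hF1]; exact one_ne_zero)
  have hDu : D.app ⊤ le_rfl u = 0 := by
    have h4 := congrArg (D.app ⊤ le_rfl) hu
    rw [D.leibniz _ _ _ _ _ hpar, hc, zero_mul, zero_add, D.app_one] at h4
    have h5 : h * D.app ⊤ le_rfl u = 0 := by simpa [sgn] using h4
    have h6 := congrArg (fun s => u * s) h5
    simpa [← mul_assoc, hu'] using h6
  have hDβ : D.app ⊤ le_rfl (F * u) = 1 := by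
    rw [D.leibniz _ _ _ _ _ hF, hDu, mul_zero, smul_zero, add_zero, hu]
  -- `Q (F h⁻¹) = 1`; the odd part of `F h⁻¹` is kept
  obtain ⟨p, hp, q, hq, hpq⟩ := exists_parts 1 (F * u)
  refine ⟨p, hp, ?_⟩
  rw [← hpq, map_add] at hDβ
  have hq1 : D.app ⊤ le_rfl q ∈ X.par ⊤ 1 := by
    have := D.app_par _ le_top _ _ hq
    rwa [← add_assoc, show (1 : ZMod 2) + 1 + 1 = 1 from by decide] at this
  have hq0 : D.app ⊤ le_rfl q ∈ X.par ⊤ 0 := by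
    rw [← eq_sub_iff_add_eq'] at hDβ
    rw [hDβ]
    exact sub_mem (X.one_mem_par _) (D.app_par _ le_top _ _ hp)
  have := Submodule.disjoint_def.1 (X.isCompl_par ⊤).disjoint _ hq0 hq1
  rwa [this, add_zero] at hDβ

variable {G : CSManifold} [SuperLieGroup G] {Q : VectorField G.toSuperSpace ⊤ 1}
  {a : Action G X} {QX : VectorField X.toSuperSpace ⊤ 1}

/-- A function on which the points of the group act by a character is an eigenfunction of `Q²`: near the
unit its pullback along the action is `c(g) F`, up to odd functions on the group, and `Q²` sees only
the derivative of `c` because `Q²` of an odd function on the group is odd. -/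
lemma exists_sq_eq_smul (hQ : IsLeftInvariant Q) (hQX : a.IsFundamental Q QX) {c : G.carrier → ℂ}
    {F : X.sec ⊤} (hF : ∀ g, pb (actPt a g) F = c g • F) (hF1 : ∀ x, val (QX.app ⊤ le_rfl F) x = 1)
    (x₀ : X.carrier) : ∃ lam : ℂ, QX.app ⊤ le_rfl (QX.app ⊤ le_rfl F) = lam • F := by
  obtain ⟨φ, u₀, hu₀⟩ := exists_chart_at (1 : G.carrier)
  have hslice : ∀ (ψ : Chart X) u v, killInl _ _ (rd (actChart a φ ψ) F (Sum.elim u v)) =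
      c (φ.hom.pt u) • rd ψ.hom F v := fun ψ u v => by
    rw [← rd_actPt, ← rd_pb, hF, rd_smul]
  -- the character is smooth, being a quotient of a coefficient of the action by one of `F`
  have hcs : ContDiff ℝ ∞ fun u => c (φ.hom.pt u) := by
    obtain ⟨ψ, v₀, hv₀⟩ := exists_chart_at x₀
    obtain ⟨v, hv⟩ : ∃ v, rd ψ.hom F v ≠ 0 := by
      by_contra! hv
      have : X.res (le_top : ψ.image ≤ ⊤) F = 0 := sec_ext_chart ψ.isOpenImmersion subset_rfl fun v hv' => by
        rw [rd_res _ _ _ _ hv', hv, rd_zero]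
      have h1 := hF1 x₀
      rw [val_app QX (le_top : ψ.image ≤ ⊤) F (hv₀ ▸ ψ.base_mem v₀), this, map_zero, val_zero] at h1
      exact zero_ne_one h1
    obtain ⟨l, hl⟩ : ∃ l : Grassmann (Fin X.oddDim) →ₗ[ℂ] ℂ, l (rd ψ.hom F v) ≠ 0 := by
      by_contra! h
      exact hv (grassmann_sep fun l => by rw [h, map_zero])
    have h1 := (contDiff_killInl_rd a φ ψ F l).comp (contDiff_id.prodMk (contDiff_const (c := v)))
    have h2 : (fun u => c (φ.hom.pt u)) = fun u =>
        l (killInl _ _ (rd (actChart a φ ψ) F (Sum.elim u v))) / l (rd ψ.hom F v) := by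
      funext u
      rw [hslice, map_smul, smul_eq_mul, mul_div_cancel_right₀ _ hl]
    rw [h2]
    exact h1.div_const _
  -- the character as a function on the supermanifold `G` near the unit
  obtain ⟨C, hC⟩ := exists_push φ.isOpenImmersion (U := φ.image) subset_rfl
    (fun u => algebraMap ℂ (Grassmann (Fin G.oddDim)) (c (φ.hom.pt u))) fun u _ => by
      simp only [Algebra.algebraMap_eq_smul_one]
      exact SmAt.smul hcs.contDiffAt (smAt_const _ _)
  refine ⟨- val (Q.app _ le_top (Q.app _ le_top C)) 1, sec_ext fun ψ v _ => ?_⟩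
  obtain ⟨P, pr₁, pr₂, D', j, hP, h1, h2, hj1, hj2, -⟩ := id hQX
  rw [rd_app_app hQ hQX h1 h2 hj1 hj2, rd_smul, neg_smul]
  congr 1
  obtain ⟨χ, hχ, hχ1, hχ2⟩ := hP.exists_chart φ ψ
  have hχα : χ.comp (a.act pr₁ pr₂) = actChart a φ ψ := by
    have := a.comp_act (S' := modelMfd (Fin G.evenDim ⊕ Fin X.evenDim) (Fin G.oddDim ⊕ Fin X.oddDim)) χ pr₁ pr₂
    refine this.trans ?_
    exact congrArg₂ (fun g x => a.act
      (S := modelMfd (Fin G.evenDim ⊕ Fin X.evenDim) (Fin G.oddDim ⊕ Fin X.oddDim)) g x) hχ1 hχ2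
  obtain ⟨r, hr⟩ := exists_killInl_decomp (κ := Fin G.oddDim) (κ' := Fin X.oddDim)
  let b := (a.act pr₁ pr₂).pull ⊤ F
  let U : Opens P.carrier := hχ.image
  have hχU : ∀ w, χ.pt w ∈ U := fun w => ⟨w, rfl⟩
  have hrb : ∀ w, rd χ b w = rd (actChart a φ ψ) F w := fun w => by rw [← hχα]; rfl
  choose A hA using fun k => exists_push hχ (U := U) subset_rfl (fun w => r k (rd χ b w))
    fun w _ => (smAt_rd χ b w trivial).map (r k)
  let ξ : Fin G.oddDim → G.sec φ.image := fun k => toSec φ (zs u₀ (Sum.inr k))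
  have hp1 : ∀ w, pr₁.base (χ.pt w) = φ.hom.pt fun i => w (Sum.inl i) := fun w =>
    congrArg (fun h : Hom (modelSpace (Fin G.evenDim ⊕ Fin X.evenDim) (Fin G.oddDim ⊕ Fin X.oddDim))
      G.toSuperSpace => h.base w) hχ1
  have hp2 : ∀ w, pr₂.base (χ.pt w) = ψ.hom.pt fun i => w (Sum.inr i) := fun w =>
    congrArg (fun h : Hom (modelSpace (Fin G.evenDim ⊕ Fin X.evenDim) (Fin G.oddDim ⊕ Fin X.oddDim))
      X.toSuperSpace => h.base w) hχ2
  have hU1 : U ≤ Opens.comap pr₁.base φ.image := by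
    rintro _ ⟨w, rfl⟩
    have : ∀ w, pr₁.base (χ.pt w) ∈ φ.image := fun w => by rw [hp1]; exact φ.base_mem _
    exact this w
  have hU2 : U ≤ Opens.comap pr₂.base ⊤ := fun _ _ => trivial
  have hU3 : U ≤ Opens.comap (a.act pr₁ pr₂).base ⊤ := fun _ _ => trivial
  -- the pullback of `F` along the action, up to terms that vanish on the fibre over the unit
  have hb : P.res hU3 b = P.res hU1 (pr₁.pull _ C) * P.res hU2 (pr₂.pull ⊤ F) +
      ∑ k, P.res hU1 (pr₁.pull _ (ξ k)) * A k := by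
    refine sec_ext_chart hχ subset_rfl fun w hw => ?_
    have e1 : ∀ s : G.sec φ.image, rd χ (P.res hU1 (pr₁.pull _ s)) w = ExteriorAlgebra.map
        (LinearMap.pi (Sum.elim (fun k => LinearMap.proj k) 0)) (rd φ.hom s fun i => w (Sum.inl i)) := by
      intro s
      rw [rd_res _ _ _ _ hw, ← rd_comp, hχ1, rd_modelFst_comp]
    have e2 : rd χ (P.res hU2 (pr₂.pull ⊤ F)) w = inclInr _ _ (rd ψ.hom F fun i => w (Sum.inr i)) := by
      rw [rd_res _ _ _ _ hw, ← rd_comp, hχ2, rd_modelSnd_comp]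
    rw [rd_res _ _ _ _ hw, rd_add, rd_mul, rd_sum, e1, e2, hC _ (φ.base_mem _), AlgHom.commutes]
    have e3 := hr (rd χ b w)
    have e4 : w = Sum.elim (fun i => w (Sum.inl i)) (fun i => w (Sum.inr i)) := by
      funext i; rcases i with i | i <;> rfl
    have e5 : killInl _ _ (rd χ b w) =
        c (φ.hom.pt fun i => w (Sum.inl i)) • rd ψ.hom F fun i => w (Sum.inr i) := by
      rw [hrb, ← hslice, ← e4]
    rw [e5, map_smul, Algebra.smul_def] at e3
    refine e3.trans (congrArg _ (Finset.sum_congr rfl fun k _ => ?_))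
    rw [rd_mul, e1, hA k w (hχU w), rd_toSec, eval_zs_inr]
    congr 1
    rw [theta, theta, ExteriorAlgebra.map_apply_ι]
    congr 1
    funext i
    rcases i with i | i
    · simp [Pi.single_apply]
    · simp
  have hone : ∀ x, (1 : Mor X G).base x = 1 := fun x =>
    congrArg (fun m : Mor X G => m.base x) (constHom_one (G := G) X).symm
  have hmU : (ψ.hom.comp j).pt v ∈ U := by
    refine ⟨Sum.elim u₀ v, hP.bijective.1 (Prod.ext ?_ ?_)⟩
    · refine (hp1 _).trans (Eq.trans hu₀ ?_)
      exact (hone (ψ.hom.pt v)).symm.trans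
        (congrArg (fun m : Mor X G => m.base (ψ.hom.pt v)) hj1.symm)
    · refine (hp2 _).trans ?_
      exact congrArg (fun m : Mor X X => m.base (ψ.hom.pt v)) hj2.symm
  have r1 : ∀ s : G.sec φ.image, rd (ψ.hom.comp j) (P.res hU1 (pr₁.pull _ s)) v =
      algebraMap ℂ _ (val s 1) := by
    intro s
    rw [rd_res _ _ _ _ hmU, ← rd_comp, comp_assoc, hj1, ← constHom_one, rd_comp_constHom]
  have r2 : rd (ψ.hom.comp j) (P.res hU2 (pr₂.pull ⊤ F)) v = rd ψ.hom F v := by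
    rw [rd_res _ _ _ _ hmU, ← rd_comp, comp_assoc, hj2, comp_id]
  have d1 : ∀ s : G.sec φ.image, D'.app U le_top (D'.app U le_top (P.res hU1 (pr₁.pull _ s))) =
      P.res hU1 (pr₁.pull _ (Q.app _ le_top (Q.app _ le_top s))) := by
    intro s
    rw [← D'.res_app hU1 le_top, h1, ← D'.res_app hU1 le_top, h1]
  have d2 : D'.app U le_top (D'.app U le_top (P.res hU2 (pr₂.pull ⊤ F))) = 0 := by
    rw [← D'.res_app hU2 le_top, h2, map_zero, map_zero]
  have hξ : ∀ k, ξ k ∈ G.par φ.image 1 := fun k => toSec_zs_mem φ u₀ (Sum.inr k)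
  rw [← rd_res _ _ _ hU3 hmU, D'.res_app hU3 le_top, D'.res_app hU3 le_top]
  change rd _ (D'.app U _ (D'.app U _ (P.res hU3 b))) v = _
  rw [hb, map_add, map_add, map_sum, map_sum, rd_add, D'.sq_mul, d1, d2, mul_zero, add_zero, rd_mul, r1, r2,
    rd_sum, Finset.sum_eq_zero, add_zero, Algebra.smul_def]
  intro k _
  rw [D'.sq_mul, d1, rd_add, rd_mul, rd_mul, r1, r1, val_of_odd _ (hξ k), val_of_odd _ (Q.sq_par (hξ k))]
  simp

/-- On a manifold with an action of a compact CS `Q`-group for which `Q` vanishes nowhere, there is a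
global odd function `β` with `Qβ = 1`. -/
theorem exists_odd_primitive (hQ : IsQGroup G Q) (hQX : a.IsFundamental Q QX) (hne : QX.NowhereVanishing) :
    ∃ β ∈ X.par ⊤ 1, QX.app ⊤ le_rfl β = 1 := by
  have := hQ.compactSpace
  by_cases hX : Nonempty X.carrier
  · obtain ⟨x₀⟩ := hX
    obtain ⟨f, hf, hf1⟩ := hne.exists_global
    obtain ⟨c, F, hF, hF1, hFc⟩ := exists_average hQX
      (exists_disp_mul_constHom hQ.isLeftInvariant hQ.span) hf hf1 x₀
    obtain ⟨lam, hlam⟩ := exists_sq_eq_smul hQ.isLeftInvariant hQX hFc hF1 x₀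
    exact exists_primitive QX hF hF1 hlam x₀
  · exact ⟨0, zero_mem _, sec_eq_of_empty (fun x _ => hX ⟨x⟩) _ _⟩

end Square

/-! ### Coordinate vector fields -/

section Derivatives

open scoped ContDiff
open Filter Topology

variable {ι κ : Type} [Fintype ι] [Fintype κ]

/-- The partial derivative `∂F/∂v_i` of a function with values in the Grassmann algebra, taken
componentwise in a fixed basis. -/
def gpd (i : ι) (F : (ι → ℝ) → Grassmann κ) (v : ι → ℝ) : Grassmann κ :=
  ∑ j, pd i (fun w => (Module.finBasis ℂ (Grassmann κ)).coord j (F w)) v •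
    Module.finBasis ℂ (Grassmann κ) j

lemma pd_congr (i : ι) {f g : (ι → ℝ) → ℂ} {v : ι → ℝ} (h : f =ᶠ[𝓝 v] g) : pd i f v = pd i g v := by
  rw [pd, pd, h.fderiv_eq]

lemma pd_sum {J : Type*} (A : Finset J) (i : ι) {f : J → (ι → ℝ) → ℂ} {v : ι → ℝ}
    (hf : ∀ j ∈ A, DifferentiableAt ℝ (f j) v) :
    pd i (fun w => ∑ j ∈ A, f j w) v = ∑ j ∈ A, pd i (f j) v := by
  rw [pd, fderiv_fun_sum hf, sum_apply]
  rfl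

lemma pd_mul (i : ι) {f g : (ι → ℝ) → ℂ} {v : ι → ℝ} (hf : DifferentiableAt ℝ f v)
    (hg : DifferentiableAt ℝ g v) :
    pd i (fun w => f w * g w) v = pd i f v * g v + f v * pd i g v := by
  rw [pd, fderiv_fun_mul hf hg]
  simp [pd]
  ring

lemma SmAt.differentiableAt {F : (ι → ℝ) → Grassmann κ} {v : ι → ℝ} (hF : SmAt F v)
    (l : Grassmann κ →ₗ[ℂ] ℂ) : DifferentiableAt ℝ (fun w => l (F w)) v :=
  (hF l).differentiableAt (by simp)

lemma apply_gpd (i : ι) {F : (ι → ℝ) → Grassmann κ} {v : ι → ℝ} (hF : SmAt F v)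
    (l : Grassmann κ →ₗ[ℂ] ℂ) : l (gpd i F v) = pd i (fun w => l (F w)) v := by
  set b := Module.finBasis ℂ (Grassmann κ) with hb
  have h1 : (fun w => l (F w)) = fun w => ∑ j, l (b j) * b.coord j (F w) := by
    funext w
    conv_lhs => rw [← b.sum_repr (F w), map_sum]
    simp only [map_smul, smul_eq_mul, Module.Basis.coord_apply, mul_comm]
  rw [h1, pd_sum _ _ fun j _ => (hF.differentiableAt (b.coord j)).const_mul _, gpd, map_sum]
  refine Finset.sum_congr rfl fun j _ => ?_
  rw [map_smul, pd_const_mul _ _ (hF.differentiableAt (b.coord j)), smul_eq_mul, mul_comm]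

lemma gpd_congr (i : ι) {F G : (ι → ℝ) → Grassmann κ} {v : ι → ℝ} (h : F =ᶠ[𝓝 v] G) :
    gpd i F v = gpd i G v := by
  refine Finset.sum_congr rfl fun j _ => ?_
  congr 1
  exact pd_congr i (h.mono fun w hw => by simp only [hw])

lemma SmAt.eventually {F : (ι → ℝ) → Grassmann κ} {v : ι → ℝ} {U : Set (ι → ℝ)} (hU : IsOpen U)
    (hv : v ∈ U) (hF : ∀ w ∈ U, SmAt F w) (i : ι) : SmAt (gpd i F) v := by
  intro l
  have h : ContDiffAt ℝ ∞ (fun w => pd i (fun w => l (F w)) w) v :=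
    ((hF v hv l).fderiv_right (m := ∞) (by simp)).clm_apply contDiffAt_const
  refine h.congr_of_eventuallyEq ?_
  filter_upwards [hU.mem_nhds hv] with w hw
  exact apply_gpd i (hF w hw) l

lemma gpd_add (i : ι) {F G : (ι → ℝ) → Grassmann κ} {v : ι → ℝ} (hF : SmAt F v) (hG : SmAt G v) :
    gpd i (fun w => F w + G w) v = gpd i F v + gpd i G v := by
  refine grassmann_sep fun l => ?_
  rw [map_add, apply_gpd i (hF.add hG), apply_gpd i hF, apply_gpd i hG]
  simp only [map_add]
  rw [pd, fderiv_fun_add (hF.differentiableAt l) (hG.differentiableAt l)]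
  rfl

lemma gpd_smul (i : ι) (c : ℂ) {F : (ι → ℝ) → Grassmann κ} {v : ι → ℝ} (hF : SmAt F v) :
    gpd i (fun w => c • F w) v = c • gpd i F v := by
  refine grassmann_sep fun l => ?_
  rw [map_smul, apply_gpd i (SmAt.smul contDiffAt_const hF), apply_gpd i hF]
  simp only [map_smul, smul_eq_mul]
  exact pd_const_mul i c (hF.differentiableAt l)

lemma gpd_mul (i : ι) {F G : (ι → ℝ) → Grassmann κ} {v : ι → ℝ} (hF : SmAt F v) (hG : SmAt G v) :
    gpd i (fun w => F w * G w) v = gpd i F v * G v + F v * gpd i G v := by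
  refine grassmann_sep fun l => ?_
  set b := Module.finBasis ℂ (Grassmann κ) with hb
  have key : ∀ u v : Grassmann κ,
      l (u * v) = ∑ i, ∑ j, l (b i * b j) * (b.coord i u * b.coord j v) := by
    intro u v
    conv_lhs => rw [← b.sum_repr u, ← b.sum_repr v]
    simp only [Finset.sum_mul, Finset.mul_sum, map_sum, smul_mul_smul_comm, map_smul, smul_eq_mul,
      Module.Basis.coord_apply]
    rw [Finset.sum_comm]
    exact Finset.sum_congr rfl fun _ _ => Finset.sum_congr rfl fun _ _ => by ring
  have hd := fun j k => (hF.differentiableAt (b.coord j)).fun_mul (hG.differentiableAt (b.coord k))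
  rw [map_add, apply_gpd i (hF.mul hG)]
  rw [pd_congr i (.of_forall fun w => key (F w) (G w)), key (gpd i F v), key (F v)]
  rw [pd_sum _ _ fun j _ => DifferentiableAt.fun_sum fun k _ => (hd j k).const_mul _,
    ← Finset.sum_add_distrib]
  refine Finset.sum_congr rfl fun j _ => ?_
  rw [pd_sum _ _ fun k _ => (hd j k).const_mul _, ← Finset.sum_add_distrib]
  refine Finset.sum_congr rfl fun k _ => ?_
  rw [pd_const_mul _ _ (hd j k), pd_mul _ (hF.differentiableAt _) (hG.differentiableAt _), apply_gpd i hF,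
    apply_gpd i hG, ← mul_add]

lemma gpd_mem (i : ι) {F : (ι → ℝ) → Grassmann κ} {v : ι → ℝ} (hF : SmAt F v) {S : Submodule ℂ (Grassmann κ)}
    (hS : ∀ᶠ w in 𝓝 v, F w ∈ S) : gpd i F v ∈ S := by
  by_contra h
  obtain ⟨l, hl, hS'⟩ := Submodule.exists_le_ker_of_notMem h
  refine hl ?_
  rw [apply_gpd i hF, pd_congr i (g := fun _ => 0) (hS.mono fun w hw => hS' hw)]
  simp [pd]

/-- The coordinate derivation `∂/∂v_i` or `∂/∂θ_k` on Grassmann-valued functions. -/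
def cd : ι ⊕ κ → ((ι → ℝ) → Grassmann κ) → (ι → ℝ) → Grassmann κ :=
  Sum.elim gpd fun k F v => contr k (F v)

lemma cd_inl (i : ι) (F : (ι → ℝ) → Grassmann κ) (v : ι → ℝ) : cd (Sum.inl i) F v = gpd i F v := rfl

lemma cd_inr (k : κ) (F : (ι → ℝ) → Grassmann κ) (v : ι → ℝ) : cd (Sum.inr k) F v = contr k (F v) := rfl

lemma cd_congr (a : ι ⊕ κ) {F G : (ι → ℝ) → Grassmann κ} {v : ι → ℝ} (h : F =ᶠ[𝓝 v] G) :
    cd a F v = cd a G v := by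
  rcases a with i | k
  · exact gpd_congr i h
  · exact congrArg (contr k) h.eq_of_nhds

lemma smAt_cd (a : ι ⊕ κ) {F : (ι → ℝ) → Grassmann κ} {v : ι → ℝ} {U : Set (ι → ℝ)} (hU : IsOpen U)
    (hv : v ∈ U) (hF : ∀ w ∈ U, SmAt F w) : SmAt (cd a F) v := by
  rcases a with i | k
  · exact SmAt.eventually hU hv hF i
  · exact (hF v hv).map (contr k)

lemma cd_add (a : ι ⊕ κ) {F G : (ι → ℝ) → Grassmann κ} {v : ι → ℝ} (hF : SmAt F v) (hG : SmAt G v) :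
    cd a (fun w => F w + G w) v = cd a F v + cd a G v := by
  rcases a with i | k
  · exact gpd_add i hF hG
  · exact map_add (contr k) _ _

lemma cd_smul (a : ι ⊕ κ) (c : ℂ) {F : (ι → ℝ) → Grassmann κ} {v : ι → ℝ} (hF : SmAt F v) :
    cd a (fun w => c • F w) v = c • cd a F v := by
  rcases a with i | k
  · exact gpd_smul i c hF
  · exact map_smul (contr k) _ _

lemma cd_mul (a : ι ⊕ κ) {F G : (ι → ℝ) → Grassmann κ} {v : ι → ℝ} (hF : SmAt F v) (hG : SmAt G v)
    {j : ZMod 2} (hj : F v ∈ grassmannPar κ j) :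
    cd a (fun w => F w * G w) v = cd a F v * G v + sgn (cpar a * j) • (F v * cd a G v) := by
  rcases a with i | k
  · simpa [cpar, sgn_zero, cd_inl] using gpd_mul i hF hG
  · simpa [cpar, cd_inr] using contr_mul k j _ (G v) hj

lemma cd_par (a : ι ⊕ κ) {F : (ι → ℝ) → Grassmann κ} {v : ι → ℝ} (hF : SmAt F v) {j : ZMod 2}
    (hj : ∀ᶠ w in 𝓝 v, F w ∈ grassmannPar κ j) : cd a F v ∈ grassmannPar κ (cpar a + j) := by
  rcases a with i | k
  · simpa [cpar, cd_inl] using gpd_mem i hF hj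
  · exact contr_par k j _ hj.self_of_nhds

open Classical in
lemma cd_zs (a b : ι ⊕ κ) (u v : ι → ℝ) :
    cd a (fun w => sfe w (zs u b)) v = if a = b then 1 else 0 := by
  rcases b with i | k
  · have hs : ∀ w, SmAt (fun w : ι → ℝ => algebraMap ℂ (Grassmann κ) ((w i - u i : ℝ) : ℂ)) w := fun w =>
      smAt_ofReal ((contDiff_apply ℝ ℝ i).contDiffAt.sub contDiffAt_const)
    rcases a with i' | k'
    · refine grassmann_sep fun l => ?_
      change l (gpd i' (fun w => algebraMap ℂ (Grassmann κ) ((w i - u i : ℝ) : ℂ)) v) = _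
      rw [apply_gpd i' (hs v)]
      have h1 : HasFDerivAt (fun w : ι → ℝ => l (algebraMap ℂ (Grassmann κ) ((w i - u i : ℝ) : ℂ)))
          ((l 1) • (Complex.ofRealCLM.comp (ContinuousLinearMap.proj (R := ℝ) (φ := fun _ : ι => ℝ) i))) v := by
        have h2 : HasFDerivAt (fun w : ι → ℝ => ((w i - u i : ℝ) : ℂ))
            (Complex.ofRealCLM.comp (ContinuousLinearMap.proj (R := ℝ) (φ := fun _ : ι => ℝ) i)) v :=
          Complex.ofRealCLM.hasFDerivAt.comp v ((hasFDerivAt_apply i v).sub_const _)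
        refine (h2.const_mul (l 1)).congr_of_eventuallyEq (.of_forall fun w => ?_)
        simp only [Algebra.algebraMap_eq_smul_one, map_smul, smul_eq_mul, mul_comm]
      rw [pd, h1.fderiv]
      by_cases h : i' = i
      · subst h; simp
      · simp [h, Ne.symm h]
    · rw [cd_inr, eval_zs_inl, contr_algebraMap, if_neg (by simp)]
  · rcases a with i' | k'
    · refine grassmann_sep fun l => ?_
      change l (gpd i' (fun w => theta k) v) = _
      rw [apply_gpd i' (smAt_const _ _)]
      simp [pd]
    · simpa [cd_inr, eval_zs_inr] using contr_theta k' k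

end Derivatives

section CoordField

open scoped ContDiff
open Filter Topology

variable {X : CSManifold}

lemma Chart.eventually_mem (φ : Chart X) {V : Opens X.carrier} {v : Fin X.evenDim → ℝ} (hv : φ.hom.pt v ∈ V) :
    ∀ᶠ w in 𝓝 v, φ.hom.pt w ∈ V :=
  φ.hom.continuous_pt.continuousAt.eventually (V.isOpen.mem_nhds hv)

lemma Chart.exists_app (φ : Chart X) (a : Fin X.evenDim ⊕ Fin X.oddDim) {V : Opens X.carrier} (hV : V ≤ φ.image)
    (s : X.sec V) : ∃ t : X.sec V, ∀ v, φ.hom.pt v ∈ V → rd φ.hom t v = cd a (rd φ.hom s) v :=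
  exists_push φ.isOpenImmersion hV _ fun _ hv =>
    smAt_cd a (V.isOpen.preimage φ.hom.continuous_pt) hv fun w hw => smAt_rd φ.hom s w hw

/-- The coordinate vector field `∂/∂x_i` or `∂/∂θ_k` of a chart. -/
def coordField (φ : Chart X) (a : Fin X.evenDim ⊕ Fin X.oddDim) :
    VectorField X.toSuperSpace φ.image (idxPar a) where
  app V hV :=
    { toFun := fun s => (φ.exists_app a hV s).choose
      map_add' := fun s t => by
        refine sec_ext_chart φ.isOpenImmersion hV fun v hv => ?_
        rw [rd_add, (φ.exists_app a hV _).choose_spec v hv, (φ.exists_app a hV _).choose_spec v hv,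
          (φ.exists_app a hV _).choose_spec v hv,
          ← cd_add a (smAt_rd φ.hom s v hv) (smAt_rd φ.hom t v hv)]
        exact cd_congr a (.of_forall fun w => rd_add _ _ _ _)
      map_smul' := fun c s => by
        refine sec_ext_chart φ.isOpenImmersion hV fun v hv => ?_
        rw [RingHom.id_apply, rd_smul, (φ.exists_app a hV _).choose_spec v hv,
          (φ.exists_app a hV _).choose_spec v hv, ← cd_smul a c (smAt_rd φ.hom s v hv)]
        exact cd_congr a (.of_forall fun w => rd_smul _ _ _ _) }
  app_par V hV i s hs := by
    refine mem_par_of_chart φ hV fun v hv => ?_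
    change rd φ.hom (φ.exists_app a hV s).choose v ∈ _
    rw [(φ.exists_app a hV s).choose_spec v hv]
    exact cd_par a (smAt_rd φ.hom s v hv) (.of_forall fun w => rd_par _ _ _ hs)
  res_app {W V} h hV s := by
    refine sec_ext_chart φ.isOpenImmersion (h.trans hV) fun v hv => ?_
    change rd φ.hom (X.res h (φ.exists_app a hV s).choose) v =
      rd φ.hom (φ.exists_app a (h.trans hV) (X.res h s)).choose v
    rw [rd_res _ _ _ _ hv, (φ.exists_app a hV s).choose_spec v (h hv),
      (φ.exists_app a (h.trans hV) (X.res h s)).choose_spec v hv]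
    exact cd_congr a ((φ.eventually_mem hv).mono fun w hw => (rd_res _ _ _ _ hw).symm)
  leibniz V hV i s t hs := by
    refine sec_ext_chart φ.isOpenImmersion hV fun v hv => ?_
    change rd φ.hom (φ.exists_app a hV (s * t)).choose v =
      rd φ.hom ((φ.exists_app a hV s).choose * t + sgn (idxPar a * i) • (s * (φ.exists_app a hV t).choose)) v
    rw [rd_add, rd_smul, rd_mul, rd_mul, (φ.exists_app a hV _).choose_spec v hv,
      (φ.exists_app a hV _).choose_spec v hv, (φ.exists_app a hV _).choose_spec v hv,
      cd_congr a (.of_forall fun w => rd_mul φ.hom s t w)]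
    exact cd_mul a (smAt_rd φ.hom s v hv) (smAt_rd φ.hom t v hv) (rd_par _ _ _ hs)

lemma rd_coordField (φ : Chart X) (a : Fin X.evenDim ⊕ Fin X.oddDim) {V : Opens X.carrier} (hV : V ≤ φ.image)
    (s : X.sec V) {v : Fin X.evenDim → ℝ} (hv : φ.hom.pt v ∈ V) :
    rd φ.hom ((coordField φ a).app V hV s) v = cd a (rd φ.hom s) v :=
  (φ.exists_app a hV s).choose_spec v hv

/-- The coordinate functions of a chart. -/
def Chart.coord (φ : Chart X) (a : Fin X.evenDim ⊕ Fin X.oddDim) : X.sec φ.image := toSec φ (zs 0 a)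

lemma Chart.coord_mem (φ : Chart X) (a : Fin X.evenDim ⊕ Fin X.oddDim) :
    φ.coord a ∈ X.par φ.image (idxPar a) := toSec_zs_mem φ 0 a

lemma coordField_coord (φ : Chart X) (a b : Fin X.evenDim ⊕ Fin X.oddDim) {V : Opens X.carrier}
    (hV : V ≤ φ.image) : (coordField φ a).app V hV (X.res hV (φ.coord b)) = if a = b then 1 else 0 := by
  refine sec_ext_chart φ.isOpenImmersion hV fun v hv => ?_
  rw [rd_coordField φ a hV _ hv, cd_congr a (F := rd φ.hom (X.res hV (φ.coord b))) (G := fun w => sfe w (zs 0 b))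
    ((φ.eventually_mem hv).mono fun w hw => (rd_res _ _ _ _ hw).trans (rd_toSec φ _ w)), cd_zs]
  split_ifs with h
  · rw [rd_one _ _ hv]
  · exact (rd_zero φ.hom v).symm

lemma pull_coord (φ : Chart X) (a : Fin X.evenDim ⊕ Fin X.oddDim) :
    φ.hom.pull φ.image (φ.coord a) = modelCoord _ a := by
  refine Subtype.ext (funext fun ⟨v, hv⟩ => ?_)
  have h := rd_of_mem φ.hom (φ.coord a) v (φ.base_mem v)
  rw [Chart.coord, rd_toSec] at h
  refine h.symm.trans ?_
  rcases a with i | k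
  · refine (eval_zs_inl 0 v i).trans ?_
    rw [Pi.zero_apply, sub_zero]
    rfl
  · rfl

lemma eq_coord_of_pull (φ : Chart X) {a : Fin X.evenDim ⊕ Fin X.oddDim} {y : X.sec φ.image}
    (hy : φ.hom.pull φ.image y = modelCoord _ a) : y = φ.coord a := by
  rw [← pull_coord] at hy
  refine sec_ext_chart φ.isOpenImmersion (le_refl φ.image) fun v hv => ?_
  rw [rd_of_mem _ _ _ hv, rd_of_mem _ _ _ hv, hy]

lemma toSec_zs (φ : Chart X) (u : Fin X.evenDim → ℝ) (a : Fin X.evenDim ⊕ Fin X.oddDim) :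
    ∃ c : ℂ, toSec φ (zs u a) = φ.coord a - c • 1 := by
  rcases a with i | k
  · refine ⟨(u i : ℝ), ?_⟩
    rw [Chart.coord, ← map_one (toSec φ), ← map_smul, ← map_sub]
    congr 1
    refine sf_ext fun v => ?_
    rw [map_sub, map_smul, map_one, eval_zs_inl, eval_zs_inl, Algebra.algebraMap_eq_smul_one,
      Algebra.algebraMap_eq_smul_one, ← sub_smul]
    simp
  · exact ⟨0, by rw [zero_smul, sub_zero]; rfl⟩

/-- A vector field on an open subset of a chart is determined by its values on the coordinate
functions. -/
lemma VectorField.ext_coord (φ : Chart X) {W : Opens X.carrier} (hW : W ≤ φ.image) {p : ZMod 2}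
    {D D' : VectorField X.toSuperSpace W p}
    (H : ∀ a, D.app W le_rfl (X.res hW (φ.coord a)) = D'.app W le_rfl (X.res hW (φ.coord a)))
    {V : Opens X.carrier} (hV : V ≤ W) (f : X.sec V) : D.app V hV f = D'.app V hV f := by
  refine sec_ext_chart φ.isOpenImmersion (hV.trans hW) fun v hv => ?_
  obtain ⟨F, O, h1, h2, hvO, hF⟩ := exists_toSec_germ φ f hv
  have hgerm : ∀ E : VectorField X.toSuperSpace W p, rd φ.hom (E.app V hV f) v =
      rd φ.hom (E.app O (h2.trans hV) (X.res h1 (toSec φ F))) v := fun E => by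
    rw [hF, ← E.res_app h2 hV, rd_res _ _ _ _ hvO]
  have hcoord : ∀ (E : VectorField X.toSuperSpace W p) (a) (c : ℂ), E.app O (h2.trans hV)
      (X.res h1 (φ.coord a - c • 1)) = X.res (h2.trans hV) (E.app W le_rfl (X.res hW (φ.coord a))) := by
    intro E a c
    rw [E.res_app, X.res_res, map_sub, map_smul, map_one, map_sub, map_smul, E.app_one, smul_zero, sub_zero]
  have hzs : ∀ a, D.app O (h2.trans hV) (X.res h1 (toSec φ (zs v a))) =
      D'.app O (h2.trans hV) (X.res h1 (toSec φ (zs v a))) := fun a => by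
    obtain ⟨c, hc⟩ := toSec_zs φ v a
    rw [hc, hcoord D, hcoord D', H]
  let L : VectorField X.toSuperSpace W p → SF (Fin X.evenDim) (Fin X.oddDim) →ₗ[ℂ] Grassmann (Fin X.oddDim) :=
    fun E => (rdₗ φ.hom v O).comp ((E.app O (h2.trans hV)).comp
      ((X.res h1).toLinearMap.comp (toSec φ).toLinearMap))
  have hL : ∀ E F, L E F = rd φ.hom (E.app O (h2.trans hV) (X.res h1 (toSec φ F))) v := fun _ _ => rfl
  have hz : L D - L D' = 0 := by
    refine deriv_eq_zero (u := v) (y := fun a => rd φ.hom (X.res h1 (toSec φ (zs v a))) v)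
      (s := fun a => sgn (p * cpar a)) (fun a => ?_) ?_ fun a G => ?_
    · rw [rd_res _ _ _ _ hvO]
      exact aug_rd_toSec_zs φ φ.hom rfl a
    · simp only [LinearMap.sub_apply, hL, map_one, VectorField.app_one, sub_self]
    · simp only [LinearMap.sub_apply, hL, map_mul]
      rw [D.leibniz _ _ _ _ _ (X.res_par h1 _ _ (toSec_zs_mem φ v a)),
        D'.leibniz _ _ _ _ _ (X.res_par h1 _ _ (toSec_zs_mem φ v a)), hzs a]
      simp only [rd_add, rd_smul, rd_mul, mul_sub, smul_sub]
      abel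
  have := LinearMap.congr_fun hz F
  rw [hgerm D, hgerm D', ← hL, ← hL]
  exact sub_eq_zero.1 this

end CoordField

/-! ### Coordinate frames -/

section Frame

open scoped ContDiff
open Filter Topology

/-- The vector field `∑_a c_a D_a`, for homogeneous coefficients of complementary parities. -/
def VectorField.combo {Y : SuperSpace} {J : Type} [Fintype J] {U : Opens Y.carrier} {p : ZMod 2} {q : J → ZMod 2}
    (D : ∀ a, VectorField Y U (q a)) (c : J → Y.sec U) (hc : ∀ a, c a ∈ Y.par U (p + q a)) :
    VectorField Y U p where
  app V hV := ∑ a, LinearMap.mulLeft ℂ (Y.res hV (c a)) ∘ₗ (D a).app V hV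
  app_par V hV i f hf := by
    rw [LinearMap.sum_apply]
    refine sum_mem fun a _ => ?_
    have h := Y.mul_mem_par V _ _ _ _ (Y.res_par hV _ _ (hc a)) ((D a).app_par V hV i f hf)
    have h2 : p + q a + (q a + i) = p + i := by
      rcases zmod2_cases (q a) with h | h <;> rw [h]
      · simp
      · rw [show p + 1 + (1 + i) = (1 + 1) + (p + i) by ring, show (1 + 1 : ZMod 2) = 0 from rfl, zero_add]
    rw [h2] at h
    exact h
  res_app h hV f := by
    simp only [LinearMap.sum_apply, LinearMap.comp_apply, LinearMap.mulLeft_apply, map_sum, map_mul,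
      Y.res_res, (D _).res_app]
  leibniz V hV i f g hf := by
    simp only [LinearMap.sum_apply, LinearMap.comp_apply, LinearMap.mulLeft_apply, Finset.sum_mul,
      Finset.mul_sum, Finset.smul_sum]
    rw [← Finset.sum_add_distrib]
    refine Finset.sum_congr rfl fun a _ => ?_
    rw [(D a).leibniz V hV i f g hf, mul_add, ← mul_assoc, mul_smul_comm, ← mul_assoc, ← mul_assoc,
      Y.supercomm V _ _ _ _ (Y.res_par hV _ _ (hc a)) hf, smul_mul_assoc, smul_smul]
    congr 2
    rw [← sgn_add]
    congr 1
    rcases zmod2_cases (q a) with h | h <;> rw [h]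
    · ring
    · rw [show 1 * i + (p + 1) * i = (1 + 1) * i + p * i by ring, show (1 + 1 : ZMod 2) = 0 from rfl, zero_mul,
        zero_add]

lemma VectorField.combo_app {Y : SuperSpace} {J : Type} [Fintype J] {U : Opens Y.carrier} {p : ZMod 2}
    {q : J → ZMod 2} (D : ∀ a, VectorField Y U (q a)) (c : J → Y.sec U) (hc : ∀ a, c a ∈ Y.par U (p + q a))
    {V : Opens Y.carrier} (hV : V ≤ U) (f : Y.sec V) :
    (VectorField.combo D c hc).app V hV f = ∑ a, Y.res hV (c a) * (D a).app V hV f := by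
  simp [VectorField.combo]

variable {X : CSManifold}

/-- `D = ∑_a D(y_a) ∂/∂y_a` on open subsets of a chart with coordinates `y_a`. -/
lemma VectorField.eq_sum_coordField (φ : Chart X) {W : Opens X.carrier} (hW : W ≤ φ.image) {p : ZMod 2}
    (D : VectorField X.toSuperSpace W p) {V : Opens X.carrier} (hV : V ≤ W) (f : X.sec V) :
    D.app V hV f = ∑ a, X.res hV (D.app W le_rfl (X.res hW (φ.coord a))) *
      (coordField φ a).app V (hV.trans hW) f := by
  have hc : ∀ a, D.app W le_rfl (X.res hW (φ.coord a)) ∈ X.par W (p + idxPar a) := fun a =>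
    D.app_par W le_rfl _ _ (X.res_par hW _ _ (φ.coord_mem a))
  have h := VectorField.ext_coord φ hW (D := D)
    (D' := VectorField.combo (fun a => (coordField φ a).restrict hW) _ hc) (fun b => ?_) hV f
  · rw [h, VectorField.combo_app]
    rfl
  · rw [VectorField.combo_app, Finset.sum_eq_single b]
    · rw [X.res_refl]
      change _ = _ * (coordField φ b).app W hW _
      rw [coordField_coord, if_pos rfl, mul_one]
    · intro a _ hab
      change _ * (coordField φ a).app W hW _ = _
      rw [coordField_coord, if_neg hab, mul_zero]
    · simp

/-- The coordinate frame `∂/∂x_1, …, ∂/∂θ_n` of a chart. -/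
def coordFrame (φ : Chart X) : LocalFrame X φ.image where
  vec := coordField φ
  basis W hW p D := by
    refine ⟨fun a => D.app W le_rfl (X.res hW (φ.coord a)), fun V hV f => D.eq_sum_coordField φ hW hV f,
      fun c hc => funext fun a => ?_⟩
    rw [hc W le_rfl, Finset.sum_eq_single a]
    · rw [coordField_coord, if_pos rfl, mul_one, X.res_refl]
    · intro b _ hab
      rw [coordField_coord, if_neg hab, mul_zero]
    · simp

lemma isCoordFrame_coordFrame (φ : Chart X) : φ.IsCoordFrame (coordFrame φ) := by
  intro a b y hy
  have h := coordField_coord φ a b (le_refl φ.image)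
  rw [X.res_refl, ← eq_coord_of_pull φ hy] at h
  exact h

lemma Chart.IsCoordFrame.eq {φ : Chart X} {e : LocalFrame X φ.image} (he : φ.IsCoordFrame e) :
    e = coordFrame φ := by
  have h : ∀ a (V : Opens X.carrier) (hV : V ≤ φ.image) (f : X.sec V),
      (e.vec a).app V hV f = (coordField φ a).app V hV f := by
    intro a V hV f
    refine VectorField.ext_coord φ (le_refl φ.image) (fun b => ?_) hV f
    rw [coordField_coord, X.res_refl, he a b _ (pull_coord φ b)]
  have h2 : e.vec = coordField φ := by
    funext a
    have h3 : (e.vec a).app = (coordField φ a).app := by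
      funext V hV
      exact LinearMap.ext (h a V hV)
    cases hx : e.vec a
    cases hy : coordField φ a
    rw [hx, hy] at h3
    cases h3
    rfl
  cases e
  cases h2
  rfl

end Frame

/-! ### Derivatives of Berezinians -/

section Jacobi

variable {A M : Type*} [CommRing A] [Algebra ℂ A] [AddCommGroup M] [Module A M] [Module ℂ M]

lemma derivation_prod {J : Type*} [DecidableEq J] (D : Derivation ℂ A M) (s : Finset J) (x : J → A) :
    D (∏ i ∈ s, x i) = ∑ i ∈ s, (∏ j ∈ s.erase i, x j) • D (x i) := by
  induction s using Finset.induction_on with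
  | empty => simp
  | insert a s ha ih =>
    rw [Finset.prod_insert ha, D.leibniz, ih, Finset.sum_insert ha, Finset.erase_insert ha, add_comm,
      Finset.smul_sum]
    congr 1
    refine Finset.sum_congr rfl fun i hi => ?_
    rw [Finset.erase_insert_of_ne (by rintro rfl; exact ha hi), Finset.prod_insert (by simp [ha]), smul_smul]

/-- If `D S = K S`, then `D (det S) = tr K · det S`. -/
lemma derivation_det {k : ℕ} (D : Derivation ℂ A M) (S : Matrix (Fin k) (Fin k) A) (K : Fin k → Fin k → M)
    (h : ∀ i j, D (S i j) = ∑ l, S l j • K i l) : D S.det = S.det • ∑ i, K i i := by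
  have hdet : ∀ T : Matrix (Fin k) (Fin k) A,
      T.det = ∑ σ : Equiv.Perm (Fin k), (Equiv.Perm.sign σ : ℤ) • ∏ i, T i (σ i) := fun T => by
    rw [← Matrix.det_transpose, Matrix.det_apply]
    rfl
  -- replacing row `i` by row `l ≠ i` gives a matrix with two equal rows
  have hrow : ∀ i l, (S.updateRow i (S l)).det = if l = i then S.det else 0 := by
    intro i l
    split_ifs with hl
    · rw [hl, Matrix.updateRow_eq_self]
    · refine Matrix.det_zero_of_row_eq hl ?_
      rw [Matrix.updateRow_self, Matrix.updateRow_ne hl]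
  have hexp : ∀ i l, (S.updateRow i (S l)).det =
      ∑ σ : Equiv.Perm (Fin k), (Equiv.Perm.sign σ : ℤ) • ((∏ j ∈ Finset.univ.erase i, S j (σ j)) * S l (σ i)) := by
    intro i l
    rw [hdet]
    refine Finset.sum_congr rfl fun σ _ => ?_
    rw [← Finset.mul_prod_erase _ _ (Finset.mem_univ i), Matrix.updateRow_self, mul_comm]
    congr 2
    refine Finset.prod_congr rfl fun j hj => ?_
    rw [Matrix.updateRow_ne (Finset.ne_of_mem_erase hj)]
  calc D S.det = ∑ i, ∑ l, (S.updateRow i (S l)).det • K i l := by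
        rw [hdet S, map_sum]
        simp only [map_zsmul, derivation_prod, h, hexp, Finset.smul_sum, Finset.sum_smul, smul_smul,
          smul_assoc]
        rw [Finset.sum_comm]
        refine Finset.sum_congr rfl fun i _ => ?_
        rw [Finset.sum_comm]
    _ = _ := by
        simp only [hrow, ite_smul, zero_smul, Finset.sum_ite_eq', Finset.mem_univ, if_true, Finset.smul_sum]

end Jacobi

lemma map_evenDet {R R' : Type} [Ring R] [Ring R'] (f : R →+* R') {k : ℕ} (M : Matrix (Fin k) (Fin k) R) :
    f (evenDet M) = evenDet (M.map f) := by
  simp only [evenDet, map_sum, map_zsmul, map_list_prod, List.map_ofFn]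
  rfl

lemma evenDet_eq_det {R : Type} [CommRing R] {k : ℕ} (M : Matrix (Fin k) (Fin k) R) : evenDet M = M.det := by
  rw [← Matrix.det_transpose, Matrix.det_apply, evenDet]
  simp only [List.prod_ofFn]
  rfl

section Even

variable {X : SuperSpace} {W : Opens X.carrier}

/-- The subalgebra of even sections. -/
def evenSub (X : SuperSpace) (W : Opens X.carrier) : Subalgebra ℂ (X.sec W) where
  carrier := X.par W 0
  mul_mem' {a b} ha hb := by simpa using X.mul_mem_par W 0 0 a b ha hb
  add_mem' := add_mem
  algebraMap_mem' c := by
    rw [Algebra.algebraMap_eq_smul_one]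
    exact Submodule.smul_mem _ _ (X.one_mem_par W)

instance : CommRing (evenSub X W) where
  mul_comm a b := Subtype.ext (even_comm a.2 b.1)

/-- An odd vector field as a derivation on even functions. -/
def evenDer (D : VectorField X W 1) : Derivation ℂ (evenSub X W) (X.sec W) :=
  Derivation.mk' ((D.app W le_rfl).comp (evenSub X W).val.toLinearMap) fun a b => by
    change D.app W le_rfl (a.1 * b.1) = a.1 * D.app W le_rfl b.1 + b.1 * D.app W le_rfl a.1
    rw [D.leibniz W le_rfl 0 _ _ a.2, mul_zero, sgn_zero, one_smul, even_comm b.2, add_comm]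

lemma evenDer_apply (D : VectorField X W 1) (a : evenSub X W) : evenDer D a = D.app W le_rfl a.1 := rfl

lemma inverse_mem_par {u v : X.sec W} (hu : u ∈ X.par W 0) (h : u * v = 1) : v ∈ X.par W 0 := by
  -- the odd part `b` of the inverse satisfies `u b = 0`, as this section is both even and odd
  obtain ⟨a, ha, b, hb, rfl⟩ := exists_parts 0 v
  rw [zero_add] at hb
  have h1 : u * b = 1 - u * a := by rw [← h, mul_add]; abel
  have h2 : u * b ∈ X.par W 1 := by simpa using X.mul_mem_par W 0 1 u b hu hb
  have h3 : u * b ∈ X.par W 0 := by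
    rw [h1]
    exact sub_mem (X.one_mem_par W) (by simpa using X.mul_mem_par W 0 0 u a hu ha)
  have h4 : u * b = 0 := Submodule.disjoint_def.1 (X.isCompl_par W).disjoint _ h3 h2
  have h5 : b = 0 := by
    calc b = (u * (a + b)) * b := by rw [h, one_mul]
      _ = (a + b) * (u * b) := by rw [even_comm hu (a + b), mul_assoc]
      _ = 0 := by rw [h4, mul_zero]
  rw [h5, add_zero]
  exact ha

lemma ringInverse_eq {R : Type*} [Ring R] {u v : R} (h : u * v = 1) (h' : v * u = 1) : Ring.inverse u = v :=
  Ring.inverse_unit (⟨u, v, h, h'⟩ : Rˣ)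

lemma map_app_mul_even {a b c : Type} [Fintype b] (D : VectorField X W 1) {Z : Matrix a b (X.sec W)}
    {Y : Matrix b c (X.sec W)} (hZ : ∀ i j, Z i j ∈ X.par W 0) :
    (Z * Y).map (D.app W le_rfl) = Z.map (D.app W le_rfl) * Y + Z * Y.map (D.app W le_rfl) := by
  ext i j
  simp only [Matrix.map_apply, Matrix.mul_apply, Matrix.add_apply, map_sum, ← Finset.sum_add_distrib]
  refine Finset.sum_congr rfl fun k _ => ?_
  rw [D.leibniz W le_rfl 0 _ _ (hZ i k), mul_zero, sgn_zero, one_smul]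

lemma map_app_mul_odd {a b c : Type} [Fintype b] (D : VectorField X W 1) {Z : Matrix a b (X.sec W)}
    {Y : Matrix b c (X.sec W)} (hZ : ∀ i j, Z i j ∈ X.par W 1) :
    (Z * Y).map (D.app W le_rfl) = Z.map (D.app W le_rfl) * Y - Z * Y.map (D.app W le_rfl) := by
  ext i j
  simp only [Matrix.map_apply, Matrix.mul_apply, Matrix.sub_apply, map_sum, ← Finset.sum_sub_distrib]
  refine Finset.sum_congr rfl fun k _ => ?_
  rw [D.leibniz W le_rfl 1 _ _ (hZ i k), mul_one, sgn_one, neg_one_smul, sub_eq_add_neg]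

lemma mul_apply_mem {a b c : Type} [Fintype b] {p q r : ZMod 2} {Z : Matrix a b (X.sec W)}
    {Y : Matrix b c (X.sec W)} (hZ : ∀ i j, Z i j ∈ X.par W p) (hY : ∀ i j, Y i j ∈ X.par W q)
    (hr : p + q = r) (i : a) (j : c) : (Z * Y) i j ∈ X.par W r := by
  rw [Matrix.mul_apply, ← hr]
  exact sum_mem fun k _ => X.mul_mem_par W _ _ _ _ (hZ i k) (hY k j)

/-- The logarithmic derivative of the determinant of an even matrix `S` with `D S = K S` is `tr K`. -/
lemma app_evenDet (D : VectorField X W 1) {k : ℕ} {S K : Matrix (Fin k) (Fin k) (X.sec W)}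
    (hS : ∀ i j, S i j ∈ X.par W 0) (h : S.map (D.app W le_rfl) = K * S) :
    D.app W le_rfl (evenDet S) = K.trace * evenDet S := by
  set S₀ : Matrix (Fin k) (Fin k) (evenSub X W) := Matrix.of fun i j => ⟨S i j, hS i j⟩ with hS₀
  have h1 : evenDet S = (S₀.det).1 := by
    rw [← evenDet_eq_det]
    exact (map_evenDet (evenSub X W).val.toRingHom S₀).symm
  have h2 := derivation_det (evenDer D) S₀ K fun i j => by
    have := congrFun (congrFun h i) j
    rw [Matrix.map_apply, Matrix.mul_apply] at this
    rw [evenDer_apply]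
    refine this.trans (Finset.sum_congr rfl fun l _ => ?_)
    exact (even_comm (hS l j) _).symm
  rw [evenDer_apply] at h2
  rw [h1, h2]
  exact even_comm S₀.det.2 _

lemma evenDet_mem {k : ℕ} {S : Matrix (Fin k) (Fin k) (X.sec W)} (hS : ∀ i j, S i j ∈ X.par W 0) :
    evenDet S ∈ X.par W 0 := by
  set S₀ : Matrix (Fin k) (Fin k) (evenSub X W) := Matrix.of fun i j => ⟨S i j, hS i j⟩ with hS₀
  have h1 : evenDet S = (S₀.det).1 := by
    rw [← evenDet_eq_det]
    exact (map_evenDet (evenSub X W).val.toRingHom S₀).symm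
  rw [h1]
  exact S₀.det.2

/-- An even matrix whose determinant is invertible has an even inverse. -/
lemma exists_even_inverse {k : ℕ} {E : Matrix (Fin k) (Fin k) (X.sec W)} (hE : ∀ i j, E i j ∈ X.par W 0)
    (hu : IsUnit (evenDet E)) : ∃ F : Matrix (Fin k) (Fin k) (X.sec W), (∀ i j, F i j ∈ X.par W 0) ∧
      E * F = 1 ∧ F * E = 1 := by
  set S₀ : Matrix (Fin k) (Fin k) (evenSub X W) := Matrix.of fun i j => ⟨E i j, hE i j⟩ with hS₀
  have h1 : evenDet E = (S₀.det).1 := by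
    rw [← evenDet_eq_det]
    exact (map_evenDet (evenSub X W).val.toRingHom S₀).symm
  obtain ⟨v, hv⟩ := hu.exists_right_inv
  have hv0 := inverse_mem_par (evenDet_mem hE) hv
  have hunit : IsUnit S₀.det := IsUnit.of_mul_eq_one (⟨v, hv0⟩ : evenSub X W)
    (Subtype.ext (by rw [h1] at hv; exact hv))
  have hE0 : S₀.map (evenSub X W).val.toRingHom = E := rfl
  refine ⟨(S₀⁻¹).map (evenSub X W).val.toRingHom, fun i j => (S₀⁻¹ i j).2, ?_, ?_⟩
  · rw [← hE0, ← Matrix.map_mul, Matrix.mul_nonsing_inv _ hunit, Matrix.map_one _ (map_zero _) (map_one _)]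
  · rw [← hE0, ← Matrix.map_mul, Matrix.nonsing_inv_mul _ hunit, Matrix.map_one _ (map_zero _) (map_one _)]

/-- The Berezinian of a supermatrix in terms of an inverse of its odd-odd block. -/
lemma ber_eq {m n : ℕ} {M : Matrix (Fin m ⊕ Fin n) (Fin m ⊕ Fin n) (X.sec W)}
    {F : Matrix (Fin n) (Fin n) (X.sec W)} (h1 : M.toBlocks₂₂ * F = 1) (h2 : F * M.toBlocks₂₂ = 1) :
    ber M = evenDet (M.toBlocks₁₁ - M.toBlocks₁₂ * F * M.toBlocks₂₁) * Ring.inverse (evenDet M.toBlocks₂₂) := by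
  rw [ber, ringInverse_eq h1 h2]

variable {m n : ℕ} {M N : Matrix (Fin m ⊕ Fin n) (Fin m ⊕ Fin n) (X.sec W)}

lemma schur_mem (hM : ∀ a b, M a b ∈ X.par W (idxPar a + idxPar b)) {F : Matrix (Fin n) (Fin n) (X.sec W)}
    (hF : ∀ i j, F i j ∈ X.par W 0) (i j : Fin m) :
    (M.toBlocks₁₁ - M.toBlocks₁₂ * F * M.toBlocks₂₁) i j ∈ X.par W 0 := by
  refine sub_mem (by simpa [idxPar, Matrix.toBlocks₁₁] using hM (Sum.inl i) (Sum.inl j)) ?_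
  refine mul_apply_mem (p := 1) (q := 1) (fun i j => mul_apply_mem (p := 1) (q := 0) (fun i j => ?_) hF
    (add_zero _) i j) (fun i j => ?_) rfl i j
  · simpa [idxPar, Matrix.toBlocks₁₂] using hM (Sum.inl i) (Sum.inr j)
  · simpa [idxPar, Matrix.toBlocks₂₁] using hM (Sum.inr i) (Sum.inl j)

lemma ber_mem (hM : ∀ a b, M a b ∈ X.par W (idxPar a + idxPar b)) (hu : IsUnit (evenDet M.toBlocks₂₂)) :
    ber M ∈ X.par W 0 := by
  have hE : ∀ i j, M.toBlocks₂₂ i j ∈ X.par W 0 := fun i j => by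
    simpa [idxPar, Matrix.toBlocks₂₂, show (1 + 1 : ZMod 2) = 0 from rfl] using hM (Sum.inr i) (Sum.inr j)
  obtain ⟨F, hF, h1, h2⟩ := exists_even_inverse hE hu
  rw [ber_eq h1 h2]
  have := X.mul_mem_par W 0 0 _ _ (evenDet_mem (schur_mem hM hF))
    (inverse_mem_par (evenDet_mem hE) (Ring.mul_inverse_cancel _ hu))
  rwa [add_zero] at this

/-- For an odd vector field `D` with `D M = N M`, the Berezinian of `M` satisfies
`D (Ber M) = str N · Ber M`. -/
lemma app_ber (D : VectorField X W 1) (hM : ∀ a b, M a b ∈ X.par W (idxPar a + idxPar b))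
    (hN : ∀ a b, N a b ∈ X.par W (1 + idxPar a + idxPar b)) (hu : IsUnit (evenDet M.toBlocks₂₂))
    (h : M.map (D.app W le_rfl) = N * M) :
    D.app W le_rfl (ber M) = (∑ a, sgn (idxPar a) • N a a) * ber M := by
  have h11 : (1 + 1 : ZMod 2) = 0 := rfl
  have hE : ∀ i j, M.toBlocks₂₂ i j ∈ X.par W 0 := fun i j => by
    simpa [idxPar, Matrix.toBlocks₂₂, h11] using hM (Sum.inr i) (Sum.inr j)
  have hB : ∀ i j, M.toBlocks₁₂ i j ∈ X.par W 1 := fun i j => by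
    simpa [idxPar, Matrix.toBlocks₁₂] using hM (Sum.inl i) (Sum.inr j)
  have hN21 : ∀ i j, N.toBlocks₂₁ i j ∈ X.par W 0 := fun i j => by
    simpa [idxPar, Matrix.toBlocks₂₁, h11] using hN (Sum.inr i) (Sum.inl j)
  obtain ⟨F, hF, hEF, hFE⟩ := exists_even_inverse hE hu
  have hS := schur_mem hM hF
  rw [ber_eq hEF hFE]
  set d := D.app W le_rfl with hd
  set A := M.toBlocks₁₁
  set B := M.toBlocks₁₂
  set C := M.toBlocks₂₁
  set E := M.toBlocks₂₂
  have hblock : ∀ a b, d (M a b) = ∑ c, N a c * M c b := fun a b => congrFun (congrFun h a) b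
  have hdA : A.map d = N.toBlocks₁₁ * A + N.toBlocks₁₂ * C := by
    ext i j
    exact (hblock (Sum.inl i) (Sum.inl j)).trans (Fintype.sum_sum_type _)
  have hdB : B.map d = N.toBlocks₁₁ * B + N.toBlocks₁₂ * E := by
    ext i j
    exact (hblock (Sum.inl i) (Sum.inr j)).trans (Fintype.sum_sum_type _)
  have hdC : C.map d = N.toBlocks₂₁ * A + N.toBlocks₂₂ * C := by
    ext i j
    exact (hblock (Sum.inr i) (Sum.inl j)).trans (Fintype.sum_sum_type _)
  have hdE : E.map d = N.toBlocks₂₁ * B + N.toBlocks₂₂ * E := by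
    ext i j
    exact (hblock (Sum.inr i) (Sum.inr j)).trans (Fintype.sum_sum_type _)
  have hcan : ∀ {c : Type} (Z : Matrix (Fin n) c (X.sec W)), E * (F * Z) = Z := fun Z => by
    rw [← Matrix.mul_assoc, hEF, Matrix.one_mul]
  -- the derivative of the inverse block, from `F E = 1`
  have hdF : F.map d = -(F * (N.toBlocks₂₁ * (B * F))) - F * N.toBlocks₂₂ := by
    have h0 : F.map d * E + F * E.map d = 0 := by
      rw [← map_app_mul_even D hF, hFE]
      ext i j
      by_cases hij : i = j
      · subst hij; simp [D.app_one]
      · simp [hij]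
    have h1 : F.map d = -(F * E.map d * F) := by
      calc F.map d = (F.map d * E) * F := by rw [Matrix.mul_assoc, hEF, Matrix.mul_one]
        _ = _ := by rw [eq_neg_of_add_eq_zero_left h0, Matrix.neg_mul]
    rw [h1, hdE, Matrix.mul_add, Matrix.add_mul, neg_add, sub_eq_add_neg]
    simp only [Matrix.mul_assoc, hEF, Matrix.mul_one]
  -- `D S = K S` for the Schur complement `S`, and `D E = K' E`
  have hK : (A - B * F * C).map d = (N.toBlocks₁₁ + B * F * N.toBlocks₂₁) * (A - B * F * C) := by
    have hsub : (A - B * F * C).map d = A.map d - (B * (F * C)).map d := by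
      rw [Matrix.mul_assoc]
      ext i j
      simp
    rw [hsub, map_app_mul_odd D hB, map_app_mul_even D hF, ← hd, hdA, hdB, hdC, hdF]
    simp only [Matrix.add_mul, Matrix.mul_add, Matrix.sub_mul, Matrix.mul_sub, Matrix.neg_mul, Matrix.mul_neg,
      Matrix.mul_assoc, hcan]
    abel
  have hK' : E.map d = (N.toBlocks₂₁ * B * F + N.toBlocks₂₂) * E := by
    rw [hdE, Matrix.add_mul, Matrix.mul_assoc, Matrix.mul_assoc, hFE, Matrix.mul_one]
  have hdS := app_evenDet D hS hK
  have hdE' := app_evenDet D hE hK'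
  have hev := evenDet_mem hE
  have hes := evenDet_mem hS
  set e := evenDet E
  set s := evenDet (A - B * F * C)
  obtain ⟨u, hu1⟩ := hu.exists_right_inv
  have hue := inverse_mem_par hev hu1
  rw [ringInverse_eq hu1 (by rw [even_comm hue, hu1])]
  have hdu : d u = -((N.toBlocks₂₁ * B * F + N.toBlocks₂₂).trace * u) := by
    have h0 : d e * u + e * d u = 0 := by
      have := D.leibniz W le_rfl 0 e u hev
      rw [hu1, D.app_one, mul_zero, sgn_zero, one_smul] at this
      exact this.symm
    calc d u = (e * d u) * u := by
          rw [even_comm hev, mul_assoc, hu1, mul_one]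
      _ = -(d e * u) * u := by rw [eq_neg_of_add_eq_zero_right h0]
      _ = _ := by rw [hdE', mul_assoc _ e u, hu1, mul_one, neg_mul]
  -- the terms of `tr K` and `tr K'` that do not come from `N` agree, as the entries of `N₂₁` are even
  have htr : (B * F * N.toBlocks₂₁).trace = (N.toBlocks₂₁ * B * F).trace := by
    rw [Matrix.mul_assoc N.toBlocks₂₁]
    simp only [Matrix.trace, Matrix.diag_apply, Matrix.mul_apply (M := B * F), Matrix.mul_apply (M := N.toBlocks₂₁)]
    rw [Finset.sum_comm]
    exact Finset.sum_congr rfl fun i _ => Finset.sum_congr rfl fun j _ => (even_comm (hN21 i j) _).symm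
  have hstr : ∑ a, sgn (idxPar a) • N a a = N.toBlocks₁₁.trace - N.toBlocks₂₂.trace := by
    rw [Fintype.sum_sum_type]
    simp [idxPar, sgn_zero, sgn_one, Matrix.trace, Matrix.toBlocks₁₁, Matrix.toBlocks₂₂, sub_eq_add_neg]
  rw [hstr, D.leibniz W le_rfl 0 s u hes, mul_zero, sgn_zero, one_smul, ← hd, hdS, hdu, Matrix.trace_add,
    Matrix.trace_add, htr, mul_neg, ← mul_assoc, even_comm hes, mul_assoc, mul_assoc, ← sub_eq_add_neg, ← sub_mul]
  congr 1
  abel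

end Even

/-! ### Integration in a chart -/

section Support

open Filter Topology

variable {X : CSManifold} {U W V : Opens X.carrier} {K : Set X.carrier}

/-- The section `s` vanishes outside of `K`, including its nilpotent part. -/
def VanishesOff (s : X.sec W) (K : Set X.carrier) : Prop :=
  ∀ (φ : Chart X) (v : Fin X.evenDim → ℝ), φ.hom.pt v ∉ K → rd φ.hom s v = 0

lemma VanishesOff.mul_left {t : X.sec W} (s : X.sec W) (ht : VanishesOff t K) :
    VanishesOff (s * t) K := fun φ v hv => by rw [rd_mul, ht φ v hv, mul_zero]

lemma VanishesOff.mul_right {s : X.sec W} (hs : VanishesOff s K) (t : X.sec W) :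
    VanishesOff (s * t) K := fun φ v hv => by rw [rd_mul, hs φ v hv, zero_mul]

lemma VanishesOff.res {s : X.sec W} (hs : VanishesOff s K) (h : V ≤ W) : VanishesOff (X.res h s) K :=
  fun φ v hv => by
    by_cases hv' : φ.hom.pt v ∈ V
    · rw [rd_res _ _ _ _ hv', hs φ v hv]
    · exact rd_of_not_mem _ _ hv'

lemma VanishesOff.res_eq_zero {s : X.sec W} (hs : VanishesOff s K) (h : V ≤ W) (hV : ∀ x ∈ V, x ∉ K) :
    X.res h s = 0 :=
  sec_ext fun φ v hv => by
    rw [rd_res _ _ _ _ hv, hs φ v (hV _ hv)]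
    exact (rd_zero φ.hom v).symm

lemma vanishesOff_of_local {s : X.sec W} (H : ∀ x ∈ W, x ∉ K → ∃ (V : Opens X.carrier) (h : V ≤ W), x ∈ V ∧
    X.res h s = 0) : VanishesOff s K := fun φ v hv => by
  by_cases hW : φ.hom.pt v ∈ W
  · obtain ⟨V, h, hxV, h0⟩ := H _ hW hv
    rw [← rd_res φ.hom s v h hxV, h0]
    exact rd_zero φ.hom v
  · exact rd_of_not_mem _ _ hW

lemma VanishesOff.app {s : X.sec W} (hs : VanishesOff s K) (hK : IsClosed K) {p : ZMod 2}
    (D : VectorField X.toSuperSpace U p) (hW : W ≤ U) : VanishesOff (D.app W hW s) K := by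
  refine vanishesOff_of_local fun x hx hxK => ⟨W ⊓ ⟨Kᶜ, hK.isOpen_compl⟩, inf_le_left, ⟨hx, hxK⟩, ?_⟩
  have h0 : X.res (inf_le_left : W ⊓ ⟨Kᶜ, hK.isOpen_compl⟩ ≤ W) s = 0 :=
    hs.res_eq_zero _ fun y (hy : y ∈ W ⊓ ⟨Kᶜ, hK.isOpen_compl⟩) => hy.2
  rw [D.res_app, h0, map_zero]

lemma vanishesOff_of_chart (φ : Chart X) (hW : W ≤ φ.image) (hK : IsClosed K) {s : X.sec W}
    (H : ∀ v, φ.hom.pt v ∈ W → φ.hom.pt v ∉ K → rd φ.hom s v = 0) : VanishesOff s K := by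
  refine vanishesOff_of_local fun x hx hxK => ⟨W ⊓ ⟨Kᶜ, hK.isOpen_compl⟩, inf_le_left, ⟨hx, hxK⟩, ?_⟩
  refine sec_ext_chart φ.isOpenImmersion (inf_le_left.trans hW) fun v hv => ?_
  rw [rd_res _ _ _ _ hv, H v hv.1 hv.2]
  exact (rd_zero φ.hom v).symm

end Support

section Integral

open scoped ContDiff
open MeasureTheory Filter Topology

/-- Integration by parts against the constant function `1`. -/
lemma integral_pd_eq_zero {ι : Type} [Fintype ι] (i : ι) {f : (ι → ℝ) → ℂ} (hf : ContDiff ℝ ∞ f)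
    (hc : HasCompactSupport f) : ∫ v, pd i f v = 0 := by
  classical
  have h1 : HasCompactSupport fun v => fderiv ℝ f v (Pi.single i 1) := hc.fderiv_apply (𝕜 := ℝ) _
  have hcont : Continuous fun v => fderiv ℝ f v (Pi.single i 1) :=
    (hf.continuous_fderiv (by simp)).clm_apply continuous_const
  have h := integral_mul_fderiv_eq_neg_fderiv_mul_of_integrable (μ := (volume : Measure (ι → ℝ)))
    (f := fun _ : ι → ℝ => (1 : ℂ)) (g := f) (v := Pi.single i 1) (by simp)
    (by simpa using hcont.integrable_of_hasCompactSupport h1)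
    (by simpa using hf.continuous.integrable_of_hasCompactSupport hc)
    (fun x _ => differentiableAt_const _) (fun x _ => (hf.differentiable (by simp)).differentiableAt)
  simp only [one_mul, fderiv_fun_const, Pi.zero_apply, zero_apply, zero_mul, integral_zero,
    neg_zero] at h
  rw [← h]
  refine integral_congr_ae (.of_forall fun v => ?_)
  change fderiv ℝ f v _ = fderiv ℝ f v _
  congr!

variable {X : CSManifold} {W : Opens X.carrier} {K : Set X.carrier}

/-- The Lebesgue integral, in a chart, of the top coefficient of a section, extended by zero. -/
def chartInt (φ : Chart X) (s : X.sec W) : ℂ := ∫ v, topCoeff X.oddDim (rd φ.hom s v)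

lemma smAt_rd_of_vanishesOff (φ : Chart X) {s : X.sec W} (hs : VanishesOff s K) (hK : IsClosed K)
    (hKW : K ⊆ W) (v : Fin X.evenDim → ℝ) : SmAt (rd φ.hom s) v := by
  by_cases hv : φ.hom.pt v ∈ W
  · exact smAt_rd φ.hom s v hv
  · refine (smAt_const (0 : Grassmann (Fin X.oddDim)) v).congr ?_
    have h := φ.hom.continuous_pt.continuousAt.eventually
      (hK.isOpen_compl.mem_nhds (show φ.hom.pt v ∉ K from fun h => hv (hKW h)))
    exact h.mono fun w hw => hs φ w hw

lemma Chart.isCompact_preimage (φ : Chart X) (hK : IsCompact K) (hKφ : K ⊆ φ.image) :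
    IsCompact (φ.hom.pt ⁻¹' K) :=
  (φ.isOpenImmersion.isOpenEmbedding.isInducing.isCompact_preimage_iff hKφ).2 hK

lemma VanishesOff.contDiff (φ : Chart X) {s : X.sec W} (hs : VanishesOff s K) (hK : IsCompact K)
    (hKW : K ⊆ W) (l : Grassmann (Fin X.oddDim) →ₗ[ℂ] ℂ) : ContDiff ℝ ∞ fun v => l (rd φ.hom s v) :=
  contDiff_iff_contDiffAt.2 fun v => smAt_rd_of_vanishesOff φ hs hK.isClosed hKW v l

lemma VanishesOff.hasCompactSupport (φ : Chart X) {s : X.sec W} (hs : VanishesOff s K) (hK : IsCompact K)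
    (hKφ : K ⊆ φ.image) (l : Grassmann (Fin X.oddDim) →ₗ[ℂ] ℂ) :
    HasCompactSupport fun v => l (rd φ.hom s v) :=
  HasCompactSupport.intro (φ.isCompact_preimage hK hKφ) fun v hv => by rw [hs φ v hv, map_zero]

lemma VanishesOff.integrable (φ : Chart X) {s : X.sec W} (hs : VanishesOff s K) (hK : IsCompact K)
    (hKW : K ⊆ W) (hW : W ≤ φ.image) : Integrable fun v => topCoeff X.oddDim (rd φ.hom s v) :=
  (hs.contDiff φ hK hKW _).continuous.integrable_of_hasCompactSupport
    (hs.hasCompactSupport φ hK (hKW.trans hW) _)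

lemma chartInt_add (φ : Chart X) {s t : X.sec W} (hs : VanishesOff s K) (ht : VanishesOff t K) (hK : IsCompact K)
    (hKW : K ⊆ W) (hW : W ≤ φ.image) : chartInt φ (s + t) = chartInt φ s + chartInt φ t := by
  simp only [chartInt, rd_add, map_add]
  exact integral_add (hs.integrable φ hK hKW hW) (ht.integrable φ hK hKW hW)

lemma chartInt_sum (φ : Chart X) {J : Type*} (A : Finset J) {s : J → X.sec W}
    (hs : ∀ j ∈ A, VanishesOff (s j) K) (hK : IsCompact K) (hKW : K ⊆ W) (hW : W ≤ φ.image) :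
    chartInt φ (∑ j ∈ A, s j) = ∑ j ∈ A, chartInt φ (s j) := by
  simp only [chartInt, rd_sum, map_sum]
  exact integral_finsetSum _ fun j hj => (hs j hj).integrable φ hK hKW hW

/-- The integral of a coordinate derivative vanishes. -/
lemma chartInt_coordField (φ : Chart X) (a : Fin X.evenDim ⊕ Fin X.oddDim) {s : X.sec W}
    (hs : VanishesOff s K) (hK : IsCompact K) (hKW : K ⊆ W) (hW : W ≤ φ.image) :
    chartInt φ ((coordField φ a).app W hW s) = 0 := by
  have h0 : ∀ v, rd φ.hom ((coordField φ a).app W hW s) v = cd a (rd φ.hom s) v := fun v => by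
    by_cases hv : φ.hom.pt v ∈ W
    · exact rd_coordField φ a hW s hv
    · have h := φ.hom.continuous_pt.continuousAt.eventually
        (hK.isClosed.isOpen_compl.mem_nhds (show φ.hom.pt v ∉ K from fun h => hv (hKW h)))
      rw [rd_of_not_mem _ _ hv, cd_congr a (G := fun _ => (0 : ℂ) • 0) (h.mono fun w hw => by
        rw [hs φ w hw, zero_smul]), cd_smul a 0 (smAt_const _ _), zero_smul]
  simp only [chartInt, h0]
  rcases a with i | k
  · simp only [cd_inl, apply_gpd i (smAt_rd_of_vanishesOff φ hs hK.isClosed hKW _)]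
    exact integral_pd_eq_zero i (hs.contDiff φ hK hKW _) (hs.hasCompactSupport φ hK (hKW.trans hW) _)
  · simp only [cd_inr, topCoeff_contr, integral_zero]

/-- The divergence of a vector field in the coordinates of a chart. -/
def divergence (φ : Chart X) (hW : W ≤ φ.image) {p : ZMod 2} (D : VectorField X.toSuperSpace W p) : X.sec W :=
  ∑ a, (coordField φ a).app W hW (D.app W le_rfl (X.res hW (φ.coord a)))

lemma divergence_mem (φ : Chart X) (hW : W ≤ φ.image) (D : VectorField X.toSuperSpace W 1) :
    divergence φ hW D ∈ X.par W 1 := by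
  refine sum_mem fun a _ => ?_
  have h := (coordField φ a).app_par W hW _ _ (D.app_par W le_rfl _ _ (X.res_par hW _ _ (φ.coord_mem a)))
  have h2 : idxPar a + (1 + idxPar a) = 1 := by
    rcases zmod2_cases (idxPar a) with h' | h' <;> rw [h'] <;> rfl
  rwa [h2] at h

/-- The divergence theorem for odd vector fields. -/
lemma chartInt_divergence (φ : Chart X) (hW : W ≤ φ.image) (D : VectorField X.toSuperSpace W 1) {s : X.sec W}
    (hs : VanishesOff s K) (hK : IsCompact K) (hKW : K ⊆ W) :
    chartInt φ (divergence φ hW D * s + D.app W le_rfl s) = 0 := by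
  have h : divergence φ hW D * s + D.app W le_rfl s =
      ∑ a, (coordField φ a).app W hW (D.app W le_rfl (X.res hW (φ.coord a)) * s) := by
    rw [D.eq_sum_coordField φ hW le_rfl s, divergence, Finset.sum_mul, ← Finset.sum_add_distrib]
    refine Finset.sum_congr rfl fun a _ => ?_
    rw [(coordField φ a).leibniz W hW _ _ _
      (D.app_par W le_rfl _ _ (X.res_par hW _ _ (φ.coord_mem a))), X.res_refl]
    -- `D y_a` has parity `1 + |a|`, hence no sign arises
    have h2 : sgn (idxPar a * (1 + idxPar a)) = 1 := by
      rcases zmod2_cases (idxPar a) with h' | h' <;> rw [h'] <;>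
        simp [sgn, show (1 + 1 : ZMod 2) = 0 from rfl]
    rw [h2, one_smul]
  rw [h, chartInt_sum φ _ (fun a _ => ((hs.mul_left _).app hK.isClosed _ _)) hK hKW hW]
  exact Finset.sum_eq_zero fun a _ => chartInt_coordField φ a (hs.mul_left _) hK hKW hW

end Integral

section Bracket

/-- The supercommutator of two vector fields. -/
def VectorField.bracket {Y : SuperSpace} {U : Opens Y.carrier} {p q : ZMod 2} (D : VectorField Y U p)
    (E : VectorField Y U q) : VectorField Y U (p + q) where
  app V hV := (D.app V hV).comp (E.app V hV) - sgn (p * q) • (E.app V hV).comp (D.app V hV)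
  app_par V hV i f hf := by
    refine sub_mem ?_ (Submodule.smul_mem _ _ ?_)
    · rw [add_assoc]
      exact D.app_par V hV _ _ (E.app_par V hV _ _ hf)
    · rw [add_comm p q, add_assoc]
      exact E.app_par V hV _ _ (D.app_par V hV _ _ hf)
  res_app h hV f := by
    simp only [LinearMap.sub_apply, LinearMap.smul_apply, LinearMap.comp_apply, map_sub, map_smul, D.res_app,
      E.res_app]
  leibniz V hV i f g hf := by
    simp only [LinearMap.sub_apply, LinearMap.smul_apply, LinearMap.comp_apply]
    rw [E.leibniz V hV i f g hf, D.leibniz V hV i f g hf, map_add, map_add, map_smul, map_smul,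
      D.leibniz V hV _ _ g (E.app_par V hV _ _ hf), D.leibniz V hV i f _ hf,
      E.leibniz V hV _ _ g (D.app_par V hV _ _ hf), E.leibniz V hV i f _ hf]
    rcases zmod2_cases p with rfl | rfl <;> rcases zmod2_cases q with rfl | rfl <;>
      rcases zmod2_cases i with rfl | rfl <;>
      simp [sgn, show (1 + 1 : ZMod 2) = 0 from rfl, sub_mul, add_mul, mul_sub, mul_add] <;> abel

lemma VectorField.bracket_app {Y : SuperSpace} {U : Opens Y.carrier} {p q : ZMod 2} (D : VectorField Y U p)
    (E : VectorField Y U q) {V : Opens Y.carrier} (hV : V ≤ U) (f : Y.sec V) : (D.bracket E).app V hV f =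
      D.app V hV (E.app V hV f) - sgn (p * q) • E.app V hV (D.app V hV f) := rfl

variable {X : CSManifold} {W : Opens X.carrier}

/-- The coefficients of the supercommutators of an odd vector field with the coordinate fields. -/
def bracketCoeff (φ : Chart X) (hW : W ≤ φ.image) (D : VectorField X.toSuperSpace W 1) :
    Matrix (Fin X.evenDim ⊕ Fin X.oddDim) (Fin X.evenDim ⊕ Fin X.oddDim) (X.sec W) := fun a c =>
  -(sgn (idxPar a) • (coordField φ a).app W hW (D.app W le_rfl (X.res hW (φ.coord c))))

/-- The supercommutator of `D` with a coordinate field, expanded in the coordinate fields. -/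
lemma app_coordField (φ : Chart X) (hW : W ≤ φ.image) (D : VectorField X.toSuperSpace W 1)
    (a : Fin X.evenDim ⊕ Fin X.oddDim) {V : Opens X.carrier} (hV : V ≤ W) (f : X.sec V) :
    D.app V hV ((coordField φ a).app V (hV.trans hW) f) -
        sgn (idxPar a) • (coordField φ a).app V (hV.trans hW) (D.app V hV f) =
      ∑ c, X.res hV (bracketCoeff φ hW D a c) * (coordField φ c).app V (hV.trans hW) f := by
  have h := (D.bracket ((coordField φ a).restrict hW)).eq_sum_coordField φ hW hV f
  rw [VectorField.bracket_app, one_mul] at h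
  refine h.trans (Finset.sum_congr rfl fun c _ => ?_)
  congr 2
  rw [VectorField.bracket_app, one_mul]
  have h0 : D.app W le_rfl (((coordField φ a).restrict hW).app W le_rfl (X.res hW (φ.coord c))) = 0 := by
    change D.app W le_rfl ((coordField φ a).app W hW (X.res hW (φ.coord c))) = 0
    rw [coordField_coord]
    split_ifs
    · exact D.app_one le_rfl
    · exact map_zero _
  rw [h0, zero_sub]
  rfl

lemma bracketCoeff_mem (φ : Chart X) (hW : W ≤ φ.image) (D : VectorField X.toSuperSpace W 1)
    (a c : Fin X.evenDim ⊕ Fin X.oddDim) : bracketCoeff φ hW D a c ∈ X.par W (1 + idxPar a + idxPar c) := by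
  refine neg_mem (Submodule.smul_mem _ _ ?_)
  have h := (coordField φ a).app_par W hW _ _ (D.app_par W le_rfl _ _ (X.res_par hW _ _ (φ.coord_mem c)))
  rwa [← add_assoc, add_comm (idxPar a) 1] at h

/-- The supertrace of the supercommutator coefficients is minus the divergence; this is what turns
invariance of a Berezinian into a divergence equation. -/
lemma str_bracketCoeff (φ : Chart X) (hW : W ≤ φ.image) (D : VectorField X.toSuperSpace W 1) :
    ∑ a, sgn (idxPar a) • bracketCoeff φ hW D a a = -divergence φ hW D := by
  rw [divergence, ← Finset.sum_neg_distrib]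
  refine Finset.sum_congr rfl fun a _ => ?_
  rw [bracketCoeff, smul_neg, smul_smul, sgn_mul_self, one_smul]

end Bracket

section Invariant

variable {X : CSManifold} {K : Set X.carrier}

/-- The coefficient of a Berezinian in the coordinates of a chart. -/
def Berezinian.coef (ω : Berezinian X) (φ : Chart X) : X.sec φ.image := ω.app φ.image (coordFrame φ)

/-- In a chart, invariance under `D` says that `D(f) = -div(D) f` for the coefficient `f`. -/
lemma Berezinian.IsInvariant.app_coef {D : VectorField X.toSuperSpace ⊤ 1} {ω : Berezinian X}
    (hω : ω.IsInvariant D) (φ : Chart X) : D.app φ.image le_top (ω.coef φ) =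
      -(divergence φ le_rfl (D.restrict (W := φ.image) le_top) * ω.coef φ) := by
  have h := hω φ.image (coordFrame φ) (bracketCoeff φ le_rfl (D.restrict le_top)) fun a V hV f => by
    rw [one_mul]
    exact app_coordField φ le_rfl (D.restrict le_top) a hV f
  rw [str_bracketCoeff, neg_mul] at h
  exact h

/-- If `ω` is invariant under the odd vector field `D` and `s` is an odd function such that `s ω` has
compact support in a chart, then the integral of `D(s) ω` in this chart vanishes. -/
lemma Berezinian.IsInvariant.chartInt_eq_zero {D : VectorField X.toSuperSpace ⊤ 1} {ω : Berezinian X}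
    (hω : ω.IsInvariant D) (φ : Chart X) {s : X.sec ⊤} (hs : s ∈ X.par ⊤ 1)
    (hsω : VanishesOff (X.res (le_top : φ.image ≤ ⊤) s * ω.coef φ) K) (hK : IsCompact K) (hKφ : K ⊆ φ.image) :
    chartInt φ (X.res (le_top : φ.image ≤ ⊤) (D.app ⊤ le_rfl s) * ω.coef φ) = 0 := by
  have h := chartInt_divergence φ le_rfl (D.restrict (W := φ.image) le_top) hsω hK hKφ
  have hs' := X.res_par (le_top : φ.image ≤ ⊤) _ _ hs
  convert h using 2
  change _ = _ + D.app φ.image le_top _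
  rw [D.leibniz _ _ _ _ _ hs', hω.app_coef, D.res_app, ← mul_assoc,
    X.supercomm _ _ _ _ _ (divergence_mem φ le_rfl _) hs']
  simp only [mul_one, sgn_one, neg_smul, one_smul, mul_neg, neg_neg, neg_mul, mul_assoc]
  abel

end Invariant

/-! ### Change of charts -/

section Transition

open scoped ContDiff
open MeasureTheory Filter Topology

variable {X : CSManifold} {W : Opens X.carrier} (φ ψ : Chart X) (hφ : W ≤ φ.image) (hψ : W ≤ ψ.image)

/-- The Jacobian supermatrix `∂y_b/∂x_a` of the coordinates `y` of `ψ` with respect to the coordinates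
`x` of `φ`. -/
def transition : Matrix (Fin X.evenDim ⊕ Fin X.oddDim) (Fin X.evenDim ⊕ Fin X.oddDim) (X.sec W) := fun a b =>
  (coordField φ a).app W hφ (X.res hψ (ψ.coord b))

lemma transition_mem (a b : Fin X.evenDim ⊕ Fin X.oddDim) :
    transition φ ψ hφ hψ a b ∈ X.par W (idxPar a + idxPar b) :=
  (coordField φ a).app_par W hφ _ _ (X.res_par hψ _ _ (ψ.coord_mem b))

lemma coordField_eq_sum (a : Fin X.evenDim ⊕ Fin X.oddDim) {V : Opens X.carrier} (hV : V ≤ W) (f : X.sec V) :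
    (coordField φ a).app V (hV.trans hφ) f =
      ∑ b, X.res hV (transition φ ψ hφ hψ a b) * (coordField ψ b).app V (hV.trans hψ) f :=
  ((coordField φ a).restrict hφ).eq_sum_coordField ψ hψ hV f

lemma transition_mul : transition φ ψ hφ hψ * transition ψ φ hψ hφ = 1 := by
  ext a b
  have h := coordField_eq_sum φ ψ hφ hψ a le_rfl (X.res hφ (φ.coord b))
  rw [coordField_coord] at h
  simp only [X.res_refl] at h
  rw [Matrix.mul_apply, Matrix.one_apply]
  refine h.symm.trans ?_
  split_ifs <;> rfl

/-- The value of a section at a point of its domain, as an algebra homomorphism. -/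
def valHom {x : X.carrier} (hx : x ∈ W) : X.sec W →ₐ[ℂ] ℂ where
  toFun s := val s x
  map_one' := val_one hx
  map_mul' s t := val_mul s t x
  map_zero' := val_zero x
  map_add' s t := val_add s t x
  commutes' c := val_algebraMap c hx

lemma val_evenDet {x : X.carrier} (hx : x ∈ W) {k : ℕ} (M : Matrix (Fin k) (Fin k) (X.sec W)) :
    val (evenDet M) x = (M.map fun s => val s x).det := by
  rw [← evenDet_eq_det]
  exact map_evenDet (valHom hx).toRingHom M

lemma val_transition_of_ne {a b : Fin X.evenDim ⊕ Fin X.oddDim} (hab : idxPar a + idxPar b = 1) (x : X.carrier) :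
    val (transition φ ψ hφ hψ a b) x = 0 :=
  val_of_odd _ (hab ▸ transition_mem φ ψ hφ hψ a b)

/-- The odd-odd block of the Jacobian supermatrix is invertible: modulo nilpotents the off-diagonal blocks
vanish, and the reverse Jacobian provides an inverse. -/
lemma isUnit_transition : IsUnit (evenDet (transition φ ψ hφ hψ).toBlocks₂₂) := by
  refine isUnit_of_val_ne_zero _ fun x hx h0 => ?_
  rw [val_evenDet hx] at h0
  have h : ((transition φ ψ hφ hψ).toBlocks₂₂.map fun s => val s x) *
      ((transition ψ φ hψ hφ).toBlocks₂₂.map fun s => val s x) = 1 := by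
    ext i j
    have h1 := congrArg (fun s => val s x)
      (congrFun (congrFun (transition_mul φ ψ hφ hψ) (Sum.inr i)) (Sum.inr j))
    simp only [Matrix.mul_apply, Fintype.sum_sum_type, val_add, val_sum, val_mul] at h1
    rw [Finset.sum_eq_zero, zero_add] at h1
    · rw [Matrix.mul_apply]
      refine h1.trans ?_
      rw [Matrix.one_apply, Matrix.one_apply]
      by_cases hij : i = j
      · subst hij; simpa using val_one hx
      · simpa [hij] using val_zero x
    · intro c _
      rw [val_transition_of_ne φ ψ hφ hψ (by simp [idxPar]), zero_mul]
  have h2 := congrArg Matrix.det h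
  rw [Matrix.det_mul, h0, zero_mul, Matrix.det_one] at h2
  exact zero_ne_one h2

/-- Modulo nilpotents, the Berezinian of the Jacobian supermatrix is the quotient of the determinants of
its diagonal blocks. -/
lemma val_ber_transition {x : X.carrier} (hx : x ∈ W) :
    val (ber (transition φ ψ hφ hψ)) x * ((transition φ ψ hφ hψ).toBlocks₂₂.map fun s => val s x).det =
      ((transition φ ψ hφ hψ).toBlocks₁₁.map fun s => val s x).det := by
  have hu := isUnit_transition φ ψ hφ hψ
  rw [← val_evenDet hx, ← val_mul, ber, mul_assoc, Ring.inverse_mul_cancel _ hu, mul_one, val_evenDet hx]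
  congr 1
  ext i j
  simp only [Matrix.map_apply, Matrix.sub_apply, val_sub]
  rw [Matrix.mul_apply, val_sum, Finset.sum_eq_zero, sub_zero]
  intro k _
  rw [val_mul]
  have : val ((transition φ ψ hφ hψ).toBlocks₂₁ k j) x = 0 :=
    val_transition_of_ne φ ψ hφ hψ (a := Sum.inr k) (b := Sum.inl j) (by simp [idxPar]) x
  rw [this, mul_zero]

/-- The transformation rule of the coefficients of a Berezinian under a change of charts. -/
lemma Berezinian.res_coef (η : Berezinian X) :
    X.res hφ (η.coef φ) = ber (transition φ ψ hφ hψ) * X.res hψ (η.coef ψ) := by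
  rw [Berezinian.coef, Berezinian.coef, η.res_app, η.res_app]
  exact η.change W _ _ _ fun a V hV f => coordField_eq_sum φ ψ hφ hψ a hV f

/-- Odd coordinate derivatives in the chart `ψ` do not contribute to the integral in the chart `φ`. -/
lemma chartInt_ber_mul_coordField (k : Fin X.oddDim) {K : Set X.carrier} {s : X.sec W} (hs : VanishesOff s K)
    (hK : IsCompact K) (hKW : K ⊆ W) :
    chartInt φ (ber (transition φ ψ hφ hψ) * (coordField ψ (Sum.inr k)).app W hψ s) = 0 := by
  set M := transition φ ψ hφ hψ with hM
  set D : VectorField X.toSuperSpace W 1 := (coordField ψ (Sum.inr k)).restrict hψ with hD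
  -- `D` annihilates or normalizes the coordinates `y_b`, so that `D ∂_a y_b = [D, ∂_a] y_b`
  have hDM : M.map (D.app W le_rfl) = bracketCoeff φ hφ D * M := by
    ext a b
    have h := app_coordField φ hφ D a le_rfl (X.res hψ (ψ.coord b))
    have h0 : D.app W le_rfl (X.res hψ (ψ.coord b)) = if Sum.inr k = b then 1 else 0 :=
      coordField_coord ψ (Sum.inr k) b hψ
    have h1 : (coordField φ a).app W hφ (D.app W le_rfl (X.res hψ (ψ.coord b))) = 0 := by
      rw [h0]
      split_ifs
      · exact VectorField.app_one _ hφ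
      · exact map_zero _
    rw [h1, smul_zero, sub_zero] at h
    simp only [X.res_refl] at h
    exact h
  have hber := app_ber D (transition_mem φ ψ hφ hψ) (bracketCoeff_mem φ hφ D)
    (isUnit_transition φ ψ hφ hψ) hDM
  rw [str_bracketCoeff, ← hM] at hber
  have h := chartInt_divergence φ hφ D (hs.mul_left (ber M)) hK hKW
  convert h using 2
  rw [D.leibniz W le_rfl 0 _ _ (ber_mem (transition_mem φ ψ hφ hψ) (isUnit_transition φ ψ hφ hψ)), ← hM, hber]
  simp only [mul_zero, sgn_zero, one_smul, neg_mul, mul_assoc]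
  rw [add_neg_cancel_left]
  rfl

/-- The product of the odd coordinates of a chart. -/
def Chart.topSec : X.sec ψ.image := (List.ofFn fun k => ψ.coord (Sum.inr k)).prod

lemma rd_topSec {x : Fin X.evenDim → ℝ} (h : Hom (modelSpace (Fin X.evenDim) (Fin X.oddDim)) X.toSuperSpace)
    (hx : h.pt x ∈ ψ.image) :
    rd h ψ.topSec x = (List.ofFn fun k => rd h (ψ.coord (Sum.inr k)) x).prod := by
  change rdHom h x hx ψ.topSec = _
  rw [Chart.topSec, map_list_prod, List.map_ofFn]
  rfl

lemma rd_topSec_self (v : Fin X.evenDim → ℝ) : rd ψ.hom ψ.topSec v = topTheta X.oddDim := by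
  rw [rd_topSec ψ ψ.hom (ψ.base_mem v), topTheta, ExteriorAlgebra.ιMulti_apply]
  congr 2
  funext k
  rw [Chart.coord, rd_toSec, eval_zs_inr, theta]
  congr 1

/-- The product of the odd coordinates of `ψ`, read in the chart `φ`. -/
lemma rd_topSec_transition {v : Fin X.evenDim → ℝ} (hv : φ.hom.pt v ∈ W) :
    rd φ.hom ψ.topSec v =
      ((transition φ ψ hφ hψ).toBlocks₂₂.map fun s => val s (φ.hom.pt v)).det • topTheta X.oddDim := by
  rw [rd_topSec ψ φ.hom (hψ hv), prod_odd _ fun k => rd_par _ _ _ (ψ.coord_mem (Sum.inr k))]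
  congr 2
  ext l k
  rw [Matrix.of_apply, Matrix.map_apply, ← aug_rd]
  change _ = aug _ (rd φ.hom ((coordField φ (Sum.inr l)).app W hφ (X.res hψ (ψ.coord (Sum.inr k)))) v)
  rw [rd_coordField φ _ hφ _ hv, cd_inr, rd_res _ _ _ _ hv]

/-- The coordinate change between the manifolds underlying two charts, on the overlap. -/
def coordChange (v : Fin X.evenDim → ℝ) : Fin X.evenDim → ℝ := fun j =>
  (aug _ (rd φ.hom (ψ.coord (Sum.inl j)) v)).re

lemma val_coord_inl (w : Fin X.evenDim → ℝ) (j : Fin X.evenDim) :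
    val (ψ.coord (Sum.inl j)) (ψ.hom.pt w) = w j := by
  rw [← aug_rd, Chart.coord, rd_toSec, eval_zs_inl, aug_algebraMap, Pi.zero_apply, sub_zero]

lemma aug_rd_coord {v : Fin X.evenDim → ℝ} (hv : φ.hom.pt v ∈ ψ.image) (j : Fin X.evenDim) :
    aug _ (rd φ.hom (ψ.coord (Sum.inl j)) v) = coordChange φ ψ v j := by
  obtain ⟨w, hw⟩ := Chart.mem_image.1 hv
  rw [coordChange, aug_rd, ← hw, val_coord_inl, Complex.ofReal_re]

lemma pt_coordChange {v : Fin X.evenDim → ℝ} (hv : φ.hom.pt v ∈ ψ.image) :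
    ψ.hom.pt (coordChange φ ψ v) = φ.hom.pt v := by
  obtain ⟨w, hw⟩ := Chart.mem_image.1 hv
  rw [← hw]
  congr 1
  funext j
  rw [coordChange, aug_rd, ← hw, val_coord_inl, Complex.ofReal_re]

lemma hasFDerivAt_coordChange {v : Fin X.evenDim → ℝ} (hv : φ.hom.pt v ∈ ψ.image) :
    HasFDerivAt (coordChange φ ψ) (fderiv ℝ (coordChange φ ψ) v) v := by
  refine DifferentiableAt.hasFDerivAt (differentiableAt_pi.2 fun j => ?_)
  exact Complex.reCLM.differentiableAt.comp v ((smAt_rd φ.hom _ v hv).differentiableAt (aug _).toLinearMap)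

/-- The even-even block of the Jacobian supermatrix is, modulo nilpotents, the Jacobian matrix of the
underlying coordinate change. -/
lemma det_coordChange {v : Fin X.evenDim → ℝ} (hv : φ.hom.pt v ∈ W) :
    ((transition φ ψ hφ hψ).toBlocks₁₁.map fun s => val s (φ.hom.pt v)).det =
      ((fderiv ℝ (coordChange φ ψ) v).det : ℂ) := by
  have h1 : (fderiv ℝ (coordChange φ ψ) v).det =
      (Matrix.of fun i j => fderiv ℝ (coordChange φ ψ) v (Pi.single i 1) j : Matrix _ _ ℝ).det := by
    rw [← Matrix.det_transpose, ContinuousLinearMap.det, ← LinearMap.det_toMatrix']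
    congr 1
  rw [h1, ← Complex.coe_algebraMap, RingHom.map_det]
  congr 1
  ext i j
  simp only [Matrix.map_apply, RingHom.mapMatrix_apply, Matrix.of_apply, Complex.coe_algebraMap]
  rw [← aug_rd]
  change aug _ (rd φ.hom ((coordField φ (Sum.inl i)).app W hφ (X.res hψ (ψ.coord (Sum.inl j)))) v) = _
  have hev := (φ.eventually_mem hv).mono fun w hw => aug_rd_coord φ ψ (hψ hw) j
  rw [rd_coordField φ _ hφ _ hv, cd_congr _ (G := rd φ.hom (ψ.coord (Sum.inl j)))
    ((φ.eventually_mem hv).mono fun w hw => rd_res φ.hom (ψ.coord (Sum.inl j)) w hψ hw),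
    cd_inl]
  change (aug _).toLinearMap _ = _
  rw [apply_gpd i (smAt_rd φ.hom _ v (hψ hv)), pd_congr i (f := fun w => (aug (Fin X.oddDim)).toLinearMap (rd φ.hom (ψ.coord (Sum.inl j)) w))
    (g := fun w => ((coordChange φ ψ w j : ℝ) : ℂ)) hev, pd]
  have h2 : HasFDerivAt (fun w => ((coordChange φ ψ w j : ℝ) : ℂ))
      (Complex.ofRealCLM.comp ((ContinuousLinearMap.proj (R := ℝ) (φ := fun _ : Fin X.evenDim => ℝ) j).comp
        (fderiv ℝ (coordChange φ ψ) v))) v :=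
    HasFDerivAt.comp v (g := fun t : ℝ => (t : ℂ)) (f := fun w => coordChange φ ψ w j)
      Complex.ofRealCLM.hasFDerivAt (HasFDerivAt.comp v (g := fun u : Fin X.evenDim → ℝ => u j)
        (hasFDerivAt_apply j _) (hasFDerivAt_coordChange φ ψ (hψ hv)))
  rw [h2.fderiv]
  simp only [ContinuousLinearMap.comp_apply, ContinuousLinearMap.proj_apply, Complex.ofRealCLM_apply]
  congr!

end Transition

section Independence

open MeasureTheory Filter Topology

variable {X : CSManifold}

lemma chartInt_res (φ : Chart X) {U W : Opens X.carrier} {K : Set X.carrier} {s : X.sec U}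
    (hs : VanishesOff s K) (h : W ≤ U) (hKW : K ⊆ W) : chartInt φ (X.res h s) = chartInt φ s := by
  refine integral_congr_ae (.of_forall fun v => ?_)
  by_cases hv : φ.hom.pt v ∈ W
  · exact congrArg _ (rd_res φ.hom s v h hv)
  · change topCoeff _ (rd φ.hom (X.res h s) v) = topCoeff _ (rd φ.hom s v)
    rw [rd_of_not_mem _ _ hv, hs φ v fun h => hv (hKW h)]

/-- A section over a chart is, up to odd coordinate derivatives, its top coefficient times the product
of the odd coordinates. -/
lemma exists_top_decomp (ψ : Chart X) {W : Opens X.carrier} (hψ : W ≤ ψ.image) {K : Set X.carrier}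
    (hK : IsClosed K) {g : X.sec W} (hg : VanishesOff g K) :
    ∃ (γ : X.sec W) (h : Fin X.oddDim → X.sec W), VanishesOff γ K ∧ (∀ k, VanishesOff (h k) K) ∧
      (∀ v, ψ.hom.pt v ∈ W → rd ψ.hom γ v = algebraMap ℂ _ (topCoeff _ (rd ψ.hom g v))) ∧
      g = γ * X.res hψ ψ.topSec + ∑ k, (coordField ψ (Sum.inr k)).app W hψ (h k) := by
  obtain ⟨r, hr⟩ := exists_contr_decomp X.oddDim
  obtain ⟨γ, hγ⟩ := exists_push ψ.isOpenImmersion hψ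
    (fun v => (Algebra.linearMap ℂ (Grassmann (Fin X.oddDim)) ∘ₗ topCoeff _) (rd ψ.hom g v))
    fun v hv => (smAt_rd ψ.hom g v hv).map _
  choose h hh using fun k => exists_push ψ.isOpenImmersion hψ (fun v => r k (rd ψ.hom g v))
    fun v hv => (smAt_rd ψ.hom g v hv).map _
  refine ⟨γ, h, vanishesOff_of_chart ψ hψ hK fun v hv hvK => ?_,
    fun k => vanishesOff_of_chart ψ hψ hK fun v hv hvK => ?_, hγ,
    sec_ext_chart ψ.isOpenImmersion hψ fun v hv => ?_⟩
  · rw [hγ v hv, hg ψ v hvK, map_zero]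
  · rw [hh k v hv, hg ψ v hvK, map_zero]
  · rw [rd_add, rd_mul, rd_sum, hγ v hv, rd_res _ _ _ _ hv, rd_topSec_self]
    conv_lhs => rw [hr (rd ψ.hom g v)]
    refine congrArg₂ (· + ·) ?_ (Finset.sum_congr rfl fun k _ => ?_)
    · exact Algebra.smul_def (topCoeff X.oddDim (rd ψ.hom g v)) (topTheta X.oddDim)
    · rw [rd_coordField ψ _ hψ _ hv, cd_inr, hh k v hv]

/-- Independence of the integral of the chart: after removing odd derivatives, this is the classical
change of variables formula. -/
theorem chartInt_coef_eq (o : Orientation X) (η : Berezinian X) (φ ψ : Chart X) {K : Set X.carrier}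
    (hK : IsCompact K) (hKφ : K ⊆ φ.image) (hKψ : K ⊆ ψ.image) (hφη : VanishesOff (η.coef φ) K)
    (hψη : VanishesOff (η.coef ψ) K) : ((o.sign φ : ℤ) : ℂ) * chartInt φ (η.coef φ) =
      ((o.sign ψ : ℤ) : ℂ) * chartInt ψ (η.coef ψ) := by
  set W : Opens X.carrier := φ.image ⊓ ψ.image with hW
  have hφ : W ≤ φ.image := inf_le_left
  have hψ : W ≤ ψ.image := inf_le_right
  have hKW : K ⊆ W := fun x hx => ⟨hKφ hx, hKψ hx⟩
  set g := X.res hψ (η.coef ψ) with hg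
  have hgK : VanishesOff g K := hψη.res hψ
  obtain ⟨γ, h, hγK, hhK, hγ, hdec⟩ := exists_top_decomp ψ hψ hK.isClosed hgK
  set M := transition φ ψ hφ hψ with hM
  have hvt : ∀ k ∈ Finset.univ, VanishesOff (ber M * (coordField ψ (Sum.inr k)).app W hψ (h k)) K := fun k _ =>
    ((hhK k).app hK.isClosed _ hψ).mul_left _
  -- only the top coefficient contributes to the integral in `φ`
  have h1 : chartInt φ (η.coef φ) = chartInt φ (ber M * (γ * X.res hψ ψ.topSec)) := by
    rw [← chartInt_res φ hφη hφ hKW, η.res_coef φ ψ hφ hψ, ← hg, hdec, mul_add, Finset.mul_sum,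
      chartInt_add φ ((hγK.mul_right _).mul_left _) ?_ hK hKW hφ, chartInt_sum φ _ hvt hK hKW hφ,
      Finset.sum_eq_zero, add_zero]
    · exact fun k _ => chartInt_ber_mul_coordField φ ψ hφ hψ k (hhK k) hK hKW
    · rw [← Finset.mul_sum]
      intro φ' v hv
      rw [rd_mul, rd_sum, Finset.sum_eq_zero, mul_zero]
      exact fun k _ => (hhK k).app hK.isClosed _ hψ φ' v hv
  set S : Set (Fin X.evenDim → ℝ) := φ.hom.pt ⁻¹' W with hS
  set τ := coordChange φ ψ with hτ
  have hpt : ∀ v ∈ S, ψ.hom.pt (τ v) = φ.hom.pt v := fun v hv => pt_coordChange φ ψ (hψ hv)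
  have hSo : IsOpen S := W.isOpen.preimage φ.hom.continuous_pt
  have himage : τ '' S = ψ.hom.pt ⁻¹' W := by
    ext w
    constructor
    · rintro ⟨v, hv, rfl⟩
      change ψ.hom.pt (τ v) ∈ W
      rw [hpt v hv]
      exact hv
    · intro hw
      obtain ⟨v, hv⟩ := Chart.mem_image.1 (hφ hw)
      have hvS : v ∈ S := by
        change φ.hom.pt v ∈ W
        rw [hv]
        exact hw
      exact ⟨v, hvS, ψ.injective (by rw [hpt v hvS, hv])⟩
  have hinj : Set.InjOn τ S := fun v hv w hw hvw => φ.injective (by rw [← hpt v hv, ← hpt w hw, hvw])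
  have h2 : chartInt ψ (η.coef ψ) =
      ∫ v in S, |(fderiv ℝ τ v).det| • topCoeff X.oddDim (rd ψ.hom g (τ v)) := by
    rw [← chartInt_res ψ hψη hψ hKW, ← integral_image_eq_integral_abs_det_fderiv_smul volume hSo.measurableSet
      (fun v hv => (hasFDerivAt_coordChange φ ψ (hψ hv)).hasFDerivWithinAt) hinj
      (fun w => topCoeff X.oddDim (rd ψ.hom g w)), himage]
    refine (setIntegral_eq_integral_of_forall_compl_eq_zero fun w hw => ?_).symm
    rw [rd_of_not_mem _ _ hw, map_zero]
  -- the odd-odd blocks from `Ber M` and from the product of the odd coordinates cancel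
  have h3 : chartInt φ (ber M * (γ * X.res hψ ψ.topSec)) =
      ∫ v in S, ((fderiv ℝ τ v).det : ℂ) * topCoeff X.oddDim (rd ψ.hom g (τ v)) := by
    rw [chartInt, ← setIntegral_eq_integral_of_forall_compl_eq_zero (s := S) fun v hv => by
      rw [rd_of_not_mem _ _ hv, map_zero]]
    refine setIntegral_congr_fun hSo.measurableSet fun v hv => ?_
    have hvW : φ.hom.pt v ∈ W := hv
    have hτW : ψ.hom.pt (τ v) ∈ W := by rw [hpt v hv]; exact hvW
    change topCoeff _ (rd φ.hom (ber M * (γ * X.res hψ ψ.topSec)) v) = _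
    rw [rd_mul, rd_mul, rd_res _ _ _ _ hvW, rd_topSec_transition φ ψ hφ hψ hvW, mul_smul_comm, mul_smul_comm,
      ← mul_assoc, mul_topTheta, map_smul, map_smul, topCoeff_topTheta, map_mul, aug_rd, aug_rd,
      ← det_coordChange φ ψ hφ hψ hvW, ← val_ber_transition φ ψ hφ hψ hvW, ← hM, ← hpt v hv,
      ← aug_rd ψ.hom γ, hγ _ hτW, aug_algebraMap]
    simp only [smul_eq_mul]
    ring
  -- the signs of the charts turn the absolute value of the Jacobian determinant into the determinant
  rw [h1, h2, h3, ← integral_const_mul, ← integral_const_mul]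
  refine setIntegral_congr_fun hSo.measurableSet fun v hv => ?_
  have hc := o.compat φ ψ τ v <| by
    filter_upwards [hSo.mem_nhds hv] with w hw using hpt w hw
  change _ * _ = _ * _
  rw [Complex.real_smul, ← mul_assoc, ← mul_assoc]
  congr 1
  set d := (fderiv ℝ τ v).det
  rcases Int.units_eq_one_or (o.sign φ) with h1 | h1 <;> rcases Int.units_eq_one_or (o.sign ψ) with h2 | h2 <;>
    rw [h1, h2] at hc ⊢ <;> simp at hc ⊢
  · rw [abs_of_pos hc]
  · rw [abs_of_neg hc]; simp
  · rw [abs_of_neg hc]; simp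
  · rw [abs_of_pos hc]

end Independence

/-! ### Supports and partitions of unity -/

section Partition

open Filter Topology

variable {X : CSManifold}

lemma Berezinian.isClosed_support (ω : Berezinian X) : IsClosed ω.support := by
  rw [← isOpen_compl_iff, isOpen_iff_mem_nhds]
  intro x hx
  simp only [Berezinian.support, Set.mem_compl_iff, Set.mem_ofPred_eq] at hx
  push Not at hx
  obtain ⟨U, hxU, hU⟩ := hx
  refine Filter.mem_of_superset (U.isOpen.mem_nhds hxU) fun y hy hys => ?_
  obtain ⟨V, hV, e, he⟩ := hys U hy
  exact he (hU V hV e)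

lemma Berezinian.vanishesOff (ω : Berezinian X) {U : Opens X.carrier} (e : LocalFrame X U) :
    VanishesOff (ω.app U e) ω.support := by
  refine vanishesOff_of_local fun x hx hxs => ?_
  simp only [Berezinian.support, Set.mem_ofPred_eq] at hxs
  push Not at hxs
  obtain ⟨V, hxV, hV⟩ := hxs
  exact ⟨U ⊓ V, inf_le_left, ⟨hx, hxV⟩, by rw [ω.res_app]; exact hV _ inf_le_right _⟩

/-- The product of a Berezinian with an even function. -/
def Berezinian.smul (s : X.sec ⊤) (hs : s ∈ X.par ⊤ 0) (ω : Berezinian X) : Berezinian X where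
  app U e := X.res le_top s * ω.app U e
  res_app h e := by rw [map_mul, ω.res_app, X.res_res]
  change U e e' M h := by
    rw [ω.change U e e' M h, ← mul_assoc, ← mul_assoc, even_comm (X.res_par le_top _ _ hs)]

lemma Berezinian.smul_app (s : X.sec ⊤) (hs : s ∈ X.par ⊤ 0) (ω : Berezinian X) (U : Opens X.carrier)
    (e : LocalFrame X U) : (ω.smul s hs).app U e = X.res le_top s * ω.app U e := rfl

lemma Berezinian.coef_smul (s : X.sec ⊤) (hs : s ∈ X.par ⊤ 0) (ω : Berezinian X) (φ : Chart X) :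
    (ω.smul s hs).coef φ = X.res le_top s * ω.coef φ := rfl

lemma Berezinian.support_smul_subset (s : X.sec ⊤) (hs : s ∈ X.par ⊤ 0) (ω : Berezinian X) :
    (ω.smul s hs).support ⊆ ω.support := fun x hx U hxU => by
  obtain ⟨V, hV, e, he⟩ := hx U hxU
  exact ⟨V, hV, e, fun h => he (by rw [ω.smul_app s hs, h, mul_zero])⟩

lemma Berezinian.support_smul_subset_of_vanishesOff {s : X.sec ⊤} (hs : s ∈ X.par ⊤ 0) (ω : Berezinian X)
    {K : Set X.carrier} (hK : IsClosed K) (hsK : VanishesOff s K) : (ω.smul s hs).support ⊆ K := fun x hx => by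
  by_contra hxK
  obtain ⟨V, hV, e, he⟩ := hx ⟨Kᶜ, hK.isOpen_compl⟩ hxK
  exact he (by rw [ω.smul_app s hs, hsK.res_eq_zero le_top fun y hy => hV hy, zero_mul])

lemma VanishesOff.mul_inter {U : Opens X.carrier} {K L : Set X.carrier} {s t : X.sec U} (hs : VanishesOff s K)
    (ht : VanishesOff t L) : VanishesOff (s * t) (K ∩ L) := fun φ v hv => by
  by_cases hK : φ.hom.pt v ∈ K
  · rw [rd_mul, ht φ v fun h => hv ⟨hK, h⟩, mul_zero]
  · rw [rd_mul, hs φ v hK, zero_mul]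

lemma VanishesOff.mul_eq_zero {U W : Opens X.carrier} {K : Set X.carrier} {s : X.sec U} (hs : VanishesOff s K)
    (hKW : K ⊆ W) {u : X.sec ⊤} (hu : X.res (le_top : W ≤ ⊤) u = 0) : X.res le_top u * s = 0 :=
  sec_ext fun φ v hv => by
    have h0 : rd φ.hom (X.res (le_top : U ≤ ⊤) u * s) v = 0 := by
      by_cases hW : φ.hom.pt v ∈ W
      · rw [rd_mul, rd_res φ.hom u v le_top hv, ← rd_res φ.hom u v (le_top : W ≤ ⊤) hW, hu,
          show rd φ.hom (0 : X.sec W) v = 0 from rd_zero φ.hom v, zero_mul]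
      · rw [rd_mul, hs φ v fun h => hW (hKW h), mul_zero]
    rw [h0]
    exact (rd_zero φ.hom v).symm

/-- A finite family of even functions `ρ_j`, each with compact support in a chart `ψ_j`, whose sum is `1`
near `K`. -/
structure FinitePartition (K : Set X.carrier) where
  J : Type
  fintype : Fintype J
  chart : J → Chart X
  fn : J → X.sec ⊤
  supp : J → Set X.carrier
  isCompact_supp : ∀ j, IsCompact (supp j)
  supp_subset : ∀ j, supp j ⊆ (chart j).image
  even : ∀ j, fn j ∈ X.par ⊤ 0
  vanishesOff : ∀ j, VanishesOff (fn j) (supp j)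
  nhd : Opens X.carrier
  subset_nhd : K ⊆ nhd
  res_sum : X.res (le_top : nhd ≤ ⊤) (∑ j, fn j) = 1

attribute [instance] FinitePartition.fintype

lemma nonempty_finitePartition {K : Set X.carrier} (hK : IsCompact K) : Nonempty (FinitePartition K) := by
  refine hK.induction_on ?_ ?_ ?_ ?_
  · exact ⟨{
      J := Empty
      fintype := inferInstance
      chart := Empty.elim
      fn := Empty.elim
      supp := Empty.elim
      isCompact_supp := fun j => j.elim
      supp_subset := fun j => j.elim
      even := fun j => j.elim
      vanishesOff := fun j => j.elim
      nhd := ⊥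
      subset_nhd := Set.empty_subset _
      res_sum := sec_eq_of_empty (U := ⊥) (fun x (hx : x ∈ (⊥ : Opens X.carrier)) => hx) _ _ }⟩
  · rintro s t hst ⟨P⟩
    exact ⟨{ P with subset_nhd := hst.trans P.subset_nhd }⟩
  -- for a union, the second family is multiplied by `1 - σ`, where `σ` is the sum of the first one
  · rintro s t ⟨P⟩ ⟨P'⟩
    set σ := ∑ j, P.fn j with hσ
    have hσ0 : σ ∈ X.par ⊤ 0 := sum_mem fun j _ => P.even j
    have hsum : ∑ j : P.J ⊕ P'.J, Sum.elim P.fn (fun j => (1 - σ) * P'.fn j) j =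
        σ + (1 - σ) * ∑ j, P'.fn j := by
      rw [Fintype.sum_sum_type, Finset.mul_sum]
      rfl
    exact ⟨{
      J := P.J ⊕ P'.J
      fintype := inferInstance
      chart := Sum.elim P.chart P'.chart
      fn := Sum.elim P.fn fun j => (1 - σ) * P'.fn j
      supp := Sum.elim P.supp P'.supp
      isCompact_supp := Sum.rec P.isCompact_supp P'.isCompact_supp
      supp_subset := Sum.rec P.supp_subset P'.supp_subset
      even := Sum.rec P.even fun j => by
        have := X.mul_mem_par ⊤ 0 0 _ _ (sub_mem (X.one_mem_par ⊤) hσ0) (P'.even j)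
        rwa [add_zero] at this
      vanishesOff := Sum.rec P.vanishesOff fun j => (P'.vanishesOff j).mul_left _
      nhd := P.nhd ⊔ P'.nhd
      subset_nhd := by
        rw [Opens.coe_sup]
        exact Set.union_subset_union P.subset_nhd P'.subset_nhd
      res_sum := by
        rw [hsum]
        refine sec_ext_local fun x hx => ?_
        rcases hx with hx | hx
        · refine ⟨P.nhd, le_sup_left, hx, ?_⟩
          rw [X.res_res, map_add, map_mul, map_sub, hσ, P.res_sum, map_one, map_one, sub_self, zero_mul, add_zero]
        · refine ⟨P'.nhd, le_sup_right, hx, ?_⟩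
          rw [X.res_res, map_add, map_mul, P'.res_sum, mul_one, ← map_add, add_sub_cancel, map_one, map_one] }⟩
  · intro x _
    obtain ⟨φ, v, rfl⟩ := exists_chart_at x
    obtain ⟨b, L, hL, -, hb0, -, ⟨W, hxW, hW⟩, -, hbL⟩ := exists_bump φ v Filter.univ_mem
    have hLc : IsCompact (φ.hom.pt '' L) := hL.image φ.hom.continuous_pt
    refine ⟨W, mem_nhdsWithin_of_mem_nhds (W.isOpen.mem_nhds hxW), ⟨{
      J := Unit
      fintype := inferInstance
      chart := fun _ => φ
      fn := fun _ => b
      supp := fun _ => φ.hom.pt '' L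
      isCompact_supp := fun _ => hLc
      supp_subset := fun _ => by
        rintro _ ⟨w, _, rfl⟩
        exact φ.base_mem w
      even := fun _ => hb0
      vanishesOff := fun _ => vanishesOff_of_local fun y _ hy =>
        ⟨⟨(φ.hom.pt '' L)ᶜ, hLc.isClosed.isOpen_compl⟩, le_top, hy, hbL _ fun z hz => hz⟩
      nhd := W
      subset_nhd := le_rfl
      res_sum := by rw [Fintype.sum_unique, hW] }⟩⟩

end Partition

/-! ### The Berezin integral of an invariant Berezinian -/

section BerezinIntegral

open MeasureTheory Filter Topology

variable {X : CSManifold} (o : Orientation X)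

/-- The integral of a Berezinian with compact support in a chart. -/
def signedInt (φ : Chart X) (s : X.sec φ.image) : ℂ := ((o.sign φ : ℤ) : ℂ) * chartInt φ s

lemma hasChartIntegral_iff {η : Berezinian X} {c : ℂ} : HasChartIntegral o η c ↔
    ∃ φ : Chart X, IsCompact η.support ∧ η.support ⊆ φ.image ∧ c = signedInt o φ (η.coef φ) := by
  have h : ∀ φ : Chart X, chartInt φ (η.coef φ) = ∫ v : Fin X.evenDim → ℝ, topCoeff X.oddDim
      ((φ.hom.pull φ.image (η.app φ.image (coordFrame φ))).1 ⟨v, Set.mem_range_self v⟩) := fun φ =>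
    integral_congr_ae (.of_forall fun v => congrArg _ (rd_of_mem φ.hom _ v (φ.base_mem v)))
  constructor
  · rintro ⟨φ, e, he, h1, h2, h3⟩
    refine ⟨φ, h1, h2, ?_⟩
    rw [h3, he.eq, signedInt, h]
  · rintro ⟨φ, h1, h2, h3⟩
    refine ⟨φ, coordFrame φ, isCoordFrame_coordFrame φ, h1, h2, ?_⟩
    rw [h3, signedInt, h]

/-- The sum of the integrals of the members of a decomposition of `ω` can be computed with any partition
of unity; in particular it depends on `ω` only. -/
lemma sum_signedInt_eq {I : Type} [Fintype I] (φ : I → Chart X) (η : I → Berezinian X) {K : Set X.carrier}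
    (hη : ∀ i, IsCompact (η i).support) (hηφ : ∀ i, (η i).support ⊆ (φ i).image) (hηK : ∀ i, (η i).support ⊆ K)
    (P : FinitePartition K) (ω : Berezinian X)
    (hω : ∀ (U : Opens X.carrier) (e : LocalFrame X U), ω.app U e = ∑ i, (η i).app U e) :
    ∑ i, signedInt o (φ i) ((η i).coef (φ i)) =
      ∑ j, signedInt o (P.chart j) (X.res le_top (P.fn j) * ω.coef (P.chart j)) := by
  have h1 : ∀ i, signedInt o (φ i) ((η i).coef (φ i)) =
      ∑ j, signedInt o (φ i) (X.res le_top (P.fn j) * (η i).coef (φ i)) := by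
    intro i
    have h2 : (η i).coef (φ i) = ∑ j, X.res le_top (P.fn j) * (η i).coef (φ i) := by
      have h3 := VanishesOff.mul_eq_zero (W := P.nhd) (u := 1 - ∑ j, P.fn j)
        ((η i).vanishesOff (coordFrame (φ i))) ((hηK i).trans P.subset_nhd)
        (by rw [map_sub, P.res_sum, map_one, sub_self])
      rw [map_sub, sub_mul, map_one, one_mul, map_sum, Finset.sum_mul] at h3
      exact sub_eq_zero.1 h3
    conv_lhs => rw [h2]
    have h3 : ∀ j ∈ Finset.univ, VanishesOff (X.res le_top (P.fn j) * (η i).coef (φ i)) (η i).support :=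
      fun j _ => VanishesOff.mul_left _ ((η i).vanishesOff _)
    rw [signedInt, chartInt_sum (φ i) _ h3 (hη i) (hηφ i) le_rfl, Finset.mul_sum]
    rfl
  have h2 : ∀ i j, signedInt o (φ i) (X.res le_top (P.fn j) * (η i).coef (φ i)) =
      signedInt o (P.chart j) (X.res le_top (P.fn j) * (η i).coef (P.chart j)) := by
    intro i j
    have hoff : ∀ χ : Chart X, VanishesOff (((η i).smul (P.fn j) (P.even j)).coef χ)
        (P.supp j ∩ (η i).support) := fun χ =>
      ((P.vanishesOff j).res le_top).mul_inter ((η i).vanishesOff _)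
    exact chartInt_coef_eq o ((η i).smul (P.fn j) (P.even j)) (φ i) (P.chart j)
      ((hη i).inter_left (P.isCompact_supp j).isClosed) (Set.inter_subset_right.trans (hηφ i))
      (Set.inter_subset_left.trans (P.supp_subset j)) (hoff _) (hoff _)
  simp only [h1, h2]
  rw [Finset.sum_comm]
  refine Finset.sum_congr rfl fun j _ => ?_
  have h3 : ω.coef (P.chart j) = ∑ i, (η i).coef (P.chart j) := hω _ _
  rw [h3, Finset.mul_sum, signedInt, chartInt_sum (P.chart j) _
    (fun i _ => ((P.vanishesOff j).res le_top).mul_right _) (P.isCompact_supp j) (P.supp_subset j) le_rfl,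
    Finset.mul_sum]
  rfl

variable {D : VectorField X.toSuperSpace ⊤ 1} {β : X.sec ⊤} {ω : Berezinian X}

/-- The integral of an invariant Berezinian with respect to any partition of unity vanishes: with
`D β = 1`, the terms are the integrals of `-D(ρ_j) β ω`, and these add up to the integral of `0`. -/
lemma sum_signedInt_eq_zero (hβ : β ∈ X.par ⊤ 1) (hDβ : D.app ⊤ le_rfl β = 1) (hinv : ω.IsInvariant D)
    {K : Set X.carrier} (hK : ω.support ⊆ K) (P : FinitePartition K) :
    ∑ j, signedInt o (P.chart j) (X.res le_top (P.fn j) * ω.coef (P.chart j)) = 0 := by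
  have h11 : (1 + 1 : ZMod 2) = 0 := rfl
  have hodd : ∀ j, P.fn j * β ∈ X.par ⊤ 1 := fun j => by
    have := X.mul_mem_par ⊤ 0 1 _ _ (P.even j) hβ
    rwa [zero_add] at this
  have hDρ : ∀ j, VanishesOff (D.app ⊤ le_rfl (P.fn j)) (P.supp j) := fun j =>
    (P.vanishesOff j).app (P.isCompact_supp j).isClosed D le_rfl
  have heven : ∀ j, D.app ⊤ le_rfl (P.fn j) * β ∈ X.par ⊤ 0 := fun j => by
    have := X.mul_mem_par ⊤ _ _ _ _ (D.app_par ⊤ le_rfl _ _ (P.even j)) hβ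
    rwa [add_zero, h11] at this
  set ζ : P.J → Berezinian X := fun j => ω.smul _ (heven j) with hζ
  have hζs : ∀ j, (ζ j).support ⊆ P.supp j := fun j =>
    ω.support_smul_subset_of_vanishesOff (heven j) (P.isCompact_supp j).isClosed ((hDρ j).mul_right β)
  have hterm : ∀ j, signedInt o (P.chart j) (X.res le_top (P.fn j) * ω.coef (P.chart j)) =
      -signedInt o (P.chart j) ((ζ j).coef (P.chart j)) := by
    intro j
    have h := hinv.chartInt_eq_zero (P.chart j) (hodd j) ((((P.vanishesOff j).mul_right β).res le_top).mul_right _)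
      (P.isCompact_supp j) (P.supp_subset j)
    rw [D.leibniz ⊤ le_rfl 0 _ _ (P.even j), hDβ, mul_zero, sgn_zero, one_smul, mul_one, map_add, add_mul,
      chartInt_add (P.chart j) ((((hDρ j).mul_right β).res le_top).mul_right _)
        (((P.vanishesOff j).res le_top).mul_right _) (P.isCompact_supp j) (P.supp_subset j) le_rfl] at h
    rw [signedInt, signedInt, eq_neg_of_add_eq_zero_right h, mul_neg]
    rfl
  -- the `ζ_j` add up to zero, because the `D(ρ_j)` add up to `D(1) = 0` near the support of `ω`
  have hz := sum_signedInt_eq o P.chart ζ (fun j => (P.isCompact_supp j).of_isClosed_subset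
      (Berezinian.isClosed_support _) (hζs j))
    (fun j => (hζs j).trans (P.supp_subset j)) (fun j => (ω.support_smul_subset _ _).trans hK) P
    (ω.smul 0 (zero_mem _)) fun U e => by
      have h0 : X.res (le_top : P.nhd ≤ ⊤) (∑ j, D.app ⊤ le_rfl (P.fn j) * β) = 0 := by
        rw [← Finset.sum_mul, ← map_sum, map_mul, D.res_app, P.res_sum, D.app_one, zero_mul]
      have h1 := VanishesOff.mul_eq_zero (ω.vanishesOff e) (hK.trans P.subset_nhd) h0
      rw [map_sum, Finset.sum_mul] at h1
      rw [ω.smul_app, map_zero, zero_mul]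
      exact h1.symm
  simp only [hterm, Finset.sum_neg_distrib, hz, Berezinian.coef_smul, map_zero, zero_mul, mul_zero]
  refine neg_eq_zero.2 (Finset.sum_eq_zero fun j _ => ?_)
  simp [signedInt, chartInt]

/-- An invariant compactly supported Berezinian has the integral `0`, and no other. -/
theorem hasIntegral_iff_eq_zero (hβ : β ∈ X.par ⊤ 1) (hDβ : D.app ⊤ le_rfl β = 1) (hω : IsCompact ω.support)
    (hinv : ω.IsInvariant D) (c : ℂ) : HasIntegral o ω c ↔ c = 0 := by
  constructor
  · rintro ⟨k, η, d, hd, hη, rfl⟩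
    choose φ h1 h2 h3 using fun i => (hasChartIntegral_iff o).1 (hd i)
    set K := ω.support ∪ ⋃ i, (η i).support with hKdef
    have hK : IsCompact K := hω.union (isCompact_iUnion h1)
    obtain ⟨P⟩ := nonempty_finitePartition hK
    rw [Finset.sum_congr rfl fun i _ => h3 i, sum_signedInt_eq o φ η h1 h2
      (fun i => (Set.subset_iUnion (fun i => (η i).support) i).trans Set.subset_union_right) P ω hη]
    exact sum_signedInt_eq_zero o hβ hDβ hinv Set.subset_union_left P
  · rintro rfl
    obtain ⟨P⟩ := nonempty_finitePartition hω
    have hs : ∀ j, (ω.smul _ (P.even j)).support ⊆ P.supp j := fun j =>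
      ω.support_smul_subset_of_vanishesOff (P.even j) (P.isCompact_supp j).isClosed (P.vanishesOff j)
    set σ := (Fintype.equivFin P.J).symm
    refine ⟨Fintype.card P.J, fun i => ω.smul _ (P.even (σ i)),
      fun i => signedInt o (P.chart (σ i)) ((ω.smul _ (P.even (σ i))).coef (P.chart (σ i))),
      fun i => (hasChartIntegral_iff o).2 ⟨P.chart (σ i), ?_, (hs _).trans (P.supp_subset _), rfl⟩,
      fun U e => ?_, ?_⟩
    · exact (P.isCompact_supp _).of_isClosed_subset (Berezinian.isClosed_support _) (hs _)
    · have h := VanishesOff.mul_eq_zero (W := P.nhd) (u := 1 - ∑ j, P.fn j) (ω.vanishesOff e) P.subset_nhd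
        (by rw [map_sub, P.res_sum, map_one, sub_self])
      rw [map_sub, sub_mul, map_one, one_mul, map_sum, Finset.sum_mul] at h
      rw [sub_eq_zero.1 h]
      exact (Equiv.sum_comp σ fun j => X.res le_top (P.fn j) * ω.app U e).symm
    · rw [Equiv.sum_comp σ fun j => signedInt o (P.chart j) ((ω.smul _ (P.even j)).coef (P.chart j))]
      exact (sum_signedInt_eq_zero o hβ hDβ hinv le_rfl P).symm

end BerezinIntegral

end CS

end

theorem mainTheorem2 (G : CS.CSManifold) [CS.SuperLieGroup G]
    (Q : CS.VectorField G.toSuperSpace ⊤ 1) (hQ : CS.IsQGroup G Q)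
    (X : CS.CSManifold) (a : CS.Action G X)
    (QX : CS.VectorField X.toSuperSpace ⊤ 1) (hQX : a.IsFundamental Q QX)
    (hne : QX.NowhereVanishing) :
    (∃ β ∈ X.par ⊤ 1, QX.app ⊤ le_rfl β = 1) ∧
      ∀ (o : CS.Orientation X) (ω : CS.Berezinian X), IsCompact ω.support → ω.IsInvariant QX →
        ∀ c : ℂ, CS.HasIntegral o ω c ↔ c = 0 := by
  obtain ⟨β, hβ, hQβ⟩ := CS.exists_odd_primitive hQ hQX hne
  exact ⟨⟨β, hβ, hQβ⟩, fun o _ hω hinv c => CS.hasIntegral_iff_eq_zero o hβ hQβ hω hinv c⟩
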